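/- Let $k\ge 2$. A *standardized radial density* is a measurable $f:(0,\infty)\to[0,\infty)$, a.e. strictly positive, with $\mu_f:=\int_0^\infty r^{k-1}f(r)\,dr<\infty$ and such that $\tilde f(r)=r^{k-1}f(r)/\mu_f$, with distribution function $\tilde F$, satisfies $\tilde F(1)=1/2$. A *shape* is a symmetric positive definite real $k\times k$ matrix $V$ with $V_{11}=1$. For $\theta\in\mathbb R^k$, $\sigma>0$ and a shape $V$, let $P^{(n)}_{\theta,\sigma^2,V;f}$ be the joint law of $n$ i.i.d. random vectors $X_1,\dots,X_n$ in $\mathbb R^k$ with density $c_f\,\sigma^{-k}|V|^{-1/2}f\big(\sigma^{-1}((x-\theta)'V^{-1}(x-\theta))^{1/2}\big)$, where $c_f$ is the normalizing constant. Assumption (A1) on $f$: $f^{1/2}\in W^{1,2}((0,\infty),r^{k-1}dr)$. Assumption (A2) on $f$: the function $f_{\exp}^{1/2}(x):=f^{1/2}(e^x)$ is in $W^{1,2}(\mathbb R,e^{kx}dx)$. Here $W^{1,2}(\Omega,\lambda)$ is the set of functions in $L^2(\Omega,\lambda)$ whose weak derivative is in $L^2(\Omega,\lambda)$. Under (A2)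 put, for almost every $r>0$ and $u\in(0,1)$, $$\psi_f(r)=-2r^{-1}\frac{(f_{\exp}^{1/2})'(\ln r)}{f_{\exp}^{1/2}(\ln r)},\qquad K_f(u)=\psi_f(\tilde F^{-1}(u))\,\tilde F^{-1}(u).$$ Write $D_k(g)=\int_0^1(\tilde G^{-1}(u))^2du$, $E_k(g)=\int_0^1(\tilde G^{-1}(u))^4du$, $\mathrm E[K^2(U)]=\int_0^1K^2(u)\,du$, $\mathcal J_k(K;g)=\int_0^1K(u)K_g(u)\,du$, $\mathcal J_k(f,g)=\int_0^1K_f(u)K_g(u)\,du$ and $\mathcal J_k(f)=\int_0^1K_f^2(u)\,du$. Finite kurtosis of $g$ means $E_k(g)<\infty$. For given $\theta$ and a null shape $V_0$ let $Z_i=V_0^{-1/2}(X_i-\theta)$ (symmetric root), $d_i=\|Z_i\|$, $U_i=Z_i/d_i$, and let $R_i$ be the rank of $d_i$ among $d_1,\dots,d_n$. The rank test $\phi_K$ and the adjusted Gaussian test $\phi_{\mathcal N}$ of $V=V_0$ at nominal level $\alpha\in(0,1)$ reject when, respectively, $$Q_K=\frac{k(k+2)}{2n\,\mathrm E[K^2(U)]}\sum_{i,j=1}^nK\Big(\frac{R_i}{n+1}\Big)K\Big(\frac{R_j}{n+1}\Big)\Big((U_i'U_j)^2-\frac1k\Big),\qquad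 Q_{\mathcal N}=\frac{k(k+2)}{2\sum_{i=1}^nd_i^4}\sum_{i,j=1}^nd_i^2d_j^2\Big((U_i'U_j)^2-\frac1k\Big)$$ exceeds the $\alpha$ upper-quantile of the chi-square law with $k(k+1)/2-1$ degrees of freedom. The statement that $\mathrm{ARE}_{k,g}(\phi_K/\phi_{\mathcal N})=r$ means the following, for every $\theta$, every $\sigma>0$ and every shape $V_0$. Both tests have asymptotic level $\alpha$, for every $\alpha\in(0,1)$, under $P^{(n)}_{\theta,\sigma^2,V_0;g}$. Moreover, for every symmetric $v\neq0$ with $v_{11}=0$, under $P^{(n)}_{\theta,\sigma^2,V_0+n^{-1/2}v;g}$ the statistics $Q_K$ and $Q_{\mathcal N}$ converge in law to noncentral chi-square laws with $k(k+1)/2-1$ degrees of freedom and noncentrality parameters $\lambda_K\ge0$ and $\lambda_{\mathcal N}>0$, respectively, and $\lambda_K/\lambda_{\mathcal N}=r$. **Proposition 4.2.** Let $g_1$ be a standardized radial density satisfying (A1), (A2) and $E_k(g_1)<\infty$. (a) Let $K:(0,1)\to\mathbb R$ be continuous, not identically zero, and the difference of two nondecreasing square integrable functions on $(0,1)$. Then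 $$\mathrm{ARE}_{k,g_1}(\phi_K/\phi_{\mathcal N})=\frac1{(k+2)^2}\,\frac{E_k(g_1)}{D_k^2(g_1)}\,\frac{\mathcal J_k^2(K;g_1)}{\mathrm E[K^2(U)]}.$$ (b) Let $f_1$ be a standardized radial density satisfying (A1) and (A2) such that $K_{f_1}$ coincides a.e. on $(0,1)$ with a continuous function that is the difference of two nondecreasing square integrable functions. Then, for $\phi_{f_1}:=\phi_{K_{f_1}}$ (computed with this continuous version), $$\mathrm{ARE}_{k,g_1}(\phi_{f_1}/\phi_{\mathcal N})=\frac1{(k+2)^2}\,\frac{E_k(g_1)}{D_k^2(g_1)}\,\frac{\mathcal J_k^2(f_1,g_1)}{\mathcal J_k(f_1)}.$$ -/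

import Mathlib

open MeasureTheory ProbabilityTheory Filter Topology

noncomputable section

namespace EllipticalShape

/-! ## Weak derivatives and weighted Sobolev spaces on the line -/

/-- `T` is a weak derivative (derivative in the sense of distributions) of `g` on the open set
`Ω ⊆ ℝ`. -/
def IsWeakDeriv (Ω : Set ℝ) (g T : ℝ → ℝ) : Prop :=
  LocallyIntegrableOn T Ω ∧
    ∀ φ : ℝ → ℝ, ContDiff ℝ (⊤ : ℕ∞) φ → HasCompactSupport φ → tsupport φ ⊆ Ω →
      ∫ x in Ω, g x * deriv φ x = -∫ x in Ω, T x * φ x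

open Classical in
/-- The weak derivative of `g` on `Ω` (unique up to a Lebesgue null set), `0` if there is none. -/
def weakDeriv (Ω : Set ℝ) (g : ℝ → ℝ) : ℝ → ℝ :=
  if h : ∃ T, IsWeakDeriv Ω g T then Classical.choose h else 0

/-- Lebesgue measure on `Ω` with weight `w`. -/
def weighted (Ω : Set ℝ) (w : ℝ → ℝ) : Measure ℝ :=
  (volume.restrict Ω).withDensity (fun x => ENNReal.ofReal (w x))

/-- The Sobolev space `W^{1,2}(Ω, w(x) dx)`. -/
def MemW12 (Ω : Set ℝ) (w : ℝ → ℝ) (g : ℝ → ℝ) : Prop :=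
  MemLp g 2 (weighted Ω w) ∧ ∃ T, IsWeakDeriv Ω g T ∧ MemLp T 2 (weighted Ω w)

/-! ## Radial densities

A radial density is a function on `(0, ∞)`; here it is a function on `ℝ` whose values on
`(-∞, 0]` play no role. -/

/-- `μ_{k-1;f} = ∫_0^∞ r^{k-1} f(r) dr`. -/
def radialMass (k : ℕ) (f : ℝ → ℝ) : ℝ := ∫ r in Set.Ioi (0 : ℝ), r ^ (k - 1) * f r

/-- The density of the standardized modulus, `r ↦ r^{k-1} f(r) / μ_{k-1;f}` for `r > 0`. -/
def modulusDensity (k : ℕ) (f : ℝ → ℝ) (r : ℝ) : ℝ :=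
  if 0 < r then r ^ (k - 1) * f r / radialMass k f else 0

/-- The distribution function of the standardized modulus (for nonnegative arguments). -/
def modulusCdf (k : ℕ) (f : ℝ → ℝ) (r : ℝ) : ℝ := ∫ s in Set.Ioc (0 : ℝ) r, modulusDensity k f s

/-- The quantile function of the standardized modulus, for arguments in `(0, 1)`. -/
def modulusQuantile (k : ℕ) (f : ℝ → ℝ) (u : ℝ) : ℝ := sInf {r | 0 < r ∧ u ≤ modulusCdf k f r}

/-- Standardized radial densities: nonnegative, a.e. strictly positive on `(0, ∞)`, with
`∫_0^∞ r^{k-1} f(r) dr < ∞`, and such that the modulus has median one. -/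
structure IsRadialDensity (k : ℕ) (f : ℝ → ℝ) : Prop where
  measurable : Measurable f
  nonneg : ∀ r, 0 < r → 0 ≤ f r
  ae_pos : ∀ᵐ r ∂(volume.restrict (Set.Ioi (0 : ℝ))), 0 < f r
  integrable : IntegrableOn (fun r => r ^ (k - 1) * f r) (Set.Ioi 0)
  median : modulusCdf k f 1 = 1 / 2

/-- `f^{1/2} ∈ W^{1,2}((0,∞), r^{k-1} dr)`. -/
def AssumptionA1 (k : ℕ) (f : ℝ → ℝ) : Prop :=
  MemW12 (Set.Ioi 0) (fun r => r ^ (k - 1)) (fun r => Real.sqrt (f r))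

/-- `x ↦ f^{1/2}(e^x)`. -/
def sqrtExp (f : ℝ → ℝ) (x : ℝ) : ℝ := Real.sqrt (f (Real.exp x))

/-- `x ↦ f^{1/2}(e^x)` belongs to `W^{1,2}(ℝ, e^{kx} dx)`. -/
def AssumptionA2 (k : ℕ) (f : ℝ → ℝ) : Prop :=
  MemW12 Set.univ (fun x => Real.exp (k * x)) (sqrtExp f)

/-- `ψ_f(r) = -2 r⁻¹ (f_exp^{1/2})'(ln r) / f_exp^{1/2}(ln r)`. -/
def psi (f : ℝ → ℝ) (r : ℝ) : ℝ :=
  -2 * r⁻¹ * weakDeriv Set.univ (sqrtExp f) (Real.log r) / sqrtExp f (Real.log r)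

/-- `K_f(u) = ψ_f(F̃⁻¹(u)) F̃⁻¹(u)`, defined for almost every `u ∈ (0, 1)`. -/
def radialScore (k : ℕ) (f : ℝ → ℝ) (u : ℝ) : ℝ :=
  psi f (modulusQuantile k f u) * modulusQuantile k f u

/-- Second moment `D_k(g)` of the standardized modulus. -/
def secondMoment (k : ℕ) (g : ℝ → ℝ) : ℝ := ∫ u in Set.Ioo (0 : ℝ) 1, modulusQuantile k g u ^ 2

/-- Fourth moment `E_k(g)` of the standardized modulus. -/
def fourthMoment (k : ℕ) (g : ℝ → ℝ) : ℝ := ∫ u in Set.Ioo (0 : ℝ) 1, modulusQuantile k g u ^ 4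

/-- Finite kurtosis, that is, `E_k(g) < ∞`. -/
def FiniteKurtosis (k : ℕ) (g : ℝ → ℝ) : Prop :=
  IntegrableOn (fun u => modulusQuantile k g u ^ 4) (Set.Ioo 0 1)

/-- `E[K²(U)]`, `U` uniform on `(0, 1)`. -/
def scoreSq (K : ℝ → ℝ) : ℝ := ∫ u in Set.Ioo (0 : ℝ) 1, K u ^ 2

/-- `J_k(K; g) = ∫_0^1 K(u) K_g(u) du`. -/
def scoreInfo (k : ℕ) (K g : ℝ → ℝ) : ℝ := ∫ u in Set.Ioo (0 : ℝ) 1, K u * radialScore k g u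

/-- `J_k(f) = ∫_0^1 K_f²(u) du`. -/
def shapeInfo (k : ℕ) (f : ℝ → ℝ) : ℝ := ∫ u in Set.Ioo (0 : ℝ) 1, radialScore k f u ^ 2

/-- `J_k(f, g) = ∫_0^1 K_f(u) K_g(u) du`. -/
def crossInfo (k : ℕ) (f g : ℝ → ℝ) : ℝ :=
  ∫ u in Set.Ioo (0 : ℝ) 1, radialScore k f u * radialScore k g u

/-- Score functions on `(0, 1)`: continuous, and the difference of two nondecreasing square
integrable functions. -/
def IsScore (K : ℝ → ℝ) : Prop :=
  ContinuousOn K (Set.Ioo 0 1) ∧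
    ∃ K₁ K₂ : ℝ → ℝ, MonotoneOn K₁ (Set.Ioo 0 1) ∧ MonotoneOn K₂ (Set.Ioo 0 1) ∧
      MemLp K₁ 2 (volume.restrict (Set.Ioo 0 1)) ∧ MemLp K₂ 2 (volume.restrict (Set.Ioo 0 1)) ∧
      ∀ u ∈ Set.Ioo (0 : ℝ) 1, K u = K₁ u - K₂ u

/-! ## The elliptical model -/

/-- The sample space `ℝ^k` of one observation, with its Euclidean norm. -/
abbrev Obs (k : ℕ) : Type := EuclideanSpace ℝ (Fin k)

/-- Shape matrices: symmetric positive definite with upper left entry one. -/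
def IsShape {k : ℕ} (V : Matrix (Fin k) (Fin k) ℝ) : Prop :=
  V.PosDef ∧ ∀ i : Fin k, (i : ℕ) = 0 → V i i = 1

/-- Nonzero perturbations of a shape: symmetric matrices with upper left entry zero. -/
def IsShapePerturbation {k : ℕ} (v : Matrix (Fin k) (Fin k) ℝ) : Prop :=
  v.IsSymm ∧ (∀ i : Fin k, (i : ℕ) = 0 → v i i = 0) ∧ v ≠ 0

/-- The elliptical density with location `θ`, scale `σ`, shape `V` and radial density `f`; the
normalizing constant is the reciprocal of `∫ f(‖z‖) dz`. -/
def ellipticalDensity {k : ℕ} (θ : Obs k) (σ : ℝ) (V : Matrix (Fin k) (Fin k) ℝ) (f : ℝ → ℝ)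
    (x : Obs k) : ℝ :=
  (∫ z : Obs k, f ‖z‖)⁻¹ * (1 / (σ ^ k * Real.sqrt V.det)) *
    f (1 / σ * Real.sqrt (dotProduct (x - θ).ofLp (V⁻¹.mulVec (x - θ).ofLp)))

/-- The law of one observation. -/
def ellipticalLaw {k : ℕ} (θ : Obs k) (σ : ℝ) (V : Matrix (Fin k) (Fin k) ℝ) (f : ℝ → ℝ) :
    Measure (Obs k) :=
  volume.withDensity (fun x => ENNReal.ofReal (ellipticalDensity θ σ V f x))

/-- The joint law of `n` i.i.d. observations. -/
def sampleLaw {k : ℕ} (n : ℕ) (θ : Obs k) (σ : ℝ) (V : Matrix (Fin k) (Fin k) ℝ) (f : ℝ → ℝ) :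
    Measure (Fin n → Obs k) :=
  Measure.pi (fun _ => ellipticalLaw θ σ V f)

/-! ## The test statistics -/

open scoped MatrixOrder in
/-- The sphericized observation `Z = V^{-1/2} (x - θ)`, with the symmetric square root. -/
def sphericized {k : ℕ} (θ : Obs k) (V : Matrix (Fin k) (Fin k) ℝ) (x : Obs k) : Obs k :=
  WithLp.toLp 2 ((CFC.sqrt V)⁻¹.mulVec (x - θ).ofLp)

/-- The modulus `d = ‖Z‖`. -/
def modulus {k : ℕ} (θ : Obs k) (V : Matrix (Fin k) (Fin k) ℝ) (x : Obs k) : ℝ :=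
  ‖sphericized θ V x‖

/-- The multivariate sign `U = Z / d`. -/
def multiSign {k : ℕ} (θ : Obs k) (V : Matrix (Fin k) (Fin k) ℝ) (x : Obs k) : Obs k :=
  (modulus θ V x)⁻¹ • sphericized θ V x

/-- The rank of the `i`-th modulus among all moduli. -/
def modulusRank {k n : ℕ} (θ : Obs k) (V : Matrix (Fin k) (Fin k) ℝ) (x : Fin n → Obs k)
    (i : Fin n) : ℕ :=
  (Finset.univ.filter (fun j => modulus θ V (x j) ≤ modulus θ V (x i))).card

/-- A family of statistics for the null hypothesis `V = V₀` at known location `θ`. -/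
abbrev StatFamily (k : ℕ) : Type :=
  Obs k → Matrix (Fin k) (Fin k) ℝ → (n : ℕ) → (Fin n → Obs k) → ℝ

/-- The signed-rank statistic `Q_K` with score function `K`. -/
def rankStat (k : ℕ) (K : ℝ → ℝ) : StatFamily k := fun θ V₀ n x =>
  (k * (k + 2) : ℝ) / (2 * n * scoreSq K) *
    ∑ i : Fin n, ∑ j : Fin n,
      K ((modulusRank θ V₀ x i : ℝ) / (n + 1)) * K ((modulusRank θ V₀ x j : ℝ) / (n + 1)) *
        ((inner ℝ (multiSign θ V₀ (x i)) (multiSign θ V₀ (x j))) ^ 2 - 1 / (k : ℝ))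

/-- The Gaussian statistic `Q_N` (John's statistic adjusted for kurtosis). -/
def gaussStat (k : ℕ) : StatFamily k := fun θ V₀ n x =>
  (k * (k + 2) : ℝ) / (2 * ∑ i : Fin n, modulus θ V₀ (x i) ^ 4) *
    ∑ i : Fin n, ∑ j : Fin n,
      modulus θ V₀ (x i) ^ 2 * modulus θ V₀ (x j) ^ 2 *
        ((inner ℝ (multiSign θ V₀ (x i)) (multiSign θ V₀ (x j))) ^ 2 - 1 / (k : ℝ))

/-! ## Chi-square laws, tests, and asymptotic relative efficiency -/

/-- The noncentral chi-square law with `d ≥ 1` degrees of freedom and noncentrality parameter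
`lam ≥ 0`: the law of a sum of squares of `d` independent normal variables with unit variances,
the first with mean `√lam` and the others centered. -/
def noncentralChiSq (d : ℕ) (lam : ℝ) : Measure ℝ :=
  (Measure.pi (fun i : Fin d => gaussianReal (if (i : ℕ) = 0 then Real.sqrt lam else 0) 1)).map
    (fun z => ∑ i, z i ^ 2)

/-- The number `k(k+1)/2 - 1` of free entries of a `k × k` shape matrix. -/
def shapeDof (k : ℕ) : ℕ := k * (k + 1) / 2 - 1

/-- The `α` upper-quantile of the (central) chi-square law with `d` degrees of freedom. -/
def chiSqUpperQuantile (d : ℕ) (α : ℝ) : ℝ :=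
  sInf {c : ℝ | noncentralChiSq d 0 (Set.Ioi c) ≤ ENNReal.ofReal α}

/-- The rejection region of the test of `V = V₀` at nominal level `α` based on a statistic `Q`:
reject as soon as `Q` exceeds the `α` upper-quantile of the chi-square law with `k(k+1)/2 - 1`
degrees of freedom. -/
def rejectionRegion {k : ℕ} (Q : StatFamily k) (θ : Obs k) (V₀ : Matrix (Fin k) (Fin k) ℝ)
    (α : ℝ) (n : ℕ) : Set (Fin n → Obs k) :=
  {x | chiSqUpperQuantile (shapeDof k) α < Q θ V₀ n x}

/-- Under the radial density `g`, the tests based on `Q` have asymptotic level `α`. -/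
def HasAsymptoticLevel {k : ℕ} (g : ℝ → ℝ) (Q : StatFamily k) (θ : Obs k) (σ : ℝ)
    (V₀ : Matrix (Fin k) (Fin k) ℝ) (α : ℝ) : Prop :=
  Tendsto (fun n : ℕ => (sampleLaw n θ σ V₀ g).real (rejectionRegion Q θ V₀ α n)) atTop (𝓝 α)

/-- Under the local alternatives with shape `V₀ + n^{-1/2} v` and radial density `g`, the statistic
`Q` converges in law to the noncentral chi-square law with `k(k+1)/2 - 1` degrees of freedom and
noncentrality parameter `lam`. -/
def HasNoncentrality {k : ℕ} (g : ℝ → ℝ) (Q : StatFamily k) (θ : Obs k) (σ : ℝ)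
    (V₀ v : Matrix (Fin k) (Fin k) ℝ) (lam : ℝ) : Prop :=
  ∀ φ : BoundedContinuousFunction ℝ ℝ,
    Tendsto
      (fun n : ℕ => ∫ x, φ (Q θ V₀ n x) ∂(sampleLaw n θ σ (V₀ + (Real.sqrt n)⁻¹ • v) g))
      atTop (𝓝 (∫ y, φ y ∂(noncentralChiSq (shapeDof k) lam)))

/-- `r` is the asymptotic relative efficiency, under the radial density `g`, of the tests based on
`Q` with respect to the tests based on `Q'`: whatever the location, the scale and the null value of
the shape, both have asymptotic level `α` (for every `α`), and along all local alternatives both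
statistics are asymptotically noncentral chi-square (with the same number of degrees of freedom),
the ratio of the noncentrality parameters being `r`. -/
def IsARE (k : ℕ) (g : ℝ → ℝ) (Q Q' : StatFamily k) (r : ℝ) : Prop :=
  ∀ (θ : Obs k) (σ : ℝ) (V₀ : Matrix (Fin k) (Fin k) ℝ), 0 < σ → IsShape V₀ →
    (∀ α : ℝ, 0 < α → α < 1 →
      HasAsymptoticLevel g Q θ σ V₀ α ∧ HasAsymptoticLevel g Q' θ σ V₀ α) ∧
    ∀ v : Matrix (Fin k) (Fin k) ℝ, IsShapePerturbation v →
      ∃ lam lam' : ℝ, 0 ≤ lam ∧ 0 < lam' ∧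
        HasNoncentrality g Q θ σ V₀ v lam ∧ HasNoncentrality g Q' θ σ V₀ v lam' ∧
        lam / lam' = r

end EllipticalShape

end

/-!
# Efficiency of signed-rank tests for shape

Fix a null shape `V₀` and standardize the observations to `w = σ⁻¹ V₀^{-1/2} (x - θ)`. Under the null
hypothesis they have the spherical law with radial density `g`, and under the local alternative
`V₀ + n^{-1/2} v` the shape matrix `1 + n^{-1/2} B` with `B = V₀^{-1/2} v V₀^{-1/2}`
(`map_standardize_sampleLaw`, `exists_standardized_perturbation`). Both test statistics have the form
`quadStat`: with weights `W_i` that depend on the moduli, they are the squared norm of the vectors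
`√c n^{-1/2} ∑ W_i (u_i' M_a u_i)`, where `u_i` are the directions and `(M_a)` runs through an
orthonormal basis of the symmetric matrices with trace zero, a space of dimension `k (k + 1) / 2 - 1`
(`exists_traceless_basis`).

*Local alternatives.* Under (A2) the square root of the density is differentiable in quadratic mean
along the alternatives (`IsRadialDensity.exists_isDQM`). In the coordinates `x = log r` a perturbation
of the shape translates `f^{1/2}(e^x)`, by an amount that depends on the direction, and a function
with a weak derivative in `L²(e^{kx} dx)` is differentiable along translations
(`IsWeakDeriv.eventually_expNormSq_le`). Differentiability in quadratic mean has two consequences: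
events that are asymptotically negligible under the null law are so under the alternatives
(`IsDQM.contiguous`), and a normalized sum of centered square integrable terms `b` has characteristic
functions converging to those of the normal law with mean `2 ∫ b h` and variance `∫ b²`, where `h` is
the half-score (`IsDQM.tendsto_charFun`). This gives noncentral chi-square limits for all statistics
that are asymptotically equivalent, under the null law only, to the squared norm of such a sum
(`IsDQM.tendsto_integral_noncentralChiSq`).

*Asymptotic equivalence.* Given the moduli, the directions are independent and uniform on the sphere,
so the error made by replacing the weights `W_i` by functions `κ(r_i)` of the single moduli is
measured by the mean of `(W_i - κ(r_i))²` (`measure_sum_mul_dir_le`). For the rank statistic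
`κ = K ∘ F̃`, and the error tends to zero because `K` is a difference of monotone square integrable
functions (`tendsto_rankError`); for the Gaussian statistic `κ(r) = r²`, and the law of large numbers
takes care of the empirical fourth moment (`tendsto_integral_gaussQuadStat`).

*Noncentrality.* The fourth moments of the uniform law on the sphere (`integral_quadForm_mul_quadForm`)
turn the drift into the noncentrality parameter `(∫ κ S)² ‖B₀‖² / (2 k (k + 2) ∫ κ²)`, where `S` is the
score of the modulus and `B₀` the traceless part of `B` (`tendsto_integral_quadStat`). The factor
`‖B₀‖²` is positive and cancels in the ratio. For the Gaussian statistic `∫ r² S = (k + 2) D_k(g)` by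
integration by parts (`IsRadialDensity.integral_pow_mul_radialScore`), and the ratio is the asserted
one. The case `B = 0` gives the asymptotic level, as the chi-square law has no atoms. The same
integration by parts shows that `K_f` has mean `k`, so that a score of a density does not vanish.
-/

noncomputable section

namespace EllipticalShape

open scoped ENNReal

/-! ### Products of densities -/

theorem lintegral_pi_prod {X : Type*} [MeasurableSpace X] (ν : Measure X) [SigmaFinite ν]
    {n : ℕ} (f : Fin n → X → ℝ≥0∞) (hf : ∀ i, Measurable (f i)) :
    ∫⁻ x, ∏ i, f i (x i) ∂(Measure.pi fun _ : Fin n => ν) = ∏ i, ∫⁻ x, f i x ∂ν := by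
  induction n with
  | zero => simp
  | succ n ih =>
    have hmp := (measurePreserving_piFinSuccAbove (fun _ : Fin (n + 1) => ν) 0).symm
    rw [← hmp.lintegral_comp_emb (MeasurableEquiv.measurableEmbedding _)]
    simp only [MeasurableEquiv.piFinSuccAbove_symm_apply, Fin.insertNthEquiv,
      Fin.prod_univ_succ, Fin.insertNth_zero]
    simp only [Equiv.coe_fn_mk, Fin.cons_zero, Fin.cons_succ]
    change ∫⁻ a : X × (Fin n → X), f 0 a.1 * ∏ i, f i.succ (a.2 i)
      ∂ν.prod (Measure.pi fun _ => ν) = _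
    rw [lintegral_prod_mul (f := f 0) (g := fun x : Fin n → X => ∏ i, f i.succ (x i)) (hf 0).aemeasurable
      (Finset.measurable_prod _ fun i _ => (hf _).comp (measurable_pi_apply i)).aemeasurable,
      ih (fun i => f i.succ) (fun i => hf _)]

theorem pi_withDensity {X : Type*} [MeasurableSpace X] (ν : Measure X) [SigmaFinite ν]
    (n : ℕ) (f : X → ℝ≥0∞) (hf : Measurable f) [SigmaFinite (ν.withDensity f)] :
    Measure.pi (fun _ : Fin n => ν.withDensity f) =
      (Measure.pi fun _ : Fin n => ν).withDensity (fun x => ∏ i, f (x i)) := by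
  symm
  refine (Measure.pi_eq fun s hs => ?_).symm
  rw [withDensity_apply _ (MeasurableSet.univ_pi hs), ← lintegral_indicator (MeasurableSet.univ_pi hs)]
  have : ∀ x : Fin n → X, (Set.univ.pi s).indicator (fun x => ∏ i, f (x i)) x =
      ∏ i, (s i).indicator f (x i) := by
    intro x
    by_cases hx : x ∈ Set.univ.pi s
    · rw [Set.indicator_of_mem hx]
      exact Finset.prod_congr rfl fun i _ => (Set.indicator_of_mem (hx i trivial) _).symm
    · rw [Set.indicator_of_notMem hx]
      simp only [Set.mem_pi, Set.mem_univ, true_imp_iff, not_forall] at hx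
      obtain ⟨i, hi⟩ := hx
      exact (Finset.prod_eq_zero (Finset.mem_univ i) (Set.indicator_of_notMem hi _)).symm
  simp only [this]
  rw [lintegral_pi_prod ν (fun i => (s i).indicator f) (fun i => hf.indicator (hs i))]
  refine Finset.prod_congr rfl fun i _ => ?_
  rw [lintegral_indicator (hs i), withDensity_apply _ (hs i)]

/-! ### Local alternatives that are differentiable in quadratic mean -/

/-- A sequence of densities `ℓ n` with respect to a probability measure `ν` such that
`√n (√(ℓ n) - 1)` converges to `g` in `L²(ν)`: differentiability in quadratic mean along the
sequence of local alternatives, with half-score `g`. -/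
structure IsDQM {X : Type*} [MeasurableSpace X] (ν : Measure X) (ℓ : ℕ → X → ℝ) (g : X → ℝ) :
    Prop where
  measurable : ∀ n, Measurable (ℓ n)
  nonneg : ∀ n x, 0 ≤ ℓ n x
  lintegral_eq_one : ∀ᶠ n in atTop, ∫⁻ x, ENNReal.ofReal (ℓ n x) ∂ν = 1
  memLp : MemLp g 2 ν
  tendsto : Tendsto
    (fun n : ℕ => ∫⁻ x, ENNReal.ofReal ((Real.sqrt n * (Real.sqrt (ℓ n x) - 1) - g x) ^ 2) ∂ν)
    atTop (𝓝 0)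

namespace IsDQM

variable {X : Type*} [MeasurableSpace X] {ν : Measure X}
  {ℓ : ℕ → X → ℝ} {g : X → ℝ}

theorem eventually_isProbabilityMeasure (h : IsDQM ν ℓ g) : ∀ᶠ n : ℕ in atTop,
    IsProbabilityMeasure (ν.withDensity fun x => ENNReal.ofReal (ℓ n x)) := by
  filter_upwards [h.lintegral_eq_one] with n hn
  exact ⟨by rw [withDensity_apply _ MeasurableSet.univ, Measure.restrict_univ, hn]⟩

theorem measurable_quotient (h : IsDQM ν ℓ g) (n : ℕ) :
    Measurable fun x => Real.sqrt n * (Real.sqrt (ℓ n x) - 1) :=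
  (((h.measurable n).sqrt).sub_const 1).const_mul _

theorem lintegral_sq_ne_top (h : IsDQM ν ℓ g) : ∫⁻ x, ENNReal.ofReal (g x ^ 2) ∂ν ≠ ⊤ := by
  have := h.memLp.integrable_sq
  exact (hasFiniteIntegral_iff_ofReal (Eventually.of_forall fun x => sq_nonneg _)).1 this.2 |>.ne

theorem ofReal_sq_le (a b : ℝ) :
    ENNReal.ofReal (a ^ 2) ≤ 2 * ENNReal.ofReal ((a - b) ^ 2) + 2 * ENNReal.ofReal (b ^ 2) := by
  rw [← ENNReal.ofReal_ofNat 2, ← ENNReal.ofReal_mul (by norm_num),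
    ← ENNReal.ofReal_mul (by norm_num), ← ENNReal.ofReal_add (by positivity) (by positivity)]
  exact ENNReal.ofReal_le_ofReal (by nlinarith [sq_nonneg (a - 2 * b)])

/-- The bound on a set `s` is what makes `n ν (ℓ n ; ℓ n > 4)` small: the first term tends to zero,
the second is small when `s` is. -/
theorem setLIntegral_sq_le (h : IsDQM ν ℓ g) (n : ℕ) (s : Set X) :
    ∫⁻ x in s, ENNReal.ofReal ((Real.sqrt n * (Real.sqrt (ℓ n x) - 1)) ^ 2) ∂ν ≤
      2 * ∫⁻ x, ENNReal.ofReal ((Real.sqrt n * (Real.sqrt (ℓ n x) - 1) - g x) ^ 2) ∂ν +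
      2 * ∫⁻ x in s, ENNReal.ofReal (g x ^ 2) ∂ν := by
  have hg : AEMeasurable (fun x => ENNReal.ofReal (g x ^ 2)) ν :=
    (h.memLp.aestronglyMeasurable.aemeasurable.pow_const 2).ennreal_ofReal
  calc _ ≤ ∫⁻ x in s, (2 * ENNReal.ofReal ((Real.sqrt n * (Real.sqrt (ℓ n x) - 1) - g x) ^ 2) +
        2 * ENNReal.ofReal (g x ^ 2)) ∂ν := lintegral_mono fun x => ofReal_sq_le _ _
    _ = 2 * ∫⁻ x in s, ENNReal.ofReal ((Real.sqrt n * (Real.sqrt (ℓ n x) - 1) - g x) ^ 2) ∂ν +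
      2 * ∫⁻ x in s, ENNReal.ofReal (g x ^ 2) ∂ν := by
        rw [lintegral_add_right' _ (hg.restrict.const_mul 2), lintegral_const_mul' _ _ (by simp),
          lintegral_const_mul' _ _ (by simp)]
    _ ≤ _ := by
        gcongr
        exact Measure.restrict_le_self

/-- The squared norms of `√n (√(ℓ n) - 1)` are bounded. -/
theorem eventually_lintegral_sq_le (h : IsDQM ν ℓ g) : ∃ C : ℝ, 0 ≤ C ∧ ∀ᶠ n : ℕ in atTop,
    ∫⁻ x, ENNReal.ofReal ((Real.sqrt n * (Real.sqrt (ℓ n x) - 1)) ^ 2) ∂ν ≤ ENNReal.ofReal C := by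
  refine ⟨(2 * 1 + 2 * ∫⁻ x, ENNReal.ofReal (g x ^ 2) ∂ν).toReal, ENNReal.toReal_nonneg, ?_⟩
  filter_upwards [(tendsto_order.1 h.tendsto).2 1 (by simp)] with n hn
  rw [ENNReal.ofReal_toReal (ENNReal.add_ne_top.2 ⟨by simp,
    ENNReal.mul_ne_top (by simp) h.lintegral_sq_ne_top⟩)]
  have := h.setLIntegral_sq_le n Set.univ
  simp only [Measure.restrict_univ] at this
  refine this.trans ?_
  gcongr

theorem one_lt_sqrt_sub_one {t : ℝ} (ht : 4 < t) : 1 < Real.sqrt t - 1 := by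
  have : Real.sqrt 4 < Real.sqrt t := Real.sqrt_lt_sqrt (by norm_num) ht
  rw [show (4 : ℝ) = 2 ^ 2 by norm_num, Real.sqrt_sq (by norm_num)] at this
  linarith

/-- `ν {ℓ n > 4} = O(1/n)`, by Chebyshev, since `√n (√(ℓ n) - 1) > √n` on this event. -/
theorem tendsto_measure_gt (h : IsDQM ν ℓ g) :
    Tendsto (fun n : ℕ => ν {x | 4 < ℓ n x}) atTop (𝓝 0) := by
  obtain ⟨C, hC, hCn⟩ := h.eventually_lintegral_sq_le
  have h2 : Tendsto (fun n : ℕ => ENNReal.ofReal C / (n : ℝ≥0∞)) atTop (𝓝 0) :=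
    by
    simpa using ENNReal.Tendsto.const_div (a := ENNReal.ofReal C) ENNReal.tendsto_nat_nhds_top (Or.inr ENNReal.ofReal_ne_top)
  refine tendsto_of_tendsto_of_tendsto_of_le_of_le' tendsto_const_nhds h2
    (Eventually.of_forall fun _ => zero_le) ?_
  filter_upwards [hCn, eventually_gt_atTop 0] with n hn hn0
  rw [ENNReal.le_div_iff_mul_le (Or.inl (by exact_mod_cast hn0.ne')) (Or.inl (by simp)), mul_comm]
  refine le_trans (le_trans ?_ (mul_meas_ge_le_lintegral
    ((h.measurable_quotient n).pow_const 2).ennreal_ofReal (n : ℝ≥0∞))) hn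
  gcongr with x
  intro hx
  have h1 := one_lt_sqrt_sub_one hx
  rw [← ENNReal.ofReal_natCast, mul_pow, Real.sq_sqrt (Nat.cast_nonneg n)]
  exact ENNReal.ofReal_le_ofReal (le_mul_of_one_le_right (Nat.cast_nonneg n) (by nlinarith))

/-- The part of the alternatives on which the likelihood ratio exceeds `4` is negligible. -/
theorem tendsto_mul_measure_gt (h : IsDQM ν ℓ g) :
    Tendsto (fun n : ℕ => (n : ℝ≥0∞) *
      (ν.withDensity fun x => ENNReal.ofReal (ℓ n x)) {x | 4 < ℓ n x}) atTop (𝓝 0) := by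
  have h1 : Tendsto (fun n : ℕ => 4 * (2 * ∫⁻ x, ENNReal.ofReal
      ((Real.sqrt n * (Real.sqrt (ℓ n x) - 1) - g x) ^ 2) ∂ν +
      2 * ∫⁻ x in {x | 4 < ℓ n x}, ENNReal.ofReal (g x ^ 2) ∂ν)) atTop (𝓝 0) := by
    have h2 := tendsto_setLIntegral_zero h.lintegral_sq_ne_top h.tendsto_measure_gt
    have := ENNReal.Tendsto.const_mul (a := 4)
      ((ENNReal.Tendsto.const_mul (a := 2) h.tendsto (Or.inr (by simp))).add
      (ENNReal.Tendsto.const_mul (a := 2) h2 (Or.inr (by simp)))) (Or.inr (by simp))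
    simpa using this
  refine tendsto_of_tendsto_of_tendsto_of_le_of_le tendsto_const_nhds h1
    (fun _ => zero_le) fun n => ?_
  have hms : MeasurableSet {x | 4 < ℓ n x} := measurableSet_lt measurable_const (h.measurable n)
  refine le_trans ?_ (mul_le_mul_right (h.setLIntegral_sq_le n {x | 4 < ℓ n x}) 4)
  simp only
  rw [withDensity_apply _ hms, ← lintegral_const_mul _ (h.measurable n).ennreal_ofReal,
    ← lintegral_const_mul _ ((h.measurable_quotient n).pow_const 2).ennreal_ofReal]
  refine setLIntegral_mono' hms fun x hx => ?_
  have h3 := one_lt_sqrt_sub_one hx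
  have h4 := Real.sq_sqrt (h.nonneg n x)
  rw [← ENNReal.ofReal_natCast, ← ENNReal.ofReal_mul (Nat.cast_nonneg n),
    ← ENNReal.ofReal_ofNat 4, ← ENNReal.ofReal_mul (by norm_num), mul_pow,
    Real.sq_sqrt (Nat.cast_nonneg n)]
  refine ENNReal.ofReal_le_ofReal ?_
  have h5 : ℓ n x ≤ 4 * (Real.sqrt (ℓ n x) - 1) ^ 2 := by nlinarith
  calc (n : ℝ) * ℓ n x ≤ n * (4 * (Real.sqrt (ℓ n x) - 1) ^ 2) := by gcongr
    _ = _ := by ring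

variable [IsProbabilityMeasure ν]

/-- Where `ℓ ≤ 4`, the elementary bound `ℓ² ≤ 2 ℓ - 1 + 9 (√ℓ - 1)²` makes the second moment of
the truncated likelihood ratio `1 + O(1/n)`. -/
theorem lintegral_sq_truncated_le (h : IsDQM ν ℓ g) : ∃ C : ℝ, 0 ≤ C ∧ ∀ᶠ n : ℕ in atTop,
    ∫⁻ x, ({x | ℓ n x ≤ 4}.indicator (fun x => ENNReal.ofReal (ℓ n x)) x) ^ 2 ∂ν ≤
      ENNReal.ofReal (1 + C / n) := by
  obtain ⟨C, hC, hCn⟩ := h.eventually_lintegral_sq_le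
  refine ⟨9 * C, by positivity, ?_⟩
  filter_upwards [hCn, eventually_gt_atTop 0, h.lintegral_eq_one] with n hn hn0 h1
  have hn0' : (0 : ℝ) < n := Nat.cast_pos.2 hn0
  set D : X → ℝ := fun x => Real.sqrt n * (Real.sqrt (ℓ n x) - 1) with hD
  have hDm : Measurable D := h.measurable_quotient n
  have key : ∀ x, ({x | ℓ n x ≤ 4}.indicator (fun x => ENNReal.ofReal (ℓ n x)) x) ^ 2 + 1 ≤
      2 * ENNReal.ofReal (ℓ n x) + ENNReal.ofReal (9 / n) * ENNReal.ofReal (D x ^ 2) := by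
    intro x
    have h0 := h.nonneg n x
    have h4 := Real.sq_sqrt h0
    have h40 := Real.sqrt_nonneg (ℓ n x)
    have hD2 : 9 / n * D x ^ 2 = 9 * (Real.sqrt (ℓ n x) - 1) ^ 2 := by
      simp only [hD]
      rw [mul_pow, Real.sq_sqrt hn0'.le]
      field_simp
    rw [← ENNReal.ofReal_mul (by positivity), hD2, ← ENNReal.ofReal_ofNat 2,
      ← ENNReal.ofReal_mul (by norm_num), ← ENNReal.ofReal_add (by positivity) (by positivity)]
    by_cases hx : ℓ n x ≤ 4
    · rw [Set.indicator_of_mem (by exact hx), ← ENNReal.ofReal_pow h0, ← ENNReal.ofReal_one,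
        ← ENNReal.ofReal_add (by positivity) (by norm_num)]
      refine ENNReal.ofReal_le_ofReal ?_
      set y := Real.sqrt (ℓ n x) with hy
      have hy2 : y ≤ 2 := by nlinarith
      rw [← h4]
      have : 0 ≤ (y - 1) ^ 2 * ((2 - y) * (4 + y)) := by
        apply mul_nonneg (sq_nonneg _)
        apply mul_nonneg <;> linarith
      nlinarith
    · rw [Set.indicator_of_notMem (by exact hx)]
      simp only [ne_eq, OfNat.ofNat_ne_zero, not_false_eq_true, zero_pow, zero_add]
      rw [← ENNReal.ofReal_one]
      refine ENNReal.ofReal_le_ofReal ?_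
      nlinarith [sq_nonneg (Real.sqrt (ℓ n x) - 1)]
  have hsum := lintegral_mono (μ := ν) key
  have hmi : Measurable fun x => ({x | ℓ n x ≤ 4}.indicator
      (fun x => ENNReal.ofReal (ℓ n x)) x) ^ 2 :=
    ((h.measurable n).ennreal_ofReal.indicator
      (measurableSet_le (h.measurable n) measurable_const)).pow_const 2
  rw [lintegral_add_left hmi, lintegral_add_left (by
      exact (h.measurable n).ennreal_ofReal.const_mul 2),
    lintegral_const_mul _ (h.measurable n).ennreal_ofReal, h1,
    lintegral_const_mul _ (hDm.pow_const 2).ennreal_ofReal] at hsum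
  simp only [lintegral_const, measure_univ, mul_one] at hsum
  have h6 : 2 + ENNReal.ofReal (9 / n) * ∫⁻ x, ENNReal.ofReal (D x ^ 2) ∂ν ≤
      ENNReal.ofReal (1 + 9 * C / n) + 1 := by
    calc _ ≤ 2 + ENNReal.ofReal (9 / n) * ENNReal.ofReal C := by gcongr
      _ = _ := by
        rw [← ENNReal.ofReal_mul (by positivity), ← ENNReal.ofReal_ofNat 2,
          ← ENNReal.ofReal_add (by norm_num) (by positivity), ← ENNReal.ofReal_one,
          ← ENNReal.ofReal_add (by positivity) (by norm_num)]
        congr 1; ring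
  exact (ENNReal.add_le_add_iff_right (by simp)).1 (hsum.trans h6)

/-- **Contiguity**: along alternatives that are differentiable in quadratic mean, events that are
asymptotically negligible under the null law are asymptotically negligible. -/
theorem contiguous (h : IsDQM ν ℓ g) (A : (n : ℕ) → Set (Fin n → X))
    (hA : Tendsto (fun n => Measure.pi (fun _ : Fin n => ν) (A n)) atTop (𝓝 0)) :
    Tendsto (fun n => Measure.pi (fun _ : Fin n =>
      ν.withDensity fun x => ENNReal.ofReal (ℓ n x)) (A n)) atTop (𝓝 0) := by
  obtain ⟨C, hC, hCn⟩ := h.lintegral_sq_truncated_le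
  -- Either some coordinate has likelihood ratio above `4`, or the product `L` of the truncated
  -- ratios is at most `M`, or it exceeds `M`, where `L ≤ M⁻¹ L²` and `∫ L² ≤ (1 + C/n)^n ≤ exp C`.
  have hexp : ∀ᶠ n : ℕ in atTop, ∀ M : ℝ≥0∞, M ≠ 0 → M ≠ ⊤ →
      Measure.pi (fun _ : Fin n => ν.withDensity fun x => ENNReal.ofReal (ℓ n x)) (A n) ≤
      (n : ℝ≥0∞) * (ν.withDensity fun x => ENNReal.ofReal (ℓ n x)) {x | 4 < ℓ n x} +
      (M * Measure.pi (fun _ : Fin n => ν) (A n) + M⁻¹ * ENNReal.ofReal (Real.exp C)) := by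
    filter_upwards [hCn, eventually_gt_atTop 0, h.eventually_isProbabilityMeasure]
      with n hn hn0 hprob M hM0 hMt
    set f : X → ℝ≥0∞ := fun x => ENNReal.ofReal (ℓ n x) with hf
    have hfm : Measurable f := (h.measurable n).ennreal_ofReal
    set G : Set X := {x | ℓ n x ≤ 4} with hG
    have hGm : MeasurableSet G := measurableSet_le (h.measurable n) measurable_const
    set P := Measure.pi (fun _ : Fin n => ν)
    set Q := Measure.pi (fun _ : Fin n => ν.withDensity f)
    have hsub : A n ⊆ (⋃ i : Fin n, (fun x : Fin n → X => x i) ⁻¹' Gᶜ) ∪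
        (A n ∩ Set.univ.pi fun _ => G) := by
      intro x hx
      by_cases hxG : ∀ i, x i ∈ G
      · exact Or.inr ⟨hx, fun i _ => hxG i⟩
      · push Not at hxG
        obtain ⟨i, hi⟩ := hxG
        exact Or.inl (Set.mem_iUnion.2 ⟨i, hi⟩)
    have hb1 : Q (⋃ i : Fin n, (fun x : Fin n → X => x i) ⁻¹' Gᶜ) ≤
        n * (ν.withDensity f) {x | 4 < ℓ n x} := by
      refine (measure_iUnion_fintype_le _ _).trans ?_
      have : ∀ i : Fin n, Q ((fun x : Fin n → X => x i) ⁻¹' Gᶜ) =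
          (ν.withDensity f) {x | 4 < ℓ n x} := by
        intro i
        rw [(measurePreserving_eval (fun _ : Fin n => ν.withDensity f) i).measure_preimage
          hGm.compl.nullMeasurableSet]
        congr 1
        ext x; simp [hG]
      simp only [this, Finset.sum_const, Finset.card_univ, Fintype.card_fin, nsmul_eq_mul, le_refl]
    have hb2 : Q (A n ∩ Set.univ.pi fun _ => G) ≤
        M * P (A n) + M⁻¹ * ENNReal.ofReal (Real.exp C) := by
      have e1 : Q.restrict (Set.univ.pi fun _ => G) =
          P.withDensity (fun x => ∏ i, G.indicator f (x i)) := by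
        have : (ν.withDensity f).restrict G = ν.withDensity (G.indicator f) := by
          rw [withDensity_indicator hGm, restrict_withDensity hGm]
        have hs : SigmaFinite (ν.withDensity (G.indicator f)) := by rw [← this]; infer_instance
        rw [Measure.restrict_pi_pi, this, pi_withDensity _ _ _ (hfm.indicator hGm)]
      rw [← Measure.restrict_apply' (MeasurableSet.univ_pi fun _ => hGm), e1]
      set L : (Fin n → X) → ℝ≥0∞ := fun x => ∏ i, G.indicator f (x i) with hL
      have hLm : Measurable L := Finset.measurable_prod _ fun i _ =>
        (hfm.indicator hGm).comp (measurable_pi_apply i)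
      have hL2 : ∫⁻ x, L x ^ 2 ∂P ≤ ENNReal.ofReal (Real.exp C) := by
        simp only [hL, ← Finset.prod_pow]
        rw [lintegral_pi_prod ν (fun _ x => G.indicator f x ^ 2)
          fun _ => (hfm.indicator hGm).pow_const 2]
        simp only [Finset.prod_const, Finset.card_univ, Fintype.card_fin]
        calc _ ≤ ENNReal.ofReal (1 + C / n) ^ n := by gcongr
          _ = ENNReal.ofReal ((1 + C / n) ^ n) := (ENNReal.ofReal_pow (by positivity) n).symm
          _ ≤ _ := by
            refine ENNReal.ofReal_le_ofReal ?_
            have hn0' : (0 : ℝ) < n := Nat.cast_pos.2 hn0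
            calc (1 + C / n) ^ n ≤ (Real.exp (C / n)) ^ n := by
                  gcongr
                  rw [add_comm]; exact Real.add_one_le_exp _
              _ = Real.exp C := by
                  rw [← Real.exp_nat_mul]; congr 1; field_simp
      calc P.withDensity L (A n) ≤ P.withDensity L (toMeasurable P (A n)) :=
            measure_mono (subset_toMeasurable _ _)
        _ = ∫⁻ x in toMeasurable P (A n), L x ∂P :=
            withDensity_apply _ (measurableSet_toMeasurable _ _)
        _ ≤ ∫⁻ x in toMeasurable P (A n), (M + M⁻¹ * L x ^ 2) ∂P := by
            refine lintegral_mono fun x => ?_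
            rcases le_total (L x) M with hle | hle
            · exact hle.trans le_self_add
            · refine le_trans ?_ le_add_self
              calc L x = M⁻¹ * M * L x := by rw [ENNReal.inv_mul_cancel hM0 hMt, one_mul]
                _ ≤ M⁻¹ * L x * L x := by gcongr
                _ = _ := by ring
        _ ≤ M * P (A n) + M⁻¹ * ∫⁻ x, L x ^ 2 ∂P := by
            rw [lintegral_add_left measurable_const, lintegral_const, Measure.restrict_apply_univ,
              measure_toMeasurable, lintegral_const_mul _ (hLm.pow_const 2)]
            gcongr
            exact Measure.restrict_le_self
        _ ≤ _ := by gcongr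
    exact (measure_mono hsub).trans ((measure_union_le _ _).trans (add_le_add hb1 hb2))
  rw [ENNReal.tendsto_nhds_zero]
  intro ε hε
  -- the truncation level `M` is chosen so that `exp C / M ≤ ε / 3`
  rcases eq_or_ne ε ⊤ with rfl | hεt
  · exact Eventually.of_forall fun _ => le_top
  have hε3 : 0 < ε / 3 := ENNReal.div_pos hε.ne' (by simp)
  set M : ℝ≥0∞ := ENNReal.ofReal (Real.exp C) / (ε / 3) with hM
  have hM0 : M ≠ 0 := (ENNReal.div_pos (by simp [Real.exp_pos]) (ENNReal.div_ne_top hεt (by simp))).ne'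
  have hMt : M ≠ ⊤ := ENNReal.div_ne_top ENNReal.ofReal_ne_top hε3.ne'
  have t1 := (ENNReal.tendsto_nhds_zero.1 h.tendsto_mul_measure_gt) (ε / 3) hε3
  have t2 : Tendsto (fun n => M * Measure.pi (fun _ : Fin n => ν) (A n)) atTop (𝓝 0) := by
    simpa using ENNReal.Tendsto.const_mul (a := M) hA (Or.inr hMt)
  filter_upwards [hexp, t1, (ENNReal.tendsto_nhds_zero.1 t2) (ε / 3) hε3] with n hn h1 h2
  refine (hn M hM0 hMt).trans ?_
  have h3 : M⁻¹ * ENNReal.ofReal (Real.exp C) ≤ ε / 3 := by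
    rw [hM, ENNReal.inv_div (Or.inl (ENNReal.div_ne_top hεt (by simp))) (Or.inl hε3.ne'),
      ENNReal.div_mul_cancel (by simp [Real.exp_pos]) ENNReal.ofReal_ne_top]
  calc _ ≤ ε / 3 + (ε / 3 + ε / 3) := by gcongr
    _ = ε := by rw [← add_assoc]; exact ENNReal.add_thirds ε

end IsDQM

/-! ### Characteristic functions of normalized sums under local alternatives -/

theorem norm_exp_mul_I_sub_one_sub_le (y : ℝ) :
    ‖Complex.exp (y * Complex.I) - 1 - y * Complex.I‖ ≤ 3 * y ^ 2 := by
  rcases le_total |y| 1 with h | h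
  · have hn : ‖(y : ℂ) * Complex.I‖ = |y| := by simp
    have := Complex.norm_exp_sub_one_sub_id_le (x := y * Complex.I) (by rw [hn]; exact h)
    rw [hn, sq_abs] at this
    nlinarith [sq_nonneg y]
  · calc _ ≤ ‖Complex.exp (y * Complex.I)‖ + ‖(1 : ℂ)‖ + ‖(y : ℂ) * Complex.I‖ :=
          (norm_sub_le _ _).trans (add_le_add_left (norm_sub_le _ _) _)
      _ = 2 + |y| := by
          rw [Complex.norm_exp_ofReal_mul_I]; simp; norm_num
      _ ≤ 3 * |y| ^ 2 := by nlinarith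
      _ = _ := by rw [sq_abs]

theorem norm_exp_mul_I_sub_one_le (y : ℝ) : ‖Complex.exp (y * Complex.I) - 1‖ ≤ |y| := by
  have := Real.norm_exp_I_mul_ofReal_sub_one_le (x := y)
  rwa [mul_comm, Real.norm_eq_abs] at this

theorem norm_exp_mul_I_sub_one_le_two (y : ℝ) : ‖Complex.exp (y * Complex.I) - 1‖ ≤ 2 := by
  refine (norm_sub_le _ _).trans ?_
  rw [Complex.norm_exp_ofReal_mul_I, norm_one]; norm_num

theorem tendsto_inv_sqrt_nat : Tendsto (fun n : ℕ => (Real.sqrt n)⁻¹) atTop (𝓝 0) :=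
  tendsto_inv_atTop_zero.comp (Real.tendsto_sqrt_atTop.comp tendsto_natCast_atTop_atTop)

/-- The second order term of the characteristic function of a summand. -/
theorem tendsto_exp_second_order (y : ℝ) :
    Tendsto (fun n : ℕ => (n : ℂ) * (Complex.exp (((Real.sqrt n)⁻¹ * y : ℝ) * Complex.I) - 1 -
      ((Real.sqrt n)⁻¹ * y : ℝ) * Complex.I)) atTop (𝓝 (-(y : ℂ) ^ 2 / 2)) := by
  have h0 : Tendsto (fun n : ℕ => |y| ^ 3 * (Real.sqrt n)⁻¹) atTop (𝓝 0) := by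
    simpa using tendsto_inv_sqrt_nat.const_mul (|y| ^ 3)
  have hsmall : ∀ᶠ n : ℕ in atTop, |(Real.sqrt n)⁻¹ * y| ≤ 1 := by
    have : Tendsto (fun n : ℕ => |(Real.sqrt n)⁻¹ * y|) atTop (𝓝 0) := by
      simpa using (tendsto_inv_sqrt_nat.mul_const y).abs
    exact (this.eventually (gt_mem_nhds zero_lt_one)).mono fun n hn => hn.le
  rw [tendsto_iff_norm_sub_tendsto_zero]
  refine squeeze_zero' (Eventually.of_forall fun _ => norm_nonneg _) ?_ h0
  filter_upwards [hsmall, eventually_gt_atTop 0] with n hn hn0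
  have hn0' : (0 : ℝ) < n := Nat.cast_pos.2 hn0
  set a := (Real.sqrt n)⁻¹ with ha
  have ha0 : 0 ≤ a := by positivity
  have ha2 : (n : ℝ) * a ^ 2 = 1 := by
    rw [ha, inv_pow, Real.sq_sqrt hn0'.le]; field_simp
  set z : ℂ := ((a * y : ℝ) : ℂ) * Complex.I with hz
  have hzn : ‖z‖ = a * |y| := by
    rw [hz, norm_mul, Complex.norm_I, mul_one, Complex.norm_real, Real.norm_eq_abs, abs_mul,
      abs_of_nonneg ha0]
  have hb := Complex.exp_bound (x := z) (by rw [hzn, ← abs_of_nonneg ha0, ← abs_mul]; exact hn)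
    (n := 3) (by norm_num)
  simp only [Finset.sum_range_succ, Finset.sum_range_zero] at hb
  have e1 : (n : ℂ) * (Complex.exp z - 1 - z) - -(y : ℂ) ^ 2 / 2 =
      n * (Complex.exp z - (0 + z ^ 0 / (Nat.factorial 0 : ℕ) + z ^ 1 / (Nat.factorial 1 : ℕ) +
        z ^ 2 / (Nat.factorial 2 : ℕ))) := by
    have : (n : ℂ) * z ^ 2 = -(y : ℂ) ^ 2 := by
      rw [hz, mul_pow, Complex.I_sq]
      push_cast
      have : (n : ℂ) * (a : ℂ) ^ 2 = 1 := by exact_mod_cast ha2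
      linear_combination -(y : ℂ) ^ 2 * this
    simp [Nat.factorial]
    linear_combination (1 / 2 : ℂ) * this
  rw [e1, norm_mul, Complex.norm_natCast]
  calc (n : ℝ) * _ ≤ n * (‖z‖ ^ 3 * _) := mul_le_mul_of_nonneg_left hb (by positivity)
    _ ≤ n * (‖z‖ ^ 3 * 1) := by
        gcongr
        simp [Nat.factorial]; norm_num
    _ = |y| ^ 3 * a * (n * a ^ 2) := by rw [hzn]; ring
    _ = _ := by rw [ha2, mul_one]

/-- The first order term of the characteristic function of a summand. -/
theorem tendsto_sqrt_mul_exp_sub_one (y : ℝ) :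
    Tendsto (fun n : ℕ => (Real.sqrt n : ℂ) *
      (Complex.exp (((Real.sqrt n)⁻¹ * y : ℝ) * Complex.I) - 1)) atTop
      (𝓝 ((y : ℂ) * Complex.I)) := by
  have h1 := (tendsto_inv_sqrt_nat.ofReal.mul (tendsto_exp_second_order y)).add_const
    ((y : ℂ) * Complex.I)
  simp only [Complex.ofReal_zero, zero_mul, zero_add] at h1
  refine h1.congr' ?_
  filter_upwards [eventually_gt_atTop 0] with n hn0
  have hn0' : (0 : ℝ) < n := Nat.cast_pos.2 hn0
  have hs : (Real.sqrt n : ℂ) ≠ 0 := by exact_mod_cast (Real.sqrt_pos.2 hn0').ne'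
  have hs2 : (n : ℂ) = (Real.sqrt n : ℂ) * Real.sqrt n := by
    exact_mod_cast (Real.mul_self_sqrt hn0'.le).symm
  have e : ((((Real.sqrt n)⁻¹ : ℝ) : ℂ)) = (Real.sqrt n : ℂ)⁻¹ := by push_cast; rfl
  rw [hs2]
  simp only [Complex.ofReal_mul, e]
  field_simp
  ring

theorem integral_abs_mul_le_sqrt {X : Type*} [MeasurableSpace X] {μ : Measure X} {f g : X → ℝ}
    (hf : MemLp f 2 μ) (hg : MemLp g 2 μ) :
    ∫ x, |f x| * |g x| ∂μ ≤ Real.sqrt (∫ x, f x ^ 2 ∂μ) * Real.sqrt (∫ x, g x ^ 2 ∂μ) := by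
  have h2 : ENNReal.ofReal 2 = 2 := by simp
  have := integral_mul_norm_le_Lp_mul_Lq (μ := μ) (f := f) (g := g) Real.HolderConjugate.two_two
    (by rwa [h2]) (by rwa [h2])
  simpa [Real.norm_eq_abs, Real.sqrt_eq_rpow] using this

namespace IsDQM

variable {X : Type*} [MeasurableSpace X] {ν : Measure X}
  {ℓ : ℕ → X → ℝ} {g : X → ℝ}

theorem eventually_memLp (h : IsDQM ν ℓ g) : ∀ᶠ n : ℕ in atTop,
    MemLp (fun x => Real.sqrt n * (Real.sqrt (ℓ n x) - 1)) 2 ν := by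
  obtain ⟨C, hC, hCn⟩ := h.eventually_lintegral_sq_le
  filter_upwards [hCn] with n hn
  rw [memLp_two_iff_integrable_sq (h.measurable_quotient n).aestronglyMeasurable]
  refine ⟨((h.measurable_quotient n).pow_const 2).aestronglyMeasurable, ?_⟩
  rw [hasFiniteIntegral_iff_ofReal (Eventually.of_forall fun x => sq_nonneg _)]
  exact hn.trans_lt ENNReal.ofReal_lt_top

theorem tendsto_integral_sq (h : IsDQM ν ℓ g) : Tendsto
    (fun n : ℕ => ∫ x, (Real.sqrt n * (Real.sqrt (ℓ n x) - 1) - g x) ^ 2 ∂ν) atTop (𝓝 0) := by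
  have := (ENNReal.tendsto_toReal ENNReal.zero_ne_top).comp h.tendsto
  refine this.congr fun n => ?_
  rw [integral_eq_lintegral_of_nonneg_ae (Eventually.of_forall fun x => sq_nonneg _)]
  · rfl
  · exact (((h.measurable_quotient n).aemeasurable.sub
      h.memLp.aestronglyMeasurable.aemeasurable).pow_const 2).aestronglyMeasurable

variable [IsProbabilityMeasure ν]

/-- The expansion of the characteristic function of a single summand: with
`nℓ = n + 2 √n D + D²` and `D → g` in `L²`, the drift `2 ∫ b g` comes from the cross term and the
variance from the null law; no expansion of the log-likelihood is needed. -/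
theorem tendsto_mul_charFun_sub_one (h : IsDQM ν ℓ g) {b : X → ℝ} (hb : MemLp b 2 ν)
    (hb0 : ∫ x, b x ∂ν = 0) :
    Tendsto (fun n : ℕ => (n : ℂ) *
      ((∫ x, Complex.exp (((Real.sqrt n)⁻¹ * b x : ℝ) * Complex.I)
        ∂(ν.withDensity fun x => ENNReal.ofReal (ℓ n x))) - 1)) atTop
      (𝓝 (2 * ((∫ x, b x * g x ∂ν : ℝ) : ℂ) * Complex.I - ((∫ x, b x ^ 2 ∂ν : ℝ) : ℂ) / 2)) := by
  set e : ℕ → X → ℂ := fun n x => Complex.exp (((Real.sqrt n)⁻¹ * b x : ℝ) * Complex.I) with he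
  set D : ℕ → X → ℝ := fun n x => Real.sqrt n * (Real.sqrt (ℓ n x) - 1) with hD
  have hg := h.memLp
  have hbm : AEMeasurable b ν := hb.aestronglyMeasurable.aemeasurable
  have hem : ∀ n, AEStronglyMeasurable (e n) ν := fun n =>
    (Complex.continuous_exp.measurable.comp_aemeasurable
      ((Complex.measurable_ofReal.comp_aemeasurable (hbm.const_mul _)).mul_const _)).aestronglyMeasurable
  have hnorm : ∀ (n : ℕ) (x : X), √(n : ℝ) * ‖e n x - 1‖ ≤ |b x| := by
    intro n x
    rcases Nat.eq_zero_or_pos n with rfl | hn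
    · simp
    have hs : 0 < √(n : ℝ) := Real.sqrt_pos.2 (Nat.cast_pos.2 hn)
    calc _ ≤ √(n : ℝ) * |(√(n : ℝ))⁻¹ * b x| := by
          gcongr; exact norm_exp_mul_I_sub_one_le _
      _ = |b x| := by
          rw [abs_mul, abs_of_pos (inv_pos.2 hs), ← mul_assoc, mul_inv_cancel₀ hs.ne', one_mul]
  have he2 : ∀ n x, ‖e n x - 1‖ ≤ 2 := fun n x => norm_exp_mul_I_sub_one_le_two _
  -- the three limits
  have I1 : Tendsto (fun n : ℕ => ∫ x, (n : ℂ) * (e n x - 1 -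
      ((Real.sqrt n)⁻¹ * b x : ℝ) * Complex.I) ∂ν) atTop (𝓝 (∫ x, -(b x : ℂ) ^ 2 / 2 ∂ν)) := by
    refine tendsto_integral_of_dominated_convergence (fun x => 3 * b x ^ 2) (fun n => ?_)
      (hb.integrable_sq.const_mul 3) (fun n => Eventually.of_forall fun x => ?_)
      (Eventually.of_forall fun x => tendsto_exp_second_order (b x))
    · exact ((((hem n).sub aestronglyMeasurable_const)).sub
        ((Complex.measurable_ofReal.comp_aemeasurable (hbm.const_mul _)).mul_const
          _).aestronglyMeasurable).const_mul _
    · rw [norm_mul, Complex.norm_natCast]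
      rcases Nat.eq_zero_or_pos n with rfl | hn
      · simp; positivity
      calc (n : ℝ) * _ ≤ n * (3 * ((√(n : ℝ))⁻¹ * b x) ^ 2) := by
            gcongr; exact norm_exp_mul_I_sub_one_sub_le _
        _ = 3 * b x ^ 2 := by
            rw [mul_pow, inv_pow, Real.sq_sqrt (Nat.cast_nonneg n)]
            have : (n : ℝ) ≠ 0 := by exact_mod_cast hn.ne'
            field_simp
  have I2 : Tendsto (fun n : ℕ => ∫ x, ((√n : ℂ) * (e n x - 1)) * (2 * g x : ℝ) ∂ν) atTop
      (𝓝 (∫ x, ((b x : ℂ) * Complex.I) * (2 * g x : ℝ) ∂ν)) := by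
    refine tendsto_integral_of_dominated_convergence (fun x => |b x| * |2 * g x|) (fun n => ?_)
      ?_ (fun n => Eventually.of_forall fun x => ?_)
      (Eventually.of_forall fun x => (tendsto_sqrt_mul_exp_sub_one (b x)).mul_const _)
    · exact (((hem n).sub aestronglyMeasurable_const).const_mul _).mul
        (Complex.measurable_ofReal.comp_aemeasurable
          (hg.aestronglyMeasurable.aemeasurable.const_mul 2)).aestronglyMeasurable
    · simp only [← abs_mul]
      exact (MemLp.integrable_mul hb (hg.const_mul 2)).abs
    · rw [norm_mul, norm_mul, Complex.norm_real, Complex.norm_real, Real.norm_eq_abs,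
        Real.norm_eq_abs, abs_of_nonneg (Real.sqrt_nonneg _)]
      gcongr
      exact hnorm n x
  have I2' : Tendsto (fun n : ℕ => ∫ x, ((√n : ℂ) * (e n x - 1)) * (2 * (D n x - g x) : ℝ) ∂ν)
      atTop (𝓝 0) := by
    have hlim : Tendsto (fun n : ℕ => 2 * (Real.sqrt (∫ x, b x ^ 2 ∂ν) *
        Real.sqrt (∫ x, (D n x - g x) ^ 2 ∂ν))) atTop (𝓝 0) := by
      have := ((Real.continuous_sqrt.tendsto 0).comp h.tendsto_integral_sq).const_mul
        (Real.sqrt (∫ x, b x ^ 2 ∂ν))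
      simpa using this.const_mul 2
    rw [tendsto_zero_iff_norm_tendsto_zero]
    refine squeeze_zero' (Eventually.of_forall fun _ => norm_nonneg _) ?_ hlim
    filter_upwards [h.eventually_memLp] with n hn
    have hDg : MemLp (fun x => D n x - g x) 2 ν := hn.sub hg
    refine (norm_integral_le_integral_norm _).trans ?_
    calc _ ≤ ∫ x, 2 * (|b x| * |D n x - g x|) ∂ν := by
          refine integral_mono_of_nonneg (Eventually.of_forall fun _ => norm_nonneg _) ?_
            (Eventually.of_forall fun x => ?_)
          · simp only [← abs_mul]
            exact (MemLp.integrable_mul hb hDg).abs.const_mul 2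
          · simp only
            rw [norm_mul, norm_mul, Complex.norm_real, Complex.norm_real, Real.norm_eq_abs,
              Real.norm_eq_abs, abs_of_nonneg (Real.sqrt_nonneg _), abs_mul,
              abs_of_nonneg (zero_le_two (α := ℝ))]
            have := mul_le_mul_of_nonneg_right (hnorm n x) (abs_nonneg (D n x - g x))
            linarith
      _ ≤ _ := by
          rw [integral_const_mul]
          exact mul_le_mul_of_nonneg_left (integral_abs_mul_le_sqrt hb hDg) zero_le_two
  have I3' : Tendsto (fun n : ℕ => ∫ x, ‖e n x - 1‖ * g x ^ 2 ∂ν) atTop (𝓝 (∫ x, (0 : ℝ) ∂ν)) := by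
    refine tendsto_integral_of_dominated_convergence (fun x => 2 * g x ^ 2) (fun n => ?_)
      (hg.integrable_sq.const_mul 2) (fun n => Eventually.of_forall fun x => ?_)
      (Eventually.of_forall fun x => ?_)
    · exact ((hem n).sub aestronglyMeasurable_const).norm.mul
        (hg.aestronglyMeasurable.pow 2)
    · rw [norm_mul, norm_norm, Real.norm_eq_abs, abs_of_nonneg (sq_nonneg (g x))]
      gcongr
      exact he2 n x
    · have : Tendsto (fun n : ℕ => |(√(n : ℝ))⁻¹ * b x| * g x ^ 2) atTop (𝓝 0) := by
        have := (tendsto_inv_sqrt_nat.mul_const (b x)).abs.mul_const (g x ^ 2)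
        simpa using this
      refine squeeze_zero (fun n => by positivity) (fun n => ?_) this
      gcongr
      exact norm_exp_mul_I_sub_one_le _
  have I3 : Tendsto (fun n : ℕ => ∫ x, (e n x - 1) * (D n x ^ 2 : ℝ) ∂ν) atTop (𝓝 0) := by
    have hlim : Tendsto (fun n : ℕ => 4 * (∫ x, (D n x - g x) ^ 2 ∂ν) +
        2 * ∫ x, ‖e n x - 1‖ * g x ^ 2 ∂ν) atTop (𝓝 0) := by
      rw [integral_zero] at I3'
      simpa using (h.tendsto_integral_sq.const_mul 4).add (I3'.const_mul 2)
    rw [tendsto_zero_iff_norm_tendsto_zero]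
    refine squeeze_zero' (Eventually.of_forall fun _ => norm_nonneg _) ?_ hlim
    filter_upwards [h.eventually_memLp] with n hn
    have hDg : MemLp (fun x => D n x - g x) 2 ν := hn.sub hg
    have hint : Integrable (fun x => ‖e n x - 1‖ * g x ^ 2) ν := by
      refine Integrable.mono' (hg.integrable_sq.const_mul 2)
        (((hem n).sub aestronglyMeasurable_const).norm.mul (hg.aestronglyMeasurable.pow 2))
        (Eventually.of_forall fun x => ?_)
      rw [norm_mul, norm_norm, Real.norm_eq_abs, abs_of_nonneg (sq_nonneg (g x))]
      gcongr
      exact he2 n x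
    refine (norm_integral_le_integral_norm _).trans ?_
    rw [← integral_const_mul, ← integral_const_mul, ← integral_add
      (hDg.integrable_sq.const_mul 4) (hint.const_mul 2)]
    refine integral_mono_of_nonneg (Eventually.of_forall fun _ => norm_nonneg _)
      ((hDg.integrable_sq.const_mul 4).add (hint.const_mul 2)) (Eventually.of_forall fun x => ?_)
    simp only
    rw [norm_mul, Complex.norm_real, Real.norm_eq_abs, abs_of_nonneg (sq_nonneg _)]
    have h1 : D n x ^ 2 ≤ 2 * (D n x - g x) ^ 2 + 2 * g x ^ 2 := by
      nlinarith [sq_nonneg (D n x - 2 * g x)]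
    have h2 := he2 n x
    have h3 := norm_nonneg (e n x - 1)
    calc _ ≤ ‖e n x - 1‖ * (2 * (D n x - g x) ^ 2 + 2 * g x ^ 2) := by gcongr
      _ = ‖e n x - 1‖ * (2 * (D n x - g x) ^ 2) + 2 * (‖e n x - 1‖ * g x ^ 2) := by ring
      _ ≤ 2 * (2 * (D n x - g x) ^ 2) + 2 * (‖e n x - 1‖ * g x ^ 2) := by gcongr
      _ = _ := by ring
  have hsum := ((I1.add I2).add I2').add I3
  have hlimit : (∫ x, -(b x : ℂ) ^ 2 / 2 ∂ν) + (∫ x, ((b x : ℂ) * Complex.I) * (2 * g x : ℝ) ∂ν)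
      + 0 + 0 = 2 * ((∫ x, b x * g x ∂ν : ℝ) : ℂ) * Complex.I -
        ((∫ x, b x ^ 2 ∂ν : ℝ) : ℂ) / 2 := by
    have e1 : (∫ x, -(b x : ℂ) ^ 2 / 2 ∂ν) = -((∫ x, b x ^ 2 ∂ν : ℝ) : ℂ) / 2 := by
      rw [integral_div, ← integral_complex_ofReal, ← integral_neg]
      push_cast; rfl
    have e2 : (∫ x, ((b x : ℂ) * Complex.I) * (2 * g x : ℝ) ∂ν) =
        2 * ((∫ x, b x * g x ∂ν : ℝ) : ℂ) * Complex.I := by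
      rw [← integral_complex_ofReal, ← integral_const_mul, ← integral_mul_const]
      congr 1; ext x; push_cast; ring
    rw [e1, e2]; ring
  rw [hlimit] at hsum
  refine hsum.congr' ?_
  filter_upwards [h.eventually_memLp, h.lintegral_eq_one, eventually_gt_atTop 0] with n hn h1 hn0
  have hn0' : (0 : ℝ) < n := Nat.cast_pos.2 hn0
  have hs : 0 < √(n : ℝ) := Real.sqrt_pos.2 hn0'
  have hDm : MemLp (D n) 2 ν := hn
  have hDg : MemLp (fun x => D n x - g x) 2 ν := hn.sub hg
  have hℓint : Integrable (ℓ n) ν := by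
    refine ⟨(h.measurable n).aestronglyMeasurable, ?_⟩
    rw [hasFiniteIntegral_iff_ofReal (Eventually.of_forall (h.nonneg n)), h1]
    exact ENNReal.one_lt_top
  have hℓ1 : ∫ x, ℓ n x ∂ν = 1 := by
    rw [integral_eq_lintegral_of_nonneg_ae (Eventually.of_forall (h.nonneg n))
      (h.measurable n).aestronglyMeasurable, h1, ENNReal.toReal_one]
  have hem1 : AEStronglyMeasurable (fun x => e n x - 1) ν := (hem n).sub aestronglyMeasurable_const
  have bdd : ∀ {f : X → ℝ}, Integrable f ν → Integrable (fun x => (e n x - 1) * (f x : ℂ)) ν :=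
    fun hf => (hf.ofReal (𝕜 := ℂ)).bdd_mul hem1 (c := 2) (Eventually.of_forall fun x => he2 n x)
  have i1 : Integrable (fun x => (n : ℂ) * (e n x - 1 - ((√n)⁻¹ * b x : ℝ) * Complex.I)) ν := by
    refine Integrable.const_mul (Integrable.sub ?_ ?_) _
    · simpa using bdd (integrable_const (1 : ℝ))
    · exact (((hb.integrable (by norm_num)).const_mul _).ofReal).mul_const _
  have i2 : Integrable (fun x => ((√n : ℂ) * (e n x - 1)) * (2 * g x : ℝ)) ν := by
    simp only [mul_assoc]
    exact (bdd ((hg.integrable (by norm_num)).const_mul 2)).const_mul _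
  have i2' : Integrable (fun x => ((√n : ℂ) * (e n x - 1)) * (2 * (D n x - g x) : ℝ)) ν := by
    simp only [mul_assoc]
    exact (bdd ((hDg.integrable (by norm_num)).const_mul 2)).const_mul _
  have i3 : Integrable (fun x => (e n x - 1) * (D n x ^ 2 : ℝ)) ν := bdd hDm.integrable_sq
  have ib : Integrable (fun x => (((√n)⁻¹ * b x : ℝ) : ℂ) * Complex.I) ν :=
    (((hb.integrable (by norm_num)).const_mul _).ofReal).mul_const _
  have hib : ∫ x, (((√n)⁻¹ * b x : ℝ) : ℂ) * Complex.I ∂ν = 0 := by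
    rw [integral_mul_const, integral_complex_ofReal, integral_const_mul, hb0]; simp
  have i12 : Integrable (fun x => (n : ℂ) * (e n x - 1 - ((√n)⁻¹ * b x : ℝ) * Complex.I) +
      ((√n : ℂ) * (e n x - 1)) * (2 * g x : ℝ)) ν := i1.add i2
  have i123 : Integrable (fun x => (n : ℂ) * (e n x - 1 - ((√n)⁻¹ * b x : ℝ) * Complex.I) +
      ((√n : ℂ) * (e n x - 1)) * (2 * g x : ℝ) +
      ((√n : ℂ) * (e n x - 1)) * (2 * (D n x - g x) : ℝ)) ν := i12.add i2'
  rw [← integral_add i1 i2, ← integral_add i12 i2', ← integral_add i123 i3]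
  have hdens : ∫ x, e n x ∂(ν.withDensity fun x => ENNReal.ofReal (ℓ n x)) =
      ∫ x, (ℓ n x : ℂ) * e n x ∂ν := by
    rw [integral_withDensity_eq_integral_toReal_smul (h.measurable n).ennreal_ofReal
      (Eventually.of_forall fun x => ENNReal.ofReal_lt_top)]
    congr 1; ext x
    rw [ENNReal.toReal_ofReal (h.nonneg n x), Complex.real_smul]
  have hone : (1 : ℂ) = ∫ x, (ℓ n x : ℂ) ∂ν := by rw [integral_complex_ofReal, hℓ1]; simp
  change _ = (n : ℂ) * (∫ x, e n x ∂(ν.withDensity fun x => ENNReal.ofReal (ℓ n x)) - 1)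
  have hie : Integrable (fun x => (e n x - 1) * (ℓ n x : ℂ)) ν := bdd hℓint
  have : ∫ x, e n x ∂(ν.withDensity fun x => ENNReal.ofReal (ℓ n x)) - 1 =
      ∫ x, (e n x - 1) * (ℓ n x : ℂ) ∂ν := by
    have iℓ : Integrable (fun x => (ℓ n x : ℂ)) ν := hℓint.ofReal
    rw [hdens]
    nth_rewrite 1 [hone]
    rw [← integral_sub _ iℓ]
    · congr 1; ext x; ring
    · refine (hie.add iℓ).congr (Eventually.of_forall fun x => ?_)
      simp only [Pi.add_apply]; ring
  rw [this, ← integral_const_mul, ← sub_eq_zero, ← integral_sub _ (hie.const_mul _)]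
  swap
  · exact i123.add i3
  rw [← neg_eq_zero, ← integral_neg]
  have hz : ∫ x, (n : ℂ) * ((((√n)⁻¹ * b x : ℝ) : ℂ) * Complex.I) ∂ν = 0 := by
    rw [integral_const_mul, hib, mul_zero]
  rw [← hz]
  congr 1; ext x
  have hℓ : (n : ℝ) * ℓ n x = n + 2 * √n * D n x + D n x ^ 2 := by
    have h4 := Real.sq_sqrt (h.nonneg n x)
    have h5 := Real.sq_sqrt hn0'.le
    simp only [hD]
    nth_rewrite 1 [← h5]
    nth_rewrite 1 [← h4]
    nth_rewrite 2 [← h5]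
    ring
  have hℓ' : (n : ℂ) * (ℓ n x : ℂ) = n + 2 * (√n : ℂ) * D n x + (D n x : ℂ) ^ 2 := by
    exact_mod_cast hℓ
  push_cast
  linear_combination (e n x - 1) * hℓ'

/-- **Characteristic functions under local alternatives**: a normalized sum of centered square
integrable terms `b` is asymptotically normal with mean `2 ∫ b g` and variance `∫ b²`. -/
theorem tendsto_charFun (h : IsDQM ν ℓ g) {b : X → ℝ} (hb : MemLp b 2 ν)
    (hb0 : ∫ x, b x ∂ν = 0) :
    Tendsto (fun n : ℕ => ∫ x : Fin n → X,
        Complex.exp (((Real.sqrt n)⁻¹ * ∑ i, b (x i) : ℝ) * Complex.I)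
        ∂(Measure.pi fun _ : Fin n => ν.withDensity fun x => ENNReal.ofReal (ℓ n x))) atTop
      (𝓝 (Complex.exp (2 * ((∫ x, b x * g x ∂ν : ℝ) : ℂ) * Complex.I -
        ((∫ x, b x ^ 2 ∂ν : ℝ) : ℂ) / 2))) := by
  have := Complex.tendsto_one_add_pow_exp_of_tendsto (h.tendsto_mul_charFun_sub_one hb hb0)
  refine this.congr' ?_
  filter_upwards [h.eventually_isProbabilityMeasure] with n hprob
  have e1 : ∀ x : Fin n → X, Complex.exp (((Real.sqrt n)⁻¹ * ∑ i, b (x i) : ℝ) * Complex.I) =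
      ∏ i, Complex.exp (((Real.sqrt n)⁻¹ * b (x i) : ℝ) * Complex.I) := by
    intro x
    rw [← Complex.exp_sum, Finset.mul_sum, Complex.ofReal_sum, Finset.sum_mul]
  simp only [e1]
  rw [integral_fintype_prod_eq_pow (fun x => Complex.exp (((Real.sqrt n)⁻¹ * b x : ℝ) * Complex.I)),
    Fintype.card_fin]
  congr 1; ring

end IsDQM

/-! ### Noncentral chi-square limits -/

/-- The mean vector in the definition of the noncentral chi-square law. -/
def ncMean (d : ℕ) (lam : ℝ) (i : Fin d) : ℝ := if (i : ℕ) = 0 then Real.sqrt lam else 0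

/-- The normal law on `ℝ^d` with identity covariance whose squared norm is noncentral
chi-square. -/
def ncGaussian (d : ℕ) (lam : ℝ) : Measure (EuclideanSpace ℝ (Fin d)) :=
  (Measure.pi (fun i : Fin d => gaussianReal (ncMean d lam i) 1)).map (WithLp.toLp 2)

instance (d : ℕ) (lam : ℝ) : IsProbabilityMeasure (ncGaussian d lam) :=
  Measure.isProbabilityMeasure_map (Measurable.aemeasurable (by fun_prop))

/-- The limit in `IsDQM.tendsto_charFun_of_equiv` is recognized by its characteristic function. -/
theorem charFun_ncGaussian (d : ℕ) (lam : ℝ) (t : EuclideanSpace ℝ (Fin d)) :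
    charFun (ncGaussian d lam) t =
      Complex.exp (((∑ i, t i * ncMean d lam i : ℝ) : ℂ) * Complex.I - ((‖t‖ ^ 2 : ℝ) : ℂ) / 2) := by
  rw [charFun_apply, ncGaussian, integral_map (Measurable.aemeasurable (by fun_prop))
    (Measurable.aestronglyMeasurable (by fun_prop))]
  have e1 : ∀ x : Fin d → ℝ, Complex.exp ((inner ℝ (WithLp.toLp 2 x) t : ℝ) * Complex.I) =
      ∏ i, Complex.exp (t i * x i * Complex.I) := by
    intro x
    rw [← Complex.exp_sum, PiLp.inner_apply, Complex.ofReal_sum, Finset.sum_mul]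
    simp
  simp only [e1]
  rw [integral_fintype_prod_eq_prod (f := fun i x => Complex.exp (t i * (x : ℝ) * Complex.I))]
  simp only [← charFun_apply_real, charFun_gaussianReal]
  rw [← Complex.exp_sum, EuclideanSpace.norm_sq_eq]
  congr 1
  push_cast
  rw [Finset.sum_sub_distrib, Finset.sum_mul, ← Finset.sum_div]
  congr 2
  refine Finset.sum_congr rfl fun i _ => ?_
  rw [Real.norm_eq_abs, ← Complex.ofReal_pow, ← Complex.ofReal_pow, sq_abs, one_mul]

theorem noncentralChiSq_eq_map (d : ℕ) (lam : ℝ) :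
    noncentralChiSq d lam = (ncGaussian d lam).map (fun z => ‖z‖ ^ 2) := by
  rw [ncGaussian, Measure.map_map (by fun_prop) (by fun_prop), noncentralChiSq]
  congr 1
  ext z
  simp [EuclideanSpace.norm_sq_eq]

instance (d : ℕ) (lam : ℝ) : IsProbabilityMeasure (noncentralChiSq d lam) := by
  rw [noncentralChiSq_eq_map]
  exact Measure.isProbabilityMeasure_map (Measurable.aemeasurable (by fun_prop))

theorem norm_exp_mul_I_sub_exp_mul_I_le (a b : ℝ) :
    ‖Complex.exp (a * Complex.I) - Complex.exp (b * Complex.I)‖ ≤ |a - b| := by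
  have : Complex.exp (a * Complex.I) - Complex.exp (b * Complex.I) =
      Complex.exp (b * Complex.I) * (Complex.exp (((a - b : ℝ) : ℂ) * Complex.I) - 1) := by
    rw [mul_sub, ← Complex.exp_add, mul_one]
    congr 2
    push_cast; ring
  rw [this, norm_mul, Complex.norm_exp_ofReal_mul_I, one_mul]
  exact norm_exp_mul_I_sub_one_le _

namespace IsDQM

variable {X : Type*} [MeasurableSpace X] {ν : Measure X} [IsProbabilityMeasure ν]
  {ℓ : ℕ → X → ℝ} {g : X → ℝ}

/-- A statistic that is asymptotically equivalent, under the null law, to the normalized sum of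
an orthonormal family `a` of centered functions has, along the local alternatives, the same
limiting characteristic function as that sum. -/
theorem tendsto_charFun_of_equiv (h : IsDQM ν ℓ g) {d : ℕ} {lam : ℝ} {a : Fin d → X → ℝ}
    (ham : ∀ i, Measurable (a i)) (ha : ∀ i, MemLp (a i) 2 ν) (ha0 : ∀ i, ∫ x, a i x ∂ν = 0)
    (hcov : ∀ i j, ∫ x, a i x * a j x ∂ν = if i = j then 1 else 0)
    (hmean : ∀ i, 2 * ∫ x, a i x * g x ∂ν = ncMean d lam i)
    {T : (n : ℕ) → (Fin n → X) → EuclideanSpace ℝ (Fin d)} (hT : ∀ n, Measurable (T n))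
    (hequiv : ∀ ε > 0, Tendsto (fun n : ℕ => Measure.pi (fun _ : Fin n => ν)
      {x | ∃ i, ε ≤ |T n x i - (Real.sqrt n)⁻¹ * ∑ j, a i (x j)|}) atTop (𝓝 0))
    (t : EuclideanSpace ℝ (Fin d)) :
    Tendsto (fun n : ℕ => ∫ x, Complex.exp ((inner ℝ (T n x) t : ℝ) * Complex.I)
        ∂(Measure.pi fun _ : Fin n => ν.withDensity fun x => ENNReal.ofReal (ℓ n x))) atTop
      (𝓝 (charFun (ncGaussian d lam) t)) := by
  have hb : MemLp (fun x => ∑ i, t i * a i x) 2 ν :=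
    memLp_finsetSum _ fun i _ => (ha i).const_mul _
  have hb0 : ∫ x, ∑ i, t i * a i x ∂ν = 0 := by
    rw [integral_finsetSum _ fun i _ => ((ha i).integrable (by norm_num)).const_mul _]
    simp [integral_const_mul, ha0]
  have hbg : 2 * ∫ x, (∑ i, t i * a i x) * g x ∂ν = ∑ i, t i * ncMean d lam i := by
    simp only [Finset.sum_mul]
    rw [integral_finsetSum _ fun i _ => by
      simpa only [mul_assoc, Pi.mul_apply] using (MemLp.integrable_mul (ha i) h.memLp).const_mul (t i),
      Finset.mul_sum]
    refine Finset.sum_congr rfl fun i _ => ?_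
    simp only [mul_assoc]
    rw [integral_const_mul, ← hmean i]; ring
  have hb2 : ∫ x, (∑ i, t i * a i x) ^ 2 ∂ν = ‖t‖ ^ 2 := by
    have hint : ∀ i j, Integrable (fun x => t i * a i x * (t j * a j x)) ν := fun i j =>
      MemLp.integrable_mul ((ha i).const_mul _) ((ha j).const_mul _)
    simp only [sq, Finset.sum_mul_sum]
    rw [integral_finsetSum _ fun i _ => integrable_finsetSum _ fun j _ => hint i j]
    rw [← sq, EuclideanSpace.norm_sq_eq]
    refine Finset.sum_congr rfl fun i _ => ?_
    rw [integral_finsetSum _ fun j _ => hint i j]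
    have : ∀ j, ∫ x, t i * a i x * (t j * a j x) ∂ν = t i * t j * if i = j then 1 else 0 := by
      intro j
      rw [← hcov i j, ← integral_const_mul]
      congr 1; ext x; ring
    simp only [this]
    simp [sq]
  have hmain := h.tendsto_charFun hb hb0
  have hlim : Complex.exp (2 * ((∫ x, (∑ i, t i * a i x) * g x ∂ν : ℝ) : ℂ) * Complex.I -
      ((∫ x, (∑ i, t i * a i x) ^ 2 ∂ν : ℝ) : ℂ) / 2) = charFun (ncGaussian d lam) t := by
    rw [charFun_ncGaussian, hb2, ← hbg]
    push_cast; rfl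
  rw [hlim] at hmain
  rw [← tendsto_sub_nhds_zero_iff] at hmain ⊢
  suffices hdiff : Tendsto (fun n : ℕ =>
      ∫ x, Complex.exp ((inner ℝ (T n x) t : ℝ) * Complex.I)
        ∂(Measure.pi fun _ : Fin n => ν.withDensity fun x => ENNReal.ofReal (ℓ n x)) -
      ∫ x : Fin n → X, Complex.exp (((Real.sqrt n)⁻¹ * ∑ j, ∑ i, t i * a i (x j) : ℝ) * Complex.I)
        ∂(Measure.pi fun _ : Fin n => ν.withDensity fun x => ENNReal.ofReal (ℓ n x)))
      atTop (𝓝 0) by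
    have := hdiff.add hmain
    rw [zero_add] at this
    exact this.congr fun n => by ring
  set S : ℝ := ∑ i, |t i| with hS
  have hS0 : 0 ≤ S := Finset.sum_nonneg fun i _ => abs_nonneg _
  rw [Metric.tendsto_nhds]
  intro η hη
  -- Outside of the exceptional set `B` below, the two exponents differ by at most `ε S < η / 2`.
  set ε : ℝ := η / (2 * (S + 1)) with hε
  have hε0 : 0 < ε := by positivity
  have hbad := (ENNReal.tendsto_toReal ENNReal.zero_ne_top).comp
    (h.contiguous _ (hequiv ε hε0))
  filter_upwards [h.eventually_isProbabilityMeasure,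
    hbad.eventually (gt_mem_nhds (show (0 : ENNReal).toReal < η / 8 by simpa using by positivity))]
    with n hprob hn
  set Q := Measure.pi fun _ : Fin n => ν.withDensity fun x => ENNReal.ofReal (ℓ n x) with hQ
  set B : Set (Fin n → X) :=
    {x | ∃ i, ε ≤ |T n x i - (Real.sqrt n)⁻¹ * ∑ j, a i (x j)|} with hB
  have hTi : ∀ i, Measurable fun x => T n x i := fun i =>
    (EuclideanSpace.proj (𝕜 := ℝ) i).continuous.measurable.comp (hT n)
  have hT0 : ∀ i, Measurable fun x : Fin n → X => (Real.sqrt n)⁻¹ * ∑ j, a i (x j) := fun i =>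
    (Finset.measurable_sum _ fun j _ => (ham i).comp (measurable_pi_apply j)).const_mul _
  have hBm : MeasurableSet B := by
    have : B = ⋃ i, {x | ε ≤ |T n x i - (Real.sqrt n)⁻¹ * ∑ j, a i (x j)|} := by
      ext x; simp [hB]
    rw [this]
    exact MeasurableSet.iUnion fun i => measurableSet_le measurable_const
      (continuous_abs.measurable.comp ((hTi i).sub (hT0 i)))
  have hin : ∀ x, inner ℝ (T n x) t = ∑ i, t i * T n x i := fun x => by
    simp [PiLp.inner_apply]
  have hin0 : ∀ x : Fin n → X, (Real.sqrt n)⁻¹ * ∑ j, ∑ i, t i * a i (x j) =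
      ∑ i, t i * ((Real.sqrt n)⁻¹ * ∑ j, a i (x j)) := by
    intro x
    rw [Finset.sum_comm, Finset.mul_sum]
    refine Finset.sum_congr rfl fun i _ => ?_
    rw [← Finset.mul_sum]; ring
  have cexp_int : ∀ {f : (Fin n → X) → ℝ}, Measurable f →
      Integrable (fun x => Complex.exp ((f x : ℂ) * Complex.I)) Q := fun hf =>
    Integrable.of_bound (Complex.continuous_exp.measurable.comp
      ((Complex.measurable_ofReal.comp hf).mul_const _)).aestronglyMeasurable 1
      (Eventually.of_forall fun x => (Complex.norm_exp_ofReal_mul_I _).le)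
  have m1 : Measurable fun x => (inner ℝ (T n x) t : ℝ) := by
    simp only [hin]
    exact Finset.measurable_sum _ fun i _ => (hTi i).const_mul _
  have m2 : Measurable fun x : Fin n → X => (Real.sqrt n)⁻¹ * ∑ j, ∑ i, t i * a i (x j) := by
    simp only [hin0]
    exact Finset.measurable_sum _ fun i _ => (hT0 i).const_mul _
  rw [dist_zero_right, ← integral_sub (cexp_int m1) (cexp_int m2)]
  calc _ ≤ ∫ x, ‖_‖ ∂Q := norm_integral_le_integral_norm _
    _ ≤ ∫ x, (ε * S + B.indicator (fun _ => (2 : ℝ)) x) ∂Q := by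
        refine integral_mono_of_nonneg (Eventually.of_forall fun _ => norm_nonneg _)
          ((integrable_const _).add ((integrable_const _).indicator hBm))
          (Eventually.of_forall fun x => ?_)
        simp only
        by_cases hx : x ∈ B
        · rw [Set.indicator_of_mem hx]
          have h2 : ‖Complex.exp ((inner ℝ (T n x) t : ℝ) * Complex.I) -
              Complex.exp (((Real.sqrt n)⁻¹ * ∑ j, ∑ i, t i * a i (x j) : ℝ) * Complex.I)‖ ≤ 2 := by
            refine (norm_sub_le _ _).trans ?_
            rw [Complex.norm_exp_ofReal_mul_I, Complex.norm_exp_ofReal_mul_I]; norm_num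
          have : 0 ≤ ε * S := by positivity
          linarith
        · rw [Set.indicator_of_notMem hx, add_zero]
          refine (norm_exp_mul_I_sub_exp_mul_I_le _ _).trans ?_
          rw [hin, hin0, ← Finset.sum_sub_distrib, hS, Finset.mul_sum]
          refine (Finset.abs_sum_le_sum_abs _ _).trans (Finset.sum_le_sum fun i _ => ?_)
          rw [← mul_sub, abs_mul, mul_comm]
          gcongr
          simp only [hB, Set.mem_ofPred_eq, not_exists, not_le] at hx
          exact (hx i).le
    _ = ε * S + 2 * Q.real B := by
        rw [integral_add (integrable_const _) ((integrable_const _).indicator hBm),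
          integral_indicator_const _ hBm]
        simp [mul_comm]
    _ < η := by
        have h1 : ε * S ≤ η / 2 := by
          rw [hε, div_mul_eq_mul_div, div_le_div_iff₀ (by positivity) (by positivity)]
          nlinarith
        have h2 : Q.real B < η / 8 := hn
        linarith

/-- If a statistic equals almost surely the squared norm of a vector that is asymptotically
equivalent to the normalized sum of a centered orthonormal family, then it is asymptotically
noncentral chi-square along the local alternatives. -/
theorem tendsto_integral_noncentralChiSq (h : IsDQM ν ℓ g) {d : ℕ} {lam : ℝ} {a : Fin d → X → ℝ}
    (ham : ∀ i, Measurable (a i)) (ha : ∀ i, MemLp (a i) 2 ν) (ha0 : ∀ i, ∫ x, a i x ∂ν = 0)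
    (hcov : ∀ i j, ∫ x, a i x * a j x ∂ν = if i = j then 1 else 0)
    (hmean : ∀ i, 2 * ∫ x, a i x * g x ∂ν = ncMean d lam i)
    {T : (n : ℕ) → (Fin n → X) → EuclideanSpace ℝ (Fin d)} (hT : ∀ n, Measurable (T n))
    (hequiv : ∀ ε > 0, Tendsto (fun n : ℕ => Measure.pi (fun _ : Fin n => ν)
      {x | ∃ i, ε ≤ |T n x i - (Real.sqrt n)⁻¹ * ∑ j, a i (x j)|}) atTop (𝓝 0))
    {Q : (n : ℕ) → (Fin n → X) → ℝ}
    (hQ : ∀ n, ∀ᵐ x ∂(Measure.pi fun _ : Fin n => ν), Q n x = ‖T n x‖ ^ 2)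
    (φ : BoundedContinuousFunction ℝ ℝ) :
    Tendsto (fun n : ℕ => ∫ x, φ (Q n x)
        ∂(Measure.pi fun _ : Fin n => ν.withDensity fun x => ENNReal.ofReal (ℓ n x))) atTop
      (𝓝 (∫ y, φ y ∂(noncentralChiSq d lam))) := by
  obtain ⟨N, hN⟩ := eventually_atTop.1 h.eventually_isProbabilityMeasure
  rw [← tendsto_add_atTop_iff_nat N]
  have hp : ∀ n, IsProbabilityMeasure
      (ν.withDensity fun x => ENNReal.ofReal (ℓ (n + N) x)) := fun n => hN _ (Nat.le_add_left _ _)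
  set P : (n : ℕ) → Measure (Fin (n + N) → X) := fun n =>
    Measure.pi fun _ : Fin (n + N) => ν.withDensity fun x => ENNReal.ofReal (ℓ (n + N) x) with hP
  have hpT : ∀ n, IsProbabilityMeasure ((P n).map (T (n + N))) := fun n =>
    Measure.isProbabilityMeasure_map (hT _).aemeasurable
  set μ : ℕ → ProbabilityMeasure (EuclideanSpace ℝ (Fin d)) := fun n =>
    ⟨(P n).map (T (n + N)), hpT n⟩ with hμ
  have hconv : Tendsto μ atTop (𝓝 (⟨ncGaussian d lam, inferInstance⟩ : ProbabilityMeasure _)) := by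
    refine ProbabilityMeasure.tendsto_of_tendsto_charFun fun t => ?_
    refine ((tendsto_add_atTop_iff_nat N).2
      (h.tendsto_charFun_of_equiv ham ha ha0 hcov hmean hT hequiv t)).congr fun n => ?_
    rw [hμ, ProbabilityMeasure.coe_mk, charFun_apply, integral_map (hT _).aemeasurable
      (Measurable.aestronglyMeasurable (by fun_prop))]
  have := (ProbabilityMeasure.tendsto_iff_forall_integral_tendsto.1 hconv)
    (φ.compContinuous ⟨fun z => ‖z‖ ^ 2, by fun_prop⟩)
  rw [noncentralChiSq_eq_map, integral_map (Measurable.aemeasurable (by fun_prop))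
    φ.continuous.measurable.aestronglyMeasurable]
  refine this.congr fun n => ?_
  rw [hμ, ProbabilityMeasure.coe_mk, integral_map (hT _).aemeasurable
    (BoundedContinuousFunction.continuous _).measurable.aestronglyMeasurable]
  refine integral_congr_ae ?_
  have hac : P n ≪ Measure.pi fun _ : Fin (n + N) => ν := by
    rw [hP]
    simp only
    rw [pi_withDensity _ _ _ (h.measurable _).ennreal_ofReal]
    exact withDensity_absolutelyContinuous _ _
  filter_upwards [hac.ae_le (hQ (n + N))] with x hx
  rw [hx]; rfl

end IsDQM

/-! ### Polar coordinates and the uniform law on the unit sphere -/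

/-- The uniform law on the unit sphere of `ℝ^k`, as a measure on `ℝ^k`. -/
def dirLaw (k : ℕ) : Measure (Obs k) :=
  ((volume : Measure (Obs k)).toSphere Set.univ)⁻¹ •
    (volume : Measure (Obs k)).toSphere.map ((↑) : Metric.sphere (0 : Obs k) 1 → Obs k)

/-- The surface measure of the unit sphere. -/
def sphereMass (k : ℕ) : ℝ≥0∞ := (volume : Measure (Obs k)).toSphere Set.univ

theorem nontrivial_obs {k : ℕ} (hk : 2 ≤ k) : Nontrivial (Obs k) := by
  have : Nonempty (Fin k) := ⟨⟨0, by omega⟩⟩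
  infer_instance

theorem sphereMass_ne_zero {k : ℕ} (hk : 2 ≤ k) : sphereMass k ≠ 0 := by
  have := nontrivial_obs hk
  exact Measure.measure_univ_ne_zero.2 (Measure.toSphere_ne_zero _)

theorem sphereMass_ne_top (k : ℕ) : sphereMass k ≠ ⊤ := measure_ne_top _ _

theorem isProbabilityMeasure_dirLaw {k : ℕ} (hk : 2 ≤ k) : IsProbabilityMeasure (dirLaw k) := by
  constructor
  rw [dirLaw, Measure.smul_apply, Measure.map_apply measurable_subtype_coe MeasurableSet.univ,
    Set.preimage_univ, smul_eq_mul]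
  exact ENNReal.inv_mul_cancel (sphereMass_ne_zero hk) (sphereMass_ne_top k)

theorem ae_norm_eq_one_dirLaw (k : ℕ) : ∀ᵐ u ∂(dirLaw k), ‖u‖ = 1 := by
  refine Measure.ae_smul_measure ?_ _
  rw [ae_map_iff measurable_subtype_coe.aemeasurable (measurableSet_eq_fun (by fun_prop) (by fun_prop))]
  exact Eventually.of_forall fun u => by simp

/-- Integration in polar coordinates. -/
theorem lintegral_polar {k : ℕ} (hk : 2 ≤ k) (F : Obs k → ℝ≥0∞) (hF : Measurable F) :
    ∫⁻ w, F w = sphereMass k * ∫⁻ u, (∫⁻ r in Set.Ioi (0 : ℝ),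
      ENNReal.ofReal (r ^ (k - 1)) * F (r • u)) ∂(dirLaw k) := by
  have hnt := nontrivial_obs hk
  have hmeas : Measurable fun p : Obs k × ℝ => ENNReal.ofReal (p.2 ^ (k - 1)) * F (p.2 • p.1) := by
    fun_prop
  have h1 : ∫⁻ w, F w = ∫⁻ w : ({0}ᶜ : Set (Obs k)), F w ∂(volume.comap Subtype.val) := by
    rw [lintegral_subtype_comap (measurableSet_singleton _).compl, restrict_compl_singleton]
  have h2 := (volume : Measure (Obs k)).measurePreserving_homeomorphUnitSphereProd.lintegral_comp_emb
    (Homeomorph.measurableEmbedding _) (fun p => F (p.2.1 • (p.1 : Obs k)))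
  have h3 : ∀ w : ({0}ᶜ : Set (Obs k)), F (((homeomorphUnitSphereProd (Obs k)) w).2.1 •
      (((homeomorphUnitSphereProd (Obs k)) w).1 : Obs k)) = F w := by
    intro w
    congr 1
    simp only [homeomorphUnitSphereProd_apply_snd_coe, homeomorphUnitSphereProd_apply_fst_coe]
    rw [smul_smul, mul_inv_cancel₀ (norm_ne_zero_iff.2 w.2), one_smul]
  simp only [h3] at h2
  rw [h1, h2, lintegral_prod _ (by fun_prop)]
  rw [dirLaw, lintegral_smul_measure, lintegral_map hmeas.lintegral_prod_right' measurable_subtype_coe,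
    smul_eq_mul, ← mul_assoc]
  change _ = sphereMass k * (sphereMass k)⁻¹ * _
  rw [ENNReal.mul_inv_cancel (sphereMass_ne_zero hk) (sphereMass_ne_top k), one_mul]
  refine lintegral_congr fun u => ?_
  simp only [Measure.volumeIoiPow]
  rw [lintegral_withDensity_eq_lintegral_mul _ (by fun_prop) (by fun_prop)]
  simp only [Pi.mul_apply, finrank_euclideanSpace, Fintype.card_fin]
  exact lintegral_subtype_comap measurableSet_Ioi
    (fun r => ENNReal.ofReal (r ^ (k - 1)) * F (r • (u : Obs k)))

/-- The uniform law on the sphere is invariant under linear isometries. -/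
theorem map_isometry_dirLaw {k : ℕ} (hk : 2 ≤ k) (φ : Obs k ≃ₗᵢ[ℝ] Obs k) :
    (dirLaw k).map φ = dirLaw k := by
  refine Measure.ext_of_lintegral _ fun G hG => ?_
  rw [lintegral_map hG φ.continuous.measurable]
  -- both sides are read off from integrals over the unit ball, which the isometry preserves
  have key : ∀ G : Obs k → ℝ≥0∞, Measurable G →
      ∫⁻ w : Obs k, (Metric.ball (0 : Obs k) 1).indicator (fun w => G (‖w‖⁻¹ • w)) w =
      sphereMass k * ((∫⁻ u, G u ∂(dirLaw k)) *
        ∫⁻ r in Set.Ioo (0 : ℝ) 1, ENNReal.ofReal (r ^ (k - 1))) := by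
    intro G hG
    have hGm : Measurable fun w : Obs k => G (‖w‖⁻¹ • w) := by fun_prop
    rw [lintegral_polar hk _ (hGm.indicator measurableSet_ball)]
    congr 1
    rw [← lintegral_mul_const _ hG]
    refine lintegral_congr_ae ?_
    filter_upwards [ae_norm_eq_one_dirLaw k] with u hu
    rw [← lintegral_const_mul _ (by fun_prop), ← lintegral_indicator measurableSet_Ioi,
      ← lintegral_indicator measurableSet_Ioo]
    refine lintegral_congr fun r => ?_
    by_cases hr : 0 < r
    · have hn : ‖r • u‖ = r := by rw [norm_smul, hu, Real.norm_of_nonneg hr.le, mul_one]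
      rw [Set.indicator_of_mem (show r ∈ Set.Ioi (0 : ℝ) from hr)]
      by_cases hr1 : r < 1
      · rw [Set.indicator_of_mem (show r ∈ Set.Ioo (0 : ℝ) 1 from ⟨hr, hr1⟩),
          Set.indicator_of_mem (show r • u ∈ Metric.ball (0 : Obs k) 1 by
            rw [mem_ball_zero_iff, hn]; exact hr1), hn, smul_smul, inv_mul_cancel₀ hr.ne',
          one_smul, mul_comm]
      · rw [Set.indicator_of_notMem (show r ∉ Set.Ioo (0 : ℝ) 1 from fun h => hr1 h.2),
          Set.indicator_of_notMem (show r • u ∉ Metric.ball (0 : Obs k) 1 by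
            rw [mem_ball_zero_iff, hn]; exact hr1), mul_zero]
    · rw [Set.indicator_of_notMem (by exact hr), Set.indicator_of_notMem (by simp [hr])]
  have hinv : ∫⁻ w : Obs k, (Metric.ball (0 : Obs k) 1).indicator
        (fun w => (fun u => G (φ u)) (‖w‖⁻¹ • w)) w =
      ∫⁻ w : Obs k, (Metric.ball (0 : Obs k) 1).indicator (fun w => G (‖w‖⁻¹ • w)) w := by
    rw [← φ.measurePreserving.lintegral_comp_emb φ.toHomeomorph.measurableEmbedding
      (f := (Metric.ball (0 : Obs k) 1).indicator (fun w => G (‖w‖⁻¹ • w)))]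
    refine lintegral_congr fun w => ?_
    by_cases hw : ‖w‖ < 1
    · rw [Set.indicator_of_mem (by simpa using hw), Set.indicator_of_mem (by simpa using hw)]
      simp
    · rw [Set.indicator_of_notMem (by simpa using hw), Set.indicator_of_notMem (by simpa using hw)]
  rw [key (fun u => G (φ u)) (hG.comp φ.continuous.measurable), key _ hG] at hinv
  have hc0 : ∫⁻ r in Set.Ioo (0 : ℝ) 1, ENNReal.ofReal (r ^ (k - 1)) ≠ 0 := by
    rw [← pos_iff_ne_zero, setLIntegral_pos_iff (by fun_prop)]
    have : Set.Ioo (0 : ℝ) 1 ⊆ (Function.support fun r : ℝ => ENNReal.ofReal (r ^ (k - 1))) ∩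
        Set.Ioo 0 1 := fun r hr => ⟨by simpa using pow_pos hr.1 _, hr⟩
    exact lt_of_lt_of_le (by simp) (measure_mono this)
  have hct : ∫⁻ r in Set.Ioo (0 : ℝ) 1, ENNReal.ofReal (r ^ (k - 1)) ≠ ⊤ := by
    refine ne_of_lt (lt_of_le_of_lt (setLIntegral_mono (g := fun _ => 1) measurable_const
      fun r hr => ?_) (by simp))
    rw [← ENNReal.ofReal_one]
    exact ENNReal.ofReal_le_ofReal (pow_le_one₀ hr.1.le hr.2.le)
  exact (ENNReal.mul_left_inj hc0 hct).1
    ((ENNReal.mul_right_inj (sphereMass_ne_zero hk) (sphereMass_ne_top k)).1 hinv)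

/-! ### Fourth moments of the uniform law on the sphere -/

theorem integrable_dirLaw {k : ℕ} (hk : 2 ≤ k) {F : Obs k → ℝ} (hF : Continuous F) :
    Integrable F (dirLaw k) := by
  have := isProbabilityMeasure_dirLaw hk
  obtain ⟨C, hC⟩ := (isCompact_sphere (0 : Obs k) 1).exists_bound_of_continuousOn hF.continuousOn
  refine Integrable.of_bound hF.measurable.aestronglyMeasurable C ?_
  filter_upwards [ae_norm_eq_one_dirLaw k] with u hu
  exact hC u (by simpa using hu)

/-- Two unit vectors are exchanged by a reflection, so the fourth moment of `⟨u, t⟩` depends on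
the norm of `t` only. -/
theorem exists_integral_inner_pow_four {k : ℕ} (hk : 2 ≤ k) :
    ∃ C : ℝ, ∀ t : Obs k, ∫ u, (inner ℝ u t : ℝ) ^ 4 ∂(dirLaw k) = C * ‖t‖ ^ 4 := by
  have hnt := nontrivial_obs hk
  obtain ⟨e, he⟩ := exists_norm_eq (Obs k) (zero_le_one (α := ℝ))
  refine ⟨∫ u, (inner ℝ u e : ℝ) ^ 4 ∂(dirLaw k), fun t => ?_⟩
  set s : Obs k := ‖t‖ • e with hs
  have hst : ‖s‖ = ‖t‖ := by rw [hs, norm_smul, he, norm_norm, mul_one]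
  set ρ := (ℝ ∙ (s - t))ᗮ.reflection with hρ
  have h1 : ρ s = t := Submodule.reflection_sub hst
  have h2 : ∫ u, (inner ℝ u t : ℝ) ^ 4 ∂(dirLaw k) = ∫ u, (inner ℝ u s : ℝ) ^ 4 ∂(dirLaw k) := by
    rw [← map_isometry_dirLaw hk ρ, integral_map ρ.continuous.measurable.aemeasurable
      (by fun_prop), map_isometry_dirLaw hk ρ]
    congr 1; ext u
    rw [← h1, LinearIsometryEquiv.inner_map_map]
  rw [h2, hs]
  simp only [inner_smul_right, mul_pow]
  rw [integral_const_mul]; ring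

/-- Polarization of the fourth moment in two variables. -/
theorem integral_inner_sq_mul_inner_sq_of_pow_four {k : ℕ} (hk : 2 ≤ k) {C : ℝ}
    (hC : ∀ t : Obs k, ∫ u, (inner ℝ u t : ℝ) ^ 4 ∂(dirLaw k) = C * ‖t‖ ^ 4) (s t : Obs k) :
    ∫ u, (inner ℝ u s : ℝ) ^ 2 * (inner ℝ u t : ℝ) ^ 2 ∂(dirLaw k) =
      C / 3 * (‖s‖ ^ 2 * ‖t‖ ^ 2 + 2 * (inner ℝ s t : ℝ) ^ 2) := by
  have e : ∀ u : Obs k, (inner ℝ u s : ℝ) ^ 2 * (inner ℝ u t : ℝ) ^ 2 =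
      (1 / 12) * ((inner ℝ u (s + t) : ℝ) ^ 4 + (inner ℝ u (s - t) : ℝ) ^ 4 -
        (2 * (inner ℝ u s : ℝ) ^ 4 + 2 * (inner ℝ u t : ℝ) ^ 4)) := by
    intro u
    rw [inner_add_right, inner_sub_right]; ring
  have hi : ∀ t : Obs k, Integrable (fun u => (inner ℝ u t : ℝ) ^ 4) (dirLaw k) := fun t =>
    integrable_dirLaw hk (by fun_prop)
  simp only [e]
  rw [integral_const_mul, integral_sub, integral_add (hi _) (hi _), integral_add,
    integral_const_mul, integral_const_mul, hC, hC, hC, hC]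
  · have h4 : ∀ x : Obs k, ‖x‖ ^ 4 = (‖x‖ ^ 2) ^ 2 := fun x => by ring
    rw [h4 (s + t), h4 (s - t), norm_add_sq_real, norm_sub_sq_real]; ring
  · exact (hi _).const_mul _
  · exact (hi _).const_mul _
  · exact (hi _).add (hi _)
  · exact ((hi _).const_mul _).add ((hi _).const_mul _)

theorem norm_sq_eq_sum {k : ℕ} (u : Obs k) : ‖u‖ ^ 2 = ∑ i, u i ^ 2 := by
  simp [EuclideanSpace.norm_sq_eq]

/-- The constant is found by integrating `‖u‖⁴ = 1` coordinatewise. -/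
theorem integral_inner_sq_mul_inner_sq {k : ℕ} (hk : 2 ≤ k) (s t : Obs k) :
    ∫ u, (inner ℝ u s : ℝ) ^ 2 * (inner ℝ u t : ℝ) ^ 2 ∂(dirLaw k) =
      1 / (k * (k + 2)) * (‖s‖ ^ 2 * ‖t‖ ^ 2 + 2 * (inner ℝ s t : ℝ) ^ 2) := by
  have := isProbabilityMeasure_dirLaw hk
  obtain ⟨C, hC⟩ := exists_integral_inner_pow_four hk
  have hk0 : (0 : ℝ) < k := by exact_mod_cast (by omega : 0 < k)
  suffices h : C / 3 = 1 / (k * (k + 2)) by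
    rw [← h]; exact integral_inner_sq_mul_inner_sq_of_pow_four hk hC s t
  have h1 : ∫ u : Obs k, (∑ i, u i ^ 2) * (∑ j, u j ^ 2) ∂(dirLaw k) = 1 := by
    rw [integral_congr_ae (g := fun _ => (1 : ℝ))]
    · simp
    · filter_upwards [ae_norm_eq_one_dirLaw k] with u hu
      rw [← norm_sq_eq_sum, hu]; norm_num
  simp only [Finset.sum_mul_sum] at h1
  rw [integral_finsetSum _ fun i _ => integrable_dirLaw hk (by fun_prop)] at h1
  have h2 : ∀ i j : Fin k, ∫ u : Obs k, u i ^ 2 * u j ^ 2 ∂(dirLaw k) =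
      C / 3 * (1 + 2 * if i = j then 1 else 0) := by
    intro i j
    have := integral_inner_sq_mul_inner_sq_of_pow_four hk hC (EuclideanSpace.single i 1)
      (EuclideanSpace.single j 1)
    simp only [EuclideanSpace.inner_single_right, PiLp.norm_single] at this
    simpa [Pi.single_apply, eq_comm] using this
  have h3 : ∀ i : Fin k, ∫ u : Obs k, ∑ j, u i ^ 2 * u j ^ 2 ∂(dirLaw k) =
      C / 3 * (k + 2) := by
    intro i
    rw [integral_finsetSum _ fun j _ => integrable_dirLaw hk (by fun_prop)]
    simp only [h2, ← Finset.mul_sum, Finset.sum_add_distrib]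
    simp
  simp only [h3] at h1
  simp only [Finset.sum_const, Finset.card_univ, Fintype.card_fin, nsmul_eq_mul] at h1
  rw [eq_div_iff (by positivity)]
  linarith

/-- All mixed fourth moments of the uniform law on the sphere, by polarization. -/
theorem integral_inner_mul_four {k : ℕ} (hk : 2 ≤ k) (a b c d : Obs k) :
    ∫ u, ((inner ℝ u a : ℝ) * inner ℝ u b) * ((inner ℝ u c : ℝ) * inner ℝ u d) ∂(dirLaw k) =
      1 / (k * (k + 2)) * ((inner ℝ a b : ℝ) * inner ℝ c d + (inner ℝ a c : ℝ) * inner ℝ b d +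
        (inner ℝ a d : ℝ) * inner ℝ b c) := by
  have e : ∀ u : Obs k, ((inner ℝ u a : ℝ) * inner ℝ u b) * ((inner ℝ u c : ℝ) * inner ℝ u d) =
      (1 / 16) * (((inner ℝ u (a + b) : ℝ) ^ 2 * (inner ℝ u (c + d) : ℝ) ^ 2 +
        (inner ℝ u (a - b) : ℝ) ^ 2 * (inner ℝ u (c - d) : ℝ) ^ 2) -
        ((inner ℝ u (a + b) : ℝ) ^ 2 * (inner ℝ u (c - d) : ℝ) ^ 2 +
        (inner ℝ u (a - b) : ℝ) ^ 2 * (inner ℝ u (c + d) : ℝ) ^ 2)) := by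
    intro u
    simp only [inner_add_right, inner_sub_right]; ring
  have hi : ∀ s t : Obs k, Integrable
      (fun u => (inner ℝ u s : ℝ) ^ 2 * (inner ℝ u t : ℝ) ^ 2) (dirLaw k) := fun s t =>
    integrable_dirLaw hk (by fun_prop)
  simp only [e]
  rw [integral_const_mul, integral_sub, integral_add (hi _ _) (hi _ _),
    integral_add (hi _ _) (hi _ _)]
  rotate_left
  · exact (hi _ _).add (hi _ _)
  · exact (hi _ _).add (hi _ _)
  simp only [integral_inner_sq_mul_inner_sq hk]
  simp only [norm_add_sq_real, norm_sub_sq_real, inner_add_left, inner_sub_left, inner_add_right,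
    inner_sub_right]
  ring

/-- The quadratic form `u ↦ u' A u` of a matrix. -/
def quadForm {k : ℕ} (A : Matrix (Fin k) (Fin k) ℝ) (u : Obs k) : ℝ :=
  ∑ i, ∑ j, A i j * (u i * u j)

@[fun_prop]
theorem continuous_quadForm {k : ℕ} (A : Matrix (Fin k) (Fin k) ℝ) : Continuous (quadForm A) := by
  unfold quadForm; fun_prop

theorem quadForm_smul {k : ℕ} (A : Matrix (Fin k) (Fin k) ℝ) (r : ℝ) (u : Obs k) :
    quadForm A (r • u) = r ^ 2 * quadForm A u := by
  simp only [quadForm, Finset.mul_sum, PiLp.smul_apply, smul_eq_mul]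
  refine Finset.sum_congr rfl fun i _ => Finset.sum_congr rfl fun j _ => ?_
  ring

theorem quadForm_one {k : ℕ} (u : Obs k) : quadForm 1 u = ‖u‖ ^ 2 := by
  rw [norm_sq_eq_sum]
  simp [quadForm, Matrix.one_apply, sq]

/-- Mixed second moments of quadratic forms under the uniform law on the sphere. -/
theorem integral_quadForm_mul_quadForm {k : ℕ} (hk : 2 ≤ k) (A B : Matrix (Fin k) (Fin k) ℝ) :
    ∫ u, quadForm A u * quadForm B u ∂(dirLaw k) = 1 / (k * (k + 2)) *
      (A.trace * B.trace + ∑ i, ∑ j, A i j * B i j + ∑ i, ∑ j, A i j * B j i) := by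
  have hm : ∀ i j l m : Fin k, ∫ u : Obs k, (u i * u j) * (u l * u m) ∂(dirLaw k) =
      1 / (k * (k + 2)) * ((if i = j then 1 else 0) * (if l = m then 1 else 0) +
        (if i = l then 1 else 0) * (if j = m then 1 else 0) +
        (if i = m then 1 else 0) * (if j = l then 1 else 0)) := by
    intro i j l m
    have := integral_inner_mul_four hk (EuclideanSpace.single i 1)
      (EuclideanSpace.single j 1) (EuclideanSpace.single l 1) (EuclideanSpace.single m 1)
    simp only [EuclideanSpace.inner_single_right] at this
    simpa [Pi.single_apply, eq_comm] using this
  have e : ∀ u : Obs k, quadForm A u * quadForm B u =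
      ∑ i, ∑ j, ∑ l, ∑ m, A i j * B l m * ((u i * u j) * (u l * u m)) := by
    intro u
    rw [quadForm, Finset.sum_mul]
    refine Finset.sum_congr rfl fun i _ => ?_
    rw [Finset.sum_mul]
    refine Finset.sum_congr rfl fun j _ => ?_
    rw [quadForm, Finset.mul_sum]
    refine Finset.sum_congr rfl fun l _ => ?_
    rw [Finset.mul_sum]
    refine Finset.sum_congr rfl fun m _ => ?_
    ring
  simp only [e]
  rw [integral_finsetSum _ fun i _ => integrable_dirLaw hk (by fun_prop)]
  have : ∀ i j : Fin k, ∫ u : Obs k, ∑ l, ∑ m, A i j * B l m * ((u i * u j) * (u l * u m))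
      ∂(dirLaw k) = 1 / (k * (k + 2)) * (A i j * ((if i = j then 1 else 0) * B.trace + B i j +
        B j i)) := by
    intro i j
    rw [integral_finsetSum _ fun l _ => integrable_dirLaw hk (by fun_prop)]
    have : ∀ l : Fin k, ∫ u : Obs k, ∑ m, A i j * B l m * ((u i * u j) * (u l * u m))
      ∂(dirLaw k) = ∑ m, A i j * B l m * (1 / (k * (k + 2)) *
        ((if i = j then 1 else 0) * (if l = m then 1 else 0) +
        (if i = l then 1 else 0) * (if j = m then 1 else 0) +
        (if i = m then 1 else 0) * (if j = l then 1 else 0))) := by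
      intro l
      rw [integral_finsetSum _ fun m _ => integrable_dirLaw hk (by fun_prop)]
      simp only [integral_const_mul, hm]
    simp only [this]
    have e2 : ∀ l m : Fin k, A i j * B l m * (1 / (k * (k + 2)) *
        ((if i = j then 1 else 0) * (if l = m then 1 else 0) +
        (if i = l then 1 else 0) * (if j = m then 1 else 0) +
        (if i = m then 1 else 0) * (if j = l then 1 else 0))) =
        1 / (k * (k + 2)) * (A i j * ((if i = j then 1 else 0) * (if l = m then B l m else 0) +
          (if i = l then (if j = m then B l m else 0) else 0) +
          (if j = l then (if i = m then B l m else 0) else 0))) := by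
      intro l m
      split_ifs <;> ring
    simp only [e2, ← Finset.mul_sum, Finset.sum_add_distrib]
    simp [Matrix.trace]
  have h2 : ∀ i : Fin k, ∫ u : Obs k, ∑ j, ∑ l, ∑ m, A i j * B l m * ((u i * u j) * (u l * u m))
      ∂(dirLaw k) = ∑ j, 1 / (k * (k + 2)) * (A i j * ((if i = j then 1 else 0) * B.trace + B i j +
        B j i)) := by
    intro i
    rw [integral_finsetSum _ fun j _ => integrable_dirLaw hk (by fun_prop)]
    simp only [this]
  simp only [h2, ← Finset.mul_sum]
  congr 1
  simp only [mul_add, Finset.sum_add_distrib]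
  congr 2
  simp [Matrix.trace, Finset.sum_mul]

/-- The special case `B = 1` of the formula for mixed second moments, as `u' u = 1` on the sphere.
-/
theorem integral_quadForm {k : ℕ} (hk : 2 ≤ k) (A : Matrix (Fin k) (Fin k) ℝ) :
    ∫ u, quadForm A u ∂(dirLaw k) = A.trace / k := by
  have hk0 : (0 : ℝ) < k := by exact_mod_cast (by omega : 0 < k)
  have h := integral_quadForm_mul_quadForm hk A 1
  have h1 : ∫ u, quadForm A u * quadForm 1 u ∂(dirLaw k) = ∫ u, quadForm A u ∂(dirLaw k) := by
    refine integral_congr_ae ?_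
    filter_upwards [ae_norm_eq_one_dirLaw k] with u hu
    rw [quadForm_one, hu]; norm_num
  rw [← h1, h]
  simp only [Matrix.trace_one, Fintype.card_fin, Matrix.one_apply]
  simp only [mul_ite, mul_one, mul_zero, Finset.sum_ite_eq, Finset.sum_ite_eq', Finset.mem_univ,
    if_true]
  have : ∑ i, A i i = A.trace := rfl
  rw [this]
  field_simp
  ring

/-! ### The law of the modulus and its quantile function -/

/-- The law of the standardized modulus. -/
def modulusLaw (k : ℕ) (f : ℝ → ℝ) : Measure ℝ :=
  volume.withDensity fun r => ENNReal.ofReal (modulusDensity k f r)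

namespace IsRadialDensity

variable {k : ℕ} {f : ℝ → ℝ}

theorem radialMass_pos (hf : IsRadialDensity k f) : 0 < radialMass k f := by
  rw [radialMass, setIntegral_pos_iff_support_of_nonneg_ae]
  · have h1 : ∀ᵐ r ∂(volume.restrict (Set.Ioi (0 : ℝ))),
        r ∈ Function.support (fun r => r ^ (k - 1) * f r) := by
      filter_upwards [hf.ae_pos, ae_restrict_mem measurableSet_Ioi] with r hr hr0
      exact (mul_pos (pow_pos hr0 _) hr).ne'
    have h2 := measure_mono_ae (μ := volume.restrict (Set.Ioi (0 : ℝ))) (s := Set.univ)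
      (t := Function.support (fun r => r ^ (k - 1) * f r)) (by
        filter_upwards [h1] with r hr _ using hr)
    rw [Measure.restrict_apply_univ, Measure.restrict_apply' measurableSet_Ioi] at h2
    exact lt_of_lt_of_le (by simp) h2
  · filter_upwards [ae_restrict_mem measurableSet_Ioi] with r hr
    exact mul_nonneg (pow_nonneg (le_of_lt hr) _) (hf.nonneg r hr)
  · exact hf.integrable

theorem modulusDensity_nonneg (hf : IsRadialDensity k f) (r : ℝ) : 0 ≤ modulusDensity k f r := by
  unfold modulusDensity
  split_ifs with h
  · exact div_nonneg (mul_nonneg (pow_nonneg h.le _) (hf.nonneg r h)) hf.radialMass_pos.le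
  · exact le_rfl

theorem measurable_modulusDensity (hf : IsRadialDensity k f) : Measurable (modulusDensity k f) :=
  Measurable.ite measurableSet_Ioi (((measurable_id.pow_const _).mul hf.measurable).div_const _)
    measurable_const

theorem integrable_modulusDensity (hf : IsRadialDensity k f) :
    Integrable (modulusDensity k f) := by
  have : modulusDensity k f = (Set.Ioi (0 : ℝ)).indicator
      (fun r => r ^ (k - 1) * f r / radialMass k f) := by
    ext r; simp [modulusDensity, Set.indicator_apply]
  rw [this, integrable_indicator_iff measurableSet_Ioi]
  exact hf.integrable.div_const _

theorem lintegral_modulusLaw (hf : IsRadialDensity k f) (F : ℝ → ℝ≥0∞) (hF : Measurable F) :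
    ∫⁻ r, F r ∂(modulusLaw k f) = ENNReal.ofReal (radialMass k f)⁻¹ *
      ∫⁻ r in Set.Ioi (0 : ℝ), ENNReal.ofReal (r ^ (k - 1)) * (ENNReal.ofReal (f r) * F r) := by
  have hm := hf.measurable
  rw [modulusLaw, lintegral_withDensity_eq_lintegral_mul _
    hf.measurable_modulusDensity.ennreal_ofReal hF, ← lintegral_const_mul _ (by fun_prop),
    ← lintegral_indicator measurableSet_Ioi]
  refine lintegral_congr fun r => ?_
  by_cases hr : 0 < r
  · rw [Set.indicator_of_mem (by exact hr), Pi.mul_apply, modulusDensity, if_pos hr,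
      div_eq_mul_inv, ENNReal.ofReal_mul (mul_nonneg (pow_nonneg hr.le _) (hf.nonneg r hr)),
      ENNReal.ofReal_mul (pow_nonneg hr.le _)]
    ring
  · rw [Set.indicator_of_notMem (by exact hr), Pi.mul_apply, modulusDensity, if_neg hr]
    simp

theorem isProbabilityMeasure_modulusLaw (hf : IsRadialDensity k f) :
    IsProbabilityMeasure (modulusLaw k f) := by
  constructor
  rw [modulusLaw, withDensity_apply _ MeasurableSet.univ, Measure.restrict_univ,
    ← ofReal_integral_eq_lintegral_ofReal hf.integrable_modulusDensity
      (Eventually.of_forall hf.modulusDensity_nonneg)]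
  have : ∫ r, modulusDensity k f r = ∫ r in Set.Ioi (0 : ℝ), r ^ (k - 1) * f r / radialMass k f := by
    rw [← integral_indicator measurableSet_Ioi]
    congr 1
  rw [this, integral_div]
  change ENNReal.ofReal (radialMass k f / radialMass k f) = 1
  rw [div_self hf.radialMass_pos.ne', ENNReal.ofReal_one]

theorem ae_modulusLaw_pos (hf : IsRadialDensity k f) : ∀ᵐ r ∂(modulusLaw k f), 0 < r := by
  rw [modulusLaw, ae_withDensity_iff hf.measurable_modulusDensity.ennreal_ofReal]
  refine Eventually.of_forall fun r hr => ?_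
  by_contra h
  simp [modulusDensity, h] at hr

theorem modulusCdf_eq (hf : IsRadialDensity k f) (r : ℝ) :
    modulusCdf k f r = (modulusLaw k f).real (Set.Iic r) := by
  have h0 : modulusLaw k f (Set.Iic r) = modulusLaw k f (Set.Ioc 0 r) := by
    refine measure_congr ?_
    filter_upwards [hf.ae_modulusLaw_pos] with x hx
    exact propext ⟨fun h => ⟨hx, h⟩, fun h => h.2⟩
  rw [measureReal_def, h0, modulusLaw, withDensity_apply _ measurableSet_Ioc, modulusCdf,
    integral_eq_lintegral_of_nonneg_ae (Eventually.of_forall hf.modulusDensity_nonneg)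
      hf.measurable_modulusDensity.aestronglyMeasurable]

theorem modulusCdf_of_nonpos {r : ℝ} (hr : r ≤ 0) : modulusCdf k f r = 0 := by
  rw [modulusCdf, Set.Ioc_eq_empty (not_lt.2 hr)]; simp

theorem monotone_modulusCdf (hf : IsRadialDensity k f) : Monotone (modulusCdf k f) := by
  have := hf.isProbabilityMeasure_modulusLaw
  intro a b hab
  rw [hf.modulusCdf_eq, hf.modulusCdf_eq]
  exact measureReal_mono (Set.Iic_subset_Iic.2 hab)

/-- The density of the modulus is positive almost everywhere on the half-line. -/
theorem strictMonoOn_modulusCdf (hf : IsRadialDensity k f) :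
    StrictMonoOn (modulusCdf k f) (Set.Ici 0) := by
  intro a ha b hb hab
  have hsub : Set.Ioc 0 b = Set.Ioc 0 a ∪ Set.Ioc a b := (Set.Ioc_union_Ioc_eq_Ioc ha hab.le).symm
  have hint := hf.integrable_modulusDensity
  rw [modulusCdf, modulusCdf, hsub, setIntegral_union (Set.Ioc_disjoint_Ioc_of_le le_rfl)
    measurableSet_Ioc hint.integrableOn hint.integrableOn]
  refine lt_add_of_pos_right _ ?_
  rw [setIntegral_pos_iff_support_of_nonneg_ae
    (Eventually.of_forall hf.modulusDensity_nonneg) hint.integrableOn]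
  have h := (ae_restrict_iff' measurableSet_Ioi).1 hf.ae_pos
  have h2 : (volume : Measure ℝ) (Set.Ioc a b) ≤
      volume (Function.support (modulusDensity k f) ∩ Set.Ioc a b) := by
    refine measure_mono_ae ?_
    filter_upwards [h] with r hr hrab
    have hr0 : 0 < r := lt_of_le_of_lt ha hrab.1
    refine ⟨?_, hrab⟩
    rw [Function.mem_support, modulusDensity, if_pos hr0]
    exact (div_pos (mul_pos (pow_pos hr0 _) (hr hr0)) hf.radialMass_pos).ne'
  refine lt_of_lt_of_le ?_ h2
  simpa using hab

theorem continuous_modulusCdf (hf : IsRadialDensity k f) : Continuous (modulusCdf k f) := by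
  have h1 : ∀ r, modulusCdf k f r = ∫ s in (0 : ℝ)..r, modulusDensity k f s := by
    intro r
    rcases le_total 0 r with h | h
    · rw [intervalIntegral.integral_of_le h, modulusCdf]
    · rw [modulusCdf_of_nonpos h, intervalIntegral.integral_of_ge h,
        setIntegral_eq_zero_of_forall_eq_zero, neg_zero]
      intro x hx
      rw [modulusDensity, if_neg (not_lt.2 hx.2)]
  rw [show modulusCdf k f = _ from funext h1]
  exact intervalIntegral.continuous_primitive
    (fun _ _ => hf.integrable_modulusDensity.intervalIntegrable) 0

theorem modulusCdf_pos (hf : IsRadialDensity k f) {r : ℝ} (hr : 0 < r) :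
    0 < modulusCdf k f r := by
  have := hf.strictMonoOn_modulusCdf (Set.self_mem_Ici (a := (0 : ℝ))) (Set.mem_Ici.2 hr.le) hr
  rwa [modulusCdf_of_nonpos le_rfl] at this

theorem modulusCdf_lt_one (hf : IsRadialDensity k f) (r : ℝ) : modulusCdf k f r < 1 := by
  have := hf.isProbabilityMeasure_modulusLaw
  rcases le_total r 0 with h | h
  · rw [modulusCdf_of_nonpos h]; exact one_pos
  · have h1 := hf.strictMonoOn_modulusCdf (Set.mem_Ici.2 h)
      (Set.mem_Ici.2 (h.trans (lt_add_one r).le)) (lt_add_one r)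
    refine h1.trans_le ?_
    rw [hf.modulusCdf_eq]
    exact measureReal_le_one

theorem tendsto_modulusCdf_atTop (hf : IsRadialDensity k f) :
    Tendsto (modulusCdf k f) atTop (𝓝 1) := by
  have := hf.isProbabilityMeasure_modulusLaw
  have h := tendsto_measure_Iic_atTop (modulusLaw k f)
  rw [measure_univ] at h
  have h2 := (ENNReal.tendsto_toReal ENNReal.one_ne_top).comp h
  rw [ENNReal.toReal_one] at h2
  exact h2.congr fun r => (hf.modulusCdf_eq r).symm

theorem exists_modulusCdf_eq (hf : IsRadialDensity k f) {u : ℝ} (hu : u ∈ Set.Ioo (0 : ℝ) 1) :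
    ∃ r, 0 < r ∧ modulusCdf k f r = u := by
  obtain ⟨b, hb⟩ := (hf.tendsto_modulusCdf_atTop.eventually (lt_mem_nhds hu.2)).exists
  have hb0 : 0 ≤ b := by
    by_contra h
    rw [modulusCdf_of_nonpos (not_le.1 h).le] at hb
    exact lt_asymm hb hu.1
  obtain ⟨r, hr, hru⟩ := intermediate_value_Icc hb0 hf.continuous_modulusCdf.continuousOn
    (show u ∈ Set.Icc (modulusCdf k f 0) (modulusCdf k f b) from
      ⟨by rw [modulusCdf_of_nonpos le_rfl]; exact hu.1.le, hb.le⟩)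
  refine ⟨r, lt_of_le_of_ne hr.1 fun h => ?_, hru⟩
  rw [← h, modulusCdf_of_nonpos le_rfl] at hru
  exact hu.1.ne hru

/-- The probability integral transform. -/
theorem map_modulusCdf (hf : IsRadialDensity k f) :
    (modulusLaw k f).map (modulusCdf k f) = volume.restrict (Set.Ioo 0 1) := by
  have := hf.isProbabilityMeasure_modulusLaw
  have hm := hf.continuous_modulusCdf.measurable
  have : IsProbabilityMeasure ((modulusLaw k f).map (modulusCdf k f)) :=
    Measure.isProbabilityMeasure_map hm.aemeasurable
  refine Measure.ext_of_Iic _ _ fun u => ?_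
  rw [Measure.map_apply hm measurableSet_Iic, Measure.restrict_apply measurableSet_Iic]
  rcases le_or_gt u 0 with hu0 | hu0
  · have h1 : Set.Iic u ∩ Set.Ioo (0 : ℝ) 1 = ∅ := by
      ext x; simp only [Set.mem_inter_iff, Set.mem_Iic, Set.mem_Ioo, Set.mem_empty_iff_false]
      constructor
      · rintro ⟨h1, h2, h3⟩; linarith
      · exact False.elim
    rw [h1, measure_empty, ← nonpos_iff_eq_zero]
    have h2 : ∀ᵐ r ∂(modulusLaw k f), ¬ (r ∈ modulusCdf k f ⁻¹' Set.Iic u) := by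
      filter_upwards [hf.ae_modulusLaw_pos] with r hr h
      have := hf.modulusCdf_pos hr
      exact absurd (h.trans hu0) (not_le.2 this)
    exact (measure_eq_zero_iff_ae_notMem.2 h2).le
  rcases lt_or_ge u 1 with hu1 | hu1
  · obtain ⟨r, hr0, hr⟩ := hf.exists_modulusCdf_eq ⟨hu0, hu1⟩
    have h1 : modulusCdf k f ⁻¹' Set.Iic u = Set.Iic r := by
      ext x
      simp only [Set.mem_preimage, Set.mem_Iic]
      constructor
      · intro h
        by_contra hx
        have := hf.strictMonoOn_modulusCdf (Set.mem_Ici.2 hr0.le)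
          (Set.mem_Ici.2 (hr0.le.trans (not_le.1 hx).le)) (not_le.1 hx)
        rw [hr] at this
        exact absurd h (not_le.2 this)
      · intro h
        rw [← hr]; exact hf.monotone_modulusCdf h
    have h2 : Set.Iic u ∩ Set.Ioo (0 : ℝ) 1 = Set.Ioc 0 u := by
      ext x; simp only [Set.mem_inter_iff, Set.mem_Iic, Set.mem_Ioo, Set.mem_Ioc]
      exact ⟨fun h => ⟨h.2.1, h.1⟩, fun h => ⟨h.2, h.1, h.2.trans_lt hu1⟩⟩
    rw [h1, h2, Real.volume_Ioc, sub_zero, ← hr, hf.modulusCdf_eq, ofReal_measureReal]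
  · have h1 : modulusCdf k f ⁻¹' Set.Iic u = Set.univ := by
      ext x; simpa using (hf.modulusCdf_lt_one x).le.trans hu1
    have h2 : Set.Iic u ∩ Set.Ioo (0 : ℝ) 1 = Set.Ioo 0 1 := by
      ext x; simp only [Set.mem_inter_iff, Set.mem_Iic, Set.mem_Ioo]
      exact ⟨fun h => h.2, fun h => ⟨h.2.le.trans hu1, h⟩⟩
    rw [h1, h2, measure_univ]; simp

/-- The quantile function inverts the strictly increasing distribution function. -/
theorem modulusQuantile_modulusCdf (hf : IsRadialDensity k f) {r : ℝ} (hr : 0 < r) :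
    modulusQuantile k f (modulusCdf k f r) = r := by
  have h1 : {s | 0 < s ∧ modulusCdf k f r ≤ modulusCdf k f s} = Set.Ici r := by
    ext s
    simp only [Set.mem_ofPred_eq, Set.mem_Ici]
    constructor
    · rintro ⟨hs, h⟩
      by_contra hsr
      exact absurd (hf.strictMonoOn_modulusCdf (Set.mem_Ici.2 hs.le) (Set.mem_Ici.2 hr.le)
        (not_le.1 hsr)) (not_lt.2 h)
    · exact fun h => ⟨hr.trans_le h, hf.monotone_modulusCdf h⟩
  rw [modulusQuantile, h1, csInf_Ici]

theorem monotoneOn_modulusQuantile (hf : IsRadialDensity k f) :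
    MonotoneOn (modulusQuantile k f) (Set.Ioo 0 1) := by
  intro u hu v hv huv
  obtain ⟨r, hr0, rfl⟩ := hf.exists_modulusCdf_eq hu
  obtain ⟨s, hs0, rfl⟩ := hf.exists_modulusCdf_eq hv
  rw [hf.modulusQuantile_modulusCdf hr0, hf.modulusQuantile_modulusCdf hs0]
  exact hf.strictMonoOn_modulusCdf.le_iff_le (Set.mem_Ici.2 hr0.le) (Set.mem_Ici.2 hs0.le) |>.1 huv

theorem aemeasurable_modulusQuantile (hf : IsRadialDensity k f) :
    AEMeasurable (modulusQuantile k f) (volume.restrict (Set.Ioo 0 1)) :=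
  aemeasurable_restrict_of_monotoneOn measurableSet_Ioo hf.monotoneOn_modulusQuantile

/-- Quantile representation: the modulus law is the image of the uniform law. -/
theorem map_modulusQuantile (hf : IsRadialDensity k f) :
    (volume.restrict (Set.Ioo 0 1)).map (modulusQuantile k f) = modulusLaw k f := by
  have hm := hf.continuous_modulusCdf.measurable
  have hq := hf.aemeasurable_modulusQuantile
  rw [← hf.map_modulusCdf] at hq ⊢
  rw [AEMeasurable.map_map_of_aemeasurable hq hm.aemeasurable]
  conv_rhs => rw [← Measure.map_id (μ := modulusLaw k f)]
  refine Measure.map_congr ?_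
  filter_upwards [hf.ae_modulusLaw_pos] with r hr
  exact hf.modulusQuantile_modulusCdf hr

/-- Integrals of functions of the quantile function are integrals over the law of the modulus. -/
theorem integral_comp_modulusQuantile (hf : IsRadialDensity k f) {H : ℝ → ℝ}
    (hH : AEStronglyMeasurable H (modulusLaw k f)) :
    ∫ u in Set.Ioo (0 : ℝ) 1, H (modulusQuantile k f u) = ∫ r, H r ∂(modulusLaw k f) := by
  have hq := hf.aemeasurable_modulusQuantile
  rw [← hf.map_modulusQuantile] at hH ⊢
  rw [integral_map hq hH]

theorem integral_comp_modulusCdf (hf : IsRadialDensity k f) {H : ℝ → ℝ}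
    (hH : AEStronglyMeasurable H (volume.restrict (Set.Ioo 0 1))) :
    ∫ r, H (modulusCdf k f r) ∂(modulusLaw k f) = ∫ u in Set.Ioo (0 : ℝ) 1, H u := by
  rw [← hf.map_modulusCdf] at hH ⊢
  rw [integral_map hf.continuous_modulusCdf.measurable.aemeasurable hH]

theorem ae_comp_modulusCdf (hf : IsRadialDensity k f) {p : ℝ → Prop}
    (hp : ∀ᵐ u ∂(volume.restrict (Set.Ioo (0 : ℝ) 1)), p u) :
    ∀ᵐ r ∂(modulusLaw k f), p (modulusCdf k f r) := by
  rw [← hf.map_modulusCdf] at hp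
  exact ae_of_ae_map hf.continuous_modulusCdf.measurable.aemeasurable hp

end IsRadialDensity

/-! ### Spherical laws -/

/-- The spherical law with radial density `f`: the law of `R U` with `U` uniform on the unit sphere
and independent of the modulus `R`. -/
def sphericalLaw (k : ℕ) (f : ℝ → ℝ) : Measure (Obs k) :=
  ((dirLaw k).prod (modulusLaw k f)).map fun p => p.2 • p.1

section sphericalLaw

variable {k : ℕ} {f : ℝ → ℝ}

theorem isProbabilityMeasure_sphericalLaw (hk : 2 ≤ k) (hf : IsRadialDensity k f) :
    IsProbabilityMeasure (sphericalLaw k f) := by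
  have := isProbabilityMeasure_dirLaw hk
  have := hf.isProbabilityMeasure_modulusLaw
  exact Measure.isProbabilityMeasure_map (Measurable.aemeasurable (by fun_prop))

/-- Almost surely, a spherical vector in polar form has a unit direction and a positive modulus. -/
theorem ae_polar (hk : 2 ≤ k) (hf : IsRadialDensity k f) :
    ∀ᵐ p ∂((dirLaw k).prod (modulusLaw k f)), ‖p.1‖ = 1 ∧ 0 < p.2 := by
  have := isProbabilityMeasure_dirLaw hk
  have := hf.isProbabilityMeasure_modulusLaw
  have h1 : ∀ᵐ p ∂((dirLaw k).prod (modulusLaw k f)), ‖p.1‖ = 1 :=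
    Measure.quasiMeasurePreserving_fst.ae (ae_norm_eq_one_dirLaw k)
  have h2 : ∀ᵐ p ∂((dirLaw k).prod (modulusLaw k f)), 0 < p.2 :=
    Measure.quasiMeasurePreserving_snd.ae hf.ae_modulusLaw_pos
  filter_upwards [h1, h2] with p h1 h2 using ⟨h1, h2⟩

theorem polar_norm {u : Obs k} {r : ℝ} (hu : ‖u‖ = 1) (hr : 0 < r) : ‖r • u‖ = r := by
  rw [norm_smul, hu, Real.norm_of_nonneg hr.le, mul_one]

theorem polar_dir {u : Obs k} {r : ℝ} (hu : ‖u‖ = 1) (hr : 0 < r) : ‖r • u‖⁻¹ • (r • u) = u := by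
  rw [polar_norm hu hr, smul_smul, inv_mul_cancel₀ hr.ne', one_smul]

theorem lintegral_sphericalLaw (hk : 2 ≤ k) (hf : IsRadialDensity k f) (F : Obs k → ℝ≥0∞)
    (hF : Measurable F) : ∫⁻ w, F w ∂(sphericalLaw k f) =
      ∫⁻ u, (∫⁻ r, F (r • u) ∂(modulusLaw k f)) ∂(dirLaw k) := by
  have := isProbabilityMeasure_dirLaw hk
  have := hf.isProbabilityMeasure_modulusLaw
  rw [sphericalLaw, lintegral_map hF (by fun_prop), lintegral_prod _ (by fun_prop)]

/-- Modulus and direction are independent under a spherical law. -/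
theorem integral_sphericalLaw_mul (hk : 2 ≤ k) (hf : IsRadialDensity k f) {h : ℝ → ℝ}
    {q : Obs k → ℝ} (hh : Measurable h) (hq : Measurable q) :
    ∫ w, h ‖w‖ * q (‖w‖⁻¹ • w) ∂(sphericalLaw k f) =
      (∫ r, h r ∂(modulusLaw k f)) * ∫ u, q u ∂(dirLaw k) := by
  have := isProbabilityMeasure_dirLaw hk
  have := hf.isProbabilityMeasure_modulusLaw
  have hm : Measurable fun w : Obs k => h ‖w‖ * q (‖w‖⁻¹ • w) := by fun_prop
  rw [sphericalLaw, integral_map (Measurable.aemeasurable (by fun_prop)) hm.aestronglyMeasurable,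
    mul_comm, ← integral_prod_mul]
  refine integral_congr_ae ?_
  filter_upwards [ae_polar hk hf] with p hp
  rw [polar_dir hp.1 hp.2, polar_norm hp.1 hp.2, mul_comm]

theorem ae_sphericalLaw_ne_zero (hk : 2 ≤ k) (hf : IsRadialDensity k f) :
    ∀ᵐ w ∂(sphericalLaw k f), w ≠ 0 := by
  rw [sphericalLaw, ae_map_iff (p := fun w : Obs k => w ≠ 0) (Measurable.aemeasurable (by fun_prop))
    (measurableSet_singleton (0 : Obs k)).compl]
  filter_upwards [ae_polar hk hf] with p hp
  rw [← norm_ne_zero_iff, polar_norm hp.1 hp.2]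
  exact hp.2.ne'

theorem map_norm_sphericalLaw (hk : 2 ≤ k) (hf : IsRadialDensity k f) :
    (sphericalLaw k f).map (fun w => ‖w‖) = modulusLaw k f := by
  have := isProbabilityMeasure_dirLaw hk
  have := hf.isProbabilityMeasure_modulusLaw
  rw [sphericalLaw, Measure.map_map (by fun_prop) (by fun_prop)]
  have : ((fun w : Obs k => ‖w‖) ∘ fun p : Obs k × ℝ => p.2 • p.1) =ᵐ[(dirLaw k).prod
      (modulusLaw k f)] Prod.snd := by
    filter_upwards [ae_polar hk hf] with p hp
    exact polar_norm hp.1 hp.2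
  rw [Measure.map_congr this, Measure.map_snd_prod]
  simp

end sphericalLaw

/-! ### Orthonormal bases of the symmetric matrices with trace zero -/

/-- The space of `k × k` matrices with the Frobenius inner product. -/
abbrev FrobSpace (k : ℕ) : Type := EuclideanSpace ℝ (Fin k × Fin k)

/-- The symmetric matrices with trace zero. -/
def symTraceless (k : ℕ) : Submodule ℝ (FrobSpace k) where
  carrier := {x | (∀ i j, x (i, j) = x (j, i)) ∧ ∑ i, x (i, i) = 0}
  add_mem' := by
    rintro x y ⟨hx, hx0⟩ ⟨hy, hy0⟩
    refine ⟨fun i j => ?_, ?_⟩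
    · rw [PiLp.add_apply, PiLp.add_apply, hx i j, hy i j]
    · simp only [PiLp.add_apply, Finset.sum_add_distrib, hx0, hy0, add_zero]
  zero_mem' := by simp
  smul_mem' := by
    rintro c x ⟨hx, hx0⟩
    refine ⟨fun i j => ?_, ?_⟩
    · rw [PiLp.smul_apply, PiLp.smul_apply, hx i j]
    · simp only [PiLp.smul_apply, smul_eq_mul, ← Finset.mul_sum, hx0, mul_zero]

/-- The orthogonal projection of a symmetric matrix to the matrices with trace zero. -/
def tracelessPart {k : ℕ} (B : Matrix (Fin k) (Fin k) ℝ) : FrobSpace k :=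
  WithLp.toLp 2 fun p => B p.1 p.2 - if p.1 = p.2 then B.trace / k else 0

/-- The squared Frobenius norm of the traceless part of a symmetric matrix. -/
def tracelessNormSq {k : ℕ} (B : Matrix (Fin k) (Fin k) ℝ) : ℝ :=
  ∑ i, ∑ j, B i j * B i j - B.trace ^ 2 / k

theorem tracelessPart_mem {k : ℕ} (hk : 2 ≤ k) {B : Matrix (Fin k) (Fin k) ℝ} (hB : B.IsSymm) :
    tracelessPart B ∈ symTraceless k := by
  have hk0 : (k : ℝ) ≠ 0 := by exact_mod_cast (by omega : k ≠ 0)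
  refine ⟨fun i j => ?_, ?_⟩
  · simp only [tracelessPart]
    rw [hB.apply i j]
    simp only [eq_comm]
  · simp only [tracelessPart, if_true, Finset.sum_sub_distrib, Finset.sum_const, Finset.card_univ,
      Fintype.card_fin, nsmul_eq_mul]
    rw [mul_div_cancel₀ _ hk0, sub_eq_zero]; rfl

theorem inner_frob {k : ℕ} (x y : FrobSpace k) :
    (inner ℝ x y : ℝ) = ∑ i, ∑ j, x (i, j) * y (i, j) := by
  rw [PiLp.inner_apply, Fintype.sum_prod_type]
  simp [mul_comm]

theorem inner_tracelessPart {k : ℕ} {x : FrobSpace k} (hx : x ∈ symTraceless k)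
    (B : Matrix (Fin k) (Fin k) ℝ) :
    (inner ℝ x (tracelessPart B) : ℝ) = ∑ i, ∑ j, x (i, j) * B i j := by
  rw [inner_frob]
  simp only [tracelessPart, mul_sub, mul_ite, mul_zero, Finset.sum_sub_distrib,
    Finset.sum_ite_eq, Finset.mem_univ, if_true]
  rw [← Finset.sum_mul, hx.2, zero_mul, sub_zero]

theorem inner_tracelessPart_tracelessPart {k : ℕ} (hk : 2 ≤ k) (A B : Matrix (Fin k) (Fin k) ℝ) :
    (inner ℝ (tracelessPart A) (tracelessPart B) : ℝ) =
      ∑ i, ∑ j, A i j * B i j - A.trace * B.trace / k := by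
  have hk0 : (k : ℝ) ≠ 0 := by exact_mod_cast (by omega : k ≠ 0)
  rw [inner_frob]
  have e : ∀ i j : Fin k, tracelessPart A (i, j) * tracelessPart B (i, j) =
      A i j * B i j - (if i = j then (A i j * (B.trace / k) + A.trace / k * B i j -
        A.trace / k * (B.trace / k)) else 0) := by
    intro i j
    simp only [tracelessPart]
    split_ifs <;> ring
  simp only [e, Finset.sum_sub_distrib, Finset.sum_ite_eq, Finset.mem_univ, if_true,
    Finset.sum_add_distrib, ← Finset.sum_mul, ← Finset.mul_sum, Finset.sum_const, Finset.card_univ,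
    Fintype.card_fin, nsmul_eq_mul]
  have hA : ∑ i, A i i = A.trace := rfl
  have hB : ∑ i, B i i = B.trace := rfl
  rw [hA, hB]
  field_simp
  ring

theorem tracelessNormSq_nonneg {k : ℕ} (hk : 2 ≤ k) (B : Matrix (Fin k) (Fin k) ℝ) :
    0 ≤ tracelessNormSq B := by
  have := inner_tracelessPart_tracelessPart hk B B
  rw [tracelessNormSq, sq, ← this]
  exact real_inner_self_nonneg

/-- The matrix `u u'`. -/
def outer {k : ℕ} (u : Obs k) : Matrix (Fin k) (Fin k) ℝ := fun i j => u i * u j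

theorem outer_isSymm {k : ℕ} (u : Obs k) : (outer u).IsSymm := by
  ext i j; simp [outer, mul_comm]

theorem trace_outer {k : ℕ} (u : Obs k) : (outer u).trace = ‖u‖ ^ 2 := by
  rw [norm_sq_eq_sum]; simp [outer, Matrix.trace, sq]

/-- The matrix with given entries. -/
def toMatrix {k : ℕ} (x : FrobSpace k) : Matrix (Fin k) (Fin k) ℝ := fun i j => x (i, j)

theorem quadForm_toMatrix {k : ℕ} {x : FrobSpace k} (hx : x ∈ symTraceless k) (u : Obs k) :
    quadForm (toMatrix x) u = inner ℝ x (tracelessPart (outer u)) := by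
  rw [inner_tracelessPart hx]; rfl

/-- Parseval's identity for the traceless parts of `u u'` and `w w'`. -/
theorem sum_quadForm_mul_quadForm {k : ℕ} (hk : 2 ≤ k) {ι : Type*} [Fintype ι]
    (b : OrthonormalBasis ι ℝ (symTraceless k)) (u w : Obs k) :
    ∑ a, quadForm (toMatrix (b a : FrobSpace k)) u * quadForm (toMatrix (b a : FrobSpace k)) w =
      (inner ℝ u w : ℝ) ^ 2 - ‖u‖ ^ 2 * ‖w‖ ^ 2 / k := by
  have h := b.sum_inner_mul_inner (⟨tracelessPart (outer u), tracelessPart_mem hk (outer_isSymm u)⟩)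
    (⟨tracelessPart (outer w), tracelessPart_mem hk (outer_isSymm w)⟩)
  simp only [Submodule.coe_inner] at h
  rw [inner_tracelessPart_tracelessPart hk, trace_outer, trace_outer] at h
  have e : ∑ i, ∑ j, outer u i j * outer w i j = (inner ℝ u w : ℝ) ^ 2 := by
    simp only [outer, PiLp.inner_apply, sq, Finset.sum_mul_sum]
    refine Finset.sum_congr rfl fun i _ => Finset.sum_congr rfl fun j _ => ?_
    simp; ring
  rw [e] at h
  rw [← h]
  refine Finset.sum_congr rfl fun a _ => ?_
  rw [quadForm_toMatrix (b a).2, quadForm_toMatrix (b a).2, real_inner_comm]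

theorem isSymm_toMatrix {k : ℕ} {x : FrobSpace k} (hx : x ∈ symTraceless k) :
    (toMatrix x).IsSymm := by
  ext i j; exact hx.1 j i

theorem trace_toMatrix {k : ℕ} {x : FrobSpace k} (hx : x ∈ symTraceless k) :
    (toMatrix x).trace = 0 := hx.2

/-- The dimension is read off by integrating the Parseval identity over the sphere. -/
theorem finrank_symTraceless {k : ℕ} (hk : 2 ≤ k) :
    Module.finrank ℝ (symTraceless k) = shapeDof k := by
  have hprob := isProbabilityMeasure_dirLaw hk
  have hk0 : (0 : ℝ) < k := by exact_mod_cast (by omega : 0 < k)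
  set b := stdOrthonormalBasis ℝ (symTraceless k)
  set n := Module.finrank ℝ (symTraceless k)
  have h1 : ∫ u, (∑ a, quadForm (toMatrix (b a : FrobSpace k)) u *
      quadForm (toMatrix (b a : FrobSpace k)) u) ∂(dirLaw k) = 1 - 1 / k := by
    rw [integral_congr_ae (g := fun _ => (1 - 1 / k : ℝ))]
    · simp
    · filter_upwards [ae_norm_eq_one_dirLaw k] with u hu
      rw [sum_quadForm_mul_quadForm hk b u u, real_inner_self_eq_norm_sq, hu]; norm_num
  rw [integral_finsetSum _ fun a _ => integrable_dirLaw hk (by fun_prop)] at h1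
  have h2 : ∀ a, ∫ u, quadForm (toMatrix (b a : FrobSpace k)) u *
      quadForm (toMatrix (b a : FrobSpace k)) u ∂(dirLaw k) = 1 / (k * (k + 2)) * 2 := by
    intro a
    have hn : ∑ i, ∑ j, toMatrix (b a : FrobSpace k) i j * toMatrix (b a : FrobSpace k) i j = 1 := by
      have := inner_frob (b a : FrobSpace k) (b a)
      rw [real_inner_self_eq_norm_sq, Submodule.norm_coe, b.norm_eq_one, one_pow] at this
      exact this.symm
    have hn' : ∑ i, ∑ j, toMatrix (b a : FrobSpace k) i j * toMatrix (b a : FrobSpace k) j i = 1 := by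
      rw [← hn]
      refine Finset.sum_congr rfl fun i _ => Finset.sum_congr rfl fun j _ => ?_
      rw [(isSymm_toMatrix (b a).2).apply i j]
    rw [integral_quadForm_mul_quadForm hk, trace_toMatrix (b a).2, hn, hn']
    ring
  simp only [h2, Finset.sum_const, Finset.card_univ, Fintype.card_fin, nsmul_eq_mul] at h1
  have h3 : (2 * n + 2 : ℝ) = k * (k + 1) := by
    field_simp at h1
    nlinarith
  have h4 : 2 * n + 2 = k * (k + 1) := by exact_mod_cast h3
  rw [shapeDof]; omega

/-- An orthonormal basis of the symmetric matrices with trace zero, the first element of which is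
proportional to the traceless part of a given symmetric matrix `B`. -/
theorem exists_traceless_basis {k : ℕ} (hk : 2 ≤ k) {B : Matrix (Fin k) (Fin k) ℝ}
    (hB : B.IsSymm) : ∃ M : Fin (shapeDof k) → Matrix (Fin k) (Fin k) ℝ,
      (∀ a, (M a).IsSymm) ∧ (∀ a, (M a).trace = 0) ∧
      (∀ a b, ∑ i, ∑ j, M a i j * M b i j = if a = b then 1 else 0) ∧
      (∀ u w : Obs k, ∑ a, quadForm (M a) u * quadForm (M a) w =
        (inner ℝ u w : ℝ) ^ 2 - ‖u‖ ^ 2 * ‖w‖ ^ 2 / k) ∧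
      ∀ a, ∑ i, ∑ j, M a i j * B i j = ncMean (shapeDof k) (tracelessNormSq B) a := by
  set x : symTraceless k := ⟨tracelessPart B, tracelessPart_mem hk hB⟩ with hx
  have hnorm : ‖x‖ ^ 2 = tracelessNormSq B := by
    rw [← real_inner_self_eq_norm_sq, Submodule.coe_inner,
      inner_tracelessPart_tracelessPart hk, tracelessNormSq, sq]
  have hnorm' : Real.sqrt (tracelessNormSq B) = ‖x‖ := by
    rw [← hnorm, Real.sqrt_sq (norm_nonneg _)]
  obtain ⟨b, hb⟩ : ∃ b : OrthonormalBasis (Fin (shapeDof k)) ℝ (symTraceless k),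
      ∀ a, (inner ℝ (b a) x : ℝ) = ncMean (shapeDof k) (tracelessNormSq B) a := by
    have hcard : Module.finrank ℝ (symTraceless k) = Fintype.card (Fin (shapeDof k)) := by
      rw [finrank_symTraceless hk, Fintype.card_fin]
    rcases eq_or_ne x 0 with h0 | h0
    · refine ⟨(stdOrthonormalBasis ℝ (symTraceless k)).reindex
        (finCongr (finrank_symTraceless hk)), fun a => ?_⟩
      simp [ncMean, hnorm', h0]
    · have hd : 0 < shapeDof k := by
        rw [← finrank_symTraceless hk]
        exact Module.finrank_pos_iff_exists_ne_zero.2 ⟨x, h0⟩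
      have hx0 : ‖x‖ ≠ 0 := norm_ne_zero_iff.2 h0
      obtain ⟨b, hb⟩ := Orthonormal.exists_orthonormalBasis_extension_of_card_eq (𝕜 := ℝ)
        (v := fun _ : Fin (shapeDof k) => ‖x‖⁻¹ • x) (s := {⟨0, hd⟩}) hcard (by
          rw [orthonormal_iff_ite]
          rintro ⟨i, hi⟩ ⟨j, hj⟩
          rw [Set.mem_singleton_iff] at hi hj
          subst hi hj
          simp only [Set.domRestrict_apply, if_true]
          rw [real_inner_self_eq_norm_sq, norm_smul, norm_inv, norm_norm, inv_mul_cancel₀ hx0,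
            one_pow])
      have hb0 : b ⟨0, hd⟩ = ‖x‖⁻¹ • x := hb _ (Set.mem_singleton _)
      refine ⟨b, fun a => ?_⟩
      have hin : (inner ℝ (b a) x : ℝ) = ‖x‖ * inner ℝ (b a) (b ⟨0, hd⟩) := by
        have hb0' : (b ⟨0, hd⟩ : FrobSpace k) = ‖x‖⁻¹ • (x : FrobSpace k) := congrArg Subtype.val hb0
        rw [Submodule.coe_inner, Submodule.coe_inner, hb0', real_inner_smul_right, ← mul_assoc,
          mul_inv_cancel₀ hx0, one_mul]
      rw [hin, b.inner_eq_ite, ncMean, hnorm']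
      by_cases ha : a = ⟨0, hd⟩
      · simp [ha]
      · have : (a : ℕ) ≠ 0 := fun h => ha (Fin.ext h)
        simp [ha, this]
  refine ⟨fun a => toMatrix (b a : FrobSpace k), fun a => isSymm_toMatrix (b a).2,
    fun a => trace_toMatrix (b a).2, fun a c => ?_, fun u w => sum_quadForm_mul_quadForm hk b u w,
    fun a => ?_⟩
  · have := b.inner_eq_ite a c
    rw [Submodule.coe_inner, inner_frob] at this
    exact this
  · rw [← hb a, Submodule.coe_inner, inner_tracelessPart (b a).2]; rfl

/-! ### Weak derivatives and absolutely continuous representatives -/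

theorem intervalIntegrable_of_locallyIntegrable {T : ℝ → ℝ} (hT : LocallyIntegrable T) (a b : ℝ) :
    IntervalIntegrable T volume a b :=
  (hT.integrableOn_isCompact isCompact_uIcc).intervalIntegrable

theorem exists_support_bound {φ : ℝ → ℝ} (hφ : HasCompactSupport φ) :
    ∃ R, 0 < R ∧ ∀ x, R ≤ |x| → φ x = 0 := by
  obtain ⟨R, hR⟩ := hφ.isCompact.isBounded.subset_ball (0 : ℝ)
  refine ⟨max R 1, by positivity, fun x hx => ?_⟩
  by_contra h
  have := hR (subset_tsupport _ h)
  rw [mem_ball_zero_iff, Real.norm_eq_abs] at this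
  exact absurd (this.trans_le (le_max_left R 1)) (not_lt.2 hx)

theorem integral_eq_intervalIntegral_of_support {φ : ℝ → ℝ} {R : ℝ} (hR : 0 < R)
    (h : ∀ x, R ≤ |x| → φ x = 0) : ∫ x, φ x = ∫ x in (-R)..R, φ x := by
  rw [intervalIntegral.integral_of_le (by linarith), ← integral_indicator measurableSet_Ioc]
  congr 1; ext x
  by_cases hx : x ∈ Set.Ioc (-R) R
  · rw [Set.indicator_of_mem hx]
  · rw [Set.indicator_of_notMem hx]
    refine h x ?_
    by_contra hlt
    have := abs_lt.1 (not_le.1 hlt)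
    exact hx ⟨this.1, this.2.le⟩

/-- Integration by parts against a test function. -/
theorem integral_primitive_mul_deriv {T φ : ℝ → ℝ} (hT : LocallyIntegrable T)
    (hφ : ContDiff ℝ (⊤ : ℕ∞) φ) (hc : HasCompactSupport φ) :
    ∫ x, (∫ y in (0 : ℝ)..x, T y) * deriv φ x = -∫ x, T x * φ x := by
  obtain ⟨R, hR, h0⟩ := exists_support_bound hc
  obtain ⟨R', hR', h0'⟩ := exists_support_bound hc.deriv
  set S := max R R' with hS
  have hS0 : 0 < S := hR.trans_le (le_max_left _ _)
  have hSφ : ∀ x, S ≤ |x| → φ x = 0 := fun x hx => h0 x ((le_max_left _ _).trans hx)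
  have hSφ' : ∀ x, S ≤ |x| → deriv φ x = 0 := fun x hx => h0' x ((le_max_right _ _).trans hx)
  have hTi : IntervalIntegrable T volume (-S) S := (intervalIntegrable_of_locallyIntegrable hT _ _)
  rw [integral_eq_intervalIntegral_of_support hS0 fun x hx => by rw [hSφ' x hx, mul_zero],
    integral_eq_intervalIntegral_of_support (φ := fun x => T x * φ x) hS0
      fun x hx => by rw [hSφ x hx, mul_zero]]
  have hac : AbsolutelyContinuousOnInterval (fun x => ∫ y in (0 : ℝ)..x, T y) (-S) S :=
    hTi.absolutelyContinuousOnInterval_intervalIntegral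
      (by rw [Set.uIcc_of_le (by linarith)]; constructor <;> linarith)
  have hacφ : AbsolutelyContinuousOnInterval φ (-S) S :=
    (hφ.of_le (by simp)).contDiffOn.absolutelyContinuousOnInterval
  rw [hac.integral_mul_deriv_eq_deriv_mul hacφ, hSφ S (by rw [abs_of_pos hS0]),
    hSφ (-S) (by rw [abs_neg, abs_of_pos hS0]), mul_zero, mul_zero, sub_zero, zero_sub]
  congr 1
  refine intervalIntegral.integral_congr_ae ?_
  filter_upwards [LocallyIntegrable.ae_hasDerivAt_integral hT] with x hx _
  rw [(hx 0).deriv]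

theorem locallyIntegrable_of_continuous_mul {D φ : ℝ → ℝ} (hD : LocallyIntegrable D)
    (hφ : Continuous φ) (hc : HasCompactSupport φ) : Integrable fun x => D x * φ x := by
  have := hD.integrable_smul_right_of_hasCompactSupport hφ hc
  simpa only [smul_eq_mul] using this

/-- The lemma of du Bois-Reymond. -/
theorem ae_eq_const_of_integral_mul_deriv_eq_zero {D : ℝ → ℝ} (hD : LocallyIntegrable D)
    (h : ∀ φ : ℝ → ℝ, ContDiff ℝ (⊤ : ℕ∞) φ → HasCompactSupport φ → ∫ x, D x * deriv φ x = 0) :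
    ∃ C : ℝ, ∀ᵐ x, D x = C := by
  obtain ⟨ρ, hρ, hρc, hρ1⟩ : ∃ ρ : ℝ → ℝ, ContDiff ℝ (⊤ : ℕ∞) ρ ∧ HasCompactSupport ρ ∧
      ∫ x, ρ x = 1 := by
    let b : ContDiffBump (0 : ℝ) := ⟨1, 2, by norm_num, by norm_num⟩
    exact ⟨b.normed volume, b.contDiff_normed, b.hasCompactSupport_normed, b.integral_normed⟩
  refine ⟨∫ x, D x * ρ x, ?_⟩
  refine ae_eq_of_integral_contDiff_smul_eq hD (locallyIntegrable_const _) fun φ hφ hφc => ?_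
  -- `φ - (∫ φ) ρ` has integral zero, hence is the derivative of a test function
  set η : ℝ → ℝ := fun x => φ x - (∫ y, φ y) * ρ x with hη
  have hηs : ContDiff ℝ (⊤ : ℕ∞) η := hφ.sub (contDiff_const.mul hρ)
  obtain ⟨R1, hR1, h1⟩ := exists_support_bound hφc
  obtain ⟨R2, hR2, h2⟩ := exists_support_bound hρc
  set R := max R1 R2 with hR
  have hR0 : 0 < R := hR1.trans_le (le_max_left _ _)
  have hηR : ∀ x, R ≤ |x| → η x = 0 := fun x hx => by
    rw [hη]
    simp only
    rw [h1 x ((le_max_left _ _).trans hx), h2 x ((le_max_right _ _).trans hx)]; ring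
  have hη0 : ∫ x, η x = 0 := by
    rw [hη, integral_sub (hφ.continuous.integrable_of_hasCompactSupport hφc)
      ((hρ.continuous.integrable_of_hasCompactSupport hρc).const_mul _), integral_const_mul, hρ1]
    ring
  set Ψ : ℝ → ℝ := fun x => ∫ y in (-R)..x, η y with hΨ
  have hderiv : ∀ x, HasDerivAt Ψ (η x) x := fun x =>
    intervalIntegral.integral_hasDerivAt_right (hηs.continuous.intervalIntegrable _ _)
      hηs.continuous.stronglyMeasurable.stronglyMeasurableAtFilter hηs.continuous.continuousAt
  have hdΨ : deriv Ψ = η := funext fun x => (hderiv x).deriv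
  have hΨs : ContDiff ℝ (⊤ : ℕ∞) Ψ := by
    rw [contDiff_infty_iff_deriv, hdΨ]
    exact ⟨fun x => (hderiv x).differentiableAt, hηs⟩
  have hΨc : HasCompactSupport Ψ := by
    refine HasCompactSupport.intro (isCompact_Icc (a := -R) (b := R)) fun x hx => ?_
    rw [Set.mem_Icc, not_and_or, not_le, not_le] at hx
    rcases hx with hx | hx
    · have : Ψ x = ∫ y in (-R)..x, (0 : ℝ) := by
        refine intervalIntegral.integral_congr fun y hy => ?_
        rw [Set.uIcc_of_ge hx.le] at hy
        exact hηR y (by rw [abs_of_nonpos (by linarith [hy.2])]; linarith [hy.2])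
      rw [this]; simp
    · have e1 : ∫ y in R..x, η y = 0 := by
        have : ∫ y in R..x, η y = ∫ y in R..x, (0 : ℝ) := by
          refine intervalIntegral.integral_congr fun y hy => ?_
          rw [Set.uIcc_of_le hx.le] at hy
          exact hηR y (by rw [abs_of_nonneg (by linarith [hy.1])]; exact hy.1)
        rw [this]; simp
      rw [hΨ]
      simp only
      rw [← intervalIntegral.integral_add_adjacent_intervals
        (hηs.continuous.intervalIntegrable (-R) R) (hηs.continuous.intervalIntegrable R x), e1,
        ← integral_eq_intervalIntegral_of_support hR0 hηR, hη0, add_zero]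
  have key := h Ψ hΨs hΨc
  rw [hdΨ] at key
  have e2 : ∫ x, D x * η x = (∫ x, D x * φ x) - (∫ x, φ x) * ∫ x, D x * ρ x := by
    rw [← integral_const_mul, ← integral_sub (locallyIntegrable_of_continuous_mul hD hφ.continuous hφc)
      ((locallyIntegrable_of_continuous_mul hD hρ.continuous hρc).const_mul _)]
    congr 1; ext x; simp only [hη]; ring
  rw [e2, sub_eq_zero] at key
  simp only [smul_eq_mul]
  rw [integral_mul_const, ← key]
  congr 1; ext x; ring

theorem IsWeakDeriv.locallyIntegrable {q T : ℝ → ℝ} (h : IsWeakDeriv Set.univ q T) :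
    LocallyIntegrable T := locallyIntegrableOn_univ.1 h.1

/-- Weak derivatives are unique up to null sets. -/
theorem IsWeakDeriv.ae_unique {q T T' : ℝ → ℝ} (h : IsWeakDeriv Set.univ q T)
    (h' : IsWeakDeriv Set.univ q T') : T =ᵐ[volume] T' := by
  refine ae_eq_of_integral_contDiff_smul_eq h.locallyIntegrable h'.locallyIntegrable
    fun φ hφ hc => ?_
  have h1 := h.2 φ hφ hc (Set.subset_univ _)
  have h2 := h'.2 φ hφ hc (Set.subset_univ _)
  rw [Measure.restrict_univ] at h1 h2
  have h3 := neg_injective (h1.symm.trans h2)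
  simpa only [smul_eq_mul, mul_comm] using h3

theorem IsWeakDeriv.congr {q T T' : ℝ → ℝ} (h : IsWeakDeriv Set.univ q T)
    (hT : T =ᵐ[volume] T') : IsWeakDeriv Set.univ q T' := by
  refine ⟨locallyIntegrableOn_univ.2 ?_, fun φ hφ hc hs => ?_⟩
  · exact (locallyIntegrable_congr hT).1 h.locallyIntegrable
  · rw [h.2 φ hφ hc hs, Measure.restrict_univ]
    congr 1
    refine integral_congr_ae ?_
    filter_upwards [hT] with x hx
    rw [hx]

/-- A locally integrable function with a weak derivative is a primitive of it. -/
theorem IsWeakDeriv.exists_ae_eq {q T : ℝ → ℝ} (h : IsWeakDeriv Set.univ q T)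
    (hq : LocallyIntegrable q) : ∃ C : ℝ, ∀ᵐ x, q x = C + ∫ y in (0 : ℝ)..x, T y := by
  have hT := h.locallyIntegrable
  have hGc : Continuous fun x => ∫ y in (0 : ℝ)..x, T y :=
    intervalIntegral.continuous_primitive (fun _ _ => (intervalIntegrable_of_locallyIntegrable hT _ _)) 0
  have hD : LocallyIntegrable fun x => q x - ∫ y in (0 : ℝ)..x, T y :=
    hq.sub hGc.locallyIntegrable
  obtain ⟨C, hC⟩ := ae_eq_const_of_integral_mul_deriv_eq_zero hD fun φ hφ hc => by
    have hφ' : Continuous (deriv φ) := hφ.continuous_deriv (by simp)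
    have h1 := h.2 φ hφ hc (Set.subset_univ _)
    rw [Measure.restrict_univ] at h1
    simp only [sub_mul]
    rw [integral_sub (locallyIntegrable_of_continuous_mul hq hφ' hc.deriv)
      (locallyIntegrable_of_continuous_mul hGc.locallyIntegrable hφ' hc.deriv), h1,
      integral_primitive_mul_deriv hT hφ hc, sub_self]
  exact ⟨C, hC.mono fun x hx => by linarith⟩

/-! ### Differentiability of translations in a weighted `L²` space -/

/-- The squared norm of the space `L²(ℝ, e^{cx} dx)`. -/
def expNormSq (c : ℝ) (F : ℝ → ℝ) : ℝ≥0∞ :=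
  ∫⁻ x, ENNReal.ofReal (F x ^ 2) * ENNReal.ofReal (Real.exp (c * x))

theorem memLp_weighted_iff {c : ℝ} {F : ℝ → ℝ} (hF : Measurable F) :
    MemLp F 2 (weighted Set.univ fun x => Real.exp (c * x)) ↔ expNormSq c F < ⊤ := by
  rw [memLp_two_iff_integrable_sq hF.aestronglyMeasurable, weighted, Measure.restrict_univ]
  have hm : Measurable fun x => ENNReal.ofReal (Real.exp (c * x)) := by fun_prop
  have : expNormSq c F = ∫⁻ x, ENNReal.ofReal (F x ^ 2)
      ∂(volume.withDensity fun x => ENNReal.ofReal (Real.exp (c * x))) := by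
    rw [lintegral_withDensity_eq_lintegral_mul _ hm (by fun_prop)]
    simp only [expNormSq, Pi.mul_apply, mul_comm]
  rw [this, ← hasFiniteIntegral_iff_ofReal (Eventually.of_forall fun x => sq_nonneg _)]
  exact ⟨fun h => h.2, fun h => ⟨(hF.pow_const 2).aestronglyMeasurable, h⟩⟩

theorem expNormSq_eq (c : ℝ) (F : ℝ → ℝ) :
    expNormSq c F = ∫⁻ x, ENNReal.ofReal ((F x * Real.exp (c * x / 2)) ^ 2) := by
  refine lintegral_congr fun x => ?_
  rw [← ENNReal.ofReal_mul (sq_nonneg _), mul_pow, ← Real.exp_nat_mul]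
  congr 3; push_cast; ring

theorem locallyIntegrable_of_expNormSq {c : ℝ} {F : ℝ → ℝ} (hF : Measurable F)
    (h : expNormSq c F < ⊤) : LocallyIntegrable F := by
  rw [expNormSq_eq] at h
  have hm : Measurable fun x => F x * Real.exp (c * x / 2) := by fun_prop
  have h2 : MemLp (fun x => F x * Real.exp (c * x / 2)) 2 volume := by
    rw [memLp_two_iff_integrable_sq hm.aestronglyMeasurable]
    exact ⟨(hm.pow_const 2).aestronglyMeasurable,
      (hasFiniteIntegral_iff_ofReal (Eventually.of_forall fun x => sq_nonneg _)).2 h⟩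
  have h3 : LocallyIntegrable fun x => F x * Real.exp (c * x / 2) := h2.locallyIntegrable (by norm_num)
  have h4 := h3.locallyIntegrableOn Set.univ |>.continuousOn_mul
    (f := fun x => F x * Real.exp (c * x / 2)) (g := fun x => Real.exp (-(c * x / 2)))
    (by fun_prop) isOpen_univ.isLocallyClosed
  rw [locallyIntegrableOn_univ] at h4
  refine h4.congr (Eventually.of_forall fun x => ?_)
  simp only
  rw [mul_comm, mul_assoc, ← Real.exp_add]; simp

theorem lintegral_ofReal_sq_eq {X : Type*} [MeasurableSpace X] (μ : Measure X) (F : X → ℝ) :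
    ∫⁻ x, ENNReal.ofReal (F x ^ 2) ∂μ = eLpNorm F 2 μ ^ 2 := by
  have h := eLpNorm_nnreal_pow_eq_lintegral (f := F) (μ := μ) (p := 2) two_ne_zero
  have h' : eLpNorm F 2 μ ^ 2 = ∫⁻ x, ‖F x‖ₑ ^ (2 : ℝ) ∂μ := by
    rw [← ENNReal.rpow_two]; simpa using h
  rw [h']
  refine lintegral_congr fun x => ?_
  rw [← sq_abs, ENNReal.ofReal_pow (abs_nonneg _), ← Real.enorm_eq_ofReal_abs, ENNReal.rpow_two]

/-- Translations are continuous in `L²(ℝ)`. -/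
theorem tendsto_lintegral_translate_sub {S : ℝ → ℝ} (hS : MemLp S 2 volume) :
    Tendsto (fun y => ∫⁻ x, ENNReal.ofReal ((S (x + y) - S x) ^ 2)) (𝓝 0) (𝓝 0) := by
  let g : ℝ → C(ℝ, ℝ) := fun y => ⟨fun x => x + y, by fun_prop⟩
  have hgm : ∀ y, MeasurePreserving (g y) volume volume := fun y =>
    measurePreserving_add_right volume y
  have hg : Continuous g :=
    ContinuousMap.continuous_of_continuous_uncurry _ (continuous_snd.add continuous_fst)
  have key := (continuous_const (y := hS.toLp S)).compMeasurePreservingLp hg hgm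
    (p := 2) (by simp)
  have key0 := key.tendsto 0
  rw [tendsto_iff_norm_sub_tendsto_zero] at key0
  have e : ∀ y, ENNReal.ofReal (‖Lp.compMeasurePreserving (g y) (hgm y) (hS.toLp S) -
      Lp.compMeasurePreserving (g 0) (hgm 0) (hS.toLp S)‖ ^ 2) =
      ∫⁻ x, ENNReal.ofReal ((S (x + y) - S x) ^ 2) := fun y => by
    rw [Lp.toLp_compMeasurePreserving hS (hgm y), Lp.toLp_compMeasurePreserving hS (hgm 0),
      ← MemLp.toLp_sub, Lp.norm_toLp, lintegral_ofReal_sq_eq, ENNReal.ofReal_pow ENNReal.toReal_nonneg,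
      ENNReal.ofReal_toReal]
    · congr 2
      ext x
      simp [g]
    · exact ((hS.comp_measurePreserving (hgm y)).sub (hS.comp_measurePreserving (hgm 0))).eLpNorm_lt_top.ne
  simp_rw [← e]
  have := ENNReal.tendsto_ofReal (key0.pow 2)
  simpa using this

theorem expNormSq_add_le (c : ℝ) {F G : ℝ → ℝ} (hG : Measurable G) :
    expNormSq c (fun x => F x + G x) ≤ 2 * expNormSq c F + 2 * expNormSq c G := by
  simp only [expNormSq]
  rw [← lintegral_const_mul' _ _ (by simp), ← lintegral_const_mul' _ _ (by simp),
    ← lintegral_add_right _ (by fun_prop)]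
  refine lintegral_mono fun x => ?_
  simp only
  rw [← mul_assoc, ← mul_assoc, ← add_mul]
  gcongr
  have := IsDQM.ofReal_sq_le (F x + G x) (G x)
  rwa [add_sub_cancel_right] at this

theorem expNormSq_const_mul (c a : ℝ) (F : ℝ → ℝ) :
    expNormSq c (fun x => a * F x) = ENNReal.ofReal (a ^ 2) * expNormSq c F := by
  simp only [expNormSq]
  rw [← lintegral_const_mul' _ _ (by simp)]
  refine lintegral_congr fun x => ?_
  rw [mul_pow, ENNReal.ofReal_mul (sq_nonneg _), mul_assoc]

theorem expNormSq_translate (c h : ℝ) (F : ℝ → ℝ) :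
    expNormSq c (fun x => F (x + h)) = ENNReal.ofReal (Real.exp (-c * h)) * expNormSq c F := by
  simp only [expNormSq]
  rw [← lintegral_const_mul' _ _ (by simp),
    ← lintegral_add_right_eq_self (μ := volume) (fun x => ENNReal.ofReal (Real.exp (-c * h)) *
      (ENNReal.ofReal (F x ^ 2) * ENNReal.ofReal (Real.exp (c * x)))) h]
  refine lintegral_congr fun x => ?_
  rw [mul_left_comm, ← ENNReal.ofReal_mul (Real.exp_pos _).le, ← Real.exp_add]
  congr 3; ring

theorem memLp_mul_exp {c : ℝ} {F : ℝ → ℝ} (hF : Measurable F) (h : expNormSq c F < ⊤) :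
    MemLp (fun x => F x * Real.exp (c * x / 2)) 2 volume := by
  rw [expNormSq_eq] at h
  have hm : Measurable fun x => F x * Real.exp (c * x / 2) := by fun_prop
  rw [memLp_two_iff_integrable_sq hm.aestronglyMeasurable]
  exact ⟨(hm.pow_const 2).aestronglyMeasurable,
    (hasFiniteIntegral_iff_ofReal (Eventually.of_forall fun x => sq_nonneg _)).2 h⟩

/-- Translations are continuous in `L²(ℝ, e^{cx} dx)`; multiplication by `e^{cx/2}` reduces this to
Lebesgue measure. -/
theorem tendsto_expNormSq_translate_sub {c : ℝ} {T : ℝ → ℝ} (hT : Measurable T)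
    (h : expNormSq c T < ⊤) :
    Tendsto (fun y => expNormSq c fun x => T (x + y) - T x) (𝓝 0) (𝓝 0) := by
  set S : ℝ → ℝ := fun x => T x * Real.exp (c * x / 2) with hS
  have hSm : Measurable S := by fun_prop
  have hSL : MemLp S 2 volume := memLp_mul_exp hT h
  have hSf : ∫⁻ x, ENNReal.ofReal (S x ^ 2) ≠ ⊤ := by rw [← expNormSq_eq]; exact h.ne
  have bound : ∀ y, expNormSq c (fun x => T (x + y) - T x) ≤
      2 * (ENNReal.ofReal (Real.exp (-c * y)) * ∫⁻ x, ENNReal.ofReal ((S (x + y) - S x) ^ 2)) +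
      2 * (ENNReal.ofReal ((Real.exp (-c * y / 2) - 1) ^ 2) * ∫⁻ x, ENNReal.ofReal (S x ^ 2)) := by
    intro y
    rw [expNormSq_eq, ← lintegral_const_mul' _ _ (by simp), ← lintegral_const_mul' _ _ (by simp),
      ← lintegral_const_mul' _ _ (by simp), ← lintegral_const_mul' _ _ (by simp),
      ← lintegral_add_right _ (by fun_prop)]
    refine lintegral_mono fun x => ?_
    simp only
    have h1 := IsDQM.ofReal_sq_le ((T (x + y) - T x) * Real.exp (c * x / 2))
      ((Real.exp (-c * y / 2) - 1) * S x)
    have h2 : (T (x + y) - T x) * Real.exp (c * x / 2) - (Real.exp (-c * y / 2) - 1) * S x =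
        Real.exp (-c * y / 2) * (S (x + y) - S x) := by
      have : Real.exp (c * x / 2) = Real.exp (-c * y / 2) * Real.exp (c * (x + y) / 2) := by
        rw [← Real.exp_add]; congr 1; ring
      simp only [hS]
      linear_combination (T (x + y)) * this
    have h3 : ∀ z : ℝ, Real.exp (z / 2) ^ 2 = Real.exp z := fun z => by
      rw [← Real.exp_nat_mul]; congr 1; push_cast; ring
    rwa [h2, mul_pow (Real.exp (-c * y / 2)), mul_pow (Real.exp (-c * y / 2) - 1),
      ENNReal.ofReal_mul (sq_nonneg _), ENNReal.ofReal_mul (sq_nonneg _), h3] at h1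
  refine tendsto_of_tendsto_of_tendsto_of_le_of_le tendsto_const_nhds ?_ (fun _ => zero_le)
    bound
  have t1 : Tendsto (fun y => ENNReal.ofReal (Real.exp (-c * y))) (𝓝 0) (𝓝 (ENNReal.ofReal 1)) := by
    refine ENNReal.tendsto_ofReal ?_
    have : Continuous fun y : ℝ => Real.exp (-c * y) := by fun_prop
    simpa using this.tendsto 0
  have t2 : Tendsto (fun y => ENNReal.ofReal ((Real.exp (-c * y / 2) - 1) ^ 2)) (𝓝 0)
      (𝓝 (ENNReal.ofReal 0)) := by
    refine ENNReal.tendsto_ofReal ?_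
    have : Continuous fun y : ℝ => (Real.exp (-c * y / 2) - 1) ^ 2 := by fun_prop
    simpa using this.tendsto 0
  have t3 := ENNReal.Tendsto.const_mul (a := 2) (ENNReal.Tendsto.mul t1 (by simp)
    (tendsto_lintegral_translate_sub hSL) (by simp)) (by simp)
  have t4 := ENNReal.Tendsto.const_mul (a := 2) (ENNReal.Tendsto.mul_const
    (b := ∫⁻ x, ENNReal.ofReal (S x ^ 2)) t2 (Or.inr hSf)) (by simp)
  simpa using t3.add t4

/-- The Cauchy-Schwarz inequality against the constant function one. -/
theorem ofReal_sq_setIntegral_le {F : ℝ → ℝ} (hF : Measurable F) (s : Set ℝ) :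
    ENNReal.ofReal ((∫ y in s, F y) ^ 2) ≤
      volume s * ∫⁻ y in s, ENNReal.ofReal (F y ^ 2) := by
  have h1 : ENNReal.ofReal ((∫ y in s, F y) ^ 2) ≤ (∫⁻ y in s, ‖F y‖ₑ) ^ 2 := by
    rw [← sq_abs, ENNReal.ofReal_pow (abs_nonneg _), ← Real.enorm_eq_ofReal_abs]
    gcongr
    exact enorm_integral_le_lintegral_enorm _
  refine h1.trans ?_
  have h2 := ENNReal.lintegral_mul_le_Lp_mul_Lq (volume.restrict s) Real.HolderConjugate.two_two
    (f := fun _ => 1) (g := fun y => ‖F y‖ₑ) aemeasurable_const (by fun_prop)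
  simp only [Pi.mul_apply, one_mul, ENNReal.one_rpow, lintegral_const, Measure.restrict_apply_univ]
    at h2
  calc (∫⁻ y in s, ‖F y‖ₑ) ^ 2
      ≤ (volume s ^ (1 / 2 : ℝ) * (∫⁻ y in s, ‖F y‖ₑ ^ (2 : ℝ)) ^ (1 / 2 : ℝ)) ^ 2 := by gcongr
    _ = _ := by
      rw [mul_pow, ← ENNReal.rpow_natCast, ← ENNReal.rpow_natCast, ← ENNReal.rpow_mul,
        ← ENNReal.rpow_mul]
      norm_num
      congr 1
      refine lintegral_congr fun y => ?_
      rw [← sq_abs (F y), ENNReal.ofReal_pow (abs_nonneg _), ← Real.enorm_eq_ofReal_abs]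

/-- A function with a weak derivative `T` in `L²(ℝ, e^{cx} dx)` is differentiable along
translations in this space, with derivative `T`. -/
theorem IsWeakDeriv.eventually_expNormSq_le {c : ℝ} {q T : ℝ → ℝ} (h : IsWeakDeriv Set.univ q T)
    (hqm : Measurable q) (hTm : Measurable T) (hq : expNormSq c q < ⊤) (hT : expNormSq c T < ⊤)
    {ε : ℝ} (hε : 0 < ε) :
    ∀ᶠ y in 𝓝 (0 : ℝ), expNormSq c (fun x => q (x + y) - q x - y * T x) ≤
      ENNReal.ofReal (ε * y ^ 2) := by
  have hql := locallyIntegrable_of_expNormSq hqm hq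
  have hTl := h.locallyIntegrable
  obtain ⟨C, hC⟩ := h.exists_ae_eq hql
  have ev := (tendsto_expNormSq_translate_sub hTm hT).eventually_le_const
    (show (0 : ℝ≥0∞) < ENNReal.ofReal ε by simpa using hε)
  obtain ⟨δ, hδ, hball⟩ := Metric.eventually_nhds_iff.1 ev
  filter_upwards [Metric.ball_mem_nhds (0 : ℝ) hδ] with y hy
  have hii : ∀ a b, IntervalIntegrable T volume a b := intervalIntegrable_of_locallyIntegrable hTl
  -- The remainder is an integral of translates of `T` minus `T`, to which the Cauchy-Schwarz
  -- inequality and continuity of translations apply.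
  have e1 : ∀ᵐ x, q (x + y) - q x - y * T x = ∫ z in (0 : ℝ)..y, (T (x + z) - T x) := by
    have hC' : ∀ᵐ x, q (x + y) = C + ∫ z in (0 : ℝ)..(x + y), T z :=
      (measurePreserving_add_right volume y).quasiMeasurePreserving.ae hC
    filter_upwards [hC, hC'] with x hx hx'
    have hi : IntervalIntegrable (fun z => T (x + z)) volume 0 y := by
      have := (hii x (x + y)).comp_add_left x
      simpa using this
    rw [intervalIntegral.integral_sub hi (by simp), intervalIntegral.integral_const,
      intervalIntegral.integral_comp_add_left, hx, hx', add_zero,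
      ← intervalIntegral.integral_add_adjacent_intervals (hii 0 x) (hii x (x + y))]
    simp only [sub_zero, smul_eq_mul]; ring
  have hvol : volume (Set.uIoc 0 y) = ENNReal.ofReal |y| := by
    rw [Set.uIoc, Real.volume_Ioc, max_sub_min_eq_abs]; simp
  have e2 : ∀ᵐ x, ENNReal.ofReal ((q (x + y) - q x - y * T x) ^ 2) ≤ ENNReal.ofReal |y| *
      ∫⁻ z in Set.uIoc 0 y, ENNReal.ofReal ((T (x + z) - T x) ^ 2) := by
    filter_upwards [e1] with x hx
    rw [hx, ← hvol, ← sq_abs, intervalIntegral.abs_intervalIntegral_eq, sq_abs]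
    exact ofReal_sq_setIntegral_le (by fun_prop) _
  have hm2 : Measurable fun p : ℝ × ℝ => ENNReal.ofReal ((T (p.1 + p.2) - T p.1) ^ 2) *
      ENNReal.ofReal (Real.exp (c * p.1)) := by fun_prop
  calc expNormSq c (fun x => q (x + y) - q x - y * T x)
      ≤ ∫⁻ x, ENNReal.ofReal |y| * ∫⁻ z in Set.uIoc 0 y,
        ENNReal.ofReal ((T (x + z) - T x) ^ 2) * ENNReal.ofReal (Real.exp (c * x)) := by
        refine lintegral_mono_ae ?_
        filter_upwards [e2] with x hx
        rw [lintegral_mul_const' _ _ (by simp), ← mul_assoc]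
        gcongr
    _ = ENNReal.ofReal |y| * ∫⁻ z in Set.uIoc 0 y, expNormSq c fun x => T (x + z) - T x := by
        rw [lintegral_const_mul' _ _ (by simp), lintegral_lintegral_swap hm2.aemeasurable]
        rfl
    _ ≤ ENNReal.ofReal |y| * ∫⁻ z in Set.uIoc 0 y, ENNReal.ofReal ε := by
        gcongr ENNReal.ofReal |y| * ?_
        refine setLIntegral_mono measurable_const fun z hz => hball ?_
        rw [Real.dist_0_eq_abs]
        rw [Metric.mem_ball, Real.dist_0_eq_abs] at hy
        refine lt_of_le_of_lt ?_ hy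
        rcases Set.mem_uIoc.1 hz with h1 | h1
        · rw [abs_of_pos h1.1, abs_of_pos (h1.1.trans_le h1.2)]; exact h1.2
        · rw [abs_of_nonpos h1.2, abs_of_neg (h1.1.trans_le h1.2)]; linarith [h1.1]
    _ = ENNReal.ofReal (ε * y ^ 2) := by
        rw [setLIntegral_const, hvol, ← ENNReal.ofReal_mul hε.le,
          ← ENNReal.ofReal_mul (abs_nonneg _)]
        congr 1
        rw [← sq_abs]; ring

theorem expNormSq_toReal {c : ℝ} {F : ℝ → ℝ} (hF : Measurable F) :
    (expNormSq c F).toReal = ∫ x, (F x * Real.exp (c * x / 2)) ^ 2 := by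
  rw [expNormSq_eq, integral_eq_lintegral_of_nonneg_ae (Eventually.of_forall fun x => sq_nonneg _)
    (by fun_prop)]

theorem mul_exp_mul_exp (c c' : ℝ) (F G : ℝ → ℝ) :
    (fun x => Real.exp ((c + c') / 2 * x) * (F x * G x)) =
      fun x => F x * Real.exp (c * x / 2) * (G x * Real.exp (c' * x / 2)) := by
  ext x
  have : Real.exp ((c + c') / 2 * x) = Real.exp (c * x / 2) * Real.exp (c' * x / 2) := by
    rw [← Real.exp_add]; congr 1; ring
  rw [this]; ring

theorem integrable_exp_mul_mul {c c' : ℝ} {F G : ℝ → ℝ} (hF : Measurable F) (hG : Measurable G)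
    (hF' : expNormSq c F < ⊤) (hG' : expNormSq c' G < ⊤) :
    Integrable fun x => Real.exp ((c + c') / 2 * x) * (F x * G x) := by
  rw [mul_exp_mul_exp]
  exact (memLp_mul_exp hF hF').integrable_mul (memLp_mul_exp hG hG')

/-- The Cauchy–Schwarz inequality for the pairing of two exponentially weighted `L²` spaces. -/
theorem abs_integral_exp_mul_mul_le {c c' : ℝ} {F G : ℝ → ℝ} (hF : Measurable F) (hG : Measurable G)
    (hF' : expNormSq c F < ⊤) (hG' : expNormSq c' G < ⊤) :
    |∫ x, Real.exp ((c + c') / 2 * x) * (F x * G x)| ≤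
      Real.sqrt (expNormSq c F).toReal * Real.sqrt (expNormSq c' G).toReal := by
  rw [mul_exp_mul_exp, expNormSq_toReal hF, expNormSq_toReal hG]
  refine (abs_integral_le_integral_abs).trans ?_
  simp_rw [abs_mul (_ * _) (_ * _)]
  exact integral_abs_mul_le_sqrt (memLp_mul_exp hF hF') (memLp_mul_exp hG hG')

/-- Integration by parts in exponentially weighted spaces: `2 ∫ e^{bx} q' q = -b ∫ e^{bx} q²`. It
follows from the translation formula `∫ e^{bx} q(x + y)² dx = e^{-by} ∫ e^{bx} q(x)² dx` by
differentiation at `y = 0`; the pairing of two different weights makes the left-hand side finite. -/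
theorem IsWeakDeriv.integral_exp_mul_mul {c c' : ℝ} {q T : ℝ → ℝ}
    (h : IsWeakDeriv Set.univ q T) (hqm : Measurable q) (hTm : Measurable T)
    (hq : expNormSq c q < ⊤) (hT : expNormSq c T < ⊤) (hq' : expNormSq c' q < ⊤) :
    2 * ∫ x, Real.exp ((c + c') / 2 * x) * (T x * q x) =
      -((c + c') / 2) * ∫ x, Real.exp ((c + c') / 2 * x) * (q x * q x) := by
  set b := (c + c') / 2 with hb
  set Q := ∫ x, Real.exp (b * x) * (q x * q x) with hQ
  set R := ∫ x, Real.exp (b * x) * (T x * q x) with hR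
  have hsum : ∀ (c : ℝ), expNormSq c q < ⊤ → ∀ y, expNormSq c (fun x => q (x + y)) < ⊤ := fun c hc y => by
    rw [expNormSq_translate]; exact ENNReal.mul_lt_top (by simp) hc
  have hadd : ∀ (c : ℝ) {F G : ℝ → ℝ}, Measurable G → expNormSq c F < ⊤ → expNormSq c G < ⊤ →
      expNormSq c (fun x => F x + G x) < ⊤ := fun c F G hG h1 h2 =>
    (expNormSq_add_le c hG).trans_lt (ENNReal.add_lt_top.2
      ⟨ENNReal.mul_lt_top (by simp) h1, ENNReal.mul_lt_top (by simp) h2⟩)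
  have hsmul : ∀ (c a : ℝ) {F : ℝ → ℝ}, expNormSq c F < ⊤ → expNormSq c (fun x => a * F x) < ⊤ :=
    fun c a F h1 => by rw [expNormSq_const_mul]; exact ENNReal.mul_lt_top (by simp) h1
  set D : ℝ → ℝ → ℝ := fun y x => q (x + y) - q x - y * T x with hD
  have hDm : ∀ y, Measurable (D y) := fun y => by fun_prop
  have hΔf : ∀ (c : ℝ), expNormSq c q < ⊤ → ∀ y, expNormSq c (fun x => q (x + y) - q x) < ⊤ := fun c hc y => by
    have := hadd c (F := fun x => q (x + y)) (G := fun x => (-1) * q x) (by fun_prop) (hsum c hc y)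
      (hsmul c (-1) hc)
    convert this using 2; ext x; ring
  have hDf : ∀ y, expNormSq c (D y) < ⊤ := fun y => by
    have := hadd c (F := fun x => q (x + y) - q x) (G := fun x => (-y) * T x) (by fun_prop)
      (hΔf c hq y) (hsmul c (-y) hT)
    convert this using 2; ext x; simp only [hD]; ring
  set r1 : ℝ → ℝ := fun y => ∫ x, Real.exp (b * x) * (T x * (q (x + y) - q x)) with hr1
  set r2 : ℝ → ℝ := fun y => ∫ x, Real.exp (b * x) * (D y x * (q (x + y) + q x)) with hr2
  -- The translation formula, with `q(x + y)² - q(x)²` expanded around `2 y q T`.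
  have ident : ∀ y, (Real.exp (-b * y) - 1) * Q = r2 y + y * (2 * R + r1 y) := by
    intro y
    have i1 := integrable_exp_mul_mul hTm hqm hT hq'
    have i2 := integrable_exp_mul_mul (c' := c') hTm (by fun_prop : Measurable fun x => q (x + y) - q x)
      hT (hΔf c' hq' y)
    have i3 := integrable_exp_mul_mul (c' := c') (hDm y)
      (by fun_prop : Measurable fun x => q (x + y) + q x) (hDf y) (hadd c' hqm (hsum c' hq' y) hq')
    have i4 := integrable_exp_mul_mul hqm hqm hq hq'
    have i5 := i4.comp_add_right y
    have e1 : ∫ x, Real.exp (b * (x + y)) * (q (x + y) * q (x + y)) = Q :=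
      integral_add_right_eq_self (fun x => Real.exp (b * x) * (q x * q x)) y
    calc (Real.exp (-b * y) - 1) * Q
        = Real.exp (-b * y) * (∫ x, Real.exp (b * (x + y)) * (q (x + y) * q (x + y))) - Q := by
          rw [e1]; ring
      _ = ∫ x, (Real.exp (-b * y) * (Real.exp (b * (x + y)) * (q (x + y) * q (x + y))) -
            Real.exp (b * x) * (q x * q x)) := by
          rw [integral_sub (i5.const_mul _) i4, integral_const_mul]
      _ = ∫ x, (Real.exp (b * x) * (D y x * (q (x + y) + q x)) +
            y * (2 * (Real.exp (b * x) * (T x * q x)) +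
              Real.exp (b * x) * (T x * (q (x + y) - q x)))) := by
          congr 1; ext x
          have : Real.exp (-b * y) * Real.exp (b * (x + y)) = Real.exp (b * x) := by
            rw [← Real.exp_add]; congr 1; ring
          rw [← mul_assoc, this]; simp only [hD]; ring
      _ = r2 y + y * (2 * R + r1 y) := by
          have i6 : Integrable fun x => y * (2 * (Real.exp (b * x) * (T x * q x)) +
              Real.exp (b * x) * (T x * (q (x + y) - q x))) := ((i1.const_mul 2).add i2).const_mul y
          rw [integral_add i3 i6, integral_const_mul, integral_add (i1.const_mul 2) i2,
            integral_const_mul]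
  have lim1 : Tendsto r1 (𝓝[≠] 0) (𝓝 0) := by
    rw [tendsto_zero_iff_abs_tendsto_zero]
    have hb1 : ∀ y, |r1 y| ≤ Real.sqrt (expNormSq c T).toReal *
        Real.sqrt (expNormSq c' fun x => q (x + y) - q x).toReal := fun y =>
      abs_integral_exp_mul_mul_le hTm (by fun_prop) hT (hΔf c' hq' y)
    refine squeeze_zero (fun y => abs_nonneg _) hb1 ?_
    have := ((ENNReal.tendsto_toReal ENNReal.zero_ne_top).comp
      (tendsto_expNormSq_translate_sub hqm hq')).sqrt.const_mul (Real.sqrt (expNormSq c T).toReal)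
    simp only [ENNReal.toReal_zero, Real.sqrt_zero, mul_zero] at this
    exact this.mono_left nhdsWithin_le_nhds
  have lim2 : Tendsto (fun y => y⁻¹ * r2 y) (𝓝[≠] 0) (𝓝 0) := by
    -- the translates of `q` are bounded in the second space, near the origin
    obtain ⟨B, hB0, hB⟩ : ∃ B : ℝ, 0 ≤ B ∧ ∀ᶠ y in 𝓝 (0 : ℝ),
        (expNormSq c' fun x => q (x + y) + q x).toReal ≤ B := by
      refine ⟨(2 * (ENNReal.ofReal 2 * expNormSq c' q) + 2 * expNormSq c' q).toReal,
        ENNReal.toReal_nonneg, ?_⟩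
      have : Tendsto (fun y => Real.exp (-c' * y)) (𝓝 0) (𝓝 1) := by
        have : Continuous fun y : ℝ => Real.exp (-c' * y) := by fun_prop
        simpa using this.tendsto 0
      filter_upwards [this.eventually_le_const (show (1 : ℝ) < 2 by norm_num)] with y hy
      refine ENNReal.toReal_mono ?_ ?_
      · exact (ENNReal.add_lt_top.2 ⟨ENNReal.mul_lt_top (by simp)
          (ENNReal.mul_lt_top (by simp) hq'), ENNReal.mul_lt_top (by simp) hq'⟩).ne
      · refine (expNormSq_add_le c' hqm).trans ?_
        rw [expNormSq_translate]
        gcongr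
    rw [Metric.tendsto_nhds]
    intro ε hε
    have hη : 0 < (ε / (2 * (Real.sqrt B + 1))) ^ 2 := by positivity
    filter_upwards [nhdsWithin_le_nhds (h.eventually_expNormSq_le hqm hTm hq hT hη),
      nhdsWithin_le_nhds hB, self_mem_nhdsWithin] with y h1 h2 hy
    have hy0 : 0 < |y| := abs_pos.2 hy
    rw [Real.dist_0_eq_abs, abs_mul, abs_inv]
    have h3 : |r2 y| ≤ _ := abs_integral_exp_mul_mul_le (c := c) (c' := c') (hDm y)
      (by fun_prop) (hDf y) (hadd c' hqm (hsum c' hq' y) hq')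
    have h4 : Real.sqrt (expNormSq c (D y)).toReal ≤ ε / (2 * (Real.sqrt B + 1)) * |y| := by
      rw [Real.sqrt_le_left (by positivity), mul_pow, sq_abs]
      exact ENNReal.toReal_le_of_le_ofReal (by positivity) h1
    have h5 : |r2 y| ≤ ε / (2 * (Real.sqrt B + 1)) * |y| * Real.sqrt B :=
      h3.trans (mul_le_mul h4 (Real.sqrt_le_sqrt h2) (Real.sqrt_nonneg _) (by positivity))
    calc |y|⁻¹ * |r2 y| ≤ |y|⁻¹ * (ε / (2 * (Real.sqrt B + 1)) * |y| * Real.sqrt B) := by gcongr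
      _ = ε * (Real.sqrt B / (2 * (Real.sqrt B + 1))) := by field_simp
      _ < ε * 1 := by
          gcongr
          rw [div_lt_one (by positivity)]
          linarith [Real.sqrt_nonneg B]
      _ = ε := mul_one _
  have lim3 : Tendsto (fun y => y⁻¹ * ((Real.exp (-b * y) - 1) * Q)) (𝓝[≠] 0) (𝓝 (-b * Q)) := by
    have hd : HasDerivAt (fun y : ℝ => Real.exp (-b * y)) (-b) 0 := by
      have := ((hasDerivAt_id (0 : ℝ)).const_mul (-b)).exp
      simpa using this
    have := (hasDerivAt_iff_tendsto_slope_zero.1 hd).mul_const Q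
    simpa [mul_assoc] using this
  have lim4 : Tendsto (fun y => y⁻¹ * ((Real.exp (-b * y) - 1) * Q)) (𝓝[≠] 0) (𝓝 (2 * R)) := by
    have : Tendsto (fun y => y⁻¹ * r2 y + (2 * R + r1 y)) (𝓝[≠] 0) (𝓝 (0 + (2 * R + 0))) :=
      lim2.add (tendsto_const_nhds.add lim1)
    rw [add_zero, zero_add] at this
    refine this.congr' ?_
    filter_upwards [self_mem_nhdsWithin] with y hy
    have hy' : y ≠ 0 := hy
    rw [ident y]; field_simp
  exact tendsto_nhds_unique lim4 lim3

/-! ### The radial score -/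

/-- Under (A2) the chosen weak derivative of `f^{1/2}(e^x)` has a measurable version `T`, and both
functions are in `L²(ℝ, e^{kx} dx)`. -/
theorem AssumptionA2.exists_weakDeriv {k : ℕ} {f : ℝ → ℝ} (hf : IsRadialDensity k f)
    (h : AssumptionA2 k f) : ∃ T : ℝ → ℝ, Measurable T ∧ IsWeakDeriv Set.univ (sqrtExp f) T ∧
      weakDeriv Set.univ (sqrtExp f) =ᵐ[volume] T ∧ expNormSq k (sqrtExp f) < ⊤ ∧
      expNormSq k T < ⊤ := by
  obtain ⟨hq, T₀, hT₀, hT₀L⟩ := h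
  have hqm : Measurable (sqrtExp f) := by
    have := hf.measurable
    unfold sqrtExp; fun_prop
  have hex : ∃ T, IsWeakDeriv Set.univ (sqrtExp f) T := ⟨T₀, hT₀⟩
  have hw : IsWeakDeriv Set.univ (sqrtExp f) (weakDeriv Set.univ (sqrtExp f)) := by
    rw [weakDeriv, dif_pos hex]; exact Classical.choose_spec hex
  have hae : AEStronglyMeasurable T₀ volume := hT₀.locallyIntegrable.aestronglyMeasurable
  have hTT : T₀ =ᵐ[volume] hae.mk := hae.ae_eq_mk
  refine ⟨hae.mk, hae.stronglyMeasurable_mk.measurable, hT₀.congr hTT,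
    (hw.ae_unique hT₀).trans hTT, (memLp_weighted_iff hqm).1 hq, ?_⟩
  rw [← memLp_weighted_iff hae.stronglyMeasurable_mk.measurable]
  refine hT₀L.ae_eq ?_
  have : weighted Set.univ (fun x => Real.exp (k * x)) ≪ volume := by
    rw [weighted, Measure.restrict_univ]; exact withDensity_absolutelyContinuous _ _
  exact this.ae_eq hTT

namespace IsRadialDensity

variable {k : ℕ} {f : ℝ → ℝ}

theorem measurable_sqrtExp (hf : IsRadialDensity k f) : Measurable (sqrtExp f) := by
  have := hf.measurable
  unfold sqrtExp; fun_prop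

theorem lintegral_Ioi_eq_exp (F : ℝ → ℝ≥0∞) :
    ∫⁻ r in Set.Ioi (0 : ℝ), F r = ∫⁻ x, ENNReal.ofReal (Real.exp x) * F (Real.exp x) := by
  have := lintegral_image_eq_lintegral_abs_deriv_mul (s := Set.univ) MeasurableSet.univ
    (fun x _ => (Real.hasDerivAt_exp x).hasDerivWithinAt) Real.exp_injective.injOn F
  rw [Set.image_univ, Real.range_exp, Measure.restrict_univ] at this
  rw [this]
  simp only [abs_of_pos (Real.exp_pos _)]

theorem radialMass_inv_pos (hf : IsRadialDensity k f) : 0 < (radialMass k f)⁻¹ := by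
  have := hf.radialMass_pos
  positivity

/-- The law of the logarithm of the modulus has density proportional to `e^{kx} f(e^x)`. -/
theorem modulusLaw_eq_map_exp (hk : 1 ≤ k) (hf : IsRadialDensity k f) :
    modulusLaw k f = (volume.withDensity fun x => ENNReal.ofReal
      ((radialMass k f)⁻¹ * (Real.exp (k * x) * sqrtExp f x ^ 2))).map Real.exp := by
  have hqm := hf.measurable_sqrtExp
  refine Measure.ext_of_lintegral _ fun F hF => ?_
  rw [hf.lintegral_modulusLaw F hF, lintegral_map hF Real.measurable_exp,
    lintegral_withDensity_eq_lintegral_mul _ (by fun_prop) (by fun_prop),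
    lintegral_Ioi_eq_exp, ← lintegral_const_mul' _ _ (by simp)]
  refine lintegral_congr fun x => ?_
  have h0 : 0 ≤ f (Real.exp x) := hf.nonneg _ (Real.exp_pos x)
  have h1 : Real.exp x * Real.exp x ^ (k - 1) = Real.exp (k * x) := by
    rw [← pow_succ', Nat.sub_add_cancel hk, ← Real.exp_nat_mul]
  simp only [Pi.mul_apply]
  rw [sqrtExp, Real.sq_sqrt h0, ← h1, ENNReal.ofReal_mul (hf.radialMass_inv_pos).le,
    ENNReal.ofReal_mul (by positivity), ENNReal.ofReal_mul (by positivity)]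
  ring

theorem integral_modulusLaw_eq (hk : 1 ≤ k) (hf : IsRadialDensity k f) (F : ℝ → ℝ) :
    ∫ r, F r ∂(modulusLaw k f) =
      (radialMass k f)⁻¹ * ∫ x, Real.exp (k * x) * sqrtExp f x ^ 2 * F (Real.exp x) := by
  have hqm := hf.measurable_sqrtExp
  have hpos := hf.radialMass_inv_pos
  rw [hf.modulusLaw_eq_map_exp hk, Real.isOpenEmbedding_exp.measurableEmbedding.integral_map,
    integral_withDensity_eq_integral_toReal_smul (by fun_prop) (by simp), ← integral_const_mul]
  congr 1; ext x
  rw [ENNReal.toReal_ofReal (by positivity), smul_eq_mul]; ring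

theorem lintegral_modulusLaw_eq (hk : 1 ≤ k) (hf : IsRadialDensity k f) (F : ℝ → ℝ≥0∞)
    (hF : Measurable F) :
    ∫⁻ r, F r ∂(modulusLaw k f) = ENNReal.ofReal (radialMass k f)⁻¹ *
      ∫⁻ x, ENNReal.ofReal (sqrtExp f x ^ 2) * ENNReal.ofReal (Real.exp (k * x)) * F (Real.exp x) := by
  have hqm := hf.measurable_sqrtExp
  have hpos := hf.radialMass_inv_pos
  rw [hf.modulusLaw_eq_map_exp hk, lintegral_map hF Real.measurable_exp,
    lintegral_withDensity_eq_lintegral_mul _ (by fun_prop) (by fun_prop),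
    ← lintegral_const_mul' _ _ (by simp)]
  refine lintegral_congr fun x => ?_
  simp only [Pi.mul_apply]
  rw [ENNReal.ofReal_mul hpos.le, ENNReal.ofReal_mul (Real.exp_pos _).le]
  ring

theorem ae_sqrtExp_pos (hf : IsRadialDensity k f) : ∀ᵐ x, 0 < sqrtExp f x := by
  have h := (ae_restrict_iff' measurableSet_Ioi).1 hf.ae_pos
  have h2 : Measure.QuasiMeasurePreserving Real.exp volume (volume.restrict (Set.Ioi 0)) := by
    refine ⟨Real.measurable_exp, ?_⟩
    refine Measure.AbsolutelyContinuous.mk fun s hs h0 => ?_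
    rw [Measure.map_apply Real.measurable_exp hs]
    rw [← lintegral_indicator_one hs, lintegral_Ioi_eq_exp, lintegral_eq_zero_iff' (by
      have : Measurable (s.indicator (1 : ℝ → ℝ≥0∞)) := measurable_one.indicator hs
      fun_prop)] at h0
    refine measure_mono_null (t := {x | ¬ ENNReal.ofReal (Real.exp x) *
      s.indicator 1 (Real.exp x) = (0 : ℝ → ℝ≥0∞) x}) (fun x hx => ?_) h0
    have hx' : Real.exp x ∈ s := hx
    simp [hx', Real.exp_pos]
  have h3 := h2.ae hf.ae_pos
  filter_upwards [h3] with x hx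
  exact Real.sqrt_pos.2 hx

/-- The score function at the distribution function is a logarithmic derivative. -/
theorem ae_radialScore_eq (hk : 1 ≤ k) (hf : IsRadialDensity k f) {T : ℝ → ℝ}
    (hT : weakDeriv Set.univ (sqrtExp f) =ᵐ[volume] T) :
    ∀ᵐ r ∂(modulusLaw k f), radialScore k f (modulusCdf k f r) =
      -2 * T (Real.log r) / sqrtExp f (Real.log r) := by
  have hqm := hf.measurable_sqrtExp
  rw [hf.modulusLaw_eq_map_exp hk]
  have hemb : MeasurableEmbedding Real.exp := Real.isOpenEmbedding_exp.measurableEmbedding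
  rw [hemb.ae_map_iff]
  refine (withDensity_absolutelyContinuous _ _).ae_le ?_
  filter_upwards [hT] with x hx
  have hx0 := Real.exp_pos x
  rw [radialScore, hf.modulusQuantile_modulusCdf hx0, psi, Real.log_exp, hx]
  field_simp

/-- Square integrability of the radial score: `K_f(F̃(e^x))² f(e^x) = 4 T(x)²` for the weak
derivative `T`. -/
theorem memLp_radialScore (hk : 1 ≤ k) (hf : IsRadialDensity k f) (h2 : AssumptionA2 k f) :
    MemLp (fun r => radialScore k f (modulusCdf k f r)) 2 (modulusLaw k f) := by
  obtain ⟨T, hTm, -, hTe, -, hTf⟩ := h2.exists_weakDeriv hf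
  have hqm := hf.measurable_sqrtExp
  have hae := hf.ae_radialScore_eq hk hTe
  have hm : Measurable fun r => -2 * T (Real.log r) / sqrtExp f (Real.log r) := by fun_prop
  refine MemLp.ae_eq (Filter.EventuallyEq.symm hae) ?_
  rw [memLp_two_iff_integrable_sq hm.aestronglyMeasurable]
  refine ⟨(hm.pow_const 2).aestronglyMeasurable, ?_⟩
  rw [hasFiniteIntegral_iff_ofReal (Eventually.of_forall fun x => sq_nonneg _),
    hf.lintegral_modulusLaw_eq hk _ (by fun_prop)]
  refine ENNReal.mul_lt_top (by simp) (lt_of_le_of_lt ?_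
    (ENNReal.mul_lt_top (a := 4) (by simp) hTf))
  rw [expNormSq, ← lintegral_const_mul' _ _ (by simp)]
  refine lintegral_mono fun x => ?_
  simp only [Real.log_exp]
  have h4 : sqrtExp f x ^ 2 * (-2 * T x / sqrtExp f x) ^ 2 ≤ 4 * T x ^ 2 := by
    by_cases hq : sqrtExp f x = 0
    · rw [hq]; simp; positivity
    · refine le_of_eq ?_
      field_simp
      ring
  have h5 := ENNReal.ofReal_le_ofReal h4
  rw [ENNReal.ofReal_mul (sq_nonneg _), ENNReal.ofReal_mul (by norm_num),
    ENNReal.ofReal_ofNat] at h5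
  rw [mul_right_comm, ← mul_assoc]
  gcongr

/-- Moments of the radial score: `E[d^m K_f] = (k + m) E[d^m]`. -/
theorem integral_pow_mul_radialScore (hk : 1 ≤ k) (hf : IsRadialDensity k f)
    (h2 : AssumptionA2 k f) {m : ℕ} (hm : Integrable (fun r => r ^ (2 * m)) (modulusLaw k f)) :
    ∫ r, r ^ m * radialScore k f (modulusCdf k f r) ∂(modulusLaw k f) =
      (k + m) * ∫ r, r ^ m ∂(modulusLaw k f) := by
  obtain ⟨T, hTm, hTd, hTe, hqf, hTf⟩ := h2.exists_weakDeriv hf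
  have hqm := hf.measurable_sqrtExp
  have hae := hf.ae_radialScore_eq hk hTe
  have hpos := hf.radialMass_inv_pos
  have hq' : expNormSq (k + 2 * m) (sqrtExp f) < ⊤ := by
    have h3 : ∫⁻ r, ENNReal.ofReal (r ^ (2 * m)) ∂(modulusLaw k f) < ⊤ := by
      rw [← hasFiniteIntegral_iff_ofReal (Eventually.of_forall fun x => by
        rw [pow_mul]; positivity)]
      exact hm.2
    rw [hf.lintegral_modulusLaw_eq hk _ (by fun_prop)] at h3
    have h4 := ENNReal.lt_top_of_mul_ne_top_right h3.ne (by simpa using hpos)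
    refine lt_of_eq_of_lt (lintegral_congr fun x => ?_) h4
    rw [mul_assoc, ← ENNReal.ofReal_mul (Real.exp_pos _).le, ← Real.exp_nat_mul, ← Real.exp_add]
    congr 3; push_cast; ring
  -- Integration by parts with the weight `e^{(k + m) x}`, the mean of the exponents `k` and `k + 2
  -- m` for which `q` is square integrable.
  have key := hTd.integral_exp_mul_mul hqm hTm hqf hTf hq'
  rw [integral_congr_ae (g := fun r => r ^ m * (-2 * T (Real.log r) / sqrtExp f (Real.log r)))
    (by filter_upwards [hae] with r hr; rw [hr]), hf.integral_modulusLaw_eq hk,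
    hf.integral_modulusLaw_eq hk]
  have hb : ((k : ℝ) + (k + 2 * m)) / 2 = k + m := by ring
  rw [hb] at key
  have hexp : ∀ x : ℝ, Real.exp ((k + m) * x) = Real.exp (k * x) * Real.exp x ^ m := fun x => by
    rw [← Real.exp_nat_mul, ← Real.exp_add]; congr 1; ring
  have e1 : ∫ x, Real.exp (k * x) * sqrtExp f x ^ 2 * (Real.exp x ^ m *
      (-2 * T (Real.log (Real.exp x)) / sqrtExp f (Real.log (Real.exp x)))) =
      -(2 * ∫ x, Real.exp ((k + m) * x) * (T x * sqrtExp f x)) := by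
    rw [← integral_const_mul, ← integral_neg]
    refine integral_congr_ae ?_
    filter_upwards [hf.ae_sqrtExp_pos] with x hx
    rw [Real.log_exp, hexp]
    field_simp
  have e2 : ∫ x, Real.exp (k * x) * sqrtExp f x ^ 2 * Real.exp x ^ m =
      ∫ x, Real.exp ((k + m) * x) * (sqrtExp f x * sqrtExp f x) := by
    congr 1; ext x; rw [hexp]; ring
  rw [e1, e2, key]; ring

end IsRadialDensity

/-! ### Elliptical laws as transforms of reweighted spherical laws -/

section

theorem dotProduct_mulVec_eq_quadForm {k : ℕ} (A : Matrix (Fin k) (Fin k) ℝ) (x : Obs k) :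
    dotProduct x.ofLp (A.mulVec x.ofLp) = quadForm A x := by
  simp only [dotProduct, Matrix.mulVec, quadForm, Finset.mul_sum]
  refine Finset.sum_congr rfl fun i _ => Finset.sum_congr rfl fun j _ => ?_
  ring

theorem quadForm_pos {k : ℕ} {A : Matrix (Fin k) (Fin k) ℝ} (hA : A.PosDef) {x : Obs k}
    (hx : x ≠ 0) : 0 < quadForm A x := by
  rw [← dotProduct_mulVec_eq_quadForm]
  have := hA.dotProduct_mulVec_pos (x := x.ofLp) (by simpa using hx)
  simpa using this

/-- The affine map sending spherical observations to elliptical ones. -/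
theorem lintegral_affine {k : ℕ} (θ : Obs k) {M : Matrix (Fin k) (Fin k) ℝ} (hM : M.det ≠ 0)
    {F : Obs k → ℝ≥0∞} (hF : Measurable F) :
    ∫⁻ x, F x = ENNReal.ofReal |M.det| * ∫⁻ w : Obs k, F (θ + WithLp.toLp 2 (M.mulVec w.ofLp)) := by
  set L := Matrix.toLpLin 2 2 M with hL
  have hdet : LinearMap.det L ≠ 0 := by rwa [hL, LinearMap.det_toLpLin]
  have hLw : ∀ w : Obs k, L w = WithLp.toLp 2 (M.mulVec w.ofLp) := fun w => rfl
  have hLm : Measurable L := L.continuous_of_finiteDimensional.measurable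
  have h := Measure.map_linearMap_addHaar_eq_smul_addHaar (volume : Measure (Obs k)) hdet
  rw [hL, LinearMap.det_toLpLin, ← hL] at h
  have h2 : ∫⁻ w, F (θ + L w) = ENNReal.ofReal |M.det⁻¹| * ∫⁻ x, F (θ + x) := by
    rw [← lintegral_map (f := fun y => F (θ + y)) (g := L) (by fun_prop) hLm, h,
      lintegral_smul_measure, smul_eq_mul]
  simp only [← hLw]
  rw [h2, lintegral_add_left_eq_self (fun x => F x) θ, ← mul_assoc, ← ENNReal.ofReal_mul (abs_nonneg _), ← abs_mul,
    mul_inv_cancel₀ hM]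
  simp

variable {k : ℕ} {f : ℝ → ℝ}

/-- The normalizing constant of a spherical density. -/
def sphericalConst (k : ℕ) (f : ℝ → ℝ) : ℝ := (∫ z : Obs k, f ‖z‖)⁻¹

theorem IsRadialDensity.ae_norm_pos (hk : 2 ≤ k) (hf : IsRadialDensity k f) :
    ∀ᵐ w : Obs k, 0 < f ‖w‖ := by
  have hfm := hf.measurable
  have hs : MeasurableSet {w : Obs k | ¬ 0 < f ‖w‖} :=
    (measurableSet_lt measurable_const (hfm.comp measurable_norm)).compl
  rw [ae_iff, ← lintegral_indicator_one hs, lintegral_polar hk _ (measurable_one.indicator hs)]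
  refine mul_eq_zero_of_right _ ?_
  refine (lintegral_congr_ae ?_).trans lintegral_zero
  filter_upwards [ae_norm_eq_one_dirLaw k] with u hu
  refine (lintegral_congr_ae ?_).trans lintegral_zero
  filter_upwards [hf.ae_pos, ae_restrict_mem measurableSet_Ioi] with r hr hr0
  have : ‖r • u‖ = r := by rw [norm_smul, hu, mul_one, Real.norm_of_nonneg (le_of_lt hr0)]
  simp [this, hr]

theorem IsRadialDensity.lintegral_norm (hk : 2 ≤ k) (hf : IsRadialDensity k f)
    {F : Obs k → ℝ≥0∞} (hF : Measurable F) :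
    ∫⁻ w, ENNReal.ofReal (f ‖w‖) * F w =
      sphereMass k * ENNReal.ofReal (radialMass k f) * ∫⁻ w, F w ∂(sphericalLaw k f) := by
  have hfm := hf.measurable
  have h0 := hf.radialMass_pos
  rw [lintegral_polar hk _ (by fun_prop), lintegral_sphericalLaw hk hf F hF, mul_assoc]
  congr 1
  rw [← lintegral_const_mul' _ _ (by simp)]
  refine lintegral_congr_ae ?_
  filter_upwards [ae_norm_eq_one_dirLaw k] with u hu
  rw [hf.lintegral_modulusLaw _ (by fun_prop), ← mul_assoc, ← ENNReal.ofReal_mul h0.le,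
    mul_inv_cancel₀ h0.ne', ENNReal.ofReal_one, one_mul]
  refine setLIntegral_congr_fun measurableSet_Ioi fun r hr => ?_
  have : ‖r • u‖ = r := by rw [norm_smul, hu, mul_one, Real.norm_of_nonneg (le_of_lt hr)]
  simp only [this]

/-- The normalizing constant of the spherical density is positive and matches the polar
decomposition of Lebesgue measure. -/
theorem IsRadialDensity.ofReal_sphericalConst (hk : 2 ≤ k) (hf : IsRadialDensity k f) :
    0 < sphericalConst k f ∧ ENNReal.ofReal (sphericalConst k f) *
      (sphereMass k * ENNReal.ofReal (radialMass k f)) = 1 := by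
  have hfm := hf.measurable
  have h0 := hf.radialMass_pos
  have := isProbabilityMeasure_sphericalLaw hk hf
  have h1 := hf.lintegral_norm hk (F := fun _ => 1) measurable_const
  simp only [mul_one, lintegral_const, measure_univ] at h1
  set c := sphereMass k * ENNReal.ofReal (radialMass k f) with hc
  have hct : c ≠ ⊤ := ENNReal.mul_ne_top (sphereMass_ne_top k) (by simp)
  have hc0 : c ≠ 0 := mul_ne_zero (sphereMass_ne_zero hk) (by simpa using h0)
  have h2 : ∫ z : Obs k, f ‖z‖ = c.toReal := by
    rw [integral_eq_lintegral_of_nonneg_ae ((hf.ae_norm_pos hk).mono fun w hw => hw.le)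
      (hfm.comp measurable_norm).aestronglyMeasurable, h1]
  have h3 : 0 < c.toReal := ENNReal.toReal_pos hc0 hct
  rw [sphericalConst, h2]
  refine ⟨by positivity, ?_⟩
  rw [ENNReal.ofReal_inv_of_pos h3, ENNReal.ofReal_toReal hct, ENNReal.inv_mul_cancel hc0 hct]

/-- The spherical law, defined by independent modulus and direction, has density proportional to `f
‖w‖`. -/
theorem IsRadialDensity.sphericalLaw_eq (hk : 2 ≤ k) (hf : IsRadialDensity k f) :
    sphericalLaw k f = volume.withDensity
      fun w => ENNReal.ofReal (sphericalConst k f) * ENNReal.ofReal (f ‖w‖) := by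
  have hfm := hf.measurable
  refine Measure.ext_of_lintegral _ fun F hF => ?_
  rw [lintegral_withDensity_eq_lintegral_mul _ (by fun_prop) hF]
  simp only [Pi.mul_apply, mul_assoc]
  rw [lintegral_const_mul _ (by fun_prop), hf.lintegral_norm hk hF, ← mul_assoc,
    (hf.ofReal_sphericalConst hk).2, one_mul]

/-- The likelihood ratio, with respect to the spherical law, of the elliptical law with shape
matrix `A` (of arbitrary determinant). Positive parts make it nonnegative everywhere, whatever the
value of the radial density at the origin. -/
def shapeRatio (f : ℝ → ℝ) (A : Matrix (Fin k) (Fin k) ℝ) (w : Obs k) : ℝ :=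
  (Real.sqrt A.det)⁻¹ * (max (f (Real.sqrt (quadForm A⁻¹ w))) 0 / max (f ‖w‖) 0)

theorem shapeRatio_nonneg (f : ℝ → ℝ) (A : Matrix (Fin k) (Fin k) ℝ) (w : Obs k) :
    0 ≤ shapeRatio f A w := by unfold shapeRatio; positivity

theorem IsRadialDensity.measurable_shapeRatio (hf : IsRadialDensity k f)
    (A : Matrix (Fin k) (Fin k) ℝ) : Measurable (shapeRatio f A) := by
  have := hf.measurable
  unfold shapeRatio
  have := (continuous_quadForm A⁻¹).measurable
  fun_prop

theorem IsRadialDensity.withDensity_shapeRatio (hk : 2 ≤ k) (hf : IsRadialDensity k f)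
    {A : Matrix (Fin k) (Fin k) ℝ} (hA : A.PosDef) :
    (sphericalLaw k f).withDensity (fun w => ENNReal.ofReal (shapeRatio f A w)) =
      volume.withDensity fun w => ENNReal.ofReal
        (sphericalConst k f * (Real.sqrt A.det)⁻¹ * f (Real.sqrt (quadForm A⁻¹ w))) := by
  have hfm := hf.measurable
  have hrm := hf.measurable_shapeRatio A
  rw [hf.sphericalLaw_eq hk, ← withDensity_mul _ (by fun_prop) (by fun_prop)]
  refine withDensity_congr_ae ?_
  have hnt := nontrivial_obs hk
  have hne : ∀ᵐ w : Obs k, w ≠ 0 := by simp [ae_iff]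
  filter_upwards [hf.ae_norm_pos hk, hne] with w hw hw0
  have h1 : 0 < Real.sqrt (quadForm A⁻¹ w) := Real.sqrt_pos.2 (quadForm_pos hA.inv hw0)
  have hc := (hf.ofReal_sphericalConst hk).1
  simp only [Pi.mul_apply, shapeRatio]
  rw [← ENNReal.ofReal_mul hc.le, ← ENNReal.ofReal_mul (by positivity),
    max_eq_left (hf.nonneg _ h1), max_eq_left hw.le]
  congr 1
  field_simp

/-- The change of variables `x = θ + σ R w` in the elliptical density with shape `R A R`. -/
theorem lintegral_ellipticalLaw (hf : Measurable f) (θ : Obs k) {σ : ℝ} (hσ : 0 < σ)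
    {R A : Matrix (Fin k) (Fin k) ℝ} (hR : R.IsSymm) (hRd : R.det ≠ 0)
    {F : Obs k → ℝ≥0∞} (hF : Measurable F) :
    ∫⁻ x, F x ∂(ellipticalLaw θ σ (R * A * R) f) =
      ∫⁻ w, ENNReal.ofReal
        (sphericalConst k f * (Real.sqrt A.det)⁻¹ * f (Real.sqrt (quadForm A⁻¹ w))) *
        F (θ + WithLp.toLp 2 ((σ • R).mulVec w.ofLp)) := by
  have hdm : Measurable fun x : Obs k => ellipticalDensity θ σ (R * A * R) f x := by
    simp only [ellipticalDensity, dotProduct_mulVec_eq_quadForm]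
    have := (continuous_quadForm (R * A * R)⁻¹).measurable
    fun_prop
  have hσd : (σ • R).det ≠ 0 := by
    rw [Matrix.det_smul]; exact mul_ne_zero (pow_ne_zero _ hσ.ne') hRd
  rw [ellipticalLaw, lintegral_withDensity_eq_lintegral_mul _ (by fun_prop) hF,
    lintegral_affine θ hσd (by fun_prop), ← lintegral_const_mul' _ _ ENNReal.ofReal_ne_top]
  refine lintegral_congr fun w => ?_
  simp only [Pi.mul_apply]
  rw [← mul_assoc, ← ENNReal.ofReal_mul (abs_nonneg _)]
  congr 2
  have hu : IsUnit R.det := hRd.isUnit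
  have e1 : (θ + WithLp.toLp 2 ((σ • R).mulVec w.ofLp) - θ).ofLp = σ • R.mulVec w.ofLp := by
    simp [Matrix.smul_mulVec]
  have e2 : dotProduct (σ • R.mulVec w.ofLp) ((R * A * R)⁻¹.mulVec (σ • R.mulVec w.ofLp)) =
      σ ^ 2 * quadForm A⁻¹ w := by
    rw [Matrix.mulVec_smul, smul_dotProduct, dotProduct_smul, ← dotProduct_mulVec_eq_quadForm,
      smul_eq_mul, smul_eq_mul, ← mul_assoc, ← sq, Matrix.mulVec_mulVec]
    congr 1
    have : (R * A * R)⁻¹ * R = R⁻¹ * A⁻¹ := by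
      rw [Matrix.mul_inv_rev, Matrix.mul_inv_rev, ← Matrix.mul_assoc, Matrix.mul_assoc,
        Matrix.mul_assoc, Matrix.nonsing_inv_mul R hu]
      simp
    rw [this, ← Matrix.mulVec_mulVec, Matrix.dotProduct_mulVec, ← Matrix.mulVec_transpose,
      Matrix.mulVec_mulVec, Matrix.transpose_nonsing_inv, hR.eq, Matrix.nonsing_inv_mul R hu,
      Matrix.one_mulVec]
  rw [ellipticalDensity, e1, e2, Real.sqrt_mul (sq_nonneg _), Real.sqrt_sq hσ.le, Matrix.det_smul,
    Matrix.det_mul, Matrix.det_mul, Fintype.card_fin,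
    show R.det * A.det * R.det = R.det ^ 2 * A.det by ring, Real.sqrt_mul (sq_nonneg _),
    Real.sqrt_sq_eq_abs, abs_mul, abs_of_pos (pow_pos hσ k), sphericalConst]
  have hRa : |R.det| ≠ 0 := abs_ne_zero.2 hRd
  have hσk : σ ^ k ≠ 0 := by positivity
  have e3 : 1 / σ * (σ * Real.sqrt (quadForm A⁻¹ w)) = Real.sqrt (quadForm A⁻¹ w) := by
    field_simp
  rw [e3, one_div, mul_inv, mul_inv]
  field_simp

open scoped MatrixOrder in
theorem sqrt_posDef {V : Matrix (Fin k) (Fin k) ℝ} (hV : V.PosDef) :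
    (CFC.sqrt V).IsSymm ∧ (CFC.sqrt V).det ≠ 0 ∧ CFC.sqrt V * CFC.sqrt V = V := by
  have h1 : CFC.sqrt V * CFC.sqrt V = V :=
    CFC.sqrt_mul_sqrt_self V (Matrix.nonneg_iff_posSemidef.2 hV.posSemidef)
  refine ⟨?_, ?_, h1⟩
  · have h2 := (Matrix.nonneg_iff_posSemidef.1 (CFC.sqrt_nonneg V)).1
    simpa [Matrix.IsHermitian, Matrix.IsSymm] using h2
  · intro h0
    have := hV.det_pos
    rw [← h1, Matrix.det_mul, h0] at this
    simp at this

/-- The total mass is that of the elliptical law with shape `A`; writing `A = √A 1 √A` instead of `A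
= 1 A 1` in the change of variables compares it with the spherical law. -/
theorem IsRadialDensity.lintegral_shapeRatio (hk : 2 ≤ k) (hf : IsRadialDensity k f)
    {A : Matrix (Fin k) (Fin k) ℝ} (hA : A.PosDef) :
    ∫⁻ w, ENNReal.ofReal (shapeRatio f A w) ∂(sphericalLaw k f) = 1 := by
  have hp := isProbabilityMeasure_sphericalLaw hk hf
  have key : ∀ (B : Matrix (Fin k) (Fin k) ℝ), B.PosDef → ∫⁻ w, ENNReal.ofReal
      (sphericalConst k f * (Real.sqrt B.det)⁻¹ * f (Real.sqrt (quadForm B⁻¹ w))) =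
      ∫⁻ w, ENNReal.ofReal (shapeRatio f B w) ∂(sphericalLaw k f) := fun B hB => by
    have h := congrArg (fun μ : Measure (Obs k) => μ Set.univ) (hf.withDensity_shapeRatio hk hB)
    simpa [withDensity_apply] using h.symm
  obtain ⟨hs, hd, hm⟩ := sqrt_posDef hA
  have h1 := lintegral_ellipticalLaw hf.measurable (0 : Obs k) one_pos (R := 1) (A := A)
    Matrix.isSymm_one (by simp) (F := fun _ => 1) measurable_const
  have h2 := lintegral_ellipticalLaw hf.measurable (0 : Obs k) one_pos (A := 1) hs hd
    (F := fun _ => 1) measurable_const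
  simp only [mul_one, one_mul, hm] at h1 h2
  rw [key A hA] at h1
  rw [key 1 Matrix.PosDef.one] at h2
  rw [← h1, h2]
  have h3 : ∀ᵐ w ∂(sphericalLaw k f), ENNReal.ofReal (shapeRatio f 1 w) = 1 := by
    rw [hf.sphericalLaw_eq hk]
    refine (withDensity_absolutelyContinuous _ _).ae_le ?_
    filter_upwards [hf.ae_norm_pos hk] with w hw
    rw [shapeRatio, inv_one, quadForm_one, Real.sqrt_sq (norm_nonneg _), max_eq_left hw.le,
      div_self hw.ne']
    simp
  rw [lintegral_congr_ae h3]
  simp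

open scoped MatrixOrder in
/-- Standardizing an elliptical observation by the null location, scale and shape yields the
spherical law, reweighted by the likelihood ratio of the transformed shape. -/
theorem IsRadialDensity.map_ellipticalLaw (hk : 2 ≤ k) (hf : IsRadialDensity k f)
    (θ : Obs k) {σ : ℝ} (hσ : 0 < σ) {V₀ A : Matrix (Fin k) (Fin k) ℝ} (hV : V₀.PosDef)
    (hA : A.PosDef) :
    Measurable (fun x => σ⁻¹ • sphericized θ V₀ x) ∧
    (ellipticalLaw θ σ (CFC.sqrt V₀ * A * CFC.sqrt V₀) f).map
      (fun x => σ⁻¹ • sphericized θ V₀ x) =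
      (sphericalLaw k f).withDensity fun w => ENNReal.ofReal (shapeRatio f A w) := by
  obtain ⟨hs, hd, hm⟩ := sqrt_posDef hV
  have hsm : Measurable (fun x => σ⁻¹ • sphericized θ V₀ x) := by
    have : Measurable (sphericized θ V₀) := by
      have : Continuous (sphericized θ V₀) := by
        unfold sphericized
        refine (PiLp.continuous_toLp 2 _).comp ?_
        refine Continuous.matrix_mulVec continuous_const ?_
        fun_prop
      exact this.measurable
    fun_prop
  refine ⟨hsm, ?_⟩
  have hfm := hf.measurable
  have hqm := (continuous_quadForm A⁻¹).measurable
  refine Measure.ext_of_lintegral _ fun F hF => ?_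
  rw [lintegral_map hF hsm, lintegral_ellipticalLaw hf.measurable θ hσ hs hd (by fun_prop),
    hf.withDensity_shapeRatio hk hA, lintegral_withDensity_eq_lintegral_mul _ (by fun_prop) hF]
  refine lintegral_congr fun w => ?_
  simp only [Pi.mul_apply]
  congr 2
  simp only [sphericized]
  rw [add_sub_cancel_left, Matrix.mulVec_mulVec, Matrix.mul_smul,
    Matrix.nonsing_inv_mul _ hd.isUnit, Matrix.smul_mulVec, Matrix.one_mulVec]
  ext i
  simp [hσ.ne']

end

/-! ### Differentiability in quadratic mean with respect to the shape -/

section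

variable {k : ℕ} {f : ℝ → ℝ}

theorem abs_quadForm_le (A : Matrix (Fin k) (Fin k) ℝ) {u : Obs k} (hu : ‖u‖ = 1) :
    |quadForm A u| ≤ ∑ i, ∑ j, |A i j| := by
  have hui : ∀ i, |u i| ≤ 1 := fun i => by
    rw [← hu]; exact PiLp.norm_apply_le u i
  refine (Finset.abs_sum_le_sum_abs _ _).trans (Finset.sum_le_sum fun i _ =>
    (Finset.abs_sum_le_sum_abs _ _).trans (Finset.sum_le_sum fun j _ => ?_))
  rw [abs_mul, abs_mul]
  exact mul_le_of_le_one_right (abs_nonneg _)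
    (mul_le_one₀ (hui i) (abs_nonneg _) (hui j))

theorem quadForm_add (A B : Matrix (Fin k) (Fin k) ℝ) (u : Obs k) :
    quadForm (A + B) u = quadForm A u + quadForm B u := by
  simp only [quadForm, Matrix.add_apply, add_mul, Finset.sum_add_distrib]

theorem quadForm_smul_left (t : ℝ) (A : Matrix (Fin k) (Fin k) ℝ) (u : Obs k) :
    quadForm (t • A) u = t * quadForm A u := by
  simp only [quadForm, Matrix.smul_apply, smul_eq_mul, Finset.mul_sum, mul_assoc]

theorem eventually_posDef_one_add_smul {B : Matrix (Fin k) (Fin k) ℝ} (hB : B.IsSymm) :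
    ∀ᶠ t in 𝓝 (0 : ℝ), (1 + t • B).PosDef := by
  set c := ∑ i, ∑ j, |B i j| with hc
  have hc0 : 0 ≤ c := by positivity
  have : Tendsto (fun t : ℝ => |t| * c) (𝓝 0) (𝓝 0) := by
    have : Continuous fun t : ℝ => |t| * c := by fun_prop
    simpa using this.tendsto 0
  filter_upwards [this.eventually_lt_const one_pos] with t ht
  refine Matrix.PosDef.of_dotProduct_mulVec_pos ?_ fun x hx => ?_
  · have : (1 + t • B).IsSymm := Matrix.isSymm_one.add (hB.smul t)
    simpa [Matrix.IsHermitian, Matrix.IsSymm] using this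
  · have hn : 0 < ‖WithLp.toLp 2 x‖ := norm_pos_iff.2 (by simpa using hx)
    set w : Obs k := WithLp.toLp 2 x with hw
    have h1 : star x ⬝ᵥ (1 + t • B).mulVec x = quadForm (1 + t • B) w := by
      rw [← dotProduct_mulVec_eq_quadForm]; simp [hw]
    have h2 : w = ‖w‖ • (‖w‖⁻¹ • w) := by rw [smul_smul, mul_inv_cancel₀ hn.ne', one_smul]
    have h3 : ‖‖w‖⁻¹ • w‖ = 1 := by
      rw [norm_smul, norm_inv, norm_norm, inv_mul_cancel₀ hn.ne']
    rw [h1, h2, quadForm_smul, quadForm_add, quadForm_one, quadForm_smul_left, h3]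
    have h4 := abs_quadForm_le B h3
    have h5 : |t * quadForm B (‖w‖⁻¹ • w)| ≤ |t| * c := by
      rw [abs_mul]; gcongr
    have h6 := (abs_le.1 h5).1
    have : 0 < 1 ^ 2 + t * quadForm B (‖w‖⁻¹ • w) := by linarith
    positivity

/-- The Neumann expansion `(1 + t B)⁻¹ = 1 - t B + O(t²)`, entrywise. -/
theorem exists_sum_abs_inv_le {B : Matrix (Fin k) (Fin k) ℝ} (hB : B.IsSymm) :
    ∃ C, 0 ≤ C ∧ ∀ᶠ t in 𝓝 (0 : ℝ),
      ∑ i, ∑ j, |((1 + t • B)⁻¹ - 1 + t • B) i j| ≤ C * t ^ 2 := by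
  set G : ℝ → ℝ := fun t => ∑ i, ∑ j, |(B * B * (1 + t • B)⁻¹) i j| with hG
  have hinv : ContinuousAt (fun t : ℝ => (1 + t • B)⁻¹) 0 := by
    simp only [Matrix.inv_def, Ring.inverse_eq_inv']
    refine ContinuousAt.smul (ContinuousAt.inv₀ (f := fun t : ℝ => (1 + t • B).det) ?_ (by simp)) ?_
    · exact Continuous.continuousAt (by fun_prop)
    · exact Continuous.continuousAt (by fun_prop)
  have hGc : ContinuousAt G 0 := by
    have hc : Continuous fun M : Matrix (Fin k) (Fin k) ℝ => ∑ i, ∑ j, |(B * B * M) i j| := by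
      refine continuous_finsetSum _ fun i _ => continuous_finsetSum _ fun j _ => ?_
      refine continuous_abs.comp ?_
      have : Continuous fun M : Matrix (Fin k) (Fin k) ℝ => B * B * M := by fun_prop
      exact this.matrix_elem i j
    exact hc.continuousAt.comp hinv
  refine ⟨G 0 + 1, by positivity, ?_⟩
  filter_upwards [hGc.eventually_le_const (lt_add_one (G 0)), eventually_posDef_one_add_smul hB]
    with t ht hp
  have hu : IsUnit (1 + t • B).det := hp.det_pos.ne'.isUnit
  have e : (1 + t • B)⁻¹ - 1 + t • B = t ^ 2 • (B * B * (1 + t • B)⁻¹) := by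
    have e1 : ((1 + t • B)⁻¹ - 1 + t • B) * (1 + t • B) = t ^ 2 • (B * B) := by
      rw [add_mul, sub_mul, Matrix.nonsing_inv_mul _ hu, one_mul, mul_add, mul_one,
        Matrix.smul_mul, Matrix.mul_smul, smul_smul, sq]
      abel
    have e2 := congrArg (· * (1 + t • B)⁻¹) e1
    simp only [Matrix.mul_assoc, Matrix.mul_nonsing_inv _ hu, mul_one] at e2
    rw [e2, Matrix.smul_mul, Matrix.mul_assoc]
  rw [e]
  simp only [Matrix.smul_apply, smul_eq_mul, abs_mul, abs_of_nonneg (sq_nonneg t), ← Finset.mul_sum]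
  rw [mul_comm]
  gcongr

/-- Expansion of `log ‖A^{-1/2} u‖` at `A = 1`, uniformly over the unit sphere. -/
theorem exists_abs_log_quadForm_le {B : Matrix (Fin k) (Fin k) ℝ} (hB : B.IsSymm) :
    ∃ C, 0 ≤ C ∧ ∀ᶠ t in 𝓝 (0 : ℝ), ∀ u : Obs k, ‖u‖ = 1 →
      |Real.log (Real.sqrt (quadForm (1 + t • B)⁻¹ u)) + t / 2 * quadForm B u| ≤ C * t ^ 2 := by
  obtain ⟨C, hC, hev⟩ := exists_sum_abs_inv_le hB
  set c := ∑ i, ∑ j, |B i j| with hc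
  have hc0 : 0 ≤ c := by positivity
  refine ⟨C + (C + c) ^ 2, by positivity, ?_⟩
  have hsmall : ∀ᶠ t in 𝓝 (0 : ℝ), |t| < 1 ∧ |t| * (C + c) < 1 / 2 := by
    have h1 : Tendsto (fun t : ℝ => |t|) (𝓝 0) (𝓝 0) := by
      simpa using (continuous_abs (G := ℝ)).tendsto 0
    have h2 := h1.mul_const (C + c)
    rw [zero_mul] at h2
    exact (h1.eventually_lt_const one_pos).and (h2.eventually_lt_const (by norm_num))
  filter_upwards [hev, hsmall, eventually_posDef_one_add_smul hB] with t ht ⟨ht1, ht2⟩ hp u hu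
  have hu0 : u ≠ 0 := by intro h; simp [h] at hu
  have hq := quadForm_pos hp.inv hu0
  set y := quadForm (1 + t • B)⁻¹ u - 1 with hy
  set z := quadForm ((1 + t • B)⁻¹ - 1 + t • B) u with hz
  have hz1 : |z| ≤ C * t ^ 2 := (abs_quadForm_le _ hu).trans ht
  have hb1 : |quadForm B u| ≤ c := abs_quadForm_le _ hu
  have hyz : y = z - t * quadForm B u := by
    have e : (1 + t • B)⁻¹ = ((1 + t • B)⁻¹ - 1 + t • B) + (1 + (-t) • B) := by
      rw [neg_smul]; abel
    have e' := congrArg (fun M => quadForm M u) e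
    rw [quadForm_add _ (1 + _), quadForm_add 1, quadForm_one, quadForm_smul_left, hu] at e'
    rw [hy, hz]
    linarith
  have hyabs : |y| ≤ |t| * (C + c) := by
    rw [hyz]
    refine (abs_sub _ _).trans ?_
    rw [abs_mul]
    have h1 : C * t ^ 2 ≤ C * |t| := by
      rw [← sq_abs]
      gcongr
      nlinarith [abs_nonneg t]
    have h2 : |t| * |quadForm B u| ≤ |t| * c := by gcongr
    linarith
  have hy2 : |y| < 1 / 2 := hyabs.trans_lt ht2
  have hlog : |Real.log (1 + y) - y| ≤ 2 * y ^ 2 := by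
    have hy3 := abs_lt.1 hy2
    have hp1 : 0 < 1 + y := by linarith
    have h1 := Real.log_le_sub_one_of_pos hp1
    have h2 := Real.one_sub_inv_le_log_of_pos hp1
    have h3 : y - 2 * y ^ 2 ≤ 1 - (1 + y)⁻¹ := by
      have : 1 - (1 + y)⁻¹ = y / (1 + y) := by field_simp; ring
      rw [this, le_div_iff₀ hp1]
      nlinarith [sq_nonneg y]
    rw [abs_le]; constructor <;> nlinarith [sq_nonneg y]
  have hfin : Real.log (Real.sqrt (quadForm (1 + t • B)⁻¹ u)) + t / 2 * quadForm B u =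
      1 / 2 * ((Real.log (1 + y) - y) + z) := by
    rw [Real.log_sqrt hq.le, show quadForm (1 + t • B)⁻¹ u = 1 + y by rw [hy]; ring]
    linear_combination (1 / 2 : ℝ) * hyz
  rw [hfin, abs_mul, abs_of_pos (by norm_num : (0 : ℝ) < 1 / 2)]
  have h1 : y ^ 2 ≤ (C + c) ^ 2 * t ^ 2 := by
    have := pow_le_pow_left₀ (abs_nonneg y) hyabs 2
    rw [sq_abs, mul_pow, sq_abs] at this
    linarith
  have h2 := abs_add_le (Real.log (1 + y) - y) z
  nlinarith [sq_nonneg t, mul_nonneg hC (sq_nonneg t)]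

/-- Jacobi's formula for the normalizing factor `|A|^{-1/4}` of the square root of the density. -/
theorem hasDerivAt_sqrt_det (B : Matrix (Fin k) (Fin k) ℝ) :
    HasDerivAt (fun t : ℝ => Real.sqrt (Real.sqrt (1 + t • B).det)⁻¹) (-(B.trace / 4)) 0 := by
  have h0 : HasDerivAt (fun t : ℝ => (1 + t • B).det) B.trace 0 := by
    rw [funext fun t => Matrix.det_one_add_smul t B]
    have h1 := ((hasDerivAt_id (0 : ℝ)).const_mul B.trace).const_add 1
    set P := (1 + (Polynomial.X : Polynomial ℝ) • B.map Polynomial.C).det.divX.divX with hP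
    have h2 := (P.hasDerivAt (0 : ℝ)).fun_mul ((hasDerivAt_id' (0 : ℝ)).fun_pow 2)
    have := h1.fun_add h2
    simpa using this
  have h1 : HasDerivAt (fun t : ℝ => Real.sqrt (1 + t • B).det) (B.trace / 2) 0 := by
    have := h0.sqrt (by simp)
    simpa using this
  have h2 : HasDerivAt (fun t : ℝ => (Real.sqrt (1 + t • B).det)⁻¹) (-(B.trace / 2)) 0 := by
    have := h1.fun_inv (by simp)
    simpa using this
  have := h2.sqrt (by simp)
  convert this using 1
  simp; ring

/-- Half the score of the shape in the direction `B`, at the spherical law; `S` is the radial score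
as a function of the modulus. -/
def halfScore (S : ℝ → ℝ) (B : Matrix (Fin k) (Fin k) ℝ) (w : Obs k) : ℝ :=
  1 / 4 * (S ‖w‖ * quadForm B (‖w‖⁻¹ • w) - B.trace)

theorem abs_quadForm_normalize_le (B : Matrix (Fin k) (Fin k) ℝ) (w : Obs k) :
    |quadForm B (‖w‖⁻¹ • w)| ≤ ∑ i, ∑ j, |B i j| := by
  by_cases hw : w = 0
  · subst hw
    rw [smul_zero, show quadForm B (0 : Obs k) = 0 by simp [quadForm], abs_zero]
    positivity
  · refine abs_quadForm_le B ?_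
    rw [norm_smul, norm_inv, norm_norm, inv_mul_cancel₀ (norm_ne_zero_iff.2 hw)]

theorem memLp_mul_quadForm (hk : 2 ≤ k) (hf : IsRadialDensity k f) {S : ℝ → ℝ} (hS : Measurable S)
    (hS2 : MemLp S 2 (modulusLaw k f)) (B : Matrix (Fin k) (Fin k) ℝ) :
    MemLp (fun w : Obs k => S ‖w‖ * quadForm B (‖w‖⁻¹ • w)) 2 (sphericalLaw k f) := by
  have hmp : MeasurePreserving (fun w : Obs k => ‖w‖) (sphericalLaw k f) (modulusLaw k f) :=
    ⟨measurable_norm, map_norm_sphericalLaw hk hf⟩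
  have hqm := (continuous_quadForm B).measurable
  refine (hS2.comp_measurePreserving hmp).of_le_mul (c := ∑ i, ∑ j, |B i j|)
    (Measurable.aestronglyMeasurable (by fun_prop)) (Eventually.of_forall fun w => ?_)
  rw [norm_mul, mul_comm]
  gcongr
  · exact abs_quadForm_normalize_le B w
  · rfl

theorem sqrt_max_zero (x : ℝ) : Real.sqrt (max x 0) = Real.sqrt x := by
  rcases le_total x 0 with h | h
  · rw [max_eq_right h, Real.sqrt_zero, Real.sqrt_eq_zero_of_nonpos h]
  · rw [max_eq_left h]

theorem norm_exp_smul (x : ℝ) {u : Obs k} (hu : ‖u‖ = 1) : ‖Real.exp x • u‖ = Real.exp x := by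
  rw [norm_smul, hu, mul_one, Real.norm_of_nonneg (Real.exp_pos x).le]

/-- Along a ray, in logarithmic coordinates, the square root of the likelihood ratio is a translate
of `f^{1/2}(e^x)`, normalized. -/
theorem sqrt_shapeRatio_exp_smul (f : ℝ → ℝ) {A : Matrix (Fin k) (Fin k) ℝ} (hA : A.PosDef) {u : Obs k}
    (hu : ‖u‖ = 1) (x : ℝ) : Real.sqrt (shapeRatio f A (Real.exp x • u)) =
      Real.sqrt (Real.sqrt A.det)⁻¹ *
        (sqrtExp f (x + Real.log (Real.sqrt (quadForm A⁻¹ u))) / sqrtExp f x) := by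
  have hu0 : u ≠ 0 := by intro h; simp [h] at hu
  have hq := Real.sqrt_pos.2 (quadForm_pos hA.inv hu0)
  rw [shapeRatio, Real.sqrt_mul (by positivity), Real.sqrt_div (le_max_right _ _), sqrt_max_zero,
    sqrt_max_zero, norm_exp_smul x hu, quadForm_smul, Real.sqrt_mul (sq_nonneg _),
    Real.sqrt_sq (Real.exp_pos x).le, sqrtExp, sqrtExp, Real.exp_add, Real.exp_log hq]

/-- The core estimate: uniformly in the direction, the normalized increment of the square root of
the likelihood ratio along a ray is close to the half-score in the weighted space. -/
theorem eventually_expNormSq_sub_le {q T : ℝ → ℝ} {c : ℝ} (hTd : IsWeakDeriv Set.univ q T)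
    (hqm : Measurable q) (hTm : Measurable T) (hq : expNormSq c q < ⊤) (hT : expNormSq c T < ⊤)
    {B : Matrix (Fin k) (Fin k) ℝ} (hB : B.IsSymm) {η : ℝ} (hη : 0 < η) :
    ∀ᶠ t in 𝓝[>] (0 : ℝ), ∀ u : Obs k, ‖u‖ = 1 →
      expNormSq c (fun x => t⁻¹ * (Real.sqrt (Real.sqrt (1 + t • B).det)⁻¹ *
        q (x + Real.log (Real.sqrt (quadForm (1 + t • B)⁻¹ u))) - q x) +
        (1 / 2 * quadForm B u * T x + B.trace / 4 * q x)) ≤ ENNReal.ofReal η := by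
  obtain ⟨C, hC, hlog⟩ := exists_abs_log_quadForm_le hB
  set b := ∑ i, ∑ j, |B i j| with hb
  have hb0 : 0 ≤ b := by positivity
  set d : ℝ → ℝ := fun t => Real.sqrt (Real.sqrt (1 + t • B).det)⁻¹ with hd
  have hd' := hasDerivAt_sqrt_det B
  have hd0 : d 0 = 1 := by simp [hd]
  have hdlim : Tendsto d (𝓝[>] 0) (𝓝 1) := by
    have := hd'.continuousAt.tendsto.mono_left (nhdsWithin_le_nhds (s := Set.Ioi (0 : ℝ)))
    change Tendsto d (𝓝[>] 0) (𝓝 (d 0)) at this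
    rwa [hd0] at this
  -- `β` and `γ` bound the coefficients of `q` and `T` that remain after the expansion of `q (x +
  -- h)`, where `h = O(t)` is the logarithm of `‖A^{-1/2} u‖`; `N` collects their contribution.
  set β : ℝ → ℝ := fun t => t⁻¹ * (d t - 1) + B.trace / 4 with hβ
  have hβlim : Tendsto β (𝓝[>] 0) (𝓝 0) := by
    have h1 := (hasDerivAt_iff_tendsto_slope_zero.1 hd').mono_left
      (nhdsWithin_mono (0 : ℝ) (fun x (hx : 0 < x) => hx.ne') : 𝓝[>] (0 : ℝ) ≤ _)
    have h2 := h1.add_const (B.trace / 4)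
    simpa [hβ, hd] using h2
  set γ : ℝ → ℝ := fun t => 2 * (C * t) + b / 2 * |1 - d t| with hγ
  have hγlim : Tendsto γ (𝓝[>] 0) (𝓝 0) := by
    have h1 : Tendsto (fun t : ℝ => t) (𝓝[>] 0) (𝓝 0) := tendsto_id.mono_left nhdsWithin_le_nhds
    have := ((h1.const_mul C).const_mul 2).add (((hdlim.const_sub 1).abs).const_mul (b / 2))
    simpa [hγ] using this
  set N := fun t => 2 * (2 * (ENNReal.ofReal (β t ^ 2) * expNormSq c q) +
    2 * (ENNReal.ofReal (γ t ^ 2) * expNormSq c T)) with hN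
  have hNlim : Tendsto N (𝓝[>] 0) (𝓝 0) := by
    have t1 := ENNReal.Tendsto.mul_const (ENNReal.tendsto_ofReal (hβlim.pow 2))
      (Or.inr hq.ne)
    have t2 := ENNReal.Tendsto.mul_const (ENNReal.tendsto_ofReal (hγlim.pow 2))
      (Or.inr hT.ne)
    have := ENNReal.Tendsto.const_mul (a := 2) ((ENNReal.Tendsto.const_mul (a := 2) t1
      (by simp)).add (ENNReal.Tendsto.const_mul (a := 2) t2 (by simp))) (by simp)
    simpa [hN] using this
  set C₁ := C + b / 2 with hC₁
  set ε := η / (16 * (C₁ ^ 2 + 1)) with hε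
  have hε0 : 0 < ε := by positivity
  obtain ⟨δ, hδ, hball⟩ := Metric.eventually_nhds_iff.1
    (hTd.eventually_expNormSq_le hqm hTm hq hT hε0)
  have hpos : ∀ᶠ t in 𝓝[>] (0 : ℝ), 0 < t := self_mem_nhdsWithin
  have hsmall : ∀ᶠ t in 𝓝[>] (0 : ℝ), t < 1 ∧ C₁ * t < δ := by
    have h1 : Tendsto (fun t : ℝ => t) (𝓝[>] 0) (𝓝 0) := tendsto_id.mono_left nhdsWithin_le_nhds
    have h2 := h1.const_mul C₁
    rw [mul_zero] at h2
    exact (h1.eventually_lt_const one_pos).and (h2.eventually_lt_const hδ)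
  filter_upwards [nhdsWithin_le_nhds hlog, hpos, hsmall,
    hNlim.eventually_le_const (show (0 : ℝ≥0∞) < ENNReal.ofReal (η / 2) by simpa using hη),
    hdlim.eventually_lt_const (show (1 : ℝ) < 2 by norm_num)] with t hlt ht ⟨ht1, htδ⟩ hNt hd2 u hu
  set h := Real.log (Real.sqrt (quadForm (1 + t • B)⁻¹ u)) with hh
  have hdt0 : 0 ≤ d t := Real.sqrt_nonneg _
  have hBu : |quadForm B u| ≤ b := abs_quadForm_le B hu
  have hl := hlt u hu
  rw [← hh] at hl
  have hhb : |h| ≤ C₁ * t := by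
    have e : h = (h + t / 2 * quadForm B u) - t / 2 * quadForm B u := by ring
    rw [e]
    refine (abs_sub _ _).trans ?_
    rw [abs_mul, abs_of_pos (half_pos ht)]
    have h1 : C * t ^ 2 ≤ C * t := by
      gcongr; nlinarith
    have h2 : t / 2 * |quadForm B u| ≤ t / 2 * b := by gcongr
    rw [hC₁]; linarith
  have hD : expNormSq c (fun x => q (x + h) - q x - h * T x) ≤ ENNReal.ofReal (ε * h ^ 2) :=
    hball (by rw [Real.dist_0_eq_abs]; linarith)
  set g := t⁻¹ * d t * h + 1 / 2 * quadForm B u with hg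
  have hgb : |g| ≤ γ t := by
    have e : g = d t * (t⁻¹ * (h + t / 2 * quadForm B u)) + 1 / 2 * quadForm B u * (1 - d t) := by
      rw [hg]; field_simp; ring
    rw [e, hγ]
    refine (abs_add_le _ _).trans (add_le_add ?_ ?_)
    · rw [abs_mul, abs_of_nonneg hdt0]
      refine mul_le_mul hd2.le ?_ (abs_nonneg _) (by norm_num)
      rw [abs_mul, abs_of_pos (inv_pos.2 ht), inv_mul_le_iff₀ ht]
      calc _ ≤ _ := hl
        _ = _ := by ring
    · rw [abs_mul, abs_mul, abs_of_pos (by norm_num : (0 : ℝ) < 1 / 2)]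
      have : 1 / 2 * |quadForm B u| ≤ b / 2 := by linarith
      gcongr
  have hF : (fun x => t⁻¹ * (d t * q (x + h) - q x) +
      (1 / 2 * quadForm B u * T x + B.trace / 4 * q x)) =
      fun x => t⁻¹ * d t * (q (x + h) - q x - h * T x) + (β t * q x + g * T x) := by
    ext x; rw [hg, hβ]; ring
  have htd : (t⁻¹ * d t) ^ 2 * (ε * h ^ 2) ≤ η / 4 := by
    have h1 : h ^ 2 ≤ C₁ ^ 2 * t ^ 2 := by
      rw [← sq_abs, ← mul_pow]; gcongr
    have h2 : d t ^ 2 ≤ 4 := by nlinarith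
    calc (t⁻¹ * d t) ^ 2 * (ε * h ^ 2) ≤ (t⁻¹ * d t) ^ 2 * (ε * (C₁ ^ 2 * t ^ 2)) := by gcongr
      _ = d t ^ 2 * (ε * C₁ ^ 2) := by field_simp
      _ ≤ 4 * (ε * C₁ ^ 2) := by gcongr
      _ ≤ 4 * (ε * (C₁ ^ 2 + 1)) := by gcongr; linarith
      _ = η / 4 := by rw [hε]; field_simp; norm_num
  change expNormSq c (fun x => t⁻¹ * (d t * q (x + h) - q x) +
      (1 / 2 * quadForm B u * T x + B.trace / 4 * q x)) ≤ _
  rw [hF]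
  calc _ ≤ 2 * expNormSq c (fun x => t⁻¹ * d t * (q (x + h) - q x - h * T x)) +
        2 * expNormSq c (fun x => β t * q x + g * T x) := expNormSq_add_le c (by fun_prop)
    _ ≤ 2 * ENNReal.ofReal (η / 4) + N t := by
        gcongr
        · rw [expNormSq_const_mul]
          refine (mul_le_mul_right hD _).trans ?_
          rw [← ENNReal.ofReal_mul (sq_nonneg _)]
          exact ENNReal.ofReal_le_ofReal htd
        · rw [hN]
          simp only
          gcongr
          refine (expNormSq_add_le c (by fun_prop)).trans ?_
          rw [expNormSq_const_mul, expNormSq_const_mul]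
          gcongr 2 * _ + 2 * (?_ * _)
          refine ENNReal.ofReal_le_ofReal ?_
          rw [← sq_abs g]
          gcongr
    _ ≤ ENNReal.ofReal (η / 2) + ENNReal.ofReal (η / 2) := by
        gcongr
        rw [← ENNReal.ofReal_ofNat 2, ← ENNReal.ofReal_mul (by norm_num)]
        exact ENNReal.ofReal_le_ofReal (by linarith)
    _ = ENNReal.ofReal η := by
        rw [← ENNReal.ofReal_add (by positivity) (by positivity), add_halves]

theorem tendsto_inv_sqrt_nhdsGT : Tendsto (fun n : ℕ => (Real.sqrt n)⁻¹) atTop (𝓝[>] 0) := by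
  refine tendsto_nhdsWithin_iff.2 ⟨tendsto_inv_sqrt_nat, ?_⟩
  filter_upwards [eventually_gt_atTop 0] with n hn
  have : (0 : ℝ) < n := by exact_mod_cast hn
  exact inv_pos.2 (Real.sqrt_pos.2 this)

/-- The elliptical model is differentiable in quadratic mean with respect to its shape, at the
spherical law. -/
theorem IsRadialDensity.exists_isDQM (hk : 2 ≤ k) (hf : IsRadialDensity k f)
    (h2 : AssumptionA2 k f) : ∃ S : ℝ → ℝ, Measurable S ∧ MemLp S 2 (modulusLaw k f) ∧
      (∀ᵐ r ∂(modulusLaw k f), radialScore k f (modulusCdf k f r) = S r) ∧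
      ∀ B : Matrix (Fin k) (Fin k) ℝ, B.IsSymm → IsDQM (sphericalLaw k f)
        (fun n => shapeRatio f (1 + (Real.sqrt n)⁻¹ • B)) (halfScore S B) := by
  have hk1 : 1 ≤ k := by omega
  obtain ⟨T, hTm, hTd, hTe, hqf, hTf⟩ := h2.exists_weakDeriv hf
  have hqm := hf.measurable_sqrtExp
  have hpos := hf.radialMass_inv_pos
  have := isProbabilityMeasure_sphericalLaw hk hf
  have := isProbabilityMeasure_dirLaw hk
  set S : ℝ → ℝ := fun r => -2 * T (Real.log r) / sqrtExp f (Real.log r) with hSdef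
  have hSm : Measurable S := by fun_prop
  have hSe := hf.ae_radialScore_eq hk1 hTe
  have hS2 : MemLp S 2 (modulusLaw k f) := (hf.memLp_radialScore hk1 h2).ae_eq hSe
  refine ⟨S, hSm, hS2, hSe, fun B hB => ⟨fun n => hf.measurable_shapeRatio _,
    fun n w => shapeRatio_nonneg f _ w, ?_, ?_, ?_⟩⟩
  · filter_upwards [tendsto_inv_sqrt_nat.eventually (eventually_posDef_one_add_smul hB)] with n hn
    exact hf.lintegral_shapeRatio hk hn
  · have : MemLp (fun w => (1 / 4 : ℝ) * (S ‖w‖ * quadForm B (‖w‖⁻¹ • w) - B.trace)) 2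
        (sphericalLaw k f) :=
      ((memLp_mul_quadForm hk hf hSm hS2 B).sub (memLp_const B.trace)).const_mul (1 / 4)
    exact this
  · have hqB := (continuous_quadForm B).measurable
    have hgm : Measurable (halfScore S B) := by unfold halfScore; fun_prop
    set M := ENNReal.ofReal (radialMass k f)⁻¹ with hM
    have hM0 : M ≠ 0 := by simpa [hM] using hpos
    have hMt : M ≠ ⊤ := ENNReal.ofReal_ne_top
    -- reduction to an estimate along rays
    suffices key : ∀ η : ℝ, 0 < η → ∀ᶠ n : ℕ in atTop, ∫⁻ w, ENNReal.ofReal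
        ((Real.sqrt n * (Real.sqrt (shapeRatio f (1 + (Real.sqrt n)⁻¹ • B) w) - 1) -
          halfScore S B w) ^ 2) ∂(sphericalLaw k f) ≤ M * ENNReal.ofReal η by
      rw [ENNReal.tendsto_nhds_zero]
      intro ε hε
      obtain ⟨η, hη, hηε⟩ : ∃ η : ℝ, 0 < η ∧ M * ENNReal.ofReal η ≤ ε := by
        have h1 : Tendsto (fun η : ℝ => M * ENNReal.ofReal η) (𝓝[>] 0) (𝓝 0) := by
          have h0 : Tendsto (fun η : ℝ => ENNReal.ofReal η) (𝓝[>] 0) (𝓝 (ENNReal.ofReal 0)) :=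
            ENNReal.tendsto_ofReal (tendsto_id.mono_left nhdsWithin_le_nhds)
          simpa using ENNReal.Tendsto.const_mul (a := M) h0 (Or.inr hMt)
        obtain ⟨η, h2, h3⟩ := ((h1.eventually_le_const hε).and self_mem_nhdsWithin).exists
        exact ⟨η, h3, h2⟩
      exact (key η hη).mono fun n hn => hn.trans hηε
    intro η hη
    filter_upwards [tendsto_inv_sqrt_nhdsGT.eventually
      (eventually_expNormSq_sub_le hTd hqm hTm hqf hTf hB hη),
      tendsto_inv_sqrt_nat.eventually (eventually_posDef_one_add_smul hB)] with n hn hA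
    set A := 1 + (Real.sqrt n)⁻¹ • B with hAdef
    have hrm := hf.measurable_shapeRatio A
    rw [lintegral_sphericalLaw hk hf _ (by fun_prop)]
    calc _ ≤ ∫⁻ _ : Obs k, M * ENNReal.ofReal η ∂(dirLaw k) := by
          refine lintegral_mono_ae ?_
          filter_upwards [ae_norm_eq_one_dirLaw k] with u hu
          rw [hf.lintegral_modulusLaw_eq hk1 _ (by fun_prop)]
          gcongr
          refine le_trans (le_of_eq ?_) (hn u hu)
          refine lintegral_congr_ae ?_
          filter_upwards [hf.ae_sqrtExp_pos] with x hx
          rw [mul_right_comm, ← ENNReal.ofReal_mul (sq_nonneg _), ← mul_pow]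
          congr 3
          rw [sqrt_shapeRatio_exp_smul f hA hu, halfScore, norm_exp_smul x hu, smul_smul,
            inv_mul_cancel₀ (Real.exp_pos x).ne', one_smul, hSdef]
          simp only [Real.log_exp, inv_inv]
          field_simp
          ring
      _ = M * ENNReal.ofReal η := by simp

end

/-! ### Approximation of rank scores by population scores -/

/-- The uniform law on `(0, 1)`. -/
abbrev unitLaw : Measure ℝ := volume.restrict (Set.Ioo (0 : ℝ) 1)

instance : IsProbabilityMeasure unitLaw := ⟨by simp [unitLaw]⟩

/-- The rank of the `i`-th entry of a vector. -/
def vecRank {n : ℕ} (v : Fin n → ℝ) (i : Fin n) : ℕ :=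
  (Finset.univ.filter fun j => v j ≤ v i).card

theorem vecRank_eq_sum {n : ℕ} (v : Fin n → ℝ) (i : Fin n) :
    (vecRank v i : ℝ) = ∑ j, if v j ≤ v i then (1 : ℝ) else 0 := by
  simp [vecRank]

theorem measurable_vecRank {n : ℕ} (i : Fin n) :
    Measurable fun v : Fin n → ℝ => (vecRank v i : ℝ) := by
  simp_rw [vecRank_eq_sum]
  exact Finset.measurable_sum _ fun j _ => Measurable.ite
    (measurableSet_le (measurable_pi_apply j) (measurable_pi_apply i)) measurable_const
    measurable_const

theorem vecRank_pos {n : ℕ} (v : Fin n → ℝ) (i : Fin n) : 0 < vecRank v i :=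
  Finset.card_pos.2 ⟨i, by simp⟩

theorem vecRank_le {n : ℕ} (v : Fin n → ℝ) (i : Fin n) : vecRank v i ≤ n :=
  (Finset.card_filter_le _ _).trans (by simp)

theorem vecRank_div_mem {n : ℕ} (v : Fin n → ℝ) (i : Fin n) :
    (vecRank v i : ℝ) / (n + 1) ∈ Set.Ioo (0 : ℝ) 1 := by
  have h1 : (0 : ℝ) < vecRank v i := by exact_mod_cast vecRank_pos v i
  have h2 : (vecRank v i : ℝ) ≤ n := by exact_mod_cast vecRank_le v i
  refine ⟨by positivity, ?_⟩
  rw [div_lt_one (by positivity)]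
  linarith

/-- Without ties the ranks are a permutation of `1, …, n`. -/
theorem sum_vecRank {n : ℕ} {v : Fin n → ℝ} (hv : Function.Injective v) {M : Type*}
    [AddCommMonoid M] (φ : ℕ → M) : ∑ i, φ (vecRank v i) = ∑ j ∈ Finset.range n, φ (j + 1) := by
  have hlt : ∀ i j, v i < v j → vecRank v i < vecRank v j := fun i j hij => by
    refine Finset.card_lt_card ((Finset.ssubset_iff_of_subset ?_).2 ⟨j, by simp, by simpa using hij⟩)
    intro l hl
    simp only [Finset.mem_filter, Finset.mem_univ, true_and] at hl ⊢
    exact hl.trans hij.le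
  have hinj : Function.Injective fun i => vecRank v i - 1 := fun i j hij => by
    have h1 := vecRank_pos v i
    have h2 := vecRank_pos v j
    have h3 : vecRank v i = vecRank v j := by simp only at hij; omega
    rcases lt_trichotomy (v i) (v j) with h | h | h
    · exact absurd h3 (hlt i j h).ne
    · exact hv h
    · exact absurd h3 (hlt j i h).ne'
  have himg : Finset.univ.image (fun i => vecRank v i - 1) = Finset.range n := by
    refine Finset.eq_of_subset_of_card_le ?_ ?_
    · intro m hm
      obtain ⟨i, -, rfl⟩ := Finset.mem_image.1 hm
      have h1 := vecRank_pos v i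
      have h2 := vecRank_le v i
      rw [Finset.mem_range]; omega
    · rw [Finset.card_image_of_injective _ hinj]; simp
  rw [← himg, Finset.sum_image hinj.injOn]
  refine Finset.sum_congr rfl fun i _ => ?_
  rw [Nat.sub_add_cancel (vecRank_pos v i)]

theorem map_eval_pair_pi {n : ℕ} {X : Type*} [MeasurableSpace X] (μ : Measure X)
    [IsProbabilityMeasure μ] {i j : Fin n} (hij : i ≠ j) :
    (Measure.pi fun _ : Fin n => μ).map (fun v => (v i, v j)) = μ.prod μ := by
  have h := (iIndepFun_pi (μ := fun _ : Fin n => μ) (X := fun _ x => x)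
    fun _ => aemeasurable_id).indepFun hij
  rw [indepFun_iff_map_prod_eq_prod_map_map (measurable_pi_apply i).aemeasurable
    (measurable_pi_apply j).aemeasurable] at h
  rw [h]
  have : ∀ l, (Measure.pi fun _ : Fin n => μ).map (fun v => v l) = μ := fun l =>
    (measurePreserving_eval (fun _ : Fin n => μ) l).map_eq
  rw [this, this]

/-- An i.i.d. sample from a law without atoms has no ties. -/
theorem ae_injective_pi {n : ℕ} (μ : Measure ℝ) [IsProbabilityMeasure μ] [NullSingletonClass μ] :
    ∀ᵐ v ∂(Measure.pi fun _ : Fin n => μ), Function.Injective v := by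
  have h : ∀ i j : Fin n, i ≠ j → ∀ᵐ v ∂(Measure.pi fun _ : Fin n => μ), v i ≠ v j := by
    intro i j hij
    have h1 : ∀ᵐ p ∂(μ.prod μ), p.1 ≠ p.2 := by
      rw [Measure.ae_prod_iff_ae_ae (p := fun p : ℝ × ℝ => p.1 ≠ p.2)
        (measurableSet_eq_fun measurable_fst measurable_snd).compl]
      refine Eventually.of_forall fun x => ?_
      simp only [ne_eq]
      rw [ae_iff]
      simp
    rw [← map_eval_pair_pi μ hij] at h1
    exact ae_of_ae_map (f := fun v : Fin n → ℝ => (v i, v j)) (p := fun p : ℝ × ℝ => p.1 ≠ p.2)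
      (by fun_prop) h1
  have h2 : ∀ᵐ v ∂(Measure.pi fun _ : Fin n => μ), ∀ i j, i ≠ j → v i ≠ v j := by
    rw [ae_all_iff]; intro i
    rw [ae_all_iff]; intro j
    by_cases hij : i = j
    · simp [hij]
    · exact (h i j hij).mono fun v hv _ => hv
  exact h2.mono fun v hv i j hij => by_contra fun hne => hv i j hne hij

theorem integral_unitLaw_eq (F : ℝ → ℝ) : ∫ x, F x ∂unitLaw = ∫ x in (0 : ℝ)..1, F x := by
  rw [intervalIntegral.integral_of_le zero_le_one, integral_Ioc_eq_integral_Ioo]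

theorem sum_range_add_one_sq (n : ℕ) :
    ∑ j ∈ Finset.range n, ((j : ℝ) + 1) ^ 2 = (n : ℝ) * (n + 1) * (2 * n + 1) / 6 := by
  induction n with
  | zero => simp
  | succ n ih => rw [Finset.sum_range_succ, ih]; push_cast; ring

theorem ae_unitLaw_mem {n : ℕ} : ∀ᵐ v ∂(Measure.pi fun _ : Fin n => unitLaw),
    ∀ i, v i ∈ Set.Ioo (0 : ℝ) 1 := by
  rw [ae_all_iff]
  intro i
  exact (measurePreserving_eval (fun _ : Fin n => unitLaw) i).quasiMeasurePreserving.ae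
    (ae_restrict_mem measurableSet_Ioo)

theorem integral_eval_pi {n : ℕ} {X : Type*} [MeasurableSpace X] (μ : Measure X)
    [IsProbabilityMeasure μ] (i : Fin n) {F : X → ℝ} (hF : AEStronglyMeasurable F μ) :
    ∫ v, F (v i) ∂(Measure.pi fun _ : Fin n => μ) = ∫ x, F x ∂μ := by
  have h := measurePreserving_eval (fun _ : Fin n => μ) i
  conv_rhs => rw [← h.map_eq]
  rw [integral_map h.measurable.aemeasurable (by rwa [h.map_eq])]

/-- The exact mean quadratic distance between normalized ranks and uniform variables. -/
theorem integral_sum_vecRank_sub_sq (n : ℕ) :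
    ∫ v, ∑ i, ((vecRank v i : ℝ) / (n + 1) - v i) ^ 2 ∂(Measure.pi fun _ : Fin n => unitLaw) =
      (n : ℝ) / (6 * (n + 1)) := by
  set P := Measure.pi fun _ : Fin n => unitLaw with hP
  -- Expanding the square: the sum of the squared normalized ranks is deterministic, and the cross
  -- terms are `v_i 1(v_j ≤ v_i)`, with means `1/2` for `i = j` and `1/3` otherwise.
  set ι : Fin n → Fin n → (Fin n → ℝ) → ℝ := fun i j v => if v j ≤ v i then v i else 0 with hι
  have hιm : ∀ i j, Measurable (ι i j) := fun i j => Measurable.ite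
    (measurableSet_le (measurable_pi_apply j) (measurable_pi_apply i)) (measurable_pi_apply i)
    measurable_const
  have hιi : ∀ i j, Integrable (ι i j) P := fun i j => by
    refine Integrable.of_bound (hιm i j).aestronglyMeasurable 1 ?_
    filter_upwards [ae_unitLaw_mem] with v hv
    simp only [hι]
    split_ifs
    · rw [Real.norm_of_nonneg (hv i).1.le]; exact (hv i).2.le
    · simp
  have hsi : ∀ i, Integrable (fun v : Fin n → ℝ => v i ^ 2) P := fun i => by
    refine Integrable.of_bound (Measurable.aestronglyMeasurable (by fun_prop)) 1 ?_
    filter_upwards [ae_unitLaw_mem] with v hv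
    rw [Real.norm_of_nonneg (sq_nonneg _)]
    nlinarith [(hv i).1, (hv i).2]
  have hιe : ∀ i j, ∫ v, ι i j v ∂P = if i = j then 1 / 2 else 1 / 3 := by
    intro i j
    split_ifs with hij
    · subst hij
      have : ∀ v, ι i i v = v i := fun v => by simp [hι]
      simp only [this]
      rw [integral_eval_pi unitLaw i (F := fun x => x) (by fun_prop), integral_unitLaw_eq]
      simp
    · set G : ℝ × ℝ → ℝ := fun p => if p.2 ≤ p.1 then p.1 else 0 with hG
      have hGm : Measurable G := Measurable.ite (measurableSet_le measurable_snd measurable_fst)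
        measurable_fst measurable_const
      have h1 : ∫ v, ι i j v ∂P = ∫ p, G p ∂(unitLaw.prod unitLaw) := by
        rw [← map_eval_pair_pi unitLaw hij, integral_map (by fun_prop) hGm.aestronglyMeasurable]
      have hGi : Integrable G (unitLaw.prod unitLaw) := by
        have := (hιi i j)
        rw [← map_eval_pair_pi unitLaw hij, integrable_map_measure hGm.aestronglyMeasurable
          (by fun_prop)]
        exact this
      rw [h1, integral_prod _ hGi]
      have h2 : ∀ x ∈ Set.Ioo (0 : ℝ) 1, ∫ y, G (x, y) ∂unitLaw = x ^ 2 := by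
        intro x hx
        have : (fun y => G (x, y)) = (Set.Iic x).indicator fun _ => x := by
          ext y; simp [hG, Set.indicator_apply]
        rw [this, integral_indicator measurableSet_Iic, integral_const,
          Measure.restrict_restrict measurableSet_Iic]
        have : Set.Iic x ∩ Set.Ioo 0 1 = Set.Ioc 0 x := by
          ext y; simp only [Set.mem_inter_iff, Set.mem_Iic, Set.mem_Ioo, Set.mem_Ioc]
          constructor
          · rintro ⟨h1, h2, h3⟩; exact ⟨h2, h1⟩
          · rintro ⟨h1, h2⟩; exact ⟨h2, h1, h2.trans_lt hx.2⟩
        simp [this, measureReal_def, hx.1.le, sq]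
      rw [setIntegral_congr_fun measurableSet_Ioo h2, integral_unitLaw_eq, integral_pow]
      norm_num
  have hse : ∀ i, ∫ v, v i ^ 2 ∂P = 1 / 3 := fun i => by
    rw [integral_eval_pi unitLaw i (F := fun x => x ^ 2) (by fun_prop), integral_unitLaw_eq,
      integral_pow]
    norm_num
  have hexp : ∀ᵐ v ∂P, ∑ i, ((vecRank v i : ℝ) / (n + 1) - v i) ^ 2 =
      n * (2 * n + 1) / (6 * (n + 1)) - 2 / (n + 1) * ∑ i, ∑ j, ι i j v + ∑ i, v i ^ 2 := by
    filter_upwards [ae_injective_pi unitLaw] with v hv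
    have h1 := sum_vecRank hv (fun m => (m : ℝ) ^ 2)
    push_cast at h1
    rw [sum_range_add_one_sq] at h1
    have h2 : ∀ i, ∑ j, ι i j v = (vecRank v i : ℝ) * v i := fun i => by
      rw [vecRank_eq_sum, Finset.sum_mul]
      refine Finset.sum_congr rfl fun j _ => ?_
      simp only [hι]; split_ifs <;> simp
    simp only [h2]
    have h3 : ∀ i, ((vecRank v i : ℝ) / (n + 1) - v i) ^ 2 = 1 / (n + 1) ^ 2 * (vecRank v i : ℝ) ^ 2
        - 2 / (n + 1) * ((vecRank v i : ℝ) * v i) + v i ^ 2 := fun i => by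
      field_simp; ring
    simp only [h3]
    rw [Finset.sum_add_distrib, Finset.sum_sub_distrib, ← Finset.mul_sum, ← Finset.mul_sum, h1]
    congr 2
    field_simp
  rw [integral_congr_ae hexp]
  have i1 : Integrable (fun v => 2 / ((n : ℝ) + 1) * ∑ i, ∑ j, ι i j v) P :=
    (integrable_finsetSum _ fun i _ => integrable_finsetSum _ fun j _ => hιi i j).const_mul _
  have i2 : Integrable (fun v : Fin n → ℝ => ∑ i, v i ^ 2) P :=
    integrable_finsetSum _ fun i _ => hsi i
  have i3 : Integrable (fun v => (n : ℝ) * (2 * n + 1) / (6 * (n + 1)) -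
      2 / ((n : ℝ) + 1) * ∑ i, ∑ j, ι i j v) P := (integrable_const _).sub i1
  rw [integral_add i3 i2, integral_sub (integrable_const _) i1, integral_const, integral_const_mul,
    integral_finsetSum _ fun i _ => integrable_finsetSum _ fun j _ => hιi i j,
    integral_finsetSum _ fun i _ => hsi i]
  simp only [hse]
  have h4 : ∑ i : Fin n, ∫ v, ∑ j, ι i j v ∂P = n * ((n - 1) / 3 + 1 / 2) := by
    have : ∀ i : Fin n, ∫ v, ∑ j, ι i j v ∂P = (n - 1) / 3 + 1 / 2 := fun i => by
      rw [integral_finsetSum _ fun j _ => hιi i j]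
      simp only [hιe]
      have : ∀ j : Fin n, (if i = j then (1 / 2 : ℝ) else 1 / 3) =
          1 / 3 + if i = j then 1 / 6 else 0 := fun j => by split_ifs <;> norm_num
      simp only [this]
      rw [Finset.sum_add_distrib]
      simp
      ring
    simp [this]
    ring
  rw [h4]
  simp
  field_simp
  ring

/-- A Riemann sum of a function which decreases on `(0, 1/2]` and increases on `[1/2, 1)` is at most
twice the integral, up to the mesh. -/
theorem sum_le_lintegral_of_unimodal {φ : ℝ → ℝ≥0∞} (h1 : AntitoneOn φ (Set.Ioc 0 (1 / 2)))
    (h2 : MonotoneOn φ (Set.Ico (1 / 2) 1)) (n : ℕ) :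
    ∑ j ∈ Finset.range n, φ (((j : ℝ) + 1) / (n + 1)) ≤ 2 * (n + 1) * ∫⁻ x, φ x ∂unitLaw := by
  set x : ℕ → ℝ := fun j => (j : ℝ) / (n + 1) with hx
  have hn : (0 : ℝ) < n + 1 := by positivity
  have hmono : StrictMono x := fun i j hij => by
    have : (i : ℝ) < j := by exact_mod_cast hij
    simp only [hx]; gcongr
  set F : ℕ → ℝ≥0∞ := fun j => ∫⁻ y in Set.Ioo (x j) (x (j + 1)), φ y with hF
  have hsum : ∑ j ∈ Finset.range (n + 1), F j ≤ ∫⁻ y, φ y ∂unitLaw := by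
    rw [← lintegral_biUnion_finset]
    · refine lintegral_mono_set ?_
      refine Set.iUnion₂_subset fun j hj => Set.Ioo_subset_Ioo (by positivity) ?_
      have h3 : ((j + 1 : ℕ) : ℝ) ≤ n + 1 := by exact_mod_cast Finset.mem_range.1 hj
      simp only [hx]
      rw [div_le_one hn]; exact h3
    · intro i _ j _ hij
      rcases lt_or_gt_of_ne hij with h | h
      · refine Set.disjoint_left.2 fun y hy hy' => ?_
        have := hmono.monotone (Nat.succ_le_of_lt h)
        exact absurd (hy.2.trans_le this) (not_lt.2 hy'.1.le)
      · refine Set.disjoint_left.2 fun y hy hy' => ?_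
        have := hmono.monotone (Nat.succ_le_of_lt h)
        exact absurd (hy'.2.trans_le this) (not_lt.2 hy.1.le)
    · exact fun _ _ => measurableSet_Ioo
  have hvol : ∀ j, volume (Set.Ioo (x j) (x (j + 1))) = (n + 1 : ℝ≥0∞)⁻¹ := fun j => by
    rw [Real.volume_Ioo]
    have : x (j + 1) - x j = ((n : ℝ) + 1)⁻¹ := by simp only [hx]; push_cast; field_simp; ring
    rw [this, ENNReal.ofReal_inv_of_pos hn, ENNReal.ofReal_add (by positivity) (by norm_num)]
    simp
  -- The value at a grid point is at most the mean over the adjacent cell on its outer side.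
  have hterm : ∀ j ∈ Finset.range n, φ (((j : ℝ) + 1) / (n + 1)) ≤ (n + 1) * (F (j + 1) + F j) := by
    intro j hj
    have hj' : ((j : ℝ) + 1) + 1 ≤ n + 1 := by
      have := Finset.mem_range.1 hj
      have : ((j + 1 : ℕ) : ℝ) ≤ n := by exact_mod_cast this
      push_cast at this; linarith
    set y := ((j : ℝ) + 1) / (n + 1) with hy
    have hyx : x (j + 1) = y := by simp [hx, hy]
    have hy0 : 0 < y := by positivity
    have hy1 : y < 1 := by rw [hy, div_lt_one hn]; linarith
    have hconst : φ y * (n + 1 : ℝ≥0∞)⁻¹ ≤ F (j + 1) + F j := by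
      rcases le_total (1 / 2) y with h | h
      · refine le_trans ?_ le_self_add
        rw [← hvol (j + 1), ← setLIntegral_const]
        refine setLIntegral_mono' measurableSet_Ioo fun z hz => ?_
        rw [hyx] at hz
        refine h2 ⟨h, hy1⟩ ⟨h.trans hz.1.le, hz.2.trans_le ?_⟩ hz.1.le
        simp only [hx]; rw [div_le_one hn]; push_cast; linarith
      · refine le_trans ?_ le_add_self
        rw [← hvol j, ← setLIntegral_const]
        refine setLIntegral_mono' measurableSet_Ioo fun z hz => ?_
        rw [hyx] at hz
        have hz0 : 0 < z := lt_of_le_of_lt (by positivity) hz.1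
        exact h1 ⟨hz0, hz.2.le.trans h⟩ ⟨hy0, h⟩ hz.2.le
    have hn1 : (n + 1 : ℝ≥0∞) ≠ 0 := by positivity
    have hn2 : (n + 1 : ℝ≥0∞) ≠ ⊤ := by finiteness
    calc φ y = (n + 1) * (φ y * (n + 1 : ℝ≥0∞)⁻¹) := by
          rw [mul_left_comm, ENNReal.mul_inv_cancel hn1 hn2, mul_one]
      _ ≤ _ := by gcongr
  calc _ ≤ ∑ j ∈ Finset.range n, (n + 1 : ℝ≥0∞) * (F (j + 1) + F j) := Finset.sum_le_sum hterm
    _ = (n + 1) * (∑ j ∈ Finset.range n, F (j + 1) + ∑ j ∈ Finset.range n, F j) := by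
        rw [← Finset.mul_sum, Finset.sum_add_distrib]
    _ ≤ (n + 1) * (∫⁻ y, φ y ∂unitLaw + ∫⁻ y, φ y ∂unitLaw) := by
        gcongr
        · refine le_trans ?_ hsum
          rw [Finset.sum_range_succ']
          exact le_self_add
        · refine le_trans ?_ hsum
          rw [Finset.sum_range_succ]
          exact le_self_add
    _ = _ := by ring

section

/-- The average mean quadratic error of rank scores as approximations of population scores. -/
def rankError (H : ℝ → ℝ) (n : ℕ) : ℝ≥0∞ :=
  (n : ℝ≥0∞)⁻¹ * ∑ i : Fin n, ∫⁻ v, ENNReal.ofReal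
    ((H ((vecRank v i : ℝ) / (n + 1)) - H (v i)) ^ 2) ∂(Measure.pi fun _ : Fin n => unitLaw)

theorem measurable_rankScore {H : ℝ → ℝ} (hH : Measurable H) {n : ℕ} (i : Fin n) :
    Measurable fun v : Fin n → ℝ => H ((vecRank v i : ℝ) / (n + 1)) :=
  hH.comp ((measurable_vecRank i).div_const _)

theorem ofReal_add_sq_le (a b : ℝ) : ENNReal.ofReal ((a + b) ^ 2) ≤
    2 * ENNReal.ofReal (a ^ 2) + 2 * ENNReal.ofReal (b ^ 2) := by
  have := IsDQM.ofReal_sq_le (a + b) b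
  rwa [add_sub_cancel_right] at this

theorem ofReal_sub_sq_le (a b : ℝ) : ENNReal.ofReal ((a - b) ^ 2) ≤
    2 * ENNReal.ofReal (a ^ 2) + 2 * ENNReal.ofReal (b ^ 2) := by
  have := ofReal_add_sq_le a (-b)
  rwa [neg_sq, ← sub_eq_add_neg] at this

theorem rankError_le_add {F G H : ℝ → ℝ} (hG : Measurable G) (h : ∀ x, H x = F x + G x) (n : ℕ) :
    rankError H n ≤ 2 * rankError F n + 2 * rankError G n := by
  rw [rankError, rankError, rankError, mul_left_comm 2, mul_left_comm 2, ← mul_add,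
    Finset.mul_sum (a := (2 : ℝ≥0∞)), Finset.mul_sum (a := (2 : ℝ≥0∞)), ← Finset.sum_add_distrib]
  gcongr with i
  have hm : Measurable fun v : Fin n → ℝ =>
      2 * ENNReal.ofReal ((G ((vecRank v i : ℝ) / (n + 1)) - G (v i)) ^ 2) :=
    (((measurable_rankScore hG i).sub (hG.comp (measurable_pi_apply i))).pow_const
      2).ennreal_ofReal.const_mul 2
  rw [← lintegral_const_mul' _ _ (by simp), ← lintegral_const_mul' _ _ (by simp),
    ← lintegral_add_right _ hm]
  refine lintegral_mono fun v => ?_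
  simp only [h]
  refine le_trans (le_of_eq ?_) (ofReal_add_sq_le _ _)
  congr 2; ring

/-- As the ranks are a permutation of `1, …, n`, the rank scores contribute a Riemann sum. -/
theorem rankError_le {H : ℝ → ℝ} (hH : Measurable H) {n : ℕ} (hn : n ≠ 0) :
    rankError H n ≤ 2 * ((n : ℝ≥0∞)⁻¹ * ∑ j ∈ Finset.range n,
      ENNReal.ofReal (H (((j : ℝ) + 1) / (n + 1)) ^ 2)) +
      2 * ∫⁻ x, ENNReal.ofReal (H x ^ 2) ∂unitLaw := by
  set P := Measure.pi fun _ : Fin n => unitLaw with hP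
  have h1 : ∑ i : Fin n, ∫⁻ v, ENNReal.ofReal (H ((vecRank v i : ℝ) / (n + 1)) ^ 2) ∂P =
      ∑ j ∈ Finset.range n, ENNReal.ofReal (H (((j : ℝ) + 1) / (n + 1)) ^ 2) := by
    rw [← lintegral_finsetSum _ fun i _ => by
      exact ((measurable_rankScore hH i).pow_const 2).ennreal_ofReal]
    have : ∀ᵐ v ∂P, ∑ i : Fin n, ENNReal.ofReal (H ((vecRank v i : ℝ) / (n + 1)) ^ 2) =
        ∑ j ∈ Finset.range n, ENNReal.ofReal (H (((j : ℝ) + 1) / (n + 1)) ^ 2) := by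
      filter_upwards [ae_injective_pi unitLaw] with v hv
      have := sum_vecRank hv (fun m => ENNReal.ofReal (H ((m : ℝ) / (n + 1)) ^ 2))
      push_cast at this
      exact this
    rw [lintegral_congr_ae this]
    simp [hP]
  have h2 : ∀ i : Fin n, ∫⁻ v, ENNReal.ofReal (H (v i) ^ 2) ∂P =
      ∫⁻ x, ENNReal.ofReal (H x ^ 2) ∂unitLaw := fun i =>
    (measurePreserving_eval (fun _ : Fin n => unitLaw) i).lintegral_comp
      (f := fun x => ENNReal.ofReal (H x ^ 2)) (by fun_prop)
  have h3 : ∑ i : Fin n, ∫⁻ v, ENNReal.ofReal ((H ((vecRank v i : ℝ) / (n + 1)) - H (v i)) ^ 2) ∂P ≤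
      2 * ∑ j ∈ Finset.range n, ENNReal.ofReal (H (((j : ℝ) + 1) / (n + 1)) ^ 2) +
      2 * (n * ∫⁻ x, ENNReal.ofReal (H x ^ 2) ∂unitLaw) := by
    calc _ ≤ ∑ i : Fin n, (2 * ∫⁻ v, ENNReal.ofReal (H ((vecRank v i : ℝ) / (n + 1)) ^ 2) ∂P +
          2 * ∫⁻ x, ENNReal.ofReal (H x ^ 2) ∂unitLaw) := by
          refine Finset.sum_le_sum fun i _ => ?_
          rw [← h2 i, ← lintegral_const_mul' _ _ (by simp), ← lintegral_const_mul' _ _ (by simp),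
            ← lintegral_add_right _ (by fun_prop)]
          exact lintegral_mono fun v => ofReal_sub_sq_le _ _
      _ = _ := by
          rw [Finset.sum_add_distrib, ← Finset.mul_sum, h1]
          simp
          rw [mul_left_comm]
  have hn0 : (n : ℝ≥0∞) ≠ 0 := by exact_mod_cast hn
  calc rankError H n ≤ (n : ℝ≥0∞)⁻¹ * (2 * ∑ j ∈ Finset.range n,
        ENNReal.ofReal (H (((j : ℝ) + 1) / (n + 1)) ^ 2) +
        2 * (n * ∫⁻ x, ENNReal.ofReal (H x ^ 2) ∂unitLaw)) := by rw [rankError]; gcongr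
    _ = _ := by
      rw [mul_add, mul_left_comm, mul_left_comm _ 2, ← mul_assoc (n : ℝ≥0∞)⁻¹ n,
        ENNReal.inv_mul_cancel hn0 (by simp), one_mul]

/-- Rank scores generated by a bounded uniformly continuous function. -/
theorem tendsto_rankError_of_uniformContinuous {H : ℝ → ℝ} (hH : UniformContinuous H) {B : ℝ}
    (hB : ∀ x, |H x| ≤ B) : Tendsto (rankError H) atTop (𝓝 0) := by
  have hB0 : 0 ≤ B := (abs_nonneg _).trans (hB 0)
  rw [ENNReal.tendsto_nhds_zero]
  intro ε hε
  obtain ⟨e, he, heε⟩ : ∃ e : ℝ, 0 < e ∧ ENNReal.ofReal e ≤ ε := by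
    obtain ⟨e, he1, he2⟩ := ENNReal.lt_iff_exists_nnreal_btwn.1 hε
    exact ⟨e, by exact_mod_cast he1, by simpa using he2.le⟩
  obtain ⟨η, hη, hunif⟩ := Metric.uniformContinuous_iff.1 hH (Real.sqrt (e / 2))
    (Real.sqrt_pos.2 (by positivity))
  set C := 4 * B ^ 2 / η ^ 2 with hC
  -- A quadratic modulus of continuity: uniform continuity for small distances, boundedness for
  -- large ones.
  have hpt : ∀ x y, (H x - H y) ^ 2 ≤ e / 2 + C * (x - y) ^ 2 := by
    intro x y
    by_cases hxy : dist x y < η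
    · have h1 := (hunif hxy).le
      rw [Real.dist_eq] at h1
      have h2 := pow_le_pow_left₀ (abs_nonneg _) h1 2
      rw [sq_abs, Real.sq_sqrt (by positivity)] at h2
      have : 0 ≤ C * (x - y) ^ 2 := by positivity
      linarith
    · rw [Real.dist_eq, not_lt] at hxy
      have h1 : |H x - H y| ≤ 2 * B := (abs_sub _ _).trans (by linarith [hB x, hB y])
      have h2 := pow_le_pow_left₀ (abs_nonneg _) h1 2
      rw [sq_abs] at h2
      have h3 : η ^ 2 ≤ (x - y) ^ 2 := by
        rw [← sq_abs (x - y)]; gcongr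
      have h4 : 4 * B ^ 2 ≤ C * (x - y) ^ 2 := by
        calc 4 * B ^ 2 = C * η ^ 2 := by rw [hC]; field_simp
          _ ≤ _ := by gcongr
      linarith
  have hbound : ∀ n : ℕ, n ≠ 0 → rankError H n ≤ ENNReal.ofReal (e / 2 + C * (1 / (6 * (n + 1)))) := by
    intro n hn
    have hn0 : (0 : ℝ) < n := by positivity
    set P := Measure.pi fun _ : Fin n => unitLaw with hP
    have hint : ∀ i : Fin n, Integrable (fun v : Fin n → ℝ =>
        ((vecRank v i : ℝ) / (n + 1) - v i) ^ 2) P := fun i => by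
      have hm := measurable_vecRank i
      refine Integrable.of_bound (Measurable.aestronglyMeasurable (by fun_prop)) 1 ?_
      filter_upwards [ae_unitLaw_mem] with v hv
      rw [Real.norm_of_nonneg (sq_nonneg _)]
      have h1 := vecRank_div_mem v i
      have h2 := hv i
      nlinarith [h1.1, h1.2, h2.1, h2.2]
    have hsum : ∑ i : Fin n, ∫ v, ((vecRank v i : ℝ) / (n + 1) - v i) ^ 2 ∂P =
        (n : ℝ) / (6 * (n + 1)) := by
      rw [← integral_finsetSum _ fun i _ => hint i]
      exact integral_sum_vecRank_sub_sq n
    have hi : ∀ i : Fin n, ∫⁻ v, ENNReal.ofReal ((H ((vecRank v i : ℝ) / (n + 1)) - H (v i)) ^ 2) ∂P ≤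
        ENNReal.ofReal (e / 2 + C * ∫ v, ((vecRank v i : ℝ) / (n + 1) - v i) ^ 2 ∂P) := fun i => by
      calc _ ≤ ∫⁻ v, ENNReal.ofReal (e / 2 + C * ((vecRank v i : ℝ) / (n + 1) - v i) ^ 2) ∂P :=
            lintegral_mono fun v => ENNReal.ofReal_le_ofReal (hpt _ _)
        _ = ENNReal.ofReal (∫ v, (e / 2 + C * ((vecRank v i : ℝ) / (n + 1) - v i) ^ 2) ∂P) := by
            have hint' : Integrable (fun v : Fin n → ℝ =>
                e / 2 + C * ((vecRank v i : ℝ) / (n + 1) - v i) ^ 2) P :=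
              (integrable_const _).add ((hint i).const_mul C)
            rw [ofReal_integral_eq_lintegral_ofReal hint' (Eventually.of_forall fun v => by positivity)]
        _ = _ := by
            rw [integral_add (integrable_const _) ((hint i).const_mul C), integral_const_mul]
            simp
    have hnn : ∀ i : Fin n, 0 ≤ ∫ v, ((vecRank v i : ℝ) / (n + 1) - v i) ^ 2 ∂P := fun i =>
      integral_nonneg fun v => sq_nonneg _
    calc rankError H n ≤ (n : ℝ≥0∞)⁻¹ * ∑ i : Fin n,
          ENNReal.ofReal (e / 2 + C * ∫ v, ((vecRank v i : ℝ) / (n + 1) - v i) ^ 2 ∂P) := by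
          rw [rankError]; gcongr with i; exact hi i
      _ = ENNReal.ofReal ((n : ℝ)⁻¹ * ∑ i : Fin n,
          (e / 2 + C * ∫ v, ((vecRank v i : ℝ) / (n + 1) - v i) ^ 2 ∂P)) := by
          rw [ENNReal.ofReal_mul (by positivity), ENNReal.ofReal_inv_of_pos hn0,
            ENNReal.ofReal_natCast, ENNReal.ofReal_sum_of_nonneg fun i _ => by
              have := hnn i; positivity]
      _ = _ := by
          rw [Finset.sum_add_distrib, ← Finset.mul_sum, hsum]
          congr 1
          simp
          field_simp
  have hlim : Tendsto (fun n : ℕ => C * (1 / (6 * ((n : ℝ) + 1)))) atTop (𝓝 0) := by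
    have h1 := (tendsto_one_div_add_atTop_nhds_zero_nat (𝕜 := ℝ)).const_mul (C / 6)
    rw [mul_zero] at h1
    refine h1.congr fun n => ?_
    field_simp
  filter_upwards [hlim.eventually_le_const (show (0 : ℝ) < e / 2 by positivity),
    eventually_ne_atTop 0] with n hn hn0
  exact (hbound n hn0).trans ((ENNReal.ofReal_le_ofReal (by linarith)).trans heε)

/-- The projection onto `[δ, 1 - δ]`. -/
def clampUnit (δ u : ℝ) : ℝ := max δ (min u (1 - δ))

theorem clampUnit_mem {δ : ℝ} (h : δ < 1 / 2) (u : ℝ) :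
    clampUnit δ u ∈ Set.Icc δ (1 - δ) :=
  ⟨le_max_left _ _, max_le (by linarith) (min_le_right _ _)⟩

theorem clampUnit_mem_Ioo {δ : ℝ} (h0 : 0 < δ) (h : δ < 1 / 2) (u : ℝ) :
    clampUnit δ u ∈ Set.Ioo (0 : ℝ) 1 := by
  have := clampUnit_mem h u
  exact ⟨h0.trans_le this.1, this.2.trans_lt (by linarith)⟩

theorem monotone_clampUnit (δ : ℝ) : Monotone (clampUnit δ) := fun _ _ h =>
  max_le_max le_rfl (min_le_min_right _ h)

theorem clampUnit_of_mem {δ u : ℝ} (h : u ∈ Set.Icc δ (1 - δ)) : clampUnit δ u = u := by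
  rw [clampUnit, min_eq_left h.2, max_eq_right h.1]

theorem clampUnit_of_le {δ u : ℝ} (h : δ < 1 / 2) (hu : u ≤ 1 / 2) : clampUnit δ u = max δ u := by
  rw [clampUnit, min_eq_left (by linarith)]

theorem clampUnit_of_ge {δ u : ℝ} (h : δ < 1 / 2) (hu : 1 / 2 ≤ u) :
    clampUnit δ u = min u (1 - δ) := by
  rw [clampUnit, max_eq_right (le_min (by linarith) (by linarith))]

variable {K : ℝ → ℝ}

/-- The truncation error of a monotone score is unimodal, so that its Riemann sums are controlled by
its integral. -/
theorem sum_truncation_le (hK : MonotoneOn K (Set.Ioo 0 1)) {δ : ℝ} (h0 : 0 < δ) (h : δ < 1 / 2)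
    (n : ℕ) : ∑ j ∈ Finset.range n, ENNReal.ofReal ((K (((j : ℝ) + 1) / (n + 1)) -
        K (clampUnit δ (((j : ℝ) + 1) / (n + 1)))) ^ 2) ≤
      2 * (n + 1) * ∫⁻ x, ENNReal.ofReal ((K x - K (clampUnit δ x)) ^ 2) ∂unitLaw := by
  refine sum_le_lintegral_of_unimodal
    (φ := fun x => ENNReal.ofReal ((K x - K (clampUnit δ x)) ^ 2)) ?_ ?_ n
  · intro x hx y hy hxy
    refine ENNReal.ofReal_le_ofReal ?_
    have hxm : x ∈ Set.Ioo (0 : ℝ) 1 := ⟨hx.1, by linarith [hx.2]⟩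
    have hym : y ∈ Set.Ioo (0 : ℝ) 1 := ⟨hy.1, by linarith [hy.2]⟩
    rcases le_total δ y with hd | hd
    · have : K y - K (clampUnit δ y) = 0 := by
        rw [clampUnit_of_mem ⟨hd, by linarith [hy.2]⟩, sub_self]
      rw [this, zero_pow two_ne_zero]; exact sq_nonneg _
    · have hdm : δ ∈ Set.Ioo (0 : ℝ) 1 := ⟨h0, by linarith⟩
      rw [clampUnit_of_le h hx.2, clampUnit_of_le h hy.2, max_eq_left hd,
        max_eq_left (hxy.trans hd)]
      have h1 := hK hxm hym hxy
      have h2 := hK hym hdm hd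
      nlinarith
  · intro x hx y hy hxy
    refine ENNReal.ofReal_le_ofReal ?_
    have hxm : x ∈ Set.Ioo (0 : ℝ) 1 := ⟨by linarith [hx.1], hx.2⟩
    have hym : y ∈ Set.Ioo (0 : ℝ) 1 := ⟨by linarith [hy.1], hy.2⟩
    rcases le_total x (1 - δ) with hd | hd
    · have : K x - K (clampUnit δ x) = 0 := by
        rw [clampUnit_of_mem ⟨by linarith [hx.1], hd⟩, sub_self]
      rw [this, zero_pow two_ne_zero]; exact sq_nonneg _
    · have hdm : 1 - δ ∈ Set.Ioo (0 : ℝ) 1 := ⟨by linarith, by linarith⟩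
      rw [clampUnit_of_ge h hx.1, clampUnit_of_ge h hy.1, min_eq_right hd,
        min_eq_right (hd.trans hxy)]
      have h1 := hK hxm hym hxy
      have h2 := hK hdm hxm hd
      nlinarith

theorem lintegral_sq_lt_top {X : Type*} [MeasurableSpace X] {μ : Measure X} {F : X → ℝ}
    (hF : MemLp F 2 μ) : ∫⁻ x, ENNReal.ofReal (F x ^ 2) ∂μ < ⊤ := by
  rw [lintegral_ofReal_sq_eq]
  exact ENNReal.pow_lt_top hF.2

/-- The truncated scores are dominated by a square integrable function; `1 / (m + 3)` is a sequence
of truncation levels in `(0, 1/2)`. -/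
theorem tendsto_lintegral_truncation (hK : MonotoneOn K (Set.Ioo 0 1)) (hK2 : MemLp K 2 unitLaw) :
    Tendsto (fun m : ℕ => ∫⁻ x, ENNReal.ofReal ((K x - K (clampUnit (1 / ((m : ℝ) + 3)) x)) ^ 2)
      ∂unitLaw) atTop (𝓝 0) := by
  have hδ0 : ∀ m : ℕ, 0 < 1 / ((m : ℝ) + 3) := fun m => by positivity
  have hδ1 : ∀ m : ℕ, 1 / ((m : ℝ) + 3) < 1 / 2 := fun m =>
    one_div_lt_one_div_of_lt (by norm_num) (by linarith [(Nat.cast_nonneg m : (0 : ℝ) ≤ m)])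
  have hδlim : Tendsto (fun m : ℕ => 1 / ((m : ℝ) + 3)) atTop (𝓝 0) := by
    have := (tendsto_one_div_add_atTop_nhds_zero_nat (𝕜 := ℝ)).comp (tendsto_add_atTop_nat 2)
    refine this.congr fun m => ?_
    simp only [Function.comp_apply]; push_cast; congr 1; ring
  have hmem := ae_restrict_mem (μ := volume) (measurableSet_Ioo (a := (0 : ℝ)) (b := 1))
  have hKm : AEMeasurable K unitLaw := aemeasurable_restrict_of_monotoneOn measurableSet_Ioo hK
  rw [← lintegral_zero (μ := unitLaw)]
  refine tendsto_lintegral_of_dominated_convergence'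
    (fun x => ENNReal.ofReal ((K x - K (1 / 2)) ^ 2)) ?_ ?_ ?_ ?_
  · intro m
    have : MonotoneOn (fun x => K (clampUnit (1 / ((m : ℝ) + 3)) x)) (Set.Ioo 0 1) :=
      fun x _ y _ hxy => hK (clampUnit_mem_Ioo (hδ0 m) (hδ1 m) x)
        (clampUnit_mem_Ioo (hδ0 m) (hδ1 m) y) (monotone_clampUnit _ hxy)
    have := aemeasurable_restrict_of_monotoneOn (μ := volume) measurableSet_Ioo this
    exact ((hKm.sub this).pow_const 2).ennreal_ofReal
  · intro m
    filter_upwards [hmem] with x hx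
    refine ENNReal.ofReal_le_ofReal ?_
    have hc := clampUnit_mem_Ioo (hδ0 m) (hδ1 m) x
    have hh : (1 / 2 : ℝ) ∈ Set.Ioo (0 : ℝ) 1 := ⟨by norm_num, by norm_num⟩
    rcases le_total x (1 / 2) with hd | hd
    · rw [clampUnit_of_le (hδ1 m) hd] at hc ⊢
      have h1 := hK hx hc (le_max_right _ _)
      have h2 := hK hc hh (max_le (hδ1 m).le hd)
      nlinarith
    · rw [clampUnit_of_ge (hδ1 m) hd] at hc ⊢
      have h1 := hK hc hx (min_le_left _ _)
      have h2 := hK hh hc (le_min hd (by linarith [hδ1 m]))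
      nlinarith
  · exact (lintegral_sq_lt_top (hK2.sub (memLp_const (K (1 / 2))))).ne
  · filter_upwards [hmem] with x hx
    refine tendsto_const_nhds.congr' ?_
    filter_upwards [hδlim.eventually_lt_const hx.1,
      hδlim.eventually_lt_const (show 0 < 1 - x by linarith [hx.2])] with m h1 h2
    rw [clampUnit_of_mem ⟨h1.le, by linarith⟩, sub_self]
    simp

/-- A score function, made measurable by truncation to the unit interval. -/
def unitScore (K : ℝ → ℝ) : ℝ → ℝ := (Set.Ioo (0 : ℝ) 1).indicator K

theorem unitScore_of_mem {u : ℝ} (hu : u ∈ Set.Ioo (0 : ℝ) 1) : unitScore K u = K u :=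
  Set.indicator_of_mem hu K

theorem measurable_unitScore (hK : IsScore K) : Measurable (unitScore K) := by
  classical
  have := ContinuousOn.measurable_piecewise (s := Set.Ioo (0 : ℝ) 1) hK.1
    (continuousOn_const (c := (0 : ℝ))) measurableSet_Ioo
  rwa [show (fun _ : ℝ => (0 : ℝ)) = 0 from rfl, Set.piecewise_eq_indicator] at this

theorem memLp_unitScore (hK : IsScore K) : MemLp (unitScore K) 2 unitLaw := by
  obtain ⟨-, K₁, K₂, -, -, h1, h2, h⟩ := hK
  refine (h1.sub h2).ae_eq ?_
  filter_upwards [ae_restrict_mem measurableSet_Ioo] with u hu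
  rw [unitScore_of_mem hu, h u hu]; rfl

/-- Rank scores approximate population scores in quadratic mean: truncation to `[δ, 1 - δ]` makes
the score bounded and uniformly continuous, and the truncation errors of the two monotone parts are
controlled by integrals. -/
theorem tendsto_rankError (hK : IsScore K) : Tendsto (rankError (unitScore K)) atTop (𝓝 0) := by
  have hKm := measurable_unitScore hK
  obtain ⟨hKc, K₁, K₂, hm1, hm2, hL1, hL2, hK12⟩ := hK
  have hδ0 : ∀ m : ℕ, 0 < 1 / ((m : ℝ) + 3) := fun m => by positivity
  have hδ1 : ∀ m : ℕ, 1 / ((m : ℝ) + 3) < 1 / 2 := fun m =>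
    one_div_lt_one_div_of_lt (by norm_num) (by linarith [(Nat.cast_nonneg m : (0 : ℝ) ≤ m)])
  set ρ : (ℝ → ℝ) → ℕ → ℝ≥0∞ := fun L m => ∫⁻ x, ENNReal.ofReal
    ((L x - L (clampUnit (1 / ((m : ℝ) + 3)) x)) ^ 2) ∂unitLaw with hρ
  have hlim : Tendsto (fun m => 40 * (ρ K₁ m + ρ K₂ m)) atTop (𝓝 0) := by
    have := ENNReal.Tendsto.const_mul (a := 40) ((tendsto_lintegral_truncation hm1 hL1).add
      (tendsto_lintegral_truncation hm2 hL2)) (by simp)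
    simpa only [add_zero, mul_zero] using this
  rw [ENNReal.tendsto_nhds_zero]
  intro ε hε
  have hε2 : 0 < ε / 2 := ENNReal.half_pos hε.ne'
  obtain ⟨m, hm⟩ := (hlim.eventually_le_const hε2).exists
  set δ := 1 / ((m : ℝ) + 3) with hδ
  set H := fun x => unitScore K (clampUnit δ x) with hH
  have hcc : Continuous (clampUnit δ) := by unfold clampUnit; fun_prop
  have hHK : H = fun x => K (clampUnit δ x) := by
    ext x; exact unitScore_of_mem (clampUnit_mem_Ioo (hδ0 m) (hδ1 m) x)
  have hKI : ContinuousOn K (Set.Icc δ (1 - δ)) :=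
    hKc.mono fun x hx => ⟨(hδ0 m).trans_le hx.1, by linarith [hx.2, hδ0 m]⟩
  obtain ⟨B, hB⟩ := isCompact_Icc.exists_bound_of_continuousOn hKI
  have hHu : UniformContinuous H := by
    have h1 := isCompact_Icc.uniformContinuousOn_of_continuous hKI
    rw [Metric.uniformContinuousOn_iff] at h1
    rw [Metric.uniformContinuous_iff]
    intro e he
    obtain ⟨d, hd, h2⟩ := h1 e he
    refine ⟨d, hd, fun {x y} hxy => ?_⟩
    rw [hHK]
    refine h2 _ (clampUnit_mem (hδ1 m) x) _ (clampUnit_mem (hδ1 m) y) (lt_of_le_of_lt ?_ hxy)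
    rw [Real.dist_eq, Real.dist_eq, clampUnit, clampUnit]
    refine (abs_max_sub_max_le_max _ _ _ _).trans ?_
    rw [sub_self, abs_zero]
    refine max_le (abs_nonneg _) ((abs_min_sub_min_le_max _ _ _ _).trans ?_)
    rw [sub_self, abs_zero]
    exact max_le le_rfl (abs_nonneg _)
  have hHB : ∀ x, |H x| ≤ B := fun x => by
    rw [hHK]; exact hB _ (clampUnit_mem (hδ1 m) x)
  have hHlim : Tendsto (fun n => 2 * rankError H n) atTop (𝓝 0) := by
    have := ENNReal.Tendsto.const_mul (a := 2)
      (tendsto_rankError_of_uniformContinuous hHu hHB) (by simp)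
    simpa using this
  have hHm : Measurable H := hKm.comp hcc.measurable
  set D := fun x => unitScore K x - H x with hD
  have hDm : Measurable D := hKm.sub hHm
  have hDsq : ∀ x ∈ Set.Ioo (0 : ℝ) 1, ENNReal.ofReal (D x ^ 2) ≤
      2 * ENNReal.ofReal ((K₁ x - K₁ (clampUnit δ x)) ^ 2) +
      2 * ENNReal.ofReal ((K₂ x - K₂ (clampUnit δ x)) ^ 2) := by
    intro x hx
    have e : D x = (K₁ x - K₁ (clampUnit δ x)) - (K₂ x - K₂ (clampUnit δ x)) := by
      rw [hD, hHK]
      simp only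
      rw [unitScore_of_mem hx, hK12 x hx, hK12 _ (clampUnit_mem_Ioo (hδ0 m) (hδ1 m) x)]
      ring
    rw [e]
    exact ofReal_sub_sq_le _ _
  have hDint : ∫⁻ x, ENNReal.ofReal (D x ^ 2) ∂unitLaw ≤ 2 * ρ K₁ m + 2 * ρ K₂ m := by
    have hKm2 : AEMeasurable (fun x => 2 * ENNReal.ofReal ((K₂ x - K₂ (clampUnit δ x)) ^ 2))
        unitLaw := by
      have h1 : MonotoneOn (fun x => K₂ (clampUnit δ x)) (Set.Ioo 0 1) :=
        fun x _ y _ hxy => hm2 (clampUnit_mem_Ioo (hδ0 m) (hδ1 m) x)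
          (clampUnit_mem_Ioo (hδ0 m) (hδ1 m) y) (monotone_clampUnit _ hxy)
      have h2 := aemeasurable_restrict_of_monotoneOn (μ := volume) measurableSet_Ioo h1
      have h3 := aemeasurable_restrict_of_monotoneOn (μ := volume) measurableSet_Ioo hm2
      exact ((h3.sub h2).pow_const 2).ennreal_ofReal.const_mul 2
    simp only [hρ]
    rw [← lintegral_const_mul' _ _ (by simp), ← lintegral_const_mul' _ _ (by simp),
      ← lintegral_add_right' _ hKm2]
    exact setLIntegral_mono' measurableSet_Ioo hDsq
  have hDsum : ∀ n : ℕ, n ≠ 0 → (n : ℝ≥0∞)⁻¹ * ∑ j ∈ Finset.range n,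
      ENNReal.ofReal (D (((j : ℝ) + 1) / (n + 1)) ^ 2) ≤ 8 * (ρ K₁ m + ρ K₂ m) := by
    intro n hn
    have hpt : ∀ j ∈ Finset.range n, ((j : ℝ) + 1) / (n + 1) ∈ Set.Ioo (0 : ℝ) 1 := fun j hj => by
      have : (j : ℝ) < n := by exact_mod_cast Finset.mem_range.1 hj
      refine ⟨by positivity, ?_⟩
      rw [div_lt_one (by positivity)]; linarith
    have hn0 : (n : ℝ≥0∞) ≠ 0 := by exact_mod_cast hn
    have hn1 : (n + 1 : ℝ≥0∞) ≤ 2 * n := by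
      have : n + 1 ≤ 2 * n := by omega
      exact_mod_cast this
    calc _ ≤ (n : ℝ≥0∞)⁻¹ * ∑ j ∈ Finset.range n,
          (2 * ENNReal.ofReal ((K₁ (((j : ℝ) + 1) / (n + 1)) -
            K₁ (clampUnit δ (((j : ℝ) + 1) / (n + 1)))) ^ 2) +
          2 * ENNReal.ofReal ((K₂ (((j : ℝ) + 1) / (n + 1)) -
            K₂ (clampUnit δ (((j : ℝ) + 1) / (n + 1)))) ^ 2)) := by
          gcongr with j hj
          exact hDsq _ (hpt j hj)
      _ ≤ (n : ℝ≥0∞)⁻¹ * (2 * (2 * (2 * n) * ρ K₁ m) + 2 * (2 * (2 * n) * ρ K₂ m)) := by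
          rw [Finset.sum_add_distrib, ← Finset.mul_sum, ← Finset.mul_sum]
          gcongr
          · refine (sum_truncation_le hm1 (hδ0 m) (hδ1 m) n).trans ?_
            gcongr
          · refine (sum_truncation_le hm2 (hδ0 m) (hδ1 m) n).trans ?_
            gcongr
      _ = ((n : ℝ≥0∞)⁻¹ * n) * (8 * (ρ K₁ m + ρ K₂ m)) := by ring
      _ = _ := by rw [ENNReal.inv_mul_cancel hn0 (by simp), one_mul]
  filter_upwards [hHlim.eventually_le_const hε2, eventually_ne_atTop 0] with n hn hn0
  calc rankError (unitScore K) n ≤ 2 * rankError H n + 2 * rankError D n :=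
        rankError_le_add hDm (fun x => by simp only [hD]; ring) n
    _ ≤ ε / 2 + 2 * (2 * (8 * (ρ K₁ m + ρ K₂ m)) + 2 * (2 * ρ K₁ m + 2 * ρ K₂ m)) := by
        gcongr
        exact (rankError_le hDm hn0).trans (add_le_add (mul_le_mul_right (hDsum n hn0) _)
          (mul_le_mul_right hDint _))
    _ = ε / 2 + 40 * (ρ K₁ m + ρ K₂ m) := by ring
    _ ≤ ε / 2 + ε / 2 := by gcongr
    _ = ε := ENNReal.add_halves ε

end

/-! ### Quadratic statistics with modulus-dependent weights -/

section

/-- The weak law of large numbers on finite product spaces. -/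
theorem tendsto_measure_abs_mean_sub {X : Type*} [MeasurableSpace X] (ν : Measure X)
    [IsProbabilityMeasure ν] {Y : X → ℝ} (hYm : Measurable Y) (hY : Integrable Y ν) {ε : ℝ}
    (hε : 0 < ε) : Tendsto (fun n : ℕ => (Measure.pi fun _ : Fin n => ν)
      {x | ε ≤ |(∑ i, Y (x i)) / n - ∫ z, Y z ∂ν|}) atTop (𝓝 0) := by
  set P := Measure.infinitePi fun _ : ℕ => ν with hP
  have hev : ∀ i, MeasurePreserving (fun ω : ℕ → X => ω i) P ν := fun i =>
    ⟨measurable_pi_apply i, Measure.infinitePi_map_eval (fun _ : ℕ => ν) i⟩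
  have hind : iIndepFun (fun (i : ℕ) (ω : ℕ → X) => Y (ω i)) P :=
    iIndepFun_infinitePi (P := fun _ : ℕ => ν) (X := fun _ => Y) fun _ => hYm
  have hlaw := strong_law_ae_real (μ := P) (fun i ω => Y (ω i)) ((hev 0).integrable_comp_of_integrable hY)
    (fun i j hij => hind.indepFun hij) (fun i =>
      { aemeasurable_fst := (hYm.comp (hev i).measurable).aemeasurable
        aemeasurable_snd := (hYm.comp (hev 0).measurable).aemeasurable
        map_eq := by
          have : ∀ j, P.map (fun ω => Y (ω j)) = ν.map Y := fun j => by
            rw [← (hev j).map_eq, Measure.map_map hYm (hev j).measurable]; rfl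
          rw [this, this] })
  have h0 : ∫ ω, Y (ω 0) ∂P = ∫ z, Y z ∂ν := by
    conv_rhs => rw [← (hev 0).map_eq]
    rw [integral_map (hev 0).measurable.aemeasurable hYm.aestronglyMeasurable]
  rw [h0] at hlaw
  have hm := tendstoInMeasure_of_tendsto_ae (fun n => by
    refine Measurable.aestronglyMeasurable ?_
    exact (Finset.measurable_sum _ fun i _ => hYm.comp (measurable_pi_apply i)).div_const _) hlaw
  have hm' := hm (ENNReal.ofReal ε) (by simpa using hε)
  -- Finite samples are projections of an infinite one, to which the strong law applies.
  have hproj : ∀ n : ℕ, MeasurePreserving (fun (ω : ℕ → X) (i : Fin n) => ω i) P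
      (Measure.pi fun _ : Fin n => ν) := fun n => by
    have hmeas : Measurable fun (ω : ℕ → X) (i : Fin n) => ω i :=
      measurable_pi_lambda _ fun i => measurable_pi_apply _
    refine ⟨hmeas, (Measure.pi_eq fun s hs => ?_).symm⟩
    rw [Measure.map_apply hmeas (MeasurableSet.univ_pi hs)]
    have : (fun (ω : ℕ → X) (i : Fin n) => ω i) ⁻¹' Set.univ.pi s =
        (Finset.range n : Set ℕ).pi fun j => if h : j < n then s ⟨j, h⟩ else Set.univ := by
      ext ω
      simp only [Set.mem_preimage, Set.mem_pi, Set.mem_univ, true_implies, Finset.coe_range,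
        Set.mem_Iio]
      constructor
      · intro h j hj
        rw [dif_pos hj]; exact h ⟨j, hj⟩
      · intro h i
        have := h i i.2
        rwa [dif_pos i.2] at this
    rw [this, Measure.infinitePi_pi, Finset.prod_range]
    · simp
    · intro j _
      split_ifs
      · exact hs _
      · exact MeasurableSet.univ
  refine hm'.congr fun n => ?_
  have hset : MeasurableSet {x : Fin n → X | ε ≤ |(∑ i, Y (x i)) / n - ∫ z, Y z ∂ν|} := by
    refine measurableSet_le measurable_const ?_
    have : Measurable fun x : Fin n → X => ∑ i, Y (x i) :=
      Finset.measurable_sum _ fun i _ => hYm.comp (measurable_pi_apply i)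
    exact continuous_abs.measurable.comp ((this.div_const _).sub_const _)
  rw [← (hproj n).measure_preimage hset.nullMeasurableSet]
  congr 1
  ext ω
  change ENNReal.ofReal ε ≤ edist _ _ ↔ ε ≤ |(∑ i : Fin n, Y (ω i)) / n - ∫ z, Y z ∂ν|
  rw [edist_dist, Real.dist_eq, ENNReal.ofReal_le_ofReal_iff (abs_nonneg _)]
  simp only [Finset.sum_range]

variable {k : ℕ} {f : ℝ → ℝ}

/-- The direction of a nonzero vector. -/
def dir (w : Obs k) : Obs k := ‖w‖⁻¹ • w

@[fun_prop]
theorem measurable_dir : Measurable (dir : Obs k → Obs k) := by unfold dir; fun_prop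

theorem norm_dir {w : Obs k} (hw : w ≠ 0) : ‖dir w‖ = 1 := by
  rw [dir, norm_smul, norm_inv, norm_norm, inv_mul_cancel₀ (norm_ne_zero_iff.2 hw)]

/-- A spherical sample consists of independent vectors of moduli and directions. -/
theorem lintegral_pi_sphericalLaw (hk : 2 ≤ k) (hf : IsRadialDensity k f) {n : ℕ}
    {F : (Fin n → ℝ) → (Fin n → Obs k) → ℝ≥0∞} (hF : Measurable fun p : (Fin n → ℝ) × (Fin n → Obs k) => F p.1 p.2) :
    ∫⁻ x, F (fun i => ‖x i‖) (fun i => dir (x i)) ∂(Measure.pi fun _ : Fin n => sphericalLaw k f) =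
      ∫⁻ r, (∫⁻ u, F r u ∂(Measure.pi fun _ : Fin n => dirLaw k))
        ∂(Measure.pi fun _ : Fin n => modulusLaw k f) := by
  have := isProbabilityMeasure_dirLaw hk
  have := hf.isProbabilityMeasure_modulusLaw
  have hs := isProbabilityMeasure_sphericalLaw hk hf
  have hms : Measurable fun p : Obs k × ℝ => p.2 • p.1 := by fun_prop
  have h1 : (Measure.pi fun _ : Fin n => sphericalLaw k f) =
      (Measure.pi fun _ : Fin n => (dirLaw k).prod (modulusLaw k f)).map
        fun p i => (p i).2 • (p i).1 := by
    rw [Measure.pi_map_pi (fun _ => hms.aemeasurable) (hμ := fun _ => by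
      change SigmaFinite (sphericalLaw k f); infer_instance)]
    rfl
  have hFm : Measurable fun x : Fin n → Obs k => F (fun i => ‖x i‖) (fun i => dir (x i)) := by
    have : Measurable fun x : Fin n → Obs k => ((fun i => ‖x i‖ : Fin n → ℝ), fun i => dir (x i)) := by
      fun_prop
    exact hF.comp this
  rw [h1, lintegral_map hFm (by fun_prop)]
  have h2 : ∀ᵐ p ∂(Measure.pi fun _ : Fin n => (dirLaw k).prod (modulusLaw k f)),
      ∀ i, ‖(p i).1‖ = 1 ∧ 0 < (p i).2 := by
    rw [ae_all_iff]
    intro i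
    exact (measurePreserving_eval (fun _ : Fin n => (dirLaw k).prod (modulusLaw k f))
      i).quasiMeasurePreserving.ae (ae_polar hk hf)
  have h3 : ∀ᵐ p ∂(Measure.pi fun _ : Fin n => (dirLaw k).prod (modulusLaw k f)),
      F (fun i => ‖(p i).2 • (p i).1‖) (fun i => dir ((p i).2 • (p i).1)) =
        F (fun i => (p i).2) fun i => (p i).1 := by
    filter_upwards [h2] with p hp
    congr 1
    · ext i; exact polar_norm (hp i).1 (hp i).2
    · funext i; exact polar_dir (hp i).1 (hp i).2
  rw [lintegral_congr_ae h3]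
  have h4 := measurePreserving_arrowProdEquivProdArrow (Obs k) ℝ (Fin n)
    (fun _ => dirLaw k) (fun _ => modulusLaw k f)
  have hF2 : Measurable fun p : (Fin n → Obs k) × (Fin n → ℝ) => F p.2 p.1 := by
    have : Measurable (Prod.swap : (Fin n → Obs k) × (Fin n → ℝ) → _) := measurable_swap
    exact hF.comp this
  have h5 := h4.lintegral_comp hF2
  rw [lintegral_prod_symm _ hF2.aemeasurable] at h5
  exact h5

/-- Centered independent terms are orthogonal. -/
theorem lintegral_pi_sum_mul_sq {X : Type*} [MeasurableSpace X] {μ : Measure X}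
    [IsProbabilityMeasure μ] {m : X → ℝ} (hm : MemLp m 2 μ) (hm0 : ∫ x, m x ∂μ = 0)
    {n : ℕ} (w : Fin n → ℝ) :
    ∫⁻ u, ENNReal.ofReal ((∑ i, w i * m (u i)) ^ 2) ∂(Measure.pi fun _ : Fin n => μ) =
      ENNReal.ofReal (∫ x, m x ^ 2 ∂μ) * ∑ i, ENNReal.ofReal (w i ^ 2) := by
  set P := Measure.pi fun _ : Fin n => μ with hP
  have hev : ∀ i : Fin n, MeasurePreserving (fun u : Fin n → X => u i) P μ := fun i =>
    measurePreserving_eval (fun _ : Fin n => μ) i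
  have hL : ∀ i : Fin n, MemLp (fun u : Fin n → X => w i * m (u i)) 2 P := fun i =>
    (hm.comp_measurePreserving (hev i)).const_mul (w i)
  have hS : MemLp (fun u : Fin n → X => ∑ i, w i * m (u i)) 2 P := memLp_finsetSum _ fun i _ => hL i
  have hv := variance_sum_pi (μ := fun _ : Fin n => μ) (X := fun i x => w i * m x)
    fun i => hm.const_mul (w i)
  have e1 : (∑ i : Fin n, fun u : Fin n → X => w i * m (u i)) = fun u => ∑ i, w i * m (u i) := by
    ext u; simp
  have hmean : ∫ u, ∑ i, w i * m (u i) ∂P = 0 := by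
    rw [integral_finsetSum _ fun i _ => (hL i).integrable (by norm_num)]
    refine Finset.sum_eq_zero fun i _ => ?_
    rw [integral_const_mul, integral_eval_pi μ i hm.1, hm0, mul_zero]
  rw [e1, variance_eq_sub hS, hmean] at hv
  simp only [variance_const_mul] at hv
  have hv2 : Var[m; μ] = ∫ x, m x ^ 2 ∂μ := by
    rw [variance_eq_sub hm, hm0]; simp
  rw [hv2] at hv
  have hint : Integrable (fun u : Fin n → X => (∑ i, w i * m (u i)) ^ 2) P := hS.integrable_sq
  rw [← ofReal_integral_eq_lintegral_ofReal hint (Eventually.of_forall fun u => sq_nonneg _)]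
  simp only [Pi.pow_apply] at hv
  have hv3 : ∫ u, (∑ i, w i * m (u i)) ^ 2 ∂P = (∫ x, m x ^ 2 ∂μ) * ∑ i, w i ^ 2 := by
    rw [Finset.mul_sum]
    simp only [mul_comm _ (_ ^ 2)]
    linarith
  rw [hv3, ENNReal.ofReal_mul (integral_nonneg fun _ => sq_nonneg _),
    ENNReal.ofReal_sum_of_nonneg fun i _ => sq_nonneg _]

/-- Sums of centered functions of the directions, weighted by functions of the moduli: by the
independence of moduli and directions, the second moment only involves that of the weights. -/
theorem lintegral_sum_mul_dir_sq (hk : 2 ≤ k) (hf : IsRadialDensity k f) {n : ℕ}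
    {W : (Fin n → ℝ) → Fin n → ℝ} (hW : ∀ i, Measurable fun r => W r i) {m : Obs k → ℝ}
    (hm : Continuous m) (hm0 : ∫ u, m u ∂(dirLaw k) = 0) :
    ∫⁻ x, ENNReal.ofReal ((∑ i, W (fun j => ‖x j‖) i * m (dir (x i))) ^ 2)
        ∂(Measure.pi fun _ : Fin n => sphericalLaw k f) =
      ENNReal.ofReal (∫ u, m u ^ 2 ∂(dirLaw k)) *
        ∑ i, ∫⁻ r, ENNReal.ofReal (W r i ^ 2) ∂(Measure.pi fun _ : Fin n => modulusLaw k f) := by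
  have := isProbabilityMeasure_dirLaw hk
  have hm2 : MemLp m 2 (dirLaw k) :=
    (memLp_two_iff_integrable_sq hm.measurable.aestronglyMeasurable).2
      (integrable_dirLaw hk (hm.pow 2))
  have hmm := hm.measurable
  have hF : Measurable fun p : (Fin n → ℝ) × (Fin n → Obs k) =>
      ENNReal.ofReal ((∑ i, W p.1 i * m (p.2 i)) ^ 2) := by
    refine ((Finset.measurable_sum _ fun i _ => ?_).pow_const 2).ennreal_ofReal
    exact ((hW i).comp measurable_fst).mul (hmm.comp ((measurable_pi_apply i).comp measurable_snd))
  rw [lintegral_pi_sphericalLaw hk hf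
    (F := fun r u => ENNReal.ofReal ((∑ i, W r i * m (u i)) ^ 2)) hF]
  simp only [lintegral_pi_sum_mul_sq hm2 hm0]
  rw [lintegral_const_mul' _ _ ENNReal.ofReal_ne_top,
    lintegral_finsetSum _ fun i _ => ((hW i).pow_const 2).ennreal_ofReal]

end

section

variable {k : ℕ} {f : ℝ → ℝ}

/-- The quadratic statistic with weights `W`, normalized by the second moment `M₂` of the limiting
weights. -/
def quadStat (M₂ : ℝ) {n : ℕ} (W : (Fin n → ℝ) → Fin n → ℝ) (x : Fin n → Obs k) : ℝ :=
  (k * (k + 2) : ℝ) / (2 * n * M₂) * ∑ i, ∑ j, W (fun l => ‖x l‖) i * W (fun l => ‖x l‖) j *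
    ((inner ℝ (dir (x i)) (dir (x j))) ^ 2 - 1 / (k : ℝ))

/-- The limit of a quadratic statistic under local alternatives, if its weights can be replaced by
functions of the individual moduli. -/
theorem tendsto_integral_quadStat (hk : 2 ≤ k) (hf : IsRadialDensity k f) {S : ℝ → ℝ}
    (hS : Measurable S) (hS2 : MemLp S 2 (modulusLaw k f)) {B : Matrix (Fin k) (Fin k) ℝ}
    (hB : B.IsSymm) {ℓ : ℕ → Obs k → ℝ} (hdqm : IsDQM (sphericalLaw k f) ℓ (halfScore S B))
    {κ : ℝ → ℝ} (hκ : Measurable κ) (hκ2 : MemLp κ 2 (modulusLaw k f)) {M₂ : ℝ}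
    (hM : ∫ r, κ r ^ 2 ∂(modulusLaw k f) = M₂) (hM0 : 0 < M₂)
    {W : (n : ℕ) → (Fin n → ℝ) → Fin n → ℝ} (hW : ∀ n i, Measurable fun r => W n r i)
    (hequiv : ∀ A : Matrix (Fin k) (Fin k) ℝ, A.trace = 0 → ∀ ε > 0, Tendsto (fun n : ℕ =>
      (Measure.pi fun _ : Fin n => sphericalLaw k f) {x | ε ≤
        |(Real.sqrt n)⁻¹ * ∑ i, (W n (fun j => ‖x j‖) i - κ ‖x i‖) * quadForm A (dir (x i))|})
      atTop (𝓝 0))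
    (φ : BoundedContinuousFunction ℝ ℝ) :
    Tendsto (fun n : ℕ => ∫ x, φ (quadStat M₂ (W n) x)
        ∂(Measure.pi fun _ : Fin n => (sphericalLaw k f).withDensity fun w => ENNReal.ofReal (ℓ n w)))
      atTop (𝓝 (∫ y, φ y ∂(noncentralChiSq (shapeDof k)
        ((∫ r, κ r * S r ∂(modulusLaw k f)) ^ 2 * tracelessNormSq B / (2 * k * (k + 2) * M₂))))) := by
  have hp1 := isProbabilityMeasure_dirLaw hk
  have hp2 := hf.isProbabilityMeasure_modulusLaw
  have hp3 := isProbabilityMeasure_sphericalLaw hk hf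
  have hk0 : (0 : ℝ) < k := by exact_mod_cast (by omega : 0 < k)
  set J := ∫ r, κ r * S r ∂(modulusLaw k f) with hJ
  set c : ℝ := k * (k + 2) / (2 * M₂) with hc
  have hc0 : 0 < c := by positivity
  have hsc : Real.sqrt c ^ 2 = c := Real.sq_sqrt hc0.le
  -- the basis of symmetric traceless matrices is chosen with its first vector along the drift
  set τ : ℝ := Real.sqrt c * J / (k * (k + 2)) with hτ
  obtain ⟨M, hMs, hMt, hMo, hMid, hMB⟩ := exists_traceless_basis hk (hB.smul τ)
  have hlam : tracelessNormSq (τ • B) = J ^ 2 * tracelessNormSq B / (2 * k * (k + 2) * M₂) := by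
    have h1 : tracelessNormSq (τ • B) = τ ^ 2 * tracelessNormSq B := by
      simp only [tracelessNormSq, Matrix.smul_apply, smul_eq_mul, Matrix.trace_smul, mul_sub,
        Finset.mul_sum]
      congr 1
      · refine Finset.sum_congr rfl fun i _ => Finset.sum_congr rfl fun j _ => ?_
        ring
      · ring
    rw [h1, hτ, div_pow, mul_pow, hsc, hc]
    field_simp
  rw [hlam] at hMB
  have hqm : ∀ a, Measurable (quadForm (M a)) := fun a => (continuous_quadForm _).measurable
  set a : Fin (shapeDof k) → Obs k → ℝ := fun b w =>
    Real.sqrt c * (κ ‖w‖ * quadForm (M b) (dir w)) with ha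
  have ham : ∀ b, Measurable (a b) := fun b => by
    have := hqm b
    simp only [ha]
    fun_prop
  have haL : ∀ b, MemLp (a b) 2 (sphericalLaw k f) := fun b =>
    (memLp_mul_quadForm hk hf hκ hκ2 (M b)).const_mul _
  have hq0 : ∀ b, ∫ u, quadForm (M b) u ∂(dirLaw k) = 0 := fun b => by
    rw [integral_quadForm hk, hMt, zero_div]
  have ha0 : ∀ b, ∫ w, a b w ∂(sphericalLaw k f) = 0 := fun b => by
    simp only [ha]
    rw [integral_const_mul]
    have := integral_sphericalLaw_mul hk hf hκ (hqm b)
    simp only [dir]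
    rw [this, hq0, mul_zero, mul_zero]
  have hmm : ∀ (b : Fin (shapeDof k)) {A : Matrix (Fin k) (Fin k) ℝ}, A.IsSymm →
      ∫ u, quadForm (M b) u * quadForm A u ∂(dirLaw k) =
        2 / (k * (k + 2)) * ∑ i, ∑ j, M b i j * A i j := fun b A hA => by
    rw [integral_quadForm_mul_quadForm hk, hMt]
    have : ∀ i j, A j i = A i j := fun i j => hA.apply i j
    simp only [this]
    ring
  have hcov : ∀ b b', ∫ w, a b w * a b' w ∂(sphericalLaw k f) = if b = b' then 1 else 0 := by
    intro b b'
    have h1 : ∀ w : Obs k, a b w * a b' w = c * (κ ‖w‖ ^ 2 *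
        (quadForm (M b) (‖w‖⁻¹ • w) * quadForm (M b') (‖w‖⁻¹ • w))) := fun w => by
      simp only [ha, dir]
      linear_combination (κ ‖w‖ ^ 2 * (quadForm (M b) (‖w‖⁻¹ • w) *
        quadForm (M b') (‖w‖⁻¹ • w))) * hsc
    simp only [h1]
    have := integral_sphericalLaw_mul hk hf (h := fun r => κ r ^ 2)
      (q := fun u => quadForm (M b) u * quadForm (M b') u) (hκ.pow_const 2) ((hqm b).mul (hqm b'))
    rw [integral_const_mul, this, hM, hmm b (hMs b'), hMo, hc]
    split_ifs
    · field_simp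
    · simp
  have hmean : ∀ b, 2 * ∫ w, a b w * halfScore S B w ∂(sphericalLaw k f) =
      ncMean (shapeDof k) (J ^ 2 * tracelessNormSq B / (2 * k * (k + 2) * M₂)) b := by
    intro b
    rw [← hMB]
    have h1 : ∀ w : Obs k, a b w * halfScore S B w =
        Real.sqrt c / 4 * ((κ ‖w‖ * S ‖w‖) *
          (quadForm (M b) (‖w‖⁻¹ • w) * quadForm B (‖w‖⁻¹ • w))) -
        B.trace / 4 * a b w := fun w => by
      simp only [ha, halfScore, dir]; ring
    have hqB : Measurable (quadForm B) := (continuous_quadForm B).measurable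
    have h2 := integral_sphericalLaw_mul hk hf (h := fun r => κ r * S r)
      (q := fun u => quadForm (M b) u * quadForm B u) (hκ.mul hS) ((hqm b).mul hqB)
    have hint : Integrable (fun w : Obs k => (κ ‖w‖ * S ‖w‖) *
          (quadForm (M b) (‖w‖⁻¹ • w) * quadForm B (‖w‖⁻¹ • w))) (sphericalLaw k f) := by
      have := (memLp_mul_quadForm hk hf hκ hκ2 (M b)).integrable_mul
        (memLp_mul_quadForm hk hf hS hS2 B)
      refine this.congr (Eventually.of_forall fun w => ?_)
      simp only [Pi.mul_apply]; ring
    simp only [h1]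
    rw [integral_sub (hint.const_mul _) (((haL b).integrable (by norm_num)).const_mul _),
      integral_const_mul, integral_const_mul, h2, ha0, hmm b hB]
    have h3 : ∑ i, ∑ j, M b i j * (τ • B) i j = τ * ∑ i, ∑ j, M b i j * B i j := by
      simp only [Matrix.smul_apply, smul_eq_mul, Finset.mul_sum]
      refine Finset.sum_congr rfl fun i _ => Finset.sum_congr rfl fun j _ => ?_
      ring
    rw [h3, hτ]
    field_simp
    ring
  set T : (n : ℕ) → (Fin n → Obs k) → EuclideanSpace ℝ (Fin (shapeDof k)) := fun n x =>
    WithLp.toLp 2 fun b => Real.sqrt c * ((Real.sqrt n)⁻¹ *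
      ∑ i, W n (fun j => ‖x j‖) i * quadForm (M b) (dir (x i))) with hTdef
  have hT : ∀ n, Measurable (T n) := fun n => by
    refine (PiLp.continuous_toLp 2 _).measurable.comp (measurable_pi_lambda _ fun b => ?_)
    refine ((Finset.measurable_sum _ fun i _ => ?_).const_mul _).const_mul _
    have h1 : Measurable fun x : Fin n → Obs k => (fun j => ‖x j‖ : Fin n → ℝ) := by fun_prop
    have h2 : Measurable fun x : Fin n → Obs k => quadForm (M b) (dir (x i)) :=
      (hqm b).comp (measurable_dir.comp (measurable_pi_apply i))
    exact ((hW n i).comp h1).mul h2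
  refine hdqm.tendsto_integral_noncentralChiSq ham haL ha0 hcov hmean hT ?_ ?_ φ
  · intro ε hε
    have hsc0 : 0 < Real.sqrt c := Real.sqrt_pos.2 hc0
    have hle : ∀ n : ℕ, (Measure.pi fun _ : Fin n => sphericalLaw k f)
        {x | ∃ b, ε ≤ |T n x b - (Real.sqrt n)⁻¹ * ∑ j, a b (x j)|} ≤
        ∑ b, (Measure.pi fun _ : Fin n => sphericalLaw k f) {x | ε / Real.sqrt c ≤
          |(Real.sqrt n)⁻¹ * ∑ i, (W n (fun j => ‖x j‖) i - κ ‖x i‖) *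
            quadForm (M b) (dir (x i))|} := fun n => by
      refine (measure_mono fun x hx => ?_).trans (measure_iUnion_fintype_le _ _)
      obtain ⟨b, hb⟩ := hx
      refine Set.mem_iUnion.2 ⟨b, ?_⟩
      have e : T n x b - (Real.sqrt n)⁻¹ * ∑ j, a b (x j) = Real.sqrt c * ((Real.sqrt n)⁻¹ *
          ∑ i, (W n (fun j => ‖x j‖) i - κ ‖x i‖) * quadForm (M b) (dir (x i))) := by
        simp only [hTdef, ha, ← Finset.mul_sum, sub_mul, Finset.sum_sub_distrib]
        ring
      rw [e, abs_mul, abs_of_pos hsc0] at hb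
      change ε / Real.sqrt c ≤ _
      rwa [div_le_iff₀ hsc0, mul_comm]
    refine tendsto_of_tendsto_of_tendsto_of_le_of_le tendsto_const_nhds ?_ (fun _ => zero_le) hle
    have := tendsto_finsetSum (Finset.univ : Finset (Fin (shapeDof k)))
      fun b _ => hequiv (M b) (hMt b) (ε / Real.sqrt c) (div_pos hε hsc0)
    simpa using this
  · intro n
    have hne : ∀ᵐ x ∂(Measure.pi fun _ : Fin n => sphericalLaw k f), ∀ i, x i ≠ 0 := by
      rw [ae_all_iff]
      intro i
      exact (measurePreserving_eval (fun _ : Fin n => sphericalLaw k f) i).quasiMeasurePreserving.ae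
        (ae_sphericalLaw_ne_zero hk hf)
    filter_upwards [hne] with x hx
    rw [norm_sq_eq_sum, quadStat]
    have h1 : ∀ b, T n x b ^ 2 = c / n * ∑ i, ∑ j, W n (fun l => ‖x l‖) i * W n (fun l => ‖x l‖) j *
        (quadForm (M b) (dir (x i)) * quadForm (M b) (dir (x j))) := fun b => by
      simp only [hTdef]
      rw [mul_pow, mul_pow, hsc, inv_pow, Real.sq_sqrt (Nat.cast_nonneg n), sq (∑ i, _),
        Finset.sum_mul_sum, ← mul_assoc, ← div_eq_mul_inv]
      congr 1
      refine Finset.sum_congr rfl fun i _ => Finset.sum_congr rfl fun j _ => ?_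
      ring
    rw [Finset.sum_congr rfl fun b _ => h1 b, ← Finset.mul_sum]
    have h2 : ∀ i j, ∑ b, W n (fun l => ‖x l‖) i * W n (fun l => ‖x l‖) j *
        (quadForm (M b) (dir (x i)) * quadForm (M b) (dir (x j))) =
        W n (fun l => ‖x l‖) i * W n (fun l => ‖x l‖) j *
        ((inner ℝ (dir (x i)) (dir (x j))) ^ 2 - 1 / (k : ℝ)) := fun i j => by
      rw [← Finset.mul_sum, hMid, norm_dir (hx i), norm_dir (hx j)]
      norm_num
    have h3 : ∀ i, ∑ b, ∑ j, W n (fun l => ‖x l‖) i * W n (fun l => ‖x l‖) j *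
        (quadForm (M b) (dir (x i)) * quadForm (M b) (dir (x j))) =
        ∑ j, W n (fun l => ‖x l‖) i * W n (fun l => ‖x l‖) j *
        ((inner ℝ (dir (x i)) (dir (x j))) ^ 2 - 1 / (k : ℝ)) := fun i => by
      rw [Finset.sum_comm]
      exact Finset.sum_congr rfl fun j _ => h2 i j
    refine Eq.trans ?_ (congrArg _ (Finset.sum_comm.trans
      (Finset.sum_congr rfl fun i _ => h3 i)).symm)
    congr 1
    rw [hc, div_div]
    congr 1
    ring

theorem measure_abs_ge_le {X : Type*} [MeasurableSpace X] (μ : Measure X) {F : X → ℝ}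
    (hF : Measurable F) {ε : ℝ} (hε : 0 < ε) :
    μ {x | ε ≤ |F x|} ≤ (∫⁻ x, ENNReal.ofReal (F x ^ 2) ∂μ) / ENNReal.ofReal (ε ^ 2) := by
  refine (measure_mono fun x hx => ?_).trans (meas_ge_le_lintegral_div
    (hF.pow_const 2).ennreal_ofReal.aemeasurable (by positivity) ENNReal.ofReal_ne_top)
  change ENNReal.ofReal (ε ^ 2) ≤ ENNReal.ofReal (F x ^ 2)
  rw [← sq_abs (F x)]
  have : ε ≤ |F x| := hx
  gcongr

/-- A Chebyshev bound for normalized weighted sums over the directions. -/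
theorem measure_sum_mul_dir_le (hk : 2 ≤ k) (hf : IsRadialDensity k f) {n : ℕ}
    {W : (Fin n → ℝ) → Fin n → ℝ} (hW : ∀ i, Measurable fun r => W r i)
    {A : Matrix (Fin k) (Fin k) ℝ} (hA : A.trace = 0) {ε : ℝ} (hε : 0 < ε) :
    (Measure.pi fun _ : Fin n => sphericalLaw k f) {x | ε ≤
      |(Real.sqrt n)⁻¹ * ∑ i, W (fun j => ‖x j‖) i * quadForm A (dir (x i))|} ≤
    ENNReal.ofReal (∫ u, quadForm A u ^ 2 ∂(dirLaw k)) / ENNReal.ofReal (ε ^ 2) *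
      ((n : ℝ≥0∞)⁻¹ * ∑ i, ∫⁻ r, ENNReal.ofReal (W r i ^ 2)
        ∂(Measure.pi fun _ : Fin n => modulusLaw k f)) := by
  rcases Nat.eq_zero_or_pos n with hn | hn
  · subst hn
    have : {x : Fin 0 → Obs k | ε ≤ |(Real.sqrt (0 : ℕ))⁻¹ *
        ∑ i, W (fun j => ‖x j‖) i * quadForm A (dir (x i))|} = ∅ := by
      ext x; simp [hε]
    rw [this]; simp
  have hn0 : (0 : ℝ) < n := by exact_mod_cast hn
  have hqm : Measurable (quadForm A) := (continuous_quadForm A).measurable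
  have hm : Measurable fun x : Fin n → Obs k =>
      ∑ i, W (fun j => ‖x j‖) i * quadForm A (dir (x i)) := by
    refine Finset.measurable_sum _ fun i _ => ?_
    have h1 : Measurable fun x : Fin n → Obs k => (fun j => ‖x j‖ : Fin n → ℝ) := by fun_prop
    exact ((hW i).comp h1).mul (hqm.comp (measurable_dir.comp (measurable_pi_apply i)))
  refine (measure_abs_ge_le _ (hm.const_mul _) hε).trans (le_of_eq ?_)
  have h0 : ∫ u, quadForm A u ∂(dirLaw k) = 0 := by rw [integral_quadForm hk, hA, zero_div]
  have h1 : ∀ z : ℝ, ENNReal.ofReal (((Real.sqrt n)⁻¹ * z) ^ 2) =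
      (n : ℝ≥0∞)⁻¹ * ENNReal.ofReal (z ^ 2) := fun z => by
    rw [mul_pow, inv_pow, Real.sq_sqrt hn0.le, ENNReal.ofReal_mul (by positivity),
      ENNReal.ofReal_inv_of_pos hn0, ENNReal.ofReal_natCast]
  simp only [h1]
  rw [lintegral_const_mul _ (hm.pow_const 2).ennreal_ofReal,
    lintegral_sum_mul_dir_sq hk hf hW (continuous_quadForm A) h0, ENNReal.div_eq_inv_mul,
    ENNReal.div_eq_inv_mul]
  ring

/-- Ranks are invariant under increasing transformations. -/
theorem vecRank_comp_of_strictMonoOn {n : ℕ} {G : ℝ → ℝ} {s : Set ℝ} (hG : StrictMonoOn G s)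
    {r : Fin n → ℝ} (hr : ∀ i, r i ∈ s) (i : Fin n) :
    vecRank (fun j => G (r j)) i = vecRank r i := by
  unfold vecRank
  congr 1
  ext j
  simp only [Finset.mem_filter, Finset.mem_univ, true_and]
  exact hG.le_iff_le (hr j) (hr i)

/-- The rank statistic, as a function of the standardized observations, under local alternatives. -/
theorem tendsto_integral_rankQuadStat (hk : 2 ≤ k) (hf : IsRadialDensity k f) {S : ℝ → ℝ}
    (hS : Measurable S) (hS2 : MemLp S 2 (modulusLaw k f)) {B : Matrix (Fin k) (Fin k) ℝ}
    (hB : B.IsSymm) {ℓ : ℕ → Obs k → ℝ} (hdqm : IsDQM (sphericalLaw k f) ℓ (halfScore S B))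
    {K : ℝ → ℝ} (hK : IsScore K) (hK0 : 0 < scoreSq K) (φ : BoundedContinuousFunction ℝ ℝ) :
    Tendsto (fun n : ℕ => ∫ x, φ (quadStat (scoreSq K)
        (fun r i => unitScore K ((vecRank r i : ℝ) / (n + 1))) x)
        ∂(Measure.pi fun _ : Fin n => (sphericalLaw k f).withDensity fun w => ENNReal.ofReal (ℓ n w)))
      atTop (𝓝 (∫ y, φ y ∂(noncentralChiSq (shapeDof k)
        ((∫ r, unitScore K (modulusCdf k f r) * S r ∂(modulusLaw k f)) ^ 2 * tracelessNormSq B /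
          (2 * k * (k + 2) * scoreSq K))))) := by
  have hp2 := hf.isProbabilityMeasure_modulusLaw
  have hKm := measurable_unitScore hK
  have hGm : Measurable (modulusCdf k f) := hf.continuous_modulusCdf.measurable
  have hmp : MeasurePreserving (modulusCdf k f) (modulusLaw k f) unitLaw := ⟨hGm, hf.map_modulusCdf⟩
  have hκ2 : MemLp (fun r => unitScore K (modulusCdf k f r)) 2 (modulusLaw k f) :=
    (memLp_unitScore hK).comp_measurePreserving hmp
  have hM : ∫ r, unitScore K (modulusCdf k f r) ^ 2 ∂(modulusLaw k f) = scoreSq K := by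
    rw [hf.integral_comp_modulusCdf (H := fun u => unitScore K u ^ 2)
      (hKm.pow_const 2).aestronglyMeasurable, scoreSq]
    exact setIntegral_congr_fun measurableSet_Ioo fun u hu => by
      simp only [unitScore_of_mem hu]
  refine tendsto_integral_quadStat hk hf hS hS2 hB hdqm (hKm.comp hGm) hκ2 hM hK0
    (fun n i => measurable_rankScore hKm i) ?_ φ
  intro A hA ε hε
  have hbound : ∀ n : ℕ, (Measure.pi fun _ : Fin n => sphericalLaw k f) {x | ε ≤
      |(Real.sqrt n)⁻¹ * ∑ i, (unitScore K ((vecRank (fun j => ‖x j‖) i : ℝ) / (n + 1)) -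
        unitScore K (modulusCdf k f ‖x i‖)) * quadForm A (dir (x i))|} ≤
      ENNReal.ofReal (∫ u, quadForm A u ^ 2 ∂(dirLaw k)) / ENNReal.ofReal (ε ^ 2) *
        rankError (unitScore K) n := fun n => by
    have hdm : ∀ i : Fin n, Measurable fun v : Fin n → ℝ =>
        unitScore K ((vecRank v i : ℝ) / (n + 1)) - unitScore K (v i) := fun i =>
      (measurable_rankScore hKm i).sub (hKm.comp (measurable_pi_apply i))
    refine (measure_sum_mul_dir_le hk hf (W := fun r i =>
      unitScore K ((vecRank r i : ℝ) / (n + 1)) - unitScore K (modulusCdf k f (r i)))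
      (fun i => (measurable_rankScore hKm i).sub (hKm.comp (hGm.comp (measurable_pi_apply i))))
      hA hε).trans (le_of_eq ?_)
    rw [rankError]
    congr 3
    ext i
    have hmp' : MeasurePreserving (fun (r : Fin n → ℝ) j => modulusCdf k f (r j))
        (Measure.pi fun _ : Fin n => modulusLaw k f) (Measure.pi fun _ : Fin n => unitLaw) :=
      measurePreserving_pi _ _ fun _ => hmp
    rw [← hmp'.lintegral_comp ((hdm i).pow_const 2).ennreal_ofReal]
    refine lintegral_congr_ae ?_
    have hpos : ∀ᵐ r ∂(Measure.pi fun _ : Fin n => modulusLaw k f), ∀ i, 0 < r i := by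
      rw [ae_all_iff]
      intro i
      exact (measurePreserving_eval (fun _ : Fin n => modulusLaw k f) i).quasiMeasurePreserving.ae
        hf.ae_modulusLaw_pos
    filter_upwards [hpos] with r hr
    rw [vecRank_comp_of_strictMonoOn hf.strictMonoOn_modulusCdf (fun j => (hr j).le) i]
  have hlim := ENNReal.Tendsto.const_mul (a := ENNReal.ofReal (∫ u, quadForm A u ^ 2 ∂(dirLaw k)) /
    ENNReal.ofReal (ε ^ 2)) (tendsto_rankError hK) (Or.inr (ENNReal.div_ne_top ENNReal.ofReal_ne_top
      (by positivity)))
  rw [mul_zero] at hlim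
  exact tendsto_of_tendsto_of_tendsto_of_le_of_le tendsto_const_nhds hlim (fun _ => zero_le) hbound

/-- The weights of the Gaussian statistic, normalized by the empirical fourth moment. -/
def gaussWeight (M₂ : ℝ) {n : ℕ} (r : Fin n → ℝ) (i : Fin n) : ℝ :=
  Real.sqrt (M₂ / ((∑ j, r j ^ 4) / n)) * r i ^ 2

/-- The Gaussian statistic, as a function of the standardized observations, under local
alternatives. -/
theorem tendsto_integral_gaussQuadStat (hk : 2 ≤ k) (hf : IsRadialDensity k f) {S : ℝ → ℝ}
    (hS : Measurable S) (hS2 : MemLp S 2 (modulusLaw k f)) {B : Matrix (Fin k) (Fin k) ℝ}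
    (hB : B.IsSymm) {ℓ : ℕ → Obs k → ℝ} (hdqm : IsDQM (sphericalLaw k f) ℓ (halfScore S B))
    (h4 : Integrable (fun r => r ^ 4) (modulusLaw k f)) {M₂ : ℝ}
    (hM : ∫ r, r ^ 4 ∂(modulusLaw k f) = M₂) (hM0 : 0 < M₂)
    (φ : BoundedContinuousFunction ℝ ℝ) :
    Tendsto (fun n : ℕ => ∫ x, φ (quadStat M₂ (gaussWeight M₂) x)
        ∂(Measure.pi fun _ : Fin n => (sphericalLaw k f).withDensity fun w => ENNReal.ofReal (ℓ n w)))
      atTop (𝓝 (∫ y, φ y ∂(noncentralChiSq (shapeDof k)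
        ((∫ r, r ^ 2 * S r ∂(modulusLaw k f)) ^ 2 * tracelessNormSq B /
          (2 * k * (k + 2) * M₂))))) := by
  have hp2 := hf.isProbabilityMeasure_modulusLaw
  have hp3 := isProbabilityMeasure_sphericalLaw hk hf
  have hκm : Measurable fun r : ℝ => r ^ 2 := by fun_prop
  have hsq : ∀ r : ℝ, (r ^ 2) ^ 2 = r ^ 4 := fun r => by ring
  have hκ2 : MemLp (fun r : ℝ => r ^ 2) 2 (modulusLaw k f) := by
    rw [memLp_two_iff_integrable_sq hκm.aestronglyMeasurable]
    simpa only [hsq] using h4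
  refine tendsto_integral_quadStat hk hf hS hS2 hB hdqm hκm hκ2 (by simpa only [hsq] using hM) hM0
    (fun n i => by unfold gaussWeight; fun_prop) ?_ φ
  intro A hA ε hε
  set P : (n : ℕ) → Measure (Fin n → Obs k) := fun n => Measure.pi fun _ => sphericalLaw k f with hP
  set C := ENNReal.ofReal (∫ u, quadForm A u ^ 2 ∂(dirLaw k)) * ENNReal.ofReal M₂ with hC
  have hCt : C ≠ ⊤ := ENNReal.mul_ne_top ENNReal.ofReal_ne_top ENNReal.ofReal_ne_top
  -- tightness of the sums with the nonrandom weights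
  have htight : ∀ (n : ℕ) {b : ℝ}, 0 < b → P n {x | b ≤ |(Real.sqrt n)⁻¹ *
      ∑ i, ‖x i‖ ^ 2 * quadForm A (dir (x i))|} ≤ C / ENNReal.ofReal (b ^ 2) := fun n b hb => by
    refine (measure_sum_mul_dir_le hk hf (W := fun r i => r i ^ 2) (fun i => by fun_prop) hA hb).trans ?_
    have h1 : ∀ i : Fin n, ∫⁻ r, ENNReal.ofReal ((r i ^ 2) ^ 2)
        ∂(Measure.pi fun _ : Fin n => modulusLaw k f) = ENNReal.ofReal M₂ := fun i => by
      simp only [hsq]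
      have h2 : ∫⁻ r, ENNReal.ofReal (r i ^ 4) ∂(Measure.pi fun _ : Fin n => modulusLaw k f) =
          ∫⁻ r, ENNReal.ofReal (r ^ 4) ∂(modulusLaw k f) :=
        (measurePreserving_eval (fun _ : Fin n => modulusLaw k f) i).lintegral_comp
          (f := fun x => ENNReal.ofReal (x ^ 4)) (by fun_prop)
      rw [h2, ← hM, ofReal_integral_eq_lintegral_ofReal h4 (Eventually.of_forall fun r => by
        change 0 ≤ r ^ 4; positivity)]
    simp only [h1]
    rw [hC, ENNReal.mul_div_right_comm]
    gcongr
    simp only [Finset.sum_const, Finset.card_univ, Fintype.card_fin, nsmul_eq_mul]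
    rw [← mul_assoc]
    exact mul_le_of_le_one_left zero_le (ENNReal.inv_mul_le_one _)
  have hlln : ∀ δ > 0, Tendsto (fun n => P n {x | δ ≤ |(∑ i, ‖x i‖ ^ 4) / n - M₂|}) atTop (𝓝 0) := by
    intro δ hδ
    have hmp : MeasurePreserving (fun w : Obs k => ‖w‖) (sphericalLaw k f) (modulusLaw k f) :=
      ⟨measurable_norm, map_norm_sphericalLaw hk hf⟩
    have hi : Integrable (fun w : Obs k => ‖w‖ ^ 4) (sphericalLaw k f) :=
      hmp.integrable_comp_of_integrable h4
    have := tendsto_measure_abs_mean_sub (sphericalLaw k f) (by fun_prop) hi hδ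
    have e : ∫ w : Obs k, ‖w‖ ^ 4 ∂(sphericalLaw k f) = M₂ := by
      rw [← hM, ← map_norm_sphericalLaw hk hf, integral_map (by fun_prop)
        (Measurable.aestronglyMeasurable (by fun_prop))]
    rwa [e] at this
  rw [ENNReal.tendsto_nhds_zero]
  intro e he
  have he2 : 0 < e / 2 := ENNReal.half_pos he.ne'
  obtain ⟨η, hη, hηe⟩ : ∃ η : ℝ, 0 < η ∧ C / ENNReal.ofReal ((ε / η) ^ 2) ≤ e / 2 := by
    have h1 : Tendsto (fun η : ℝ => C * ENNReal.ofReal (η ^ 2 / ε ^ 2)) (𝓝[>] 0) (𝓝 0) := by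
      have h0 : Tendsto (fun η : ℝ => ENNReal.ofReal (η ^ 2 / ε ^ 2)) (𝓝[>] 0)
          (𝓝 (ENNReal.ofReal (0 ^ 2 / ε ^ 2))) :=
        ENNReal.tendsto_ofReal (((tendsto_id.mono_left nhdsWithin_le_nhds).pow 2).div_const _)
      have := ENNReal.Tendsto.const_mul (a := C) h0 (Or.inr hCt)
      simpa using this
    obtain ⟨η, h2, h3⟩ := ((h1.eventually_le_const he2).and self_mem_nhdsWithin).exists
    have h3' : 0 < η := h3
    refine ⟨η, h3', le_trans (le_of_eq ?_) h2⟩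
    rw [ENNReal.div_eq_inv_mul, mul_comm, ← ENNReal.ofReal_inv_of_pos (by positivity)]
    congr 2
    field_simp
  obtain ⟨δ, hδ, hδη⟩ : ∃ δ > 0, ∀ y, |y - M₂| < δ → |Real.sqrt (M₂ / y) - 1| < η := by
    have hc : ContinuousAt (fun y => Real.sqrt (M₂ / y)) M₂ :=
      (continuousAt_const.div continuousAt_id hM0.ne').sqrt
    obtain ⟨δ, hδ, h⟩ := Metric.continuousAt_iff.1 hc η hη
    refine ⟨δ, hδ, fun y hy => ?_⟩
    have := h (x := y) (by rwa [Real.dist_eq])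
    rwa [Real.dist_eq, div_self hM0.ne', Real.sqrt_one] at this
  filter_upwards [(hlln δ hδ).eventually_le_const he2] with n hn
  calc _ ≤ P n ({x | δ ≤ |(∑ i, ‖x i‖ ^ 4) / n - M₂|} ∪ {x | ε / η ≤ |(Real.sqrt n)⁻¹ *
        ∑ i, ‖x i‖ ^ 2 * quadForm A (dir (x i))|}) := by
        refine measure_mono fun x hx => ?_
        rw [Set.mem_union]
        by_contra hcon
        rw [not_or] at hcon
        obtain ⟨h1, h2⟩ := hcon
        have h1' : |(∑ i, ‖x i‖ ^ 4) / n - M₂| < δ := not_le.1 h1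
        have h2' : |(Real.sqrt n)⁻¹ * ∑ i, ‖x i‖ ^ 2 * quadForm A (dir (x i))| < ε / η := not_le.1 h2
        have h3 := hδη _ h1'
        have hx' : ε ≤ |(Real.sqrt n)⁻¹ * ∑ i, (gaussWeight M₂ (fun j => ‖x j‖) i - ‖x i‖ ^ 2) *
          quadForm A (dir (x i))| := hx
        have e1 : (Real.sqrt n)⁻¹ * ∑ i, (gaussWeight M₂ (fun j => ‖x j‖) i - ‖x i‖ ^ 2) *
            quadForm A (dir (x i)) = (Real.sqrt (M₂ / ((∑ i, ‖x i‖ ^ 4) / n)) - 1) *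
            ((Real.sqrt n)⁻¹ * ∑ i, ‖x i‖ ^ 2 * quadForm A (dir (x i))) := by
          simp only [gaussWeight, Finset.mul_sum]
          refine Finset.sum_congr rfl fun i _ => ?_
          ring
        rw [e1, abs_mul] at hx'
        have h4 : |Real.sqrt (M₂ / ((∑ i, ‖x i‖ ^ 4) / n)) - 1| *
            |(Real.sqrt n)⁻¹ * ∑ i, ‖x i‖ ^ 2 * quadForm A (dir (x i))| < η * (ε / η) :=
          mul_lt_mul'' h3 h2' (abs_nonneg _) (abs_nonneg _)
        rw [mul_div_cancel₀ _ hη.ne'] at h4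
        linarith
    _ ≤ e / 2 + e / 2 := (measure_union_le _ _).trans (add_le_add hn
        ((htight n (div_pos hε hη)).trans hηe))
    _ = e := ENNReal.add_halves e

end

/-! ### Asymptotic level -/

/-- The squared norm of a normal vector has no atoms, as spheres are null sets. -/
theorem noncentralChiSq_zero_singleton {d : ℕ} (hd : 0 < d) (c : ℝ) :
    noncentralChiSq d 0 {c} = 0 := by
  have : Nonempty (Fin d) := ⟨⟨0, hd⟩⟩
  have : Nontrivial (EuclideanSpace ℝ (Fin d)) := inferInstance
  have h1 : Measure.pi (fun i : Fin d => gaussianReal (ncMean d 0 i) 1) ≪ volume := by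
    have h2 : (fun i : Fin d => gaussianReal (ncMean d 0 i) 1) =
        fun _ => volume.withDensity (gaussianPDF 0 1) := by
      ext1 i
      rw [← gaussianReal_of_var_ne_zero 0 one_ne_zero]
      simp [ncMean]
    rw [h2]
    have : SigmaFinite ((volume : Measure ℝ).withDensity (gaussianPDF 0 1)) := by
      rw [← gaussianReal_of_var_ne_zero 0 one_ne_zero]; infer_instance
    rw [pi_withDensity _ _ _ (measurable_gaussianPDF 0 1)]
    exact withDensity_absolutelyContinuous _ _
  have h2 : ncGaussian d 0 ≪ volume := by
    rw [← (PiLp.volume_preserving_toLp (Fin d)).map_eq]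
    exact h1.map (PiLp.volume_preserving_toLp (Fin d)).measurable
  rw [noncentralChiSq_eq_map, Measure.map_apply (by fun_prop) (measurableSet_singleton c)]
  refine h2 (measure_mono_null (t := Metric.sphere 0 (Real.sqrt c)) (fun z hz => ?_)
    (Measure.addHaar_sphere _ _ _))
  have hz' : ‖z‖ ^ 2 = c := hz
  rw [mem_sphere_zero_iff_norm, ← hz', Real.sqrt_sq (norm_nonneg z)]

/-- For a law without atoms the upper quantile is exact. -/
theorem measure_Ioi_sInf_eq {μ : Measure ℝ} [IsProbabilityMeasure μ] (hμ : ∀ c, μ {c} = 0) {α : ℝ}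
    (h0 : 0 < α) (h1 : α < 1) :
    μ (Set.Ioi (sInf {c : ℝ | μ (Set.Ioi c) ≤ ENNReal.ofReal α})) = ENNReal.ofReal α := by
  have hIoi : ∀ c, μ (Set.Ioi c) = ENNReal.ofReal (1 - cdf μ c) := fun c => by
    rw [← Set.compl_Iic, prob_compl_eq_one_sub measurableSet_Iic,
      ENNReal.ofReal_sub _ (cdf_nonneg μ c), ENNReal.ofReal_one, ofReal_cdf]
  have hS : {c : ℝ | μ (Set.Ioi c) ≤ ENNReal.ofReal α} = {c | 1 - α ≤ cdf μ c} := by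
    ext c
    simp only [Set.mem_ofPred_eq, hIoi, ENNReal.ofReal_le_ofReal_iff h0.le]
    constructor <;> intro h <;> linarith
  rw [hS]
  set S : Set ℝ := {c | 1 - α ≤ cdf μ c} with hSdef
  set q := sInf S with hq
  have hne : S.Nonempty :=
    ((tendsto_cdf_atTop μ).eventually_const_le (by linarith : 1 - α < 1)).exists
  obtain ⟨b, hb⟩ := ((tendsto_cdf_atBot μ).eventually_lt_const (by linarith : 0 < 1 - α)).exists
  have hbdd : BddBelow S := ⟨b, fun c hc => by
    by_contra hcb
    exact absurd (monotone_cdf μ (not_le.1 hcb).le) (not_le.2 (lt_of_lt_of_le hb hc))⟩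
  have hle : 1 - α ≤ cdf μ q := by
    have hrc : Tendsto (cdf μ) (𝓝[>] q) (𝓝 (cdf μ q)) :=
      ((cdf μ).right_continuous q).tendsto.mono_left (nhdsWithin_mono _ Set.Ioi_subset_Ici_self)
    refine ge_of_tendsto hrc ?_
    filter_upwards [self_mem_nhdsWithin] with c hc
    obtain ⟨s, hs, hsc⟩ := (csInf_lt_iff hbdd hne).1 hc
    exact le_trans (show 1 - α ≤ cdf μ s from hs) (monotone_cdf μ hsc.le)
  have hge : cdf μ q ≤ 1 - α := by
    have h2 := (cdf μ).measure_singleton q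
    rw [measure_cdf, hμ] at h2
    have h3 : cdf μ q ≤ Function.leftLim (cdf μ) q := by
      have := ENNReal.ofReal_eq_zero.1 h2.symm
      linarith
    refine h3.trans (le_of_tendsto ((monotone_cdf μ).tendsto_leftLim q) ?_)
    filter_upwards [self_mem_nhdsWithin] with c hc
    by_contra hcon
    exact absurd (csInf_le hbdd (not_le.1 hcon).le) (not_le.2 hc)
  rw [hIoi, le_antisymm hge hle]
  congr 1
  ring

/-- Weak convergence to the central chi-square law yields convergence of rejection
probabilities, as the limit has no atoms. -/
theorem tendsto_measureReal_gt_chiSqUpperQuantile {d : ℕ} (hd : 0 < d) {X : ℕ → Type*}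
    [∀ n, MeasurableSpace (X n)] {P : (n : ℕ) → Measure (X n)} [∀ n, IsProbabilityMeasure (P n)]
    {Q : (n : ℕ) → X n → ℝ} (hQ : ∀ n, Measurable (Q n))
    (h : ∀ φ : BoundedContinuousFunction ℝ ℝ, Tendsto (fun n => ∫ x, φ (Q n x) ∂(P n)) atTop
      (𝓝 (∫ y, φ y ∂(noncentralChiSq d 0)))) {α : ℝ} (h0 : 0 < α) (h1 : α < 1) :
    Tendsto (fun n => (P n).real {x | chiSqUpperQuantile d α < Q n x}) atTop (𝓝 α) := by
  set ν : ProbabilityMeasure ℝ := ⟨noncentralChiSq d 0, inferInstance⟩ with hν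
  set μ : ℕ → ProbabilityMeasure ℝ := fun n =>
    ⟨(P n).map (Q n), Measure.isProbabilityMeasure_map (hQ n).aemeasurable⟩ with hμ
  have hconv : Tendsto μ atTop (𝓝 ν) := by
    rw [ProbabilityMeasure.tendsto_iff_forall_integral_tendsto]
    intro φ
    refine (h φ).congr fun n => ?_
    rw [hμ, ProbabilityMeasure.coe_mk, integral_map (hQ n).aemeasurable
      φ.continuous.measurable.aestronglyMeasurable]
  set q := chiSqUpperQuantile d α with hq
  have key := ProbabilityMeasure.tendsto_measure_of_null_frontier_of_tendsto' hconv
    (E := Set.Ioi q) (by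
      rw [frontier_Ioi]
      exact noncentralChiSq_zero_singleton hd q)
  have hlim : (ν : Measure ℝ) (Set.Ioi q) = ENNReal.ofReal α :=
    measure_Ioi_sInf_eq (noncentralChiSq_zero_singleton hd) h0 h1
  rw [hlim] at key
  have := (ENNReal.tendsto_toReal ENNReal.ofReal_ne_top).comp key
  rw [ENNReal.toReal_ofReal h0.le] at this
  refine this.congr fun n => ?_
  simp only [Function.comp, hμ, ProbabilityMeasure.coe_mk, Measure.real]
  rw [Measure.map_apply (hQ n) measurableSet_Ioi]
  rfl

section

variable {k : ℕ} {f : ℝ → ℝ}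

/-! ### Reduction to the standardized observations -/

/-- The sample of standardized observations `σ⁻¹ V₀^{-1/2} (x_i - θ)`. -/
def standardize {n : ℕ} (θ : Obs k) (σ : ℝ) (V₀ : Matrix (Fin k) (Fin k) ℝ) (x : Fin n → Obs k) :
    Fin n → Obs k := fun i => σ⁻¹ • sphericized θ V₀ (x i)

theorem norm_standardize {n : ℕ} (θ : Obs k) {σ : ℝ} (hσ : 0 < σ) (V₀ : Matrix (Fin k) (Fin k) ℝ)
    (x : Fin n → Obs k) (i : Fin n) :
    ‖standardize θ σ V₀ x i‖ = σ⁻¹ * modulus θ V₀ (x i) := by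
  rw [standardize, norm_smul, Real.norm_of_nonneg (inv_nonneg.2 hσ.le)]; rfl

theorem dir_standardize {n : ℕ} (θ : Obs k) {σ : ℝ} (hσ : 0 < σ) (V₀ : Matrix (Fin k) (Fin k) ℝ)
    (x : Fin n → Obs k) (i : Fin n) :
    dir (standardize θ σ V₀ x i) = multiSign θ V₀ (x i) := by
  rw [dir, norm_standardize θ hσ, standardize, multiSign, smul_smul]
  congr 1
  rw [mul_inv, inv_inv]
  field_simp

/-- Ranks and signs do not depend on the scale; the values of the score outside of `(0, 1)` do not
matter. -/
theorem rankStat_eq_quadStat {n : ℕ} (K : ℝ → ℝ) (θ : Obs k) {σ : ℝ} (hσ : 0 < σ)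
    (V₀ : Matrix (Fin k) (Fin k) ℝ) (x : Fin n → Obs k) :
    rankStat k K θ V₀ n x = quadStat (scoreSq K)
      (fun r i => unitScore K ((vecRank r i : ℝ) / (n + 1))) (standardize θ σ V₀ x) := by
  have h1 : ∀ i, vecRank (fun l => ‖standardize θ σ V₀ x l‖) i = modulusRank θ V₀ x i := by
    intro i
    simp only [vecRank, modulusRank, norm_standardize θ hσ, mul_le_mul_iff_right₀ (inv_pos.2 hσ)]
  have h2 : ∀ i, unitScore K ((modulusRank θ V₀ x i : ℝ) / (n + 1)) =
      K ((modulusRank θ V₀ x i : ℝ) / (n + 1)) := fun i => by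
    rw [← h1]; exact unitScore_of_mem (vecRank_div_mem _ i)
  unfold rankStat quadStat
  simp only [dir_standardize θ hσ, h1, h2]

/-- The Gaussian statistic is scale invariant; the division by a vanishing sum of fourth powers
gives zero on both sides. -/
theorem gaussStat_eq_quadStat {n : ℕ} {M₂ : ℝ} (hM : 0 < M₂) (θ : Obs k) {σ : ℝ} (hσ : 0 < σ)
    (V₀ : Matrix (Fin k) (Fin k) ℝ) (x : Fin n → Obs k) :
    gaussStat k θ V₀ n x = quadStat M₂ (gaussWeight M₂) (standardize θ σ V₀ x) := by
  rcases Nat.eq_zero_or_pos n with hn | hn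
  · subst hn; simp [gaussStat, quadStat]
  have hn0 : (0 : ℝ) < n := by exact_mod_cast hn
  unfold gaussStat quadStat gaussWeight
  simp only [dir_standardize θ hσ, norm_standardize θ hσ, mul_pow, ← Finset.mul_sum]
  set s := ∑ i, modulus θ V₀ (x i) ^ 4 with hs
  have hs0 : 0 ≤ s := by positivity
  have hsq : Real.sqrt (M₂ / (σ⁻¹ ^ 4 * s / n)) ^ 2 = M₂ / (σ⁻¹ ^ 4 * s / n) :=
    Real.sq_sqrt (by positivity)
  have h2 : ∀ i j, Real.sqrt (M₂ / (σ⁻¹ ^ 4 * s / n)) * (σ⁻¹ ^ 2 * modulus θ V₀ (x i) ^ 2) *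
      (Real.sqrt (M₂ / (σ⁻¹ ^ 4 * s / n)) * (σ⁻¹ ^ 2 * modulus θ V₀ (x j) ^ 2)) *
      (inner ℝ (multiSign θ V₀ (x i)) (multiSign θ V₀ (x j)) ^ 2 - 1 / (k : ℝ)) =
      M₂ * n / s * (modulus θ V₀ (x i) ^ 2 * modulus θ V₀ (x j) ^ 2 *
        (inner ℝ (multiSign θ V₀ (x i)) (multiSign θ V₀ (x j)) ^ 2 - 1 / (k : ℝ))) := by
    intro i j
    have h3 : M₂ * n / s = (M₂ / (σ⁻¹ ^ 4 * s / n)) * σ⁻¹ ^ 4 := by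
      rcases eq_or_ne s 0 with h | h
      · simp [h]
      · field_simp
    rw [h3]
    linear_combination (σ⁻¹ ^ 4 * (modulus θ V₀ (x i) ^ 2 * modulus θ V₀ (x j) ^ 2 *
      (inner ℝ (multiSign θ V₀ (x i)) (multiSign θ V₀ (x j)) ^ 2 - 1 / (k : ℝ)))) * hsq
  simp only [h2, ← Finset.mul_sum]
  rw [← mul_assoc]
  congr 1
  rcases eq_or_ne s 0 with h | h
  · simp [h]
  · field_simp

theorem measurable_quadStat {M₂ : ℝ} {n : ℕ} {W : (Fin n → ℝ) → Fin n → ℝ}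
    (hW : ∀ i, Measurable fun r => W r i) :
    Measurable (quadStat M₂ W : (Fin n → Obs k) → ℝ) := by
  have h1 : Measurable fun x : Fin n → Obs k => (fun j => ‖x j‖ : Fin n → ℝ) := by fun_prop
  have h2 : ∀ i, Measurable fun x : Fin n → Obs k => W (fun j => ‖x j‖) i := fun i =>
    (hW i).comp h1
  unfold quadStat
  fun_prop

open scoped MatrixOrder in
theorem isProbabilityMeasure_ellipticalLaw (hk : 2 ≤ k) (hf : IsRadialDensity k f) (θ : Obs k)
    {σ : ℝ} (hσ : 0 < σ) {V₀ A : Matrix (Fin k) (Fin k) ℝ} (hV : V₀.PosDef) (hA : A.PosDef) :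
    IsProbabilityMeasure (ellipticalLaw θ σ (CFC.sqrt V₀ * A * CFC.sqrt V₀) f) := by
  obtain ⟨hm, hmap⟩ := hf.map_ellipticalLaw hk θ hσ hV hA
  constructor
  have h := congrArg (fun μ : Measure (Obs k) => μ Set.univ) hmap
  simp only [Measure.map_apply hm MeasurableSet.univ, Set.preimage_univ,
    withDensity_apply _ MeasurableSet.univ, Measure.restrict_univ,
    hf.lintegral_shapeRatio hk hA] at h
  exact h

open scoped MatrixOrder in
/-- The law of the standardized sample. -/
theorem map_standardize_sampleLaw (hk : 2 ≤ k) (hf : IsRadialDensity k f) (θ : Obs k)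
    {σ : ℝ} (hσ : 0 < σ) {V₀ A : Matrix (Fin k) (Fin k) ℝ} (hV : V₀.PosDef) (hA : A.PosDef)
    (n : ℕ) : Measurable (standardize θ σ V₀ : (Fin n → Obs k) → _) ∧
    (sampleLaw n θ σ (CFC.sqrt V₀ * A * CFC.sqrt V₀) f).map (standardize θ σ V₀) =
      Measure.pi fun _ : Fin n =>
        (sphericalLaw k f).withDensity fun w => ENNReal.ofReal (shapeRatio f A w) := by
  have := isProbabilityMeasure_ellipticalLaw hk hf θ hσ hV hA
  obtain ⟨hm, hmap⟩ := hf.map_ellipticalLaw hk θ hσ hV hA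
  have hp : IsProbabilityMeasure
      ((sphericalLaw k f).withDensity fun w => ENNReal.ofReal (shapeRatio f A w)) := by
    rw [← hmap]; exact Measure.isProbabilityMeasure_map hm.aemeasurable
  have hmp : MeasurePreserving (fun x => σ⁻¹ • sphericized θ V₀ x)
      (ellipticalLaw θ σ (CFC.sqrt V₀ * A * CFC.sqrt V₀) f)
      ((sphericalLaw k f).withDensity fun w => ENNReal.ofReal (shapeRatio f A w)) := ⟨hm, hmap⟩
  have := measurePreserving_pi (fun _ : Fin n => ellipticalLaw θ σ (CFC.sqrt V₀ * A * CFC.sqrt V₀) f)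
    (fun _ : Fin n => (sphericalLaw k f).withDensity fun w => ENNReal.ofReal (shapeRatio f A w))
    fun _ => hmp
  exact ⟨this.measurable, this.map_eq⟩

/-- Only multiples of the identity have a vanishing traceless part. -/
theorem eq_smul_one_of_tracelessNormSq_eq_zero (hk : 2 ≤ k) {B : Matrix (Fin k) (Fin k) ℝ}
    (h : tracelessNormSq B = 0) : B = (B.trace / k) • 1 := by
  have h1 := inner_tracelessPart_tracelessPart hk B B
  rw [← sq, ← tracelessNormSq, h, inner_self_eq_zero] at h1
  ext i j
  have h2 : tracelessPart B (i, j) = 0 := by rw [h1]; rfl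
  simp only [tracelessPart] at h2
  rw [Matrix.smul_apply, Matrix.one_apply, smul_eq_mul, mul_ite, mul_one, mul_zero]
  linarith

open scoped MatrixOrder in
/-- A perturbation of a shape, seen from the null shape, is not a multiple of the identity. -/
theorem exists_standardized_perturbation (hk : 2 ≤ k) {V₀ v : Matrix (Fin k) (Fin k) ℝ}
    (hV : IsShape V₀) (hv : IsShapePerturbation v) :
    ∃ B : Matrix (Fin k) (Fin k) ℝ, B.IsSymm ∧ 0 < tracelessNormSq B ∧
      ∀ t : ℝ, V₀ + t • v = CFC.sqrt V₀ * (1 + t • B) * CFC.sqrt V₀ := by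
  obtain ⟨hs, hd, hm⟩ := sqrt_posDef hV.1
  set R := CFC.sqrt V₀ with hR
  have hu : IsUnit R.det := hd.isUnit
  have hRB : R * (R⁻¹ * v * R⁻¹) * R = v := by
    rw [Matrix.mul_assoc, Matrix.mul_assoc (R⁻¹ * v), Matrix.nonsing_inv_mul _ hu, Matrix.mul_one,
      ← Matrix.mul_assoc, Matrix.mul_nonsing_inv _ hu, Matrix.one_mul]
  refine ⟨R⁻¹ * v * R⁻¹, ?_, ?_, fun t => ?_⟩
  · have hsi : R⁻¹.transpose = R⁻¹ := by rw [Matrix.transpose_nonsing_inv, hs.eq]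
    rw [Matrix.IsSymm, Matrix.transpose_mul, Matrix.transpose_mul, hsi, hv.1.eq, Matrix.mul_assoc]
  · refine lt_of_le_of_ne (tracelessNormSq_nonneg hk _) fun h => ?_
    have h1 := eq_smul_one_of_tracelessNormSq_eq_zero hk h.symm
    set c := (R⁻¹ * v * R⁻¹).trace / k with hc
    have h2 : v = c • V₀ := by
      rw [← hRB, h1, Matrix.mul_smul, Matrix.mul_one, Matrix.smul_mul, hm]
    -- The upper left entries of `v` and `V₀` are `0` and `1`, so `v = c V₀` forces `c = 0`.
    have h3 : v ⟨0, by omega⟩ ⟨0, by omega⟩ = 0 := hv.2.1 _ rfl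
    rw [h2, Matrix.smul_apply, hV.2 _ rfl, smul_eq_mul, mul_one] at h3
    exact hv.2.2 (by rw [h2, h3, zero_smul])
  · rw [Matrix.mul_add, Matrix.add_mul, Matrix.mul_one, hm, Matrix.mul_smul, Matrix.smul_mul, hRB]

/-! ### Asymptotic relative efficiency -/

/-- A statistic that is a quadratic statistic of the standardized observations, with a known limit
under the standardized local alternatives, has the corresponding asymptotic level and
noncentrality parameters. -/
theorem hasAsymptoticLevel_and_hasNoncentrality (hk : 2 ≤ k) (hf : IsRadialDensity k f)
    {Q : StatFamily k} {M₂ L : ℝ} {W : (n : ℕ) → (Fin n → ℝ) → Fin n → ℝ}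
    (hW : ∀ n i, Measurable fun r => W n r i) {θ : Obs k} {σ : ℝ} (hσ : 0 < σ)
    {V₀ : Matrix (Fin k) (Fin k) ℝ} (hV : IsShape V₀)
    (hQ : ∀ (n : ℕ) (x : Fin n → Obs k),
      Q θ V₀ n x = quadStat M₂ (W n) (standardize θ σ V₀ x))
    (hlim : ∀ B : Matrix (Fin k) (Fin k) ℝ, B.IsSymm → ∀ φ : BoundedContinuousFunction ℝ ℝ,
      Tendsto (fun n : ℕ => ∫ x, φ (quadStat M₂ (W n) x)
        ∂(Measure.pi fun _ : Fin n => (sphericalLaw k f).withDensity fun w =>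
          ENNReal.ofReal (shapeRatio f (1 + (Real.sqrt n)⁻¹ • B) w)))
      atTop (𝓝 (∫ y, φ y ∂(noncentralChiSq (shapeDof k) (L * tracelessNormSq B))))) :
    (∀ α : ℝ, 0 < α → α < 1 → HasAsymptoticLevel f Q θ σ V₀ α) ∧
    ∀ v B : Matrix (Fin k) (Fin k) ℝ, B.IsSymm →
      (open scoped MatrixOrder in
        ∀ t : ℝ, V₀ + t • v = CFC.sqrt V₀ * (1 + t • B) * CFC.sqrt V₀) →
      HasNoncentrality f Q θ σ V₀ v (L * tracelessNormSq B) := by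
  have hq : ∀ n, Measurable (quadStat M₂ (W n) : (Fin n → Obs k) → ℝ) := fun n =>
    measurable_quadStat (hW n)
  have hnc : ∀ v B : Matrix (Fin k) (Fin k) ℝ, B.IsSymm →
      (open scoped MatrixOrder in
        ∀ t : ℝ, V₀ + t • v = CFC.sqrt V₀ * (1 + t • B) * CFC.sqrt V₀) →
      HasNoncentrality f Q θ σ V₀ v (L * tracelessNormSq B) := by
    intro v B hB hvB φ
    refine (hlim B hB φ).congr' ?_
    have hev : ∀ᶠ n : ℕ in atTop, (1 + (Real.sqrt n)⁻¹ • B).PosDef :=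
      tendsto_inv_sqrt_nat.eventually (eventually_posDef_one_add_smul hB)
    filter_upwards [hev] with n hn
    obtain ⟨hm, hmap⟩ := map_standardize_sampleLaw hk hf θ hσ hV.1 hn n
    have hφ : Measurable fun x : Fin n → Obs k => φ (quadStat M₂ (W n) x) :=
      φ.continuous.measurable.comp (hq n)
    rw [hvB, ← hmap, integral_map hm.aemeasurable hφ.aestronglyMeasurable]
    simp only [hQ]
  refine ⟨fun α h0 h1 => ?_, hnc⟩
  have h1pd : (1 : Matrix (Fin k) (Fin k) ℝ).PosDef := Matrix.PosDef.one
  obtain ⟨-, -, hVV⟩ := sqrt_posDef hV.1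
  have hdof : 0 < shapeDof k := by
    unfold shapeDof
    have : 2 * 3 ≤ k * (k + 1) := Nat.mul_le_mul hk (by omega)
    omega
  have hP : ∀ n, IsProbabilityMeasure (sampleLaw n θ σ V₀ f) := fun n => by
    have := isProbabilityMeasure_ellipticalLaw hk hf θ hσ hV.1 h1pd
    rw [Matrix.mul_one, hVV] at this
    unfold sampleLaw
    infer_instance
  have hQm : ∀ n, Measurable (Q θ V₀ n) := fun n => by
    have e : Q θ V₀ n = quadStat M₂ (W n) ∘ standardize θ σ V₀ := funext fun x => hQ n x
    rw [e]
    exact (hq n).comp (map_standardize_sampleLaw hk hf θ hσ hV.1 h1pd n).1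
  refine tendsto_measureReal_gt_chiSqUpperQuantile hdof hQm (fun φ => ?_) h0 h1
  have := hnc 0 0 Matrix.isSymm_zero (fun t => by simp [hVV]) φ
  simpa [tracelessNormSq] using this

theorem integral_pos_of_ae_pos {X : Type*} [MeasurableSpace X] {μ : Measure X}
    [IsProbabilityMeasure μ] {h : X → ℝ} (hi : Integrable h μ) (hp : ∀ᵐ x ∂μ, 0 < h x) :
    0 < ∫ x, h x ∂μ := by
  have hn : 0 ≤ᵐ[μ] h := hp.mono fun x hx => hx.le
  refine lt_of_le_of_ne (integral_nonneg_of_ae hn) fun h0 => ?_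
  have h1 := (integral_eq_zero_iff_of_nonneg_ae hn hi).1 h0.symm
  have h2 : ∀ᵐ _ ∂μ, False := by
    filter_upwards [h1, hp] with x hx hx'
    rw [hx] at hx'
    exact lt_irrefl _ hx'
  exact h2.exists.choose_spec

namespace IsRadialDensity

theorem integrable_pow_four (hf : IsRadialDensity k f) (h4 : FiniteKurtosis k f) :
    Integrable (fun r => r ^ 4) (modulusLaw k f) := by
  have : AEStronglyMeasurable (fun r : ℝ => r ^ 4)
      ((volume.restrict (Set.Ioo 0 1)).map (modulusQuantile k f)) :=
    Measurable.aestronglyMeasurable (by fun_prop)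
  rw [← hf.map_modulusQuantile, integrable_map_measure this hf.aemeasurable_modulusQuantile]
  exact h4

theorem fourthMoment_eq (hf : IsRadialDensity k f) :
    fourthMoment k f = ∫ r, r ^ 4 ∂(modulusLaw k f) :=
  hf.integral_comp_modulusQuantile (H := fun r => r ^ 4)
    (Measurable.aestronglyMeasurable (by fun_prop))

theorem secondMoment_eq (hf : IsRadialDensity k f) :
    secondMoment k f = ∫ r, r ^ 2 ∂(modulusLaw k f) :=
  hf.integral_comp_modulusQuantile (H := fun r => r ^ 2)
    (Measurable.aestronglyMeasurable (by fun_prop))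

theorem integrable_pow_two (hf : IsRadialDensity k f) (h4 : FiniteKurtosis k f) :
    Integrable (fun r => r ^ 2) (modulusLaw k f) := by
  have := hf.isProbabilityMeasure_modulusLaw
  have h : MemLp (fun r : ℝ => r ^ 2) 2 (modulusLaw k f) := by
    rw [memLp_two_iff_integrable_sq (Measurable.aestronglyMeasurable (by fun_prop))]
    refine (hf.integrable_pow_four h4).congr (Eventually.of_forall fun r => ?_)
    change r ^ 4 = (r ^ 2) ^ 2
    ring
  exact h.integrable (by norm_num)

theorem fourthMoment_pos (hf : IsRadialDensity k f) (h4 : FiniteKurtosis k f) :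
    0 < fourthMoment k f := by
  have := hf.isProbabilityMeasure_modulusLaw
  rw [hf.fourthMoment_eq]
  exact integral_pos_of_ae_pos (hf.integrable_pow_four h4)
    (hf.ae_modulusLaw_pos.mono fun r hr => pow_pos hr 4)

theorem secondMoment_pos (hf : IsRadialDensity k f) (h4 : FiniteKurtosis k f) :
    0 < secondMoment k f := by
  have := hf.isProbabilityMeasure_modulusLaw
  rw [hf.secondMoment_eq]
  exact integral_pos_of_ae_pos (hf.integrable_pow_two h4)
    (hf.ae_modulusLaw_pos.mono fun r hr => pow_pos hr 2)

/-- The cross-information of a score as an expectation under the modulus law, for any version `S`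
of the score of the density. -/
theorem scoreInfo_eq (hf : IsRadialDensity k f) {K : ℝ → ℝ} (hK : IsScore K) {S : ℝ → ℝ}
    (hS : Measurable S)
    (hSe : ∀ᵐ r ∂(modulusLaw k f), radialScore k f (modulusCdf k f r) = S r) :
    scoreInfo k K f = ∫ r, unitScore K (modulusCdf k f r) * S r ∂(modulusLaw k f) := by
  have hp : (fun r => psi f r * r) =ᵐ[modulusLaw k f] S := by
    filter_upwards [hSe, hf.ae_modulusLaw_pos] with r hr hr0
    rw [← hr, radialScore, hf.modulusQuantile_modulusCdf hr0]
  have hpm : AEStronglyMeasurable (fun r => psi f r * r) (modulusLaw k f) :=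
    hS.aestronglyMeasurable.congr hp.symm
  have hrm : AEStronglyMeasurable (radialScore k f) (volume.restrict (Set.Ioo 0 1)) := by
    rw [← hf.map_modulusQuantile] at hpm
    exact hpm.comp_aemeasurable hf.aemeasurable_modulusQuantile
  have h1 := hf.integral_comp_modulusCdf (H := fun u => unitScore K u * radialScore k f u)
    ((measurable_unitScore hK).aestronglyMeasurable.mul hrm)
  have h2 : ∫ r, unitScore K (modulusCdf k f r) * S r ∂(modulusLaw k f) =
      ∫ r, unitScore K (modulusCdf k f r) * radialScore k f (modulusCdf k f r)
        ∂(modulusLaw k f) := integral_congr_ae (by filter_upwards [hSe] with r hr; rw [hr])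
  rw [h2, h1, scoreInfo]
  exact setIntegral_congr_fun measurableSet_Ioo fun u hu => by simp only [unitScore_of_mem hu]

end IsRadialDensity

/-- A continuous score that vanishes almost everywhere vanishes identically. -/
theorem scoreSq_pos {K : ℝ → ℝ} (hK : IsScore K) (h0 : ∃ u ∈ Set.Ioo (0 : ℝ) 1, K u ≠ 0) :
    0 < scoreSq K := by
  have hKe : ∀ᵐ u ∂(volume.restrict (Set.Ioo (0 : ℝ) 1)), unitScore K u = K u := by
    filter_upwards [ae_restrict_mem measurableSet_Ioo] with u hu using unitScore_of_mem hu
  have hmem : MemLp K 2 (volume.restrict (Set.Ioo (0 : ℝ) 1)) := (memLp_unitScore hK).ae_eq hKe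
  have hnn : 0 ≤ᵐ[volume.restrict (Set.Ioo (0 : ℝ) 1)] fun u => K u ^ 2 :=
    Eventually.of_forall fun u => sq_nonneg (K u)
  refine lt_of_le_of_ne (integral_nonneg_of_ae hnn) fun h => ?_
  have h1 := (integral_eq_zero_iff_of_nonneg_ae hnn hmem.integrable_sq).1 h.symm
  have h2 : K =ᵐ[volume.restrict (Set.Ioo (0 : ℝ) 1)] fun _ => 0 := by
    filter_upwards [h1] with u hu using pow_eq_zero_iff (two_ne_zero) |>.1 hu
  obtain ⟨u, hu, hne⟩ := h0
  exact hne (Measure.eqOn_open_of_ae_eq h2 isOpen_Ioo hK.1 continuousOn_const hu)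

/-- Both noncentrality parameters are proportional to the squared norm of the traceless part of the
standardized perturbation; for the Gaussian statistic the factor involves the expectation of
`r² ψ(r) r`, which integration by parts turns into a multiple of the second moment. -/
theorem isARE_rankStat_gaussStat (hk : 2 ≤ k) {g : ℝ → ℝ} (hg : IsRadialDensity k g)
    (h2 : AssumptionA2 k g) (h4 : FiniteKurtosis k g) {K : ℝ → ℝ} (hK : IsScore K)
    (hK0 : 0 < scoreSq K) :
    IsARE k g (rankStat k K) (gaussStat k)
      (1 / ((k : ℝ) + 2) ^ 2 * (fourthMoment k g / secondMoment k g ^ 2) *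
        (scoreInfo k K g ^ 2 / scoreSq K)) := by
  have hk0 : (0 : ℝ) < k := by exact_mod_cast (by omega : 0 < k)
  obtain ⟨S, hS, hS2, hSe, hdqm⟩ := hg.exists_isDQM hk h2
  have hE := hg.fourthMoment_pos h4
  have hD := hg.secondMoment_pos h4
  have hJN : ∫ r, r ^ 2 * S r ∂(modulusLaw k g) = (k + 2) * secondMoment k g := by
    have h := hg.integral_pow_mul_radialScore (by omega) h2 (m := 2) (hg.integrable_pow_four h4)
    rw [hg.secondMoment_eq]
    push_cast at h
    rw [← h]
    exact integral_congr_ae (by filter_upwards [hSe] with r hr; rw [hr])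
  intro θ σ V₀ hσ hV
  obtain ⟨hlevK, hncK⟩ := hasAsymptoticLevel_and_hasNoncentrality hk hg
    (L := scoreInfo k K g ^ 2 / (2 * k * (k + 2) * scoreSq K))
    (fun n i => measurable_rankScore (measurable_unitScore hK) i) hσ hV
    (fun n x => rankStat_eq_quadStat K θ hσ V₀ x) (fun B hB φ => by
      have := tendsto_integral_rankQuadStat hk hg hS hS2 hB (hdqm B hB) hK hK0 φ
      rwa [← hg.scoreInfo_eq hK hS hSe, mul_div_right_comm] at this)
  obtain ⟨hlevN, hncN⟩ := hasAsymptoticLevel_and_hasNoncentrality hk hg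
    (L := ((k + 2) * secondMoment k g) ^ 2 / (2 * k * (k + 2) * fourthMoment k g))
    (fun n i => by unfold gaussWeight; fun_prop) hσ hV
    (fun n x => gaussStat_eq_quadStat hE θ hσ V₀ x) (fun B hB φ => by
      have := tendsto_integral_gaussQuadStat hk hg hS hS2 hB (hdqm B hB)
        (hg.integrable_pow_four h4) hg.fourthMoment_eq.symm hE φ
      rwa [hJN, mul_div_right_comm] at this)
  refine ⟨fun α h0 h1 => ⟨hlevK α h0 h1, hlevN α h0 h1⟩, fun v hv => ?_⟩
  obtain ⟨B, hB, hB0, hvB⟩ := exists_standardized_perturbation hk hV hv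
  refine ⟨_, _, ?_, ?_, hncK v B hB hvB, hncN v B hB hvB, ?_⟩
  · positivity
  · positivity
  · field_simp

/-- The score of a radial density does not vanish: it has mean `k`. -/
theorem exists_ne_zero_of_ae_eq_radialScore (hk : 2 ≤ k) (hf : IsRadialDensity k f)
    (h2 : AssumptionA2 k f) {K : ℝ → ℝ}
    (hK : ∀ᵐ u ∂(volume.restrict (Set.Ioo (0 : ℝ) 1)), K u = radialScore k f u) :
    ∃ u ∈ Set.Ioo (0 : ℝ) 1, K u ≠ 0 := by
  by_contra! hcon
  have hp := hf.isProbabilityMeasure_modulusLaw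
  have h0 : ∀ᵐ u ∂(volume.restrict (Set.Ioo (0 : ℝ) 1)), radialScore k f u = 0 := by
    filter_upwards [hK, ae_restrict_mem measurableSet_Ioo] with u hu hu'
    rw [← hu, hcon u hu']
  have h := hf.integral_pow_mul_radialScore (by omega) h2 (m := 0) (by simp)
  have h1 : ∫ r, r ^ 0 * radialScore k f (modulusCdf k f r) ∂(modulusLaw k f) = 0 := by
    rw [integral_eq_zero_of_ae]
    filter_upwards [hf.ae_comp_modulusCdf h0] with r hr
    rw [hr, mul_zero]; rfl
  rw [h1] at h
  have hk0 : (k : ℝ) = 0 := by simpa using h.symm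
  have : k = 0 := by exact_mod_cast hk0
  omega

end

end EllipticalShape

end

theorem proposition4p2 (k : ℕ) (hk : 2 ≤ k) (g : ℝ → ℝ)
    (hg : EllipticalShape.IsRadialDensity k g)
    (hg1 : EllipticalShape.AssumptionA1 k g) (hg2 : EllipticalShape.AssumptionA2 k g)
    (hkurt : EllipticalShape.FiniteKurtosis k g) :
    (∀ K : ℝ → ℝ, EllipticalShape.IsScore K → (∃ u ∈ Set.Ioo (0 : ℝ) 1, K u ≠ 0) →
      EllipticalShape.IsARE k g (EllipticalShape.rankStat k K) (EllipticalShape.gaussStat k)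
        (1 / ((k : ℝ) + 2) ^ 2 *
          (EllipticalShape.fourthMoment k g / EllipticalShape.secondMoment k g ^ 2) *
          (EllipticalShape.scoreInfo k K g ^ 2 / EllipticalShape.scoreSq K))) ∧
    (∀ f : ℝ → ℝ, EllipticalShape.IsRadialDensity k f →
      EllipticalShape.AssumptionA1 k f → EllipticalShape.AssumptionA2 k f →
      ∀ K : ℝ → ℝ, EllipticalShape.IsScore K →
        (∀ᵐ u ∂(MeasureTheory.volume.restrict (Set.Ioo (0 : ℝ) 1)),
          K u = EllipticalShape.radialScore k f u) →
        EllipticalShape.IsARE k g (EllipticalShape.rankStat k K) (EllipticalShape.gaussStat k)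
          (1 / ((k : ℝ) + 2) ^ 2 *
            (EllipticalShape.fourthMoment k g / EllipticalShape.secondMoment k g ^ 2) *
            (EllipticalShape.crossInfo k f g ^ 2 / EllipticalShape.shapeInfo k f))) := by
  refine ⟨fun K hK h0 => EllipticalShape.isARE_rankStat_gaussStat hk hg hg2 hkurt hK
    (EllipticalShape.scoreSq_pos hK h0), fun f hf _ hf2 K hK hKf => ?_⟩
  have hpos := EllipticalShape.scoreSq_pos hK
    (EllipticalShape.exists_ne_zero_of_ae_eq_radialScore hk hf hf2 hKf)
  have h1 : EllipticalShape.shapeInfo k f = EllipticalShape.scoreSq K :=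
    integral_congr_ae (by filter_upwards [hKf] with u hu; rw [hu])
  have h2 : EllipticalShape.crossInfo k f g = EllipticalShape.scoreInfo k K g :=
    integral_congr_ae (by filter_upwards [hKf] with u hu; rw [hu])
  rw [h1, h2]
  exact EllipticalShape.isARE_rankStat_gaussStat hk hg hg2 hkurt hK hpos
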